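/- \textbf{Model.} Matrices are non-empty, have entries from an arbitrary totally ordered set, and are accessed only by querying entries and by comparing queried entries. Running time is the worst-case number of elementary operations of a deterministic random access machine: it has cells holding words of $O(\log(m+n))$ bits, with unit-cost arithmetic, comparison and indirect addressing, and cells holding queried entries, and an entry can be queried, copied, or compared with another one in unit time. The algorithm is a single finite program, given the two side lengths, that works for all matrix sizes and all totally ordered sets. The iterated logarithm is $\lg^* x = 0$ for $x \le 1$ and $\lg^* x = 1 + \lg^*(\log_2 x)$ for $x > 1$. A \emph{saddlepoint} of a matrix $A=(a_{i,j})$ is an entry $a_{i,j}$ such that $a_{i,j}\ge a_{i,k}$ for all $k\ne j$ and $a_{i,j}\le a_{k,j}$ for all $k\neq i$; it is \emph{strict} if all these inequalities are strict. \textbf{Theorem.} Let $A$ be an $m\times n$ or $n\times m$ matrix, where $m\ge n\ge 1$. (i) One can determine whether $A$ has a strict saddlepoint, and report its position if it exists, in time $O(m\cdot\max\{1,\lg^* n\})$, that is, in time $O(m\lg^* n)$ for $n\ge 2$ and $O(m)$ for $n=1$. (ii) If $A$ is known to have a (not necessarily strict) saddlepoint, then the common value of all saddlepoints of $A$ can be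 computed within the same time bound. The constants in the bounds are absolute. -/

import Mathlib

/-- The binary iterated logarithm: `lg* x = 0` if `x ≤ 1` and `lg* x = 1 + lg* (lg x)` if
`x > 1`, where `lg` is the base-2 logarithm. -/
noncomputable def lgStar (x : ℝ) : ℕ :=
  if 1 < x then 1 + lgStar (Real.logb 2 x) else 0
termination_by ⌊x⌋₊
decreasing_by
  rename_i hx
  have h0 : (0 : ℝ) < x := by linarith
  by_cases h2 : x < 2
  · have h1 : Real.logb 2 x < 1 := by
      rw [Real.logb_lt_iff_lt_rpow (by norm_num) h0]; simpa using h2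
    have h3 : ⌊Real.logb 2 x⌋₊ = 0 := Nat.floor_eq_zero.2 h1
    rw [h3]
    exact Nat.floor_pos.2 hx.le
  · have hx2 : 2 ≤ x := not_lt.1 h2
    have h1 : Real.logb 2 x ≤ x - 1 := by
      rw [Real.logb_le_iff_le_rpow (by norm_num) h0]
      have hb := one_add_mul_self_le_rpow_one_add (s := (1 : ℝ)) (by norm_num)
        (p := x - 1) (by linarith)
      have he : (1 : ℝ) + 1 = 2 := by norm_num
      rw [he] at hb
      linarith
    have hf : ⌊x - 1⌋₊ < ⌊x⌋₊ := by
      have hp : 1 ≤ ⌊x⌋₊ := Nat.floor_pos.2 hx.le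
      have := Nat.floor_sub_one x
      omega
    exact lt_of_le_of_lt (Nat.floor_le_floor h1) hf

/-- The entry in position `(i, j)` is a saddlepoint: a maximum of its row and a minimum of its
column. -/
def IsSaddlepoint {α : Type*} [LinearOrder α] {m n : ℕ} (A : Matrix (Fin m) (Fin n) α)
    (i : Fin m) (j : Fin n) : Prop :=
  (∀ k, k ≠ j → A i k ≤ A i j) ∧ (∀ k, k ≠ i → A i j ≤ A k j)

/-- The entry in position `(i, j)` is a strict saddlepoint: the strict maximum of its row and
the strict minimum of its column. -/
def IsStrictSaddlepoint {α : Type*} [LinearOrder α] {m n : ℕ} (A : Matrix (Fin m) (Fin n) α)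
    (i : Fin m) (j : Fin n) : Prop :=
  (∀ k, k ≠ j → A i k < A i j) ∧ (∀ k, k ≠ i → A i j < A k j)

/-! ### The machine model

A random access machine with two kinds of cells: words (natural numbers smaller than a word bound
`W`) and opaque entries of the input matrix. Entries can only be queried, copied and compared.
Programs are finite, written in a structured language with loops and (recursive) procedures with
local word variables. Every elementary operation costs one unit of time. An operation that
overflows the word bound, reads an empty entry cell or queries outside of the matrix has no
result, and an execution that performs it does not exist. -/

namespace RAM

/-- Word-valued expressions. -/
inductive Expr : Type
  | lit (k : ℕ)
  | var (x : ℕ)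
  | load (a : Expr)
  | add (a b : Expr)
  | sub (a b : Expr)
  | mul (a b : Expr)
  | div (a b : Expr)

/-- Conditions: comparison of two words, comparison of the entries stored in two entry cells
(given by their addresses), negation and conjunction. -/
inductive Test : Type
  | wordLe (a b : Expr)
  | entryLe (a b : Expr)
  | neg (b : Test)
  | conj (b c : Test)

/-- Commands. `query d i j` reads the entry in row `i` and column `j` (counted from `0`) of the
input matrix into entry cell `d`; `copy d a` copies entry cell `a` to entry cell `d`;
`call p args x` calls procedure number `p` and stores the word that it returns in variable `x`. -/
inductive Cmd : Type
  | skip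
  | assign (x : ℕ) (e : Expr)
  | store (a e : Expr)
  | query (d i j : Expr)
  | copy (d a : Expr)
  | seq (c₁ c₂ : Cmd)
  | branch (b : Test) (c₁ c₂ : Cmd)
  | loop (b : Test) (c : Cmd)
  | call (p : ℕ) (args : List Expr) (x : ℕ)

/-- A program: a main command and finitely many procedures, which may call each other. -/
structure Program : Type where
  main : Cmd
  procs : List Cmd

/-- A state of the memory: the local variables of the current procedure, the global word cells
and the global entry cells (which may be empty). -/
structure State (α : Type*) where
  loc : ℕ → ℕ
  mem : ℕ → ℕ
  ent : ℕ → Option α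

/-- The result of an arithmetical operation, if it fits into a word. -/
def word (W v : ℕ) : Option ℕ := if v < W then some v else none

/-- The value of an expression. Subtraction is truncated, division rounds down. -/
def Expr.eval {α : Type*} (W : ℕ) (s : State α) : Expr → Option ℕ
  | lit k => word W k
  | var x => some (s.loc x)
  | load a => (a.eval W s).map s.mem
  | add a b => (a.eval W s).bind fun u => (b.eval W s).bind fun v => word W (u + v)
  | sub a b => (a.eval W s).bind fun u => (b.eval W s).bind fun v => word W (u - v)
  | mul a b => (a.eval W s).bind fun u => (b.eval W s).bind fun v => word W (u * v)
  | div a b => (a.eval W s).bind fun u => (b.eval W s).bind fun v => word W (u / v)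

/-- The time to evaluate an expression: one unit for each node. -/
def Expr.time : Expr → ℕ
  | lit _ => 1
  | var _ => 1
  | load a => 1 + a.time
  | add a b => 1 + a.time + b.time
  | sub a b => 1 + a.time + b.time
  | mul a b => 1 + a.time + b.time
  | div a b => 1 + a.time + b.time

/-- The truth value of a condition. -/
def Test.eval {α : Type*} [LinearOrder α] (W : ℕ) (s : State α) : Test → Option Bool
  | wordLe a b => (a.eval W s).bind fun u => (b.eval W s).map fun v => decide (u ≤ v)
  | entryLe a b => (a.eval W s).bind fun u => (b.eval W s).bind fun v =>
      (s.ent u).bind fun x => (s.ent v).map fun y => decide (x ≤ y)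
  | neg b => (b.eval W s).map fun u => !u
  | conj b c => (b.eval W s).bind fun u => (c.eval W s).map fun v => u && v

/-- The time to evaluate a condition. -/
def Test.time : Test → ℕ
  | wordLe a b => 1 + a.time + b.time
  | entryLe a b => 1 + a.time + b.time
  | neg b => 1 + b.time
  | conj b c => 1 + b.time + c.time

/-- `Exec procs W A c s s' t`: with procedures `procs`, word bound `W` and input matrix `A`, the
command `c`, started in state `s`, halts in state `s'` after `t` units of time.

A procedure receives its arguments in its local variables `0, 1, 2, …`, its other local variables
are `0` at the start, and it returns the word in its local variable `0`. -/
inductive Exec {α : Type*} [LinearOrder α] {m n : ℕ} (procs : List Cmd) (W : ℕ)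
    (A : Matrix (Fin m) (Fin n) α) : Cmd → State α → State α → ℕ → Prop
  | skip (s : State α) : Exec procs W A .skip s s 1
  | assign (s : State α) (x : ℕ) (e : Expr) (v : ℕ) (he : e.eval W s = some v) :
      Exec procs W A (.assign x e) s { s with loc := Function.update s.loc x v } (1 + e.time)
  | store (s : State α) (a e : Expr) (u v : ℕ)
      (ha : a.eval W s = some u) (he : e.eval W s = some v) :
      Exec procs W A (.store a e) s { s with mem := Function.update s.mem u v }
        (1 + a.time + e.time)
  | query (s : State α) (d i j : Expr) (u : ℕ) (k : Fin m) (l : Fin n)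
      (hd : d.eval W s = some u) (hi : i.eval W s = some k.val) (hj : j.eval W s = some l.val) :
      Exec procs W A (.query d i j) s { s with ent := Function.update s.ent u (some (A k l)) }
        (1 + d.time + i.time + j.time)
  | copy (s : State α) (d a : Expr) (u v : ℕ) (x : α)
      (hd : d.eval W s = some u) (ha : a.eval W s = some v) (hx : s.ent v = some x) :
      Exec procs W A (.copy d a) s { s with ent := Function.update s.ent u (some x) }
        (1 + d.time + a.time)
  | seq (s s₁ s₂ : State α) (c₁ c₂ : Cmd) (t₁ t₂ : ℕ)
      (h₁ : Exec procs W A c₁ s s₁ t₁) (h₂ : Exec procs W A c₂ s₁ s₂ t₂) :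
      Exec procs W A (.seq c₁ c₂) s s₂ (t₁ + t₂)
  | branchTrue (s s' : State α) (b : Test) (c₁ c₂ : Cmd) (t : ℕ)
      (hb : b.eval W s = some true) (h : Exec procs W A c₁ s s' t) :
      Exec procs W A (.branch b c₁ c₂) s s' (1 + b.time + t)
  | branchFalse (s s' : State α) (b : Test) (c₁ c₂ : Cmd) (t : ℕ)
      (hb : b.eval W s = some false) (h : Exec procs W A c₂ s s' t) :
      Exec procs W A (.branch b c₁ c₂) s s' (1 + b.time + t)
  | loopTrue (s s₁ s₂ : State α) (b : Test) (c : Cmd) (t₁ t₂ : ℕ)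
      (hb : b.eval W s = some true) (h₁ : Exec procs W A c s s₁ t₁)
      (h₂ : Exec procs W A (.loop b c) s₁ s₂ t₂) :
      Exec procs W A (.loop b c) s s₂ (1 + b.time + t₁ + t₂)
  | loopFalse (s : State α) (b : Test) (c : Cmd) (hb : b.eval W s = some false) :
      Exec procs W A (.loop b c) s s (1 + b.time)
  | call (s s' : State α) (p : ℕ) (args : List Expr) (x : ℕ) (body : Cmd) (vs : List ℕ) (t : ℕ)
      (hp : procs[p]? = some body) (hargs : args.mapM (fun e => e.eval W s) = some vs)
      (h : Exec procs W A body { s with loc := fun y => vs.getD y 0 } s' t) :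
      Exec procs W A (.call p args x) s { s' with loc := Function.update s.loc x (s'.loc 0) }
        (1 + (args.map Expr.time).sum + t)

/-- Executions are deterministic: the final state and the time are unique. -/
theorem Exec.deterministic {α : Type*} [LinearOrder α] {m n : ℕ} {procs : List Cmd} {W : ℕ}
    {A : Matrix (Fin m) (Fin n) α} {c : Cmd} {s s₁ s₂ : State α} {t₁ t₂ : ℕ}
    (h₁ : Exec procs W A c s s₁ t₁) (h₂ : Exec procs W A c s s₂ t₂) : s₁ = s₂ ∧ t₁ = t₂ := by
  induction h₁ generalizing s₂ t₂ with
  | skip => cases h₂; simp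
  | assign => cases h₂; simp_all
  | store => cases h₂; simp_all
  | query s d i j u k l hd hi hj =>
    cases h₂ with
    | query _ _ _ _ u' k' l' hd' hi' hj' =>
      have h1 : k = k' := Fin.ext (Option.some.inj (hi.symm.trans hi'))
      have h2 : l = l' := Fin.ext (Option.some.inj (hj.symm.trans hj'))
      simp_all
  | copy => cases h₂; simp_all
  | seq s a b c₁ c₂ t u _ _ ih₁ ih₂ =>
    cases h₂ with
    | seq _ _ _ _ _ _ _ k₁ k₂ =>
      obtain ⟨rfl, rfl⟩ := ih₁ k₁
      obtain ⟨rfl, rfl⟩ := ih₂ k₂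
      simp
  | branchTrue s s' b c₁ c₂ t hb _ ih =>
    cases h₂ with
    | branchTrue _ _ _ _ _ _ _ k => obtain ⟨rfl, rfl⟩ := ih k; simp
    | branchFalse _ _ _ _ _ _ kb k => simp_all
  | branchFalse s s' b c₁ c₂ t hb _ ih =>
    cases h₂ with
    | branchTrue _ _ _ _ _ _ kb k => simp_all
    | branchFalse _ _ _ _ _ _ _ k => obtain ⟨rfl, rfl⟩ := ih k; simp
  | loopTrue s a d b c t u hb _ _ ih₁ ih₂ =>
    cases h₂ with
    | loopTrue _ _ _ _ _ _ _ _ k₁ k₂ =>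
      obtain ⟨rfl, rfl⟩ := ih₁ k₁
      obtain ⟨rfl, rfl⟩ := ih₂ k₂
      simp
    | loopFalse _ _ _ kb => simp_all
  | loopFalse s b c hb =>
    cases h₂ with
    | loopTrue _ _ _ _ _ _ _ kb k₁ k₂ => simp_all
    | loopFalse _ _ _ kb => simp
  | call s s' p args x body vs t hp hargs _ ih =>
    cases h₂ with
    | call _ _ _ _ _ body' vs' t' kp kargs k =>
      obtain rfl : body = body' := Option.some.inj (hp.symm.trans kp)
      obtain rfl : vs = vs' := Option.some.inj (hargs.symm.trans kargs)
      obtain ⟨rfl, rfl⟩ := ih k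
      simp

/-- The initial state for a matrix with `m` rows and `n` columns: local variable `0` holds `m`,
local variable `1` holds `n`, all other words are `0` and all entry cells are empty. -/
def init (α : Type*) (m n : ℕ) : State α where
  loc := fun x => if x = 0 then m else if x = 1 then n else 0
  mem := fun _ => 0
  ent := fun _ => none

/-- Started on the input matrix `A` on a machine with word bound `W`, the program `P` halts in
state `s` after `t` units of time. -/
def Program.Halts {α : Type*} [LinearOrder α] {m n : ℕ} (P : Program) (W : ℕ)
    (A : Matrix (Fin m) (Fin n) α) (s : State α) (t : ℕ) : Prop :=
  Exec P.procs W A P.main (init α m n) s t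

end RAM

/-- The final state `s` correctly answers the strict saddlepoint problem for `A`: variable `0` is
`1` and variables `1` and `2` hold the row and the column (counted from `0`) of a strict
saddlepoint, or variable `0` is `0` and there is none. -/
def ReportsStrictSaddlepoint {α : Type*} [LinearOrder α] {m n : ℕ} (A : Matrix (Fin m) (Fin n) α)
    (s : RAM.State α) : Prop :=
  (s.loc 0 = 1 ∧ ∃ i j, IsStrictSaddlepoint A i j ∧ s.loc 1 = i.val ∧ s.loc 2 = j.val) ∨
    (s.loc 0 = 0 ∧ ¬ ∃ i j, IsStrictSaddlepoint A i j)

/-- The final state `s` holds in entry cell `0` a value that is the value of every saddlepoint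
of `A`. -/
def ReportsSaddlepointValue {α : Type*} [LinearOrder α] {m n : ℕ} (A : Matrix (Fin m) (Fin n) α)
    (s : RAM.State α) : Prop :=
  ∃ v, s.ent 0 = some v ∧ ∀ i j, IsSaddlepoint A i j → A i j = v

/-! Breaking ties by position gives all entries distinct integer ranks. Call a position a value
(`IsValue`) if every row has an entry of at least its rank and every column has one of at most its
rank. Going from the value to a saddlepoint along the row of the saddlepoint, and back along its
column, gives inequalities that close up. So the entry at a value equals that of every saddlepoint,
and a strict saddlepoint can only be at the value itself. It suffices to find one value; strictness
is then checked by reading one row and one column.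

The search keeps two keys, lo and hi, such that every row has a key at least lo and every column has
a key at most hi. A row with a key at least hi, or a column with a key at most lo, need not be
looked at again. This is the invariant `Core`. Once at most one column is left, a value can be read
off (`calls_finish`). Transposing the matrix and reversing the order exchanges all roles
(`Clean.of_swapped`), so the remaining matrix may be taken with a rows and b columns, a ≥ b.

A threshold v is tested by a staircase walk with at most one comparison per row and column passed
(`calls_walk`). If all rows turn out to have a key at least v, then min(v, hi) becomes the new lo
and all columns with a known key at most v disappear. If all columns turn out to have a key at most
v, then hi drops to v at most, and all rows with a known key at least v disappear. To know such
keys, each column gets a block of t rows and the minimum of its entries there (`Blocks`). A block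
minimum at most v witnesses the column; a block minimum above v witnesses all t rows of the block.
From here on the key of a column is its block minimum.

If a < 2b, take t = 1. A walk for an approximate median of the column keys deletes a constant
fraction of the rows or of the columns (`calls_square`). If a ≥ 2b, take t = a / (2b), so that at
least half of the rows stay in reserve, and try to lower all column keys to lo. The recursion
`calls_lower` lowers the keys to v as follows. While more than e columns are above v, pick a pivot w
among their keys, lower to w recursively, and then continue towards v. With at most e columns above
v, walk. Either the walk passes all rows, and only these columns survive, or their blocks are
deleted and replaced from the reserve. The row pointer of the walk never moves back, so all walks
together pass each row once. A renewal pays O(t) for the new minimum and O(1) for each level of the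
recursion, whose depth is O(lg(b/e)). With e about b / 2^(16t) the depth is O(t), and the step takes
O(a) time. It leaves no columns, or at most e, or the reserve is exhausted and a quarter of the rows
is gone (`calls_tall`).

Passing from b to b / 2^(16t) columns turns the ratio x of (rounded) height to width into at least
2^x, which can happen only about lg* b times at one height (`level_drop`). The other losses form
geometric series. `potential` adds up both. Pivots are found deterministically in linear time from
recursively merged samples (`calls_sample`).

Memory: cell 8i + k is index i of array k. Array 0 holds scalars: 0 the transposition flag, 8 and 16
the numbers of listed rows and columns, 24 the block length t, 32 the number e, 40 the first row
index not yet in a block, 48 the row pointer of the walk, 56 and 64 the position of lo, 72 and 80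
that of hi, 88 the index of the first surviving column, 96 the number m + n. Arrays 1 and 2 list
rows and columns, and array 3 marks deleted row indices. Arrays 4 and 5 hold, for each column, the
first row index of its block and the row of its minimum. Cells from 8(m + n + 20) on are workspace.
Procedures are numbered by their places in `procs`. -/

set_option linter.unusedSimpArgs false

/-! ### Proof rules for terminating executions with running times -/

namespace RAM

/-- The value of an expression, when no operation overflows. -/
def Expr.val {α : Type*} (s : State α) : Expr → ℕ
  | lit k => k
  | var x => s.loc x
  | load a => s.mem (a.val s)
  | add a b => a.val s + b.val s
  | sub a b => a.val s - b.val s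
  | mul a b => a.val s * b.val s
  | div a b => a.val s / b.val s

/-- No operation in the evaluation of an expression overflows. -/
def Expr.Ok {α : Type*} (W : ℕ) (s : State α) : Expr → Prop
  | lit k => k < W
  | var _ => True
  | load a => a.Ok W s
  | add a b => a.Ok W s ∧ b.Ok W s ∧ a.val s + b.val s < W
  | sub a b => a.Ok W s ∧ b.Ok W s ∧ a.val s - b.val s < W
  | mul a b => a.Ok W s ∧ b.Ok W s ∧ a.val s * b.val s < W
  | div a b => a.Ok W s ∧ b.Ok W s ∧ a.val s / b.val s < W

theorem Expr.eval_of_ok {α : Type*} {W : ℕ} {s : State α} {e : Expr} (h : e.Ok W s) :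
    e.eval W s = some (e.val s) := by
  induction e with
  | lit k => simpa [Expr.eval, word, Expr.val, Expr.Ok] using h
  | var x => rfl
  | load a ih => simp [Expr.eval, Expr.val, ih h]
  | add a b iha ihb => simp [Expr.eval, Expr.val, iha h.1, ihb h.2.1, word, h.2.2]
  | sub a b iha ihb => simp [Expr.eval, Expr.val, iha h.1, ihb h.2.1, word, h.2.2]
  | mul a b iha ihb => simp [Expr.eval, Expr.val, iha h.1, ihb h.2.1, word, h.2.2]
  | div a b iha ihb => simp [Expr.eval, Expr.val, iha h.1, ihb h.2.1, word, h.2.2]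

/-- The truth of a condition on words. -/
def Test.Holds {α : Type*} [LinearOrder α] (s : State α) : Test → Prop
  | wordLe a b => a.val s ≤ b.val s
  | entryLe a b => ∃ x y, s.ent (a.val s) = some x ∧ s.ent (b.val s) = some y ∧ x ≤ y
  | neg b => ¬ b.Holds s
  | conj b c => b.Holds s ∧ c.Holds s

/-- The evaluation of a condition succeeds. -/
def Test.Ok {α : Type*} (W : ℕ) (s : State α) : Test → Prop
  | wordLe a b => a.Ok W s ∧ b.Ok W s
  | entryLe a b => a.Ok W s ∧ b.Ok W s ∧ (∃ x, s.ent (a.val s) = some x) ∧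
      ∃ y, s.ent (b.val s) = some y
  | neg b => b.Ok W s
  | conj b c => b.Ok W s ∧ c.Ok W s

open Classical in
theorem Test.eval_of_ok {α : Type*} [LinearOrder α] {W : ℕ} {s : State α} {b : Test}
    (h : b.Ok W s) : b.eval W s = some (decide (b.Holds s)) := by
  induction b with
  | wordLe a b =>
    simp only [Test.eval, Test.Holds, Expr.eval_of_ok h.1, Expr.eval_of_ok h.2, Option.bind_some,
      Option.map_some]
    congr
  | entryLe a b =>
    obtain ⟨ha, hb, ⟨x, hx⟩, ⟨y, hy⟩⟩ := h
    simp [Test.eval, Test.Holds, Expr.eval_of_ok ha, Expr.eval_of_ok hb, hx, hy]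
  | neg b ih =>
    by_cases hb : b.Holds s <;> simp [Test.eval, Test.Holds, ih h, hb]
  | conj b c ihb ihc =>
    by_cases hb : b.Holds s <;> by_cases hc : c.Holds s <;>
      simp [Test.eval, Test.Holds, ihb h.1, ihc h.2, hb, hc]

theorem mapM_eval_of_ok {α : Type*} {W : ℕ} {s : State α} {args : List Expr} (h : ∀ e ∈ args, e.Ok W s) :
    args.mapM (fun e => e.eval W s) = some (args.map fun e => e.val s) := by
  induction args with
  | nil => rfl
  | cons e l ih =>
    simp only [List.mem_cons, forall_eq_or_imp] at h
    simp [List.mapM_cons, Expr.eval_of_ok h.1, ih h.2]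

section Run

variable {α : Type*} [LinearOrder α] {m n : ℕ}

/-- The command `c`, started in `s`, halts in a state and after a time that satisfy `Q`. -/
def Run (procs : List Cmd) (W : ℕ) (A : Matrix (Fin m) (Fin n) α) (c : Cmd) (s : State α)
    (Q : State α → ℕ → Prop) : Prop :=
  ∃ s' t, Exec procs W A c s s' t ∧ Q s' t

variable {procs : List Cmd} {W : ℕ} {A : Matrix (Fin m) (Fin n) α} {s : State α}
  {Q : State α → ℕ → Prop}

theorem Run.mono {c : Cmd} {Q' : State α → ℕ → Prop} (h : Run procs W A c s Q)
    (hQ : ∀ s' t, Q s' t → Q' s' t) : Run procs W A c s Q' := by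
  obtain ⟨s', t, h1, h2⟩ := h
  exact ⟨s', t, h1, hQ _ _ h2⟩

theorem run_skip (h : Q s 1) : Run procs W A .skip s Q := ⟨_, _, .skip s, h⟩

theorem run_assign {x : ℕ} {e : Expr} (h : e.Ok W s)
    (hQ : Q { s with loc := Function.update s.loc x (e.val s) } (1 + e.time)) :
    Run procs W A (.assign x e) s Q :=
  ⟨_, _, .assign s x e _ (Expr.eval_of_ok h), hQ⟩

theorem run_store {a e : Expr} (h : a.Ok W s ∧ e.Ok W s)
    (hQ : Q { s with mem := Function.update s.mem (a.val s) (e.val s) } (1 + a.time + e.time)) :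
    Run procs W A (.store a e) s Q :=
  ⟨_, _, .store s a e _ _ (Expr.eval_of_ok h.1) (Expr.eval_of_ok h.2), hQ⟩

theorem run_query {d i j : Expr} (h : d.Ok W s ∧ i.Ok W s ∧ j.Ok W s) (hi : i.val s < m)
    (hj : j.val s < n)
    (hQ : Q { s with ent := Function.update s.ent (d.val s) (some (A ⟨i.val s, hi⟩ ⟨j.val s, hj⟩)) }
      (1 + d.time + i.time + j.time)) :
    Run procs W A (.query d i j) s Q :=
  ⟨_, _, .query s d i j _ ⟨i.val s, hi⟩ ⟨j.val s, hj⟩ (Expr.eval_of_ok h.1)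
    (Expr.eval_of_ok h.2.1) (Expr.eval_of_ok h.2.2), hQ⟩

theorem run_seq {c₁ c₂ : Cmd}
    (h : Run procs W A c₁ s fun s₁ t₁ => Run procs W A c₂ s₁ fun s₂ t₂ => Q s₂ (t₁ + t₂)) :
    Run procs W A (.seq c₁ c₂) s Q := by
  obtain ⟨s₁, t₁, h1, s₂, t₂, h2, h3⟩ := h
  exact ⟨s₂, _, .seq _ _ _ _ _ _ _ h1 h2, h3⟩

theorem run_branch {b : Test} {c₁ c₂ : Cmd} (hb : b.Ok W s)
    (h₁ : b.Holds s → Run procs W A c₁ s fun s' t => Q s' (1 + b.time + t))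
    (h₂ : ¬ b.Holds s → Run procs W A c₂ s fun s' t => Q s' (1 + b.time + t)) :
    Run procs W A (.branch b c₁ c₂) s Q := by
  classical
  have he := Test.eval_of_ok hb
  by_cases h : b.Holds s
  · obtain ⟨s', t, h1, h2⟩ := h₁ h
    exact ⟨s', _, .branchTrue _ _ _ _ _ _ (by simp [he, h]) h1, h2⟩
  · obtain ⟨s', t, h1, h2⟩ := h₂ h
    exact ⟨s', _, .branchFalse _ _ _ _ _ _ (by simp [he, h]) h1, h2⟩

/-- The rule for loops: `I` is the invariant, which depends on the time spent so far, and `μ`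
decreases. -/
theorem run_loop {b : Test} {c : Cmd} (μ : State α → ℕ) (I : State α → ℕ → Prop) (h0 : I s 0)
    (hstep : ∀ s T, I s T → b.Ok W s ∧ (b.Holds s →
      Run procs W A c s fun s' t => I s' (T + 1 + b.time + t) ∧ μ s' < μ s))
    (hQ : ∀ s' T, I s' T → ¬ b.Holds s' → Q s' (T + 1 + b.time)) :
    Run procs W A (.loop b c) s Q := by
  classical
  have key : ∀ k s T, μ s = k → I s T →
      ∃ s' t, Exec procs W A (.loop b c) s s' t ∧ Q s' (T + t) := by
    intro k
    induction k using Nat.strong_induction_on with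
    | _ k ih =>
      intro s T hk hI
      obtain ⟨hok, hb⟩ := hstep s T hI
      have he := Test.eval_of_ok hok
      by_cases h : b.Holds s
      · obtain ⟨s₁, t₁, h1, h2, h3⟩ := hb h
        obtain ⟨s', t, h4, h5⟩ := ih _ (hk ▸ h3) s₁ _ rfl h2
        refine ⟨s', _, .loopTrue _ _ _ _ _ _ _ (by simp [he, h]) h1 h4, ?_⟩
        convert h5 using 1
        omega
      · refine ⟨s, _, .loopFalse _ _ _ (by simp [he, h]), ?_⟩
        have := hQ s T hI h
        rwa [add_assoc] at this
  obtain ⟨s', t, h1, h2⟩ := key _ s 0 rfl h0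
  exact ⟨s', t, h1, by simpa using h2⟩

/-- The rule for loops that are executed `b - a` times, with at most `τ` units of time for each
execution of the body. -/
theorem run_for {b : Test} {c : Cmd} (I : ℕ → State α → Prop) (lo hi τ : ℕ) (hle : lo ≤ hi)
    (h0 : I lo s)
    (hstep : ∀ i s, lo ≤ i → i < hi → I i s → b.Ok W s ∧ b.Holds s ∧
      Run procs W A c s fun s' t => I (i + 1) s' ∧ t ≤ τ)
    (hend : ∀ s, I hi s → b.Ok W s ∧ ¬ b.Holds s)
    (hQ : ∀ s' T, I hi s' → T ≤ (hi - lo) * (1 + b.time + τ) + 1 + b.time → Q s' T) :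
    Run procs W A (.loop b c) s Q := by
  classical
  have key : ∀ k i s, i + k = hi → lo ≤ i → I i s →
      ∃ s' t, Exec procs W A (.loop b c) s s' t ∧ I hi s' ∧ t ≤ k * (1 + b.time + τ) + 1 + b.time := by
    intro k
    induction k with
    | zero =>
      intro i s hi' _ hI
      obtain rfl : i = hi := by omega
      obtain ⟨h1, h2⟩ := hend s hI
      exact ⟨s, _, .loopFalse _ _ _ (by simp [Test.eval_of_ok h1, h2]), hI, by omega⟩
    | succ k ih =>
      intro i s hi' hlo hI
      obtain ⟨h1, h2, s₁, t₁, h3, h4, h5⟩ := hstep i s hlo (by omega) hI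
      obtain ⟨s', t, h6, h7, h8⟩ := ih (i + 1) s₁ (by omega) (by omega) h4
      refine ⟨s', _, .loopTrue _ _ _ _ _ _ _ (by simp [Test.eval_of_ok h1, h2]) h3 h6, h7, ?_⟩
      rw [add_mul]
      omega
  obtain ⟨s', t, h1, h2, h3⟩ := key (hi - lo) lo s (by omega) le_rfl h0
  exact ⟨s', t, h1, hQ _ _ h2 h3⟩

/-- Procedure `p`, called with arguments `vs` when the memory is `mem`, returns a word and changes
the memory in a time, such that `Post` holds. -/
def Calls (procs : List Cmd) (W : ℕ) (A : Matrix (Fin m) (Fin n) α) (p : ℕ) (vs : List ℕ)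
    (mem : ℕ → ℕ) (Post : ℕ → (ℕ → ℕ) → ℕ → Prop) : Prop :=
  ∃ body, procs[p]? = some body ∧ ∀ ent : ℕ → Option α,
    Run procs W A body ⟨fun y => vs.getD y 0, mem, ent⟩ fun s' t => Post (s'.loc 0) s'.mem t

/-- Entry cells are scratch space. `Calls` quantifies over their contents before the call, and the
caller learns nothing about them afterwards, so specifications of procedures only speak of words. -/
theorem run_call {p x : ℕ} {args : List Expr} {Post : ℕ → (ℕ → ℕ) → ℕ → Prop}
    (hargs : ∀ e ∈ args, e.Ok W s)
    (h : Calls procs W A p (args.map fun e => e.val s) s.mem Post)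
    (hQ : ∀ r mem' ent' t, Post r mem' t →
      Q ⟨Function.update s.loc x r, mem', ent'⟩ (1 + (args.map Expr.time).sum + t)) :
    Run procs W A (.call p args x) s Q := by
  obtain ⟨body, hb, h⟩ := h
  obtain ⟨s', t, h1, h2⟩ := h s.ent
  exact ⟨_, _, .call s s' p args x body _ t hb (mapM_eval_of_ok hargs) h1, hQ _ _ s'.ent _ h2⟩

/-- This form takes the specification first and leaves the arguments and the memory as equations,
since they rarely agree syntactically with those of the specification. -/
theorem run_call_of_eq {p x : ℕ} {args : List Expr} {vs : List ℕ} {mem : ℕ → ℕ}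
    {Post : ℕ → (ℕ → ℕ) → ℕ → Prop} (h : Calls procs W A p vs mem Post)
    (hargs : ∀ e ∈ args, e.Ok W s) (hvs : args.map (fun e => e.val s) = vs) (hmem : s.mem = mem)
    (hQ : ∀ r mem' ent' t, Post r mem' t →
      Q ⟨Function.update s.loc x r, mem', ent'⟩ (1 + (args.map Expr.time).sum + t)) :
    Run procs W A (.call p args x) s Q := by
  subst hvs hmem
  exact run_call hargs h hQ

theorem Calls.mono {p : ℕ} {vs : List ℕ} {mem : ℕ → ℕ} {P P' : ℕ → (ℕ → ℕ) → ℕ → Prop}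
    (h : Calls procs W A p vs mem P) (hP : ∀ r mem' t, P r mem' t → P' r mem' t) :
    Calls procs W A p vs mem P' := by
  obtain ⟨body, hb, h⟩ := h
  exact ⟨body, hb, fun ent => (h ent).mono fun _ _ => hP _ _ _⟩

end Run

end RAM

/-! ### Weakest preconditions of straight-line code -/

namespace RAM

/-- The weakest precondition of a command, computed up to loops and procedure calls. -/
def wp {α : Type*} [LinearOrder α] {m n : ℕ} (procs : List Cmd) (W : ℕ)
    (A : Matrix (Fin m) (Fin n) α) : Cmd → State α → (State α → ℕ → Prop) → Prop
  | .skip, s, Q => Q s 1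
  | .assign x e, s, Q =>
    e.Ok W s ∧ Q { s with loc := Function.update s.loc x (e.val s) } (1 + e.time)
  | .store a e, s, Q => (a.Ok W s ∧ e.Ok W s) ∧
    Q { s with mem := Function.update s.mem (a.val s) (e.val s) } (1 + a.time + e.time)
  | .query d i j, s, Q => (d.Ok W s ∧ i.Ok W s ∧ j.Ok W s) ∧
    ∃ (hi : i.val s < m) (hj : j.val s < n),
      Q { s with
          ent := Function.update s.ent (d.val s) (some (A ⟨i.val s, hi⟩ ⟨j.val s, hj⟩)) }
        (1 + d.time + i.time + j.time)
  | .seq c₁ c₂, s, Q =>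
    wp procs W A c₁ s fun s₁ t₁ => wp procs W A c₂ s₁ fun s₂ t₂ => Q s₂ (t₁ + t₂)
  | .branch b c₁ c₂, s, Q => b.Ok W s ∧
    (b.Holds s → wp procs W A c₁ s fun s' t => Q s' (1 + b.time + t)) ∧
    (¬ b.Holds s → wp procs W A c₂ s fun s' t => Q s' (1 + b.time + t))
  | .loop b c, s, Q => Run procs W A (.loop b c) s Q
  | .copy d a, s, Q => Run procs W A (.copy d a) s Q
  | .call p args x, s, Q => Run procs W A (.call p args x) s Q

section

variable {α : Type*} [LinearOrder α] {m n : ℕ} {procs : List Cmd} {W : ℕ}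
  {A : Matrix (Fin m) (Fin n) α} {s : State α} {Q : State α → ℕ → Prop}

theorem wp_skip : wp procs W A .skip s Q = Q s 1 := rfl

theorem wp_assign {x : ℕ} {e : Expr} : wp procs W A (.assign x e) s Q =
    (e.Ok W s ∧ Q { s with loc := Function.update s.loc x (e.val s) } (1 + e.time)) := rfl

theorem wp_store {a e : Expr} : wp procs W A (.store a e) s Q = ((a.Ok W s ∧ e.Ok W s) ∧
    Q { s with mem := Function.update s.mem (a.val s) (e.val s) } (1 + a.time + e.time)) := rfl

theorem wp_query {d i j : Expr} : wp procs W A (.query d i j) s Q =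
    ((d.Ok W s ∧ i.Ok W s ∧ j.Ok W s) ∧ ∃ (hi : i.val s < m) (hj : j.val s < n),
      Q { s with
          ent := Function.update s.ent (d.val s) (some (A ⟨i.val s, hi⟩ ⟨j.val s, hj⟩)) }
        (1 + d.time + i.time + j.time)) := rfl

theorem wp_seq {c₁ c₂ : Cmd} : wp procs W A (.seq c₁ c₂) s Q =
    wp procs W A c₁ s fun s₁ t₁ => wp procs W A c₂ s₁ fun s₂ t₂ => Q s₂ (t₁ + t₂) := rfl

theorem wp_branch {b : Test} {c₁ c₂ : Cmd} : wp procs W A (.branch b c₁ c₂) s Q = (b.Ok W s ∧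
    (b.Holds s → wp procs W A c₁ s fun s' t => Q s' (1 + b.time + t)) ∧
    (¬ b.Holds s → wp procs W A c₂ s fun s' t => Q s' (1 + b.time + t))) := rfl

theorem wp_loop {b : Test} {c : Cmd} :
    wp procs W A (.loop b c) s Q = Run procs W A (.loop b c) s Q := rfl

theorem wp_call {p x : ℕ} {args : List Expr} :
    wp procs W A (.call p args x) s Q = Run procs W A (.call p args x) s Q := rfl

end

/-- For code without loops, copies and calls, `wp` unfolds to arithmetical conditions that `simp`
and `omega` can treat. At the other commands `wp` stops and leaves a `Run` for the rules above. -/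
theorem run_of_wp {α : Type*} [LinearOrder α] {m n : ℕ} {procs : List Cmd} {W : ℕ}
    {A : Matrix (Fin m) (Fin n) α} {c : Cmd} {s : State α} {Q : State α → ℕ → Prop}
    (h : wp procs W A c s Q) : Run procs W A c s Q := by
  induction c generalizing s Q with
  | skip => exact run_skip h
  | assign => exact run_assign h.1 h.2
  | store => exact run_store h.1 h.2
  | query =>
    obtain ⟨h1, hi, hj, h2⟩ := h
    exact run_query h1 hi hj h2
  | seq c₁ c₂ ih₁ ih₂ => exact run_seq ((ih₁ h).mono fun s₁ t₁ h1 => ih₂ h1)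
  | branch b c₁ c₂ ih₁ ih₂ => exact run_branch h.1 (fun hb => ih₁ (h.2.1 hb)) fun hb => ih₂ (h.2.2 hb)
  | loop => exact h
  | copy => exact h
  | call => exact h

/-- Sequential composition of a list of commands. -/
def seqs : List Cmd → Cmd
  | [] => .skip
  | [c] => c
  | c :: d :: l => .seq c (seqs (d :: l))

end RAM

/-! ### The program -/

namespace Saddle

open RAM Expr Test Cmd

attribute [simp] Expr.Ok Expr.val Expr.time Test.Ok Test.Holds Test.time seqs

/-- The condition `a < b`. -/
@[simp]
def lt (a b : Expr) : Test := neg (wordLe b a)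

/-- The address of the entry with index `i` of array number `k`. -/
@[simp]
def arr (k : ℕ) (i : Expr) : Expr := add (mul (lit 8) i) (lit k)

/-- Return whether the key in position `(v0, v1)` is less than the key in position `(v2, v3)`. -/
def cmpBody : Cmd := seqs [
  branch (lt (lit 0) (load (lit 0)))
    (seqs [assign 4 (var 0), assign 0 (var 3), assign 3 (var 4),
      assign 4 (var 1), assign 1 (var 2), assign 2 (var 4)]) skip,
  query (lit 0) (var 0) (var 1),
  query (lit 1) (var 2) (var 3),
  branch (entryLe (lit 0) (lit 1))
    (branch (entryLe (lit 1) (lit 0))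
      (branch (lt (var 0) (var 2)) (assign 0 (lit 1))
        (branch (conj (wordLe (var 0) (var 2)) (lt (var 1) (var 3)))
          (assign 0 (lit 1)) (assign 0 (lit 0))))
      (assign 0 (lit 1)))
    (assign 0 (lit 0))]

/-- Return the row with the smallest key in column `v0` among the `v2` rows listed from index `v1`
on. -/
def argminBody : Cmd := seqs [
  assign 3 (add (var 1) (lit 1)),
  assign 4 (add (var 1) (var 2)),
  assign 5 (load (arr 1 (var 1))),
  loop (lt (var 3) (var 4)) (seqs [
    assign 6 (load (arr 1 (var 3))),
    call 0 [var 6, var 0, var 5, var 0] 7,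
    branch (lt (lit 0) (var 7)) (assign 5 (var 6)) skip,
    assign 3 (add (var 3) (lit 1))]),
  assign 0 (var 5)]

/-- Merge the sorted lists of columns of length `v2` at the addresses `v0` and `v1`, writing the
element with index `q` to index `q / v4` of the list at address `v3`. -/
def mergeBody : Cmd :=
  loop (lt (add (var 5) (var 6)) (mul (lit 2) (var 2))) (seqs [
    branch (wordLe (var 2) (var 6)) (assign 7 (lit 1))
      (branch (wordLe (var 2) (var 5)) (assign 7 (lit 0)) (seqs [
        assign 8 (load (add (var 0) (mul (lit 8) (var 5)))),
        assign 9 (load (add (var 1) (mul (lit 8) (var 6)))),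
        call 0 [load (arr 5 (var 8)), var 8, load (arr 5 (var 9)), var 9] 7])),
    branch (lt (lit 0) (var 7))
      (seqs [store (add (var 3) (mul (lit 8) (div (add (var 5) (var 6)) (var 4))))
          (load (add (var 0) (mul (lit 8) (var 5)))),
        assign 5 (add (var 5) (lit 1))])
      (seqs [store (add (var 3) (mul (lit 8) (div (add (var 5) (var 6)) (var 4))))
          (load (add (var 1) (mul (lit 8) (var 6)))),
        assign 6 (add (var 6) (lit 1))])])

/-- Write a sorted sample of length `v1` of the list of `v0` columns at address `v2` to address
`v3`. -/
def sampleBody : Cmd :=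
  branch (wordLe (var 0) (lit 2))
    (call 2 [var 2, add (var 2) (lit 8), lit 1, var 3, lit 1] 4)
    (seqs [
      assign 5 (div (var 0) (lit 4)),
      assign 6 (div (var 1) (lit 2)),
      assign 7 (add (var 3) (mul (lit 8) (var 1))),
      call 3 [var 5, var 6, var 2, var 7] 4,
      call 3 [var 5, var 6, add (var 2) (mul (lit 8) (var 5)),
        add (var 7) (mul (lit 8) (var 6))] 4,
      call 3 [var 5, var 6, add (var 2) (mul (lit 16) (var 5)),
        add (var 7) (mul (lit 16) (var 6))] 4,
      call 3 [var 5, var 6, add (var 2) (mul (lit 24) (var 5)),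
        add (var 7) (mul (lit 24) (var 6))] 4,
      call 2 [var 7, add (var 7) (mul (lit 8) (var 6)), var 6,
        add (var 7) (mul (lit 16) (var 1)), lit 1] 4,
      call 2 [add (var 7) (mul (lit 16) (var 6)), add (var 7) (mul (lit 24) (var 6)), var 6,
        add (var 7) (mul (lit 24) (var 1)), lit 1] 4,
      call 2 [add (var 7) (mul (lit 16) (var 1)), add (var 7) (mul (lit 24) (var 1)), var 1,
        var 3, lit 2] 4])

/-- Return a column whose key is neither among the smallest nor among the largest keys of the
columns listed from index `v0` on. -/
def pivotBody : Cmd := seqs [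
  assign 1 (sub (load (lit 16)) (var 0)),
  assign 2 (lit 2),
  assign 3 (lit 2),
  assign 4 (mul (lit 8) (add (load (lit 96)) (lit 20))),
  loop (wordLe (mul (lit 4) (var 2)) (var 1))
    (seqs [assign 2 (mul (lit 4) (var 2)), assign 3 (mul (lit 2) (var 3))]),
  call 3 [var 2, var 3, arr 2 (var 0), var 4] 5,
  assign 0 (load (add (var 4) (mul (lit 8) (sub (div (var 3) (lit 2)) (lit 1)))))]

/-- Permute the columns listed from index `v0` on such that those with a key larger than that in
position `(v1, v2)` come last, and return the index of the first of these. -/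
def scanBody : Cmd := seqs [
  assign 3 (load (lit 16)),
  loop (lt (var 0) (var 3)) (seqs [
    assign 4 (load (arr 2 (var 0))),
    call 0 [var 1, var 2, load (arr 5 (var 4)), var 4] 5,
    branch (lt (lit 0) (var 5))
      (seqs [assign 3 (sub (var 3) (lit 1)),
        store (arr 2 (var 0)) (load (arr 2 (var 3))),
        store (arr 2 (var 3)) (var 4)])
      (assign 0 (add (var 0) (lit 1)))])]

/-- Compare the rows from the row pointer on and the columns listed from index `v0` on with the key
in position `(v1, v2)`. -/
def walkBody : Cmd := seqs [
  loop (conj (lt (load (lit 48)) (load (lit 8))) (lt (var 0) (load (lit 16)))) (seqs [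
    call 0 [load (arr 1 (load (lit 48))), load (arr 2 (var 0)), var 1, var 2] 3,
    branch (lt (lit 0) (var 3)) (assign 0 (add (var 0) (lit 1)))
      (store (lit 48) (add (load (lit 48)) (lit 1)))]),
  branch (wordLe (load (lit 8)) (load (lit 48))) (assign 0 (lit 1)) (assign 0 (lit 0))]

/-- Delete the block of rows of column `v0` and give it new blocks until its key is at most that in
position `(v1, v2)`. Return `1` if there are not enough rows. -/
def renewBody : Cmd := seqs [
  assign 3 (lit 1),
  assign 4 (lit 0),
  loop (lt (lit 0) (var 3)) (seqs [
    assign 5 (load (arr 4 (var 0))),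
    assign 6 (add (var 5) (load (lit 24))),
    loop (lt (var 5) (var 6)) (seqs [store (arr 3 (var 5)) (lit 1),
      assign 5 (add (var 5) (lit 1))]),
    branch (wordLe (add (load (lit 40)) (load (lit 24))) (load (lit 8)))
      (seqs [store (arr 4 (var 0)) (load (lit 40)),
        call 1 [var 0, load (lit 40), load (lit 24)] 7,
        store (arr 5 (var 0)) (var 7),
        store (lit 40) (add (load (lit 40)) (load (lit 24))),
        call 0 [var 1, var 2, var 7, var 0] 3])
      (seqs [assign 4 (lit 1), assign 3 (lit 0)])]),
  assign 0 (var 4)]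

/-- Renew the blocks of all columns listed from index `v0` on, for the key in position
`(v1, v2)`. Return `0` or, if there were not enough rows, `2`. -/
def killBody : Cmd := seqs [
  assign 3 (lit 0),
  loop (lt (var 0) (load (lit 16))) (seqs [
    call 7 [load (arr 2 (var 0)), var 1, var 2] 4,
    branch (lt (lit 0) (var 4)) (assign 3 (lit 2)) skip,
    assign 0 (add (var 0) (lit 1))]),
  assign 0 (var 3)]

/-- Lower the upper bound to the key in position `(v0, v1)`. -/
def lowerHiBody : Cmd := seqs [
  call 0 [var 0, var 1, load (lit 72), load (lit 80)] 2,
  branch (lt (lit 0) (var 2)) (seqs [store (lit 72) (var 0), store (lit 80) (var 1)]) skip]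

/-- Set the lower bound to the smaller one of the key in position `(v0, v1)` and the upper bound. -/
def raiseLoBody : Cmd := seqs [
  call 0 [load (lit 72), load (lit 80), var 0, var 1] 2,
  branch (lt (lit 0) (var 2))
    (seqs [store (lit 56) (load (lit 72)), store (lit 64) (load (lit 80))])
    (seqs [store (lit 56) (var 0), store (lit 64) (var 1)])]

/-- Renew the blocks of the columns listed from index `v0` on until their keys are at most that in
position `(v1, v2)`, and return `0`. Return `1` if only the columns listed from the index in cell
`88` on are left, and `2` if there were not enough rows. -/
def lowerBody : Cmd := seqs [
  call 5 [var 0, var 1, var 2] 0,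
  branch (wordLe (load (lit 16)) (var 0)) (assign 0 (lit 0))
    (branch (wordLe (sub (load (lit 16)) (var 0)) (load (lit 32)))
      (seqs [
        call 6 [var 0, var 1, var 2] 3,
        branch (lt (lit 0) (var 3))
          (seqs [store (lit 88) (var 0), call 20 [var 1, var 2] 3, assign 0 (lit 1)])
          (seqs [call 9 [var 1, var 2] 3, call 8 [var 0, var 1, var 2] 0])])
      (seqs [
        call 4 [var 0] 4,
        call 10 [var 0, load (arr 5 (var 4)), var 4] 3,
        branch (lt (lit 0) (var 3)) (assign 0 (var 3)) (call 10 [var 0, var 1, var 2] 0)]))]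

/-- Assign to each column a block of `v0` rows. -/
def blocksBody : Cmd := seqs [
  assign 1 (lit 0),
  loop (lt (var 1) (load (lit 16))) (seqs [
    assign 2 (load (arr 2 (var 1))),
    store (arr 4 (var 2)) (mul (var 0) (var 1)),
    call 1 [var 2, mul (var 0) (var 1), var 0] 3,
    store (arr 5 (var 2)) (var 3),
    assign 1 (add (var 1) (lit 1))])]

/-- Delete a constant fraction of the rows or of the columns of an almost square matrix. -/
def squareBody : Cmd := seqs [
  call 11 [lit 1] 1,
  store (lit 24) (lit 1),
  store (lit 40) (load (lit 8)),
  store (lit 48) (lit 0),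
  call 5 [lit 0, load (lit 56), load (lit 64)] 0,
  branch (wordLe (sub (load (lit 16)) (var 0)) (div (mul (lit 15) (load (lit 16))) (lit 16)))
    (store (lit 88) (var 0))
    (seqs [
      call 4 [var 0] 1,
      assign 2 (load (arr 5 (var 1))),
      call 5 [var 0, var 2, var 1] 0,
      call 6 [var 0, var 2, var 1] 3,
      branch (lt (lit 0) (var 3))
        (seqs [store (lit 88) (var 0), call 20 [var 2, var 1] 3])
        (seqs [call 9 [var 2, var 1] 3, call 8 [var 0, var 2, var 1] 3, store (lit 88) (lit 0)])])]

/-- Delete most of the columns or a constant fraction of the rows of a tall matrix. -/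
def tallBody : Cmd := seqs [
  assign 0 (div (load (lit 8)) (mul (lit 2) (load (lit 16)))),
  store (lit 24) (var 0),
  call 11 [var 0] 1,
  store (lit 40) (mul (var 0) (load (lit 16))),
  store (lit 48) (lit 0),
  store (lit 88) (lit 0),
  assign 1 (lit 1),
  assign 2 (lit 0),
  loop (conj (lt (var 2) (mul (lit 16) (var 0))) (wordLe (var 1) (load (lit 16))))
    (seqs [assign 1 (mul (lit 2) (var 1)), assign 2 (add (var 2) (lit 1))]),
  assign 3 (div (load (lit 16)) (var 1)),
  branch (wordLe (lit 1) (var 3)) skip (assign 3 (lit 1)),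
  store (lit 32) (var 3),
  call 10 [lit 0, load (lit 56), load (lit 64)] 4,
  branch (lt (lit 0) (var 4)) skip (store (lit 88) (load (lit 16)))]

/-- Drop the columns before the index in cell `88` and the deleted rows from the lists. -/
def compactBody : Cmd := seqs [
  assign 0 (load (lit 88)),
  assign 1 (lit 0),
  loop (lt (var 0) (load (lit 16))) (seqs [
    store (arr 2 (var 1)) (load (arr 2 (var 0))),
    assign 0 (add (var 0) (lit 1)),
    assign 1 (add (var 1) (lit 1))]),
  store (lit 16) (var 1),
  assign 0 (lit 0),
  assign 1 (lit 0),
  loop (lt (var 0) (load (lit 8))) (seqs [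
    branch (lt (lit 0) (load (arr 3 (var 0)))) (store (arr 3 (var 0)) (lit 0))
      (seqs [store (arr 1 (var 1)) (load (arr 1 (var 0))), assign 1 (add (var 1) (lit 1))]),
    assign 0 (add (var 0) (lit 1))]),
  store (lit 8) (var 1)]

/-- Exchange the contents of two memory cells, using the variable `x`. -/
def exchange (x : ℕ) (a b : Expr) : Cmd :=
  seqs [assign x (load a), store a (load b), store b (var x)]

/-- Exchange the roles of rows and columns. -/
def swapBody : Cmd := seqs [
  store (lit 0) (sub (lit 1) (load (lit 0))),
  assign 1 (load (lit 8)),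
  branch (wordLe (var 1) (load (lit 16))) (assign 1 (load (lit 16))) skip,
  exchange 2 (lit 8) (lit 16),
  exchange 2 (lit 56) (lit 80),
  exchange 2 (lit 64) (lit 72),
  assign 0 (lit 0),
  loop (lt (var 0) (var 1)) (seqs [
    exchange 2 (arr 1 (var 0)) (arr 2 (var 0)),
    assign 0 (add (var 0) (lit 1))])]

/-- Set the lower bound to the smallest key in the first column. -/
def initLoBody : Cmd := seqs [
  call 1 [load (lit 2), lit 0, load (lit 8)] 0,
  store (lit 56) (var 0),
  store (lit 64) (load (lit 2))]

/-- Initialize the memory for a matrix with `v0` rows and `v1` columns. -/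
def initBody : Cmd := seqs [
  store (lit 8) (var 0),
  store (lit 16) (var 1),
  store (lit 96) (add (var 0) (var 1)),
  loop (lt (var 2) (var 0)) (seqs [
    store (arr 1 (var 2)) (var 2), assign 2 (add (var 2) (lit 1))]),
  loop (lt (var 3) (var 1)) (seqs [
    store (arr 2 (var 3)) (var 3), assign 3 (add (var 3) (lit 1))]),
  call 16 [] 4,
  call 15 [] 4,
  call 16 [] 4]

/-- Reduce the matrix until at most one column is left. -/
def reduceBody : Cmd :=
  loop (neg (conj (wordLe (load (lit 16)) (load (lit 8))) (wordLe (load (lit 16)) (lit 1))))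
    (branch (lt (load (lit 8)) (load (lit 16))) (call 15 [] 0)
      (seqs [
        branch (lt (load (lit 8)) (mul (lit 2) (load (lit 16)))) (call 12 [] 0) (call 13 [] 0),
        call 14 [] 0]))

/-- Set the cells `56` and `64` to the position of the value of the game. -/
def finishBody : Cmd := seqs [
  branch (wordLe (load (lit 16)) (lit 0)) skip
    (seqs [
      assign 1 (load (lit 2)),
      call 1 [var 1, lit 0, load (lit 8)] 0,
      call 9 [var 0, var 1] 2,
      call 0 [load (lit 56), load (lit 64), load (lit 72), load (lit 80)] 2,
      branch (lt (lit 0) (var 2))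
        (seqs [store (lit 56) (load (lit 72)), store (lit 64) (load (lit 80))]) skip]),
  branch (lt (lit 0) (load (lit 0))) (exchange 0 (lit 56) (lit 64)) skip]

/-- The procedures of both programs. -/
def procs : List Cmd := [cmpBody, argminBody, mergeBody, sampleBody, pivotBody, scanBody, walkBody,
  renewBody, killBody, lowerHiBody, lowerBody, blocksBody, squareBody, tallBody, compactBody,
  swapBody, initLoBody, initBody, reduceBody, finishBody, raiseLoBody]

/-- Compute the position of a candidate for a strict saddlepoint. -/
def core : Cmd := seqs [call 17 [var 0, var 1] 9, call 18 [] 9, call 19 [] 9]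

/-- Report the value of the saddlepoints. -/
def valueMain : Cmd := seqs [core, query (lit 0) (load (lit 56)) (load (lit 64))]

/-- Report a strict saddlepoint. -/
def strictMain : Cmd := seqs [core,
  assign 3 (var 0),
  assign 4 (var 1),
  assign 0 (lit 1),
  assign 1 (load (lit 56)),
  assign 2 (load (lit 64)),
  query (lit 0) (var 1) (var 2),
  loop (lt (var 5) (var 3)) (seqs [
    query (lit 1) (var 5) (var 2),
    branch (conj (neg (conj (wordLe (var 5) (var 1)) (wordLe (var 1) (var 5))))
      (entryLe (lit 1) (lit 0))) (assign 0 (lit 0)) skip,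
    assign 5 (add (var 5) (lit 1))]),
  loop (lt (var 6) (var 4)) (seqs [
    query (lit 1) (var 1) (var 6),
    branch (conj (neg (conj (wordLe (var 6) (var 2)) (wordLe (var 2) (var 6))))
      (entryLe (lit 0) (lit 1))) (assign 0 (lit 0)) skip,
    assign 6 (add (var 6) (lit 1))])]

end Saddle

/-! ### Distinct keys by tie-breaking, transposition, and the comparison of keys -/

namespace Saddle

open RAM Expr Test Cmd

variable {α : Type*} [LinearOrder α] {m n : ℕ}

/-- The strict order of the positions of a matrix by their entries, with ties broken by the row
and the column. -/
def posLt (A : Matrix (Fin m) (Fin n) α) (p q : Fin m × Fin n) : Prop :=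
  A p.1 p.2 < A q.1 q.2 ∨ A p.1 p.2 = A q.1 q.2 ∧ (p.1 < q.1 ∨ p.1 = q.1 ∧ p.2 < q.2)

theorem posLt_trans {A : Matrix (Fin m) (Fin n) α} {p q r : Fin m × Fin n} (h : posLt A p q)
    (h' : posLt A q r) : posLt A p r := by
  unfold posLt at *
  rcases h with h | ⟨h, h1⟩ <;> rcases h' with h' | ⟨h', h1'⟩
  · exact .inl (h.trans h')
  · exact .inl (h'.symm ▸ h)
  · exact .inl (h.symm ▸ h')
  · refine .inr ⟨h.trans h', ?_⟩
    rcases h1 with h1 | ⟨h1, h2⟩ <;> rcases h1' with h1' | ⟨h1', h2'⟩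
    · exact .inl (h1.trans h1')
    · exact .inl (h1' ▸ h1)
    · exact .inl (h1 ▸ h1')
    · exact .inr ⟨h1.trans h1', h2.trans h2'⟩

theorem posLt_irrefl {A : Matrix (Fin m) (Fin n) α} {p : Fin m × Fin n} : ¬ posLt A p p := by
  simp [posLt]

theorem posLt_trichotomy {A : Matrix (Fin m) (Fin n) α} (p q : Fin m × Fin n) :
    posLt A p q ∨ p = q ∨ posLt A q p := by
  unfold posLt
  rcases lt_trichotomy (A p.1 p.2) (A q.1 q.2) with h | h | h
  · simp [h]
  · rcases lt_trichotomy p.1 q.1 with h1 | h1 | h1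
    · simp [h, h1]
    · rcases lt_trichotomy p.2 q.2 with h2 | h2 | h2
      · exact .inl (.inr ⟨h, .inr ⟨h1, h2⟩⟩)
      · exact .inr (.inl (Prod.ext h1 h2))
      · exact .inr (.inr (.inr ⟨h.symm, .inr ⟨h1.symm, h2⟩⟩))
    · simp [h, h1]
  · simp [h]

open Classical in
/-- The rank of a position in the order `posLt`. -/
noncomputable def posRank (A : Matrix (Fin m) (Fin n) α) (p : Fin m × Fin n) : ℕ :=
  (Finset.univ.filter fun q => posLt A q p).card

/-- Counting predecessors embeds the strict total order `posLt` into the natural numbers. All later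
reasoning about entries becomes integer arithmetic. -/
theorem posRank_lt_posRank {A : Matrix (Fin m) (Fin n) α} {p q : Fin m × Fin n} :
    posRank A p < posRank A q ↔ posLt A p q := by
  have key : ∀ {p q : Fin m × Fin n}, posLt A p q → posRank A p < posRank A q := by
    intro p q h
    refine Finset.card_lt_card ⟨fun r hr => ?_, fun hs => ?_⟩
    · simp only [Finset.mem_filter, Finset.mem_univ, true_and] at hr ⊢
      exact posLt_trans hr h
    · have := hs (show p ∈ _ by simpa using h)
      simp only [Finset.mem_filter, Finset.mem_univ, true_and] at this
      exact posLt_irrefl this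
  refine ⟨fun h => ?_, key⟩
  rcases posLt_trichotomy (A := A) p q with h' | rfl | h'
  · exact h'
  · exact absurd h (lt_irrefl _)
  · exact absurd h (key h').le.not_gt

/-- The rank of the position in row `r` and column `c`. -/
noncomputable def rank (A : Matrix (Fin m) (Fin n) α) (r c : ℕ) : ℕ :=
  if h : r < m ∧ c < n then posRank A (⟨r, h.1⟩, ⟨c, h.2⟩) else 0

theorem rank_lt_rank {A : Matrix (Fin m) (Fin n) α} {r c r' c' : ℕ} (hr : r < m) (hc : c < n)
    (hr' : r' < m) (hc' : c' < n) : rank A r c < rank A r' c' ↔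
      A ⟨r, hr⟩ ⟨c, hc⟩ < A ⟨r', hr'⟩ ⟨c', hc'⟩ ∨ A ⟨r, hr⟩ ⟨c, hc⟩ = A ⟨r', hr'⟩ ⟨c', hc'⟩ ∧
        (r < r' ∨ r = r' ∧ c < c') := by
  rw [rank, rank, dif_pos ⟨hr, hc⟩, dif_pos ⟨hr', hc'⟩, posRank_lt_posRank]
  simp [posLt]

theorem rank_inj {A : Matrix (Fin m) (Fin n) α} {r c r' c' : ℕ} (hr : r < m) (hc : c < n)
    (hr' : r' < m) (hc' : c' < n) (h : rank A r c = rank A r' c') : r = r' ∧ c = c' := by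
  have h1 := (rank_lt_rank (A := A) hr hc hr' hc').not.1 h.not_lt
  have h2 := (rank_lt_rank (A := A) hr' hc' hr hc).not.1 h.not_gt
  push Not at h1 h2
  have h3 := le_antisymm h2.1 h1.1
  have := h1.2 h3
  have := h2.2 h3.symm
  omega

/-- The key of the position in row `r` and column `c`. If `o` is not `0`, then rows and columns are
exchanged and the order is reversed. -/
noncomputable def key (A : Matrix (Fin m) (Fin n) α) (o r c : ℕ) : ℤ :=
  if o = 0 then rank A r c else - (rank A c r : ℤ)

/-- The number of rows, or of columns if rows and columns are exchanged. -/
def rows (m n o : ℕ) : ℕ := if o = 0 then m else n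

theorem rows_le (m n o : ℕ) : rows m n o ≤ m + n := by
  unfold rows; split <;> omega

/-- Flipping the flag transposes the matrix and reverses the order. Upper and lower bounds, and rows
and columns, then play each other's roles, so only the case of at least as many rows as columns
needs an algorithm. -/
theorem key_swap (A : Matrix (Fin m) (Fin n) α) {o : ℕ} (ho : o ≤ 1) (r c : ℕ) :
    key A (1 - o) r c = - key A o c r := by
  obtain rfl | rfl : o = 0 ∨ o = 1 := by omega
  all_goals simp [key]

theorem rows_swap {o : ℕ} (ho : o ≤ 1) (m n : ℕ) : rows m n (1 - o) = rows n m o := by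
  obtain rfl | rfl : o = 0 ∨ o = 1 := by omega
  all_goals simp [rows]

theorem key_inj {A : Matrix (Fin m) (Fin n) α} {o r c r' c' : ℕ} (hr : r < rows m n o)
    (hc : c < rows n m o) (hr' : r' < rows m n o) (hc' : c' < rows n m o)
    (h : key A o r c = key A o r' c') : r = r' ∧ c = c' := by
  unfold key rows at *
  split_ifs at * with ho
  · exact rank_inj hr hc hr' hc' (by exact_mod_cast h)
  · exact (rank_inj (A := A) hc hr hc' hr' (by omega)).symm

variable {W : ℕ} {A : Matrix (Fin m) (Fin n) α} {mem : ℕ → ℕ}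

/-- With the flag set, the key at (r, c) is below that at (r', c') exactly if the rank at (c', r')
is below that at (c, r). The body therefore only has to reverse its list of four arguments. Testing
`≤` in both directions detects equal entries, for which the positions decide. -/
theorem calls_cmp (hW : 1000 * (m + n + 20) ≤ W) (ho : mem 0 ≤ 1) {r c r' c' : ℕ}
    (hr : r < rows m n (mem 0)) (hc : c < rows n m (mem 0)) (hr' : r' < rows m n (mem 0))
    (hc' : c' < rows n m (mem 0)) :
    Calls procs W A 0 [r, c, r', c'] mem fun v mem' t => mem' = mem ∧
      v = (if key A (mem 0) r c < key A (mem 0) r' c' then 1 else 0) ∧ t ≤ 60 := by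
  refine ⟨cmpBody, rfl, fun ent => run_of_wp ?_⟩
  have hW1 : 1 < W := by omega
  have hW0 : 0 < W := by omega
  obtain h0 | h0 : mem 0 = 0 ∨ mem 0 = 1 := by omega
  · simp only [h0, rows, Saddle.key, if_true] at hr hc hr' hc' ⊢
    have key := rank_lt_rank (A := A) hr hc hr' hc'
    simp only [cmpBody, seqs, lt, ↓wp_seq, ↓wp_assign, ↓wp_branch, ↓wp_query, ↓wp_skip, Test.Ok,
      Test.Holds, Test.time, Expr.Ok, Expr.val, Expr.time, h0, hr, hc, hr', hc', hW0, hW1,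
      Function.update_apply, Nat.reduceEqDiff, reduceIte, OfNat.ofNat_ne_zero,
      List.getD_cons_zero, List.getD_cons_succ, exists_true_left, true_and, Option.some.injEq,
      exists_eq', and_true, le_refl, not_true_eq_false, not_false_eq_true, false_imp_iff,
      true_imp_iff, exists_and_left, exists_eq_left', Nat.le_zero_eq, one_ne_zero, not_le, Nat.cast_lt, neg_lt_neg_iff, key,
      Nat.reduceAdd, Nat.reduceLeDiff]
    rcases lt_trichotomy (A ⟨r, hr⟩ ⟨c, hc⟩) (A ⟨r', hr'⟩ ⟨c', hc'⟩) with h | h | h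
    · simp [h, h.le, h.not_ge, h.not_gt, h.ne, h.ne']
    · simp [h]
      grind
    · simp [h, h.le, h.not_ge, h.not_gt, h.ne, h.ne']
  · simp only [h0, rows, Saddle.key, one_ne_zero, if_false] at hr hc hr' hc' ⊢
    have key := rank_lt_rank (A := A) hc' hr' hc hr
    simp only [cmpBody, seqs, lt, ↓wp_seq, ↓wp_assign, ↓wp_branch, ↓wp_query, ↓wp_skip, Test.Ok,
      Test.Holds, Test.time, Expr.Ok, Expr.val, Expr.time, h0, hr, hc, hr', hc', hW0, hW1,
      Function.update_apply, Nat.reduceEqDiff, reduceIte, OfNat.ofNat_ne_zero,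
      List.getD_cons_zero, List.getD_cons_succ, exists_true_left, true_and, Option.some.injEq,
      exists_eq', and_true, le_refl, not_true_eq_false, not_false_eq_true, false_imp_iff,
      true_imp_iff, exists_and_left, exists_eq_left', Nat.le_zero_eq, one_ne_zero, not_le, Nat.cast_lt, neg_lt_neg_iff, key,
      Nat.reduceAdd, Nat.reduceLeDiff]
    rcases lt_trichotomy (A ⟨c', hc'⟩ ⟨r', hr'⟩) (A ⟨c, hc⟩ ⟨r, hr⟩) with h | h | h
    · simp [h, h.le, h.not_ge, h.not_gt, h.ne, h.ne']
    · simp [h]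
      grind
    · simp [h, h.le, h.not_ge, h.not_gt, h.ne, h.ne']

end Saddle

/-! ### Minima in blocks and merging of sorted lists of columns -/

namespace Saddle

open RAM Expr Test Cmd

variable {α : Type*} [LinearOrder α] {m n : ℕ} {W : ℕ} {A : Matrix (Fin m) (Fin n) α}
  {mem : ℕ → ℕ}

theorem calls_argmin (hW : 1000 * (m + n + 20) ≤ W) (ho : mem 0 ≤ 1) {y pos t : ℕ}
    (hy : y < rows n m (mem 0)) (ht : 1 ≤ t) (hpos : pos + t ≤ m + n)
    (hR : ∀ k, pos ≤ k → k < pos + t → mem (8 * k + 1) < rows m n (mem 0)) :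
    Calls procs W A 1 [y, pos, t] mem fun v mem' T => mem' = mem ∧
      (∃ k, pos ≤ k ∧ k < pos + t ∧ v = mem (8 * k + 1)) ∧
      (∀ k, pos ≤ k → k < pos + t →
        key A (mem 0) v y ≤ key A (mem 0) (mem (8 * k + 1)) y) ∧ T ≤ 120 * t := by
  refine ⟨argminBody, rfl, fun ent => run_of_wp ?_⟩
  simp only [argminBody, seqs, lt, arr, ↓wp_seq, ↓wp_assign, ↓wp_branch, ↓wp_query, ↓wp_skip, ↓wp_store, ↓wp_loop,
    ↓wp_call, Test.Ok, Test.Holds, Test.time, Expr.Ok, Expr.val, Expr.time, Function.update_apply,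
    Nat.reduceEqDiff, reduceIte, OfNat.ofNat_ne_zero, OfNat.ofNat_ne_one, OfNat.zero_ne_ofNat,
    OfNat.one_ne_ofNat, one_ne_zero, zero_ne_one, List.getD_cons_zero, List.getD_cons_succ,
    List.getD_nil, true_and, and_true, and_assoc, not_le, Nat.reduceAdd, Nat.reduceMul]
  repeat refine And.intro (by omega) ?_
  refine run_for (fun i s => s.mem = mem ∧ s.loc 0 = y ∧ s.loc 3 = i ∧ s.loc 4 = pos + t ∧
    (∃ k, pos ≤ k ∧ k < i ∧ s.loc 5 = mem (8 * k + 1)) ∧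
      (∀ k, pos ≤ k → k < i → key A (mem 0) (s.loc 5) y ≤ key A (mem 0) (mem (8 * k + 1)) y))
    (pos + 1) (pos + t) 100 (by omega) ?_ ?_ ?_ ?_
  · refine ⟨rfl, rfl, rfl, rfl, ⟨pos, le_rfl, by omega, rfl⟩, fun k h1 h2 => ?_⟩
    obtain rfl : k = pos := by omega
    exact le_rfl
  · rintro i ⟨loc, mem', ent'⟩ hi1 hi2 ⟨h1, h2, h3, h4, ⟨k, h5, h6, h7⟩, h8⟩
    dsimp only at *
    subst h1
    refine ⟨by simp, by simp [h3, h4]; omega, run_of_wp ?_⟩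
    simp only [h2, h3, h4, seqs, lt, arr, ↓wp_seq, ↓wp_assign, ↓wp_branch, ↓wp_query, ↓wp_skip, ↓wp_store, ↓wp_loop,
    ↓wp_call, Test.Ok, Test.Holds, Test.time, Expr.Ok, Expr.val, Expr.time, Function.update_apply,
    Nat.reduceEqDiff, reduceIte, OfNat.ofNat_ne_zero, OfNat.ofNat_ne_one, OfNat.zero_ne_ofNat,
    OfNat.one_ne_ofNat, one_ne_zero, zero_ne_one, List.getD_cons_zero, List.getD_cons_succ,
    List.getD_nil, true_and, and_true, and_assoc, not_le, Nat.reduceAdd, Nat.reduceMul]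
    repeat refine And.intro (by omega) ?_
    refine run_call (by simp) (calls_cmp hW ho (hR i (by omega) hi2) (by simpa [h2] using hy)
      (by simpa [h7] using hR k h5 (by omega)) (by simpa [h2] using hy)) ?_
    rintro r mem₁ ent₁ T ⟨rfl, rfl, hT⟩
    simp only [h2, h3, h4, seqs, lt, arr, ↓wp_seq, ↓wp_assign, ↓wp_branch, ↓wp_query, ↓wp_skip, ↓wp_store, ↓wp_loop,
    ↓wp_call, Test.Ok, Test.Holds, Test.time, Expr.Ok, Expr.val, Expr.time, Function.update_apply,
    Nat.reduceEqDiff, reduceIte, OfNat.ofNat_ne_zero, OfNat.ofNat_ne_one, OfNat.zero_ne_ofNat,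
    OfNat.one_ne_ofNat, one_ne_zero, zero_ne_one, List.getD_cons_zero, List.getD_cons_succ,
    List.getD_nil, true_and, and_true, and_assoc, not_le, Nat.reduceAdd, Nat.reduceMul, List.map_cons, List.map_nil, List.sum_cons, List.sum_nil]
    refine ⟨by omega, fun h => ?_, fun h => ?_⟩
    · have h' : key A (mem₁ 0) (mem₁ (8 * i + 1)) y < key A (mem₁ 0) (loc 5) y := by
        by_contra h9
        simp [h9] at h
      refine ⟨by omega, by omega, ⟨i, by omega, by omega, rfl⟩, ?_, by omega⟩
      intro k' h9 h10
      obtain rfl | h11 : k' = i ∨ k' < i := by omega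
      · exact le_rfl
      · exact h'.le.trans (h8 _ h9 h11)
    · have h' : key A (mem₁ 0) (loc 5) y ≤ key A (mem₁ 0) (mem₁ (8 * i + 1)) y := by
        by_contra h9
        simp [not_le.1 h9] at h
      refine ⟨by omega, by omega, ⟨k, by omega, by omega, h7⟩, ?_, by omega⟩
      intro k' h9 h10
      obtain rfl | h11 : k' = i ∨ k' < i := by omega
      · exact h'
      · exact h8 _ h9 h11
  · rintro ⟨loc, mem', ent'⟩ ⟨h1, h2, h3, h4, h5⟩
    dsimp only at *
    simp [h3, h4]
  · rintro ⟨loc, mem', ent'⟩ T ⟨h1, h2, h3, h4, h5, h6⟩ hT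
    dsimp only at *
    subst h1
    simp only [seqs, lt, arr, ↓wp_seq, ↓wp_assign, ↓wp_branch, ↓wp_query, ↓wp_skip, ↓wp_store, ↓wp_loop,
    ↓wp_call, Test.Ok, Test.Holds, Test.time, Expr.Ok, Expr.val, Expr.time, Function.update_apply,
    Nat.reduceEqDiff, reduceIte, OfNat.ofNat_ne_zero, OfNat.ofNat_ne_one, OfNat.zero_ne_ofNat,
    OfNat.one_ne_ofNat, one_ne_zero, zero_ne_one, List.getD_cons_zero, List.getD_cons_succ,
    List.getD_nil, true_and, and_true, and_assoc, not_le, Nat.reduceAdd, Nat.reduceMul] at hT ⊢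
    exact ⟨h5, h6, by omega⟩

/-- The list `o` of length `q` is an initial segment of a merge of the sorted lists `a` and `b` of
length `len`. -/
structure Merged (κ : ℕ → ℤ) (a b o : ℕ → ℕ) (len q : ℕ) : Prop where
  sorted : ∀ x y, x ≤ y → y < q → κ (o x) ≤ κ (o y)
  src : ∀ x < q, (∃ i < len, o x = a i) ∨ ∃ i < len, o x = b i
  below : ∀ x < q, ∃ i j, i + j = x + 1 ∧ i ≤ len ∧ j ≤ len ∧ (∀ i' < i, κ (a i') ≤ κ (o x)) ∧
    ∀ j' < j, κ (b j') ≤ κ (o x)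
  above : ∀ x < q, ∃ i j, i + j = x ∧ i ≤ len ∧ j ≤ len ∧
    (∀ i', i ≤ i' → i' < len → κ (o x) ≤ κ (a i')) ∧ ∀ j', j ≤ j' → j' < len → κ (o x) ≤ κ (b j')

/-- The first `i` elements of `a` and the first `j` elements of `b` are merged into `o`. -/
structure MergeState (κ : ℕ → ℤ) (a b o : ℕ → ℕ) (len i j : ℕ) : Prop where
  merged : Merged κ a b o len (i + j)
  left_le : i ≤ len
  right_le : j ≤ len
  left : ∀ x < i + j, ∀ i', i ≤ i' → i' < len → κ (o x) ≤ κ (a i')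
  right : ∀ x < i + j, ∀ j', j ≤ j' → j' < len → κ (o x) ≤ κ (b j')
  cross_left : ∀ i' < i, ∀ j', j ≤ j' → j' < len → κ (a i') ≤ κ (b j')
  cross_right : ∀ j' < j, ∀ i', i ≤ i' → i' < len → κ (b j') ≤ κ (a i')

theorem Merged.symm {κ : ℕ → ℤ} {a b o : ℕ → ℕ} {len q : ℕ} (h : Merged κ a b o len q) :
    Merged κ b a o len q where
  sorted := h.sorted
  src x hx := (h.src x hx).symm
  below x hx := by
    obtain ⟨i, j, h1, h2, h3, h4, h5⟩ := h.below x hx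
    exact ⟨j, i, by omega, h3, h2, h5, h4⟩
  above x hx := by
    obtain ⟨i, j, h1, h2, h3, h4, h5⟩ := h.above x hx
    exact ⟨j, i, by omega, h3, h2, h5, h4⟩

theorem MergeState.symm {κ : ℕ → ℤ} {a b o : ℕ → ℕ} {len i j : ℕ}
    (h : MergeState κ a b o len i j) : MergeState κ b a o len j i where
  merged := by rw [add_comm]; exact h.merged.symm
  left_le := h.right_le
  right_le := h.left_le
  left := by rw [add_comm]; exact h.right
  right := by rw [add_comm]; exact h.left
  cross_left := h.cross_right
  cross_right := h.cross_left

/-- The new element `a i` stands at place i + j, after i elements of `a` and j of `b`. The splits (i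
+ 1, j) and (i, j) witness `below` and `above` for it. The two `cross` conditions are what makes
both splits valid, and they survive the step because `a i` is at most all remaining elements of `b`.
-/
theorem MergeState.left_step {κ : ℕ → ℤ} {a b o : ℕ → ℕ} {len i j : ℕ}
    (h : MergeState κ a b o len i j) (ha : ∀ x y, x ≤ y → y < len → κ (a x) ≤ κ (a y))
    (hb : ∀ x y, x ≤ y → y < len → κ (b x) ≤ κ (b y)) (hi : i < len)
    (hj : j < len → κ (a i) ≤ κ (b j)) :
    MergeState κ a b (Function.update o (i + j) (a i)) len (i + 1) j := by
  have hlt : ∀ x < i + j, Function.update o (i + j) (a i) x = o x := fun x hx =>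
    Function.update_of_ne (by omega) _ _
  have hab : ∀ j', j ≤ j' → j' < len → κ (a i) ≤ κ (b j') := fun j' h1 h2 =>
    (hj (by omega)).trans (hb _ _ h1 h2)
  refine ⟨⟨fun x y hxy hy => ?_, fun x hx => ?_, fun x hx => ?_, fun x hx => ?_⟩, hi, h.right_le,
    fun x hx i' h1 h2 => ?_, fun x hx j' h1 h2 => ?_, fun i' h1 j' h2 h3 => ?_,
    fun j' h1 i' h2 h3 => h.cross_right _ h1 _ (by omega) h3⟩
  · obtain rfl | hy' : y = i + j ∨ y < i + j := by omega
    · obtain rfl | hx' : x = i + j ∨ x < i + j := by omega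
      · exact le_rfl
      · rw [hlt _ hx', Function.update_self]
        exact h.left x hx' _ le_rfl hi
    · rw [hlt _ hy', hlt x (by omega)]
      exact h.merged.sorted _ _ hxy hy'
  · obtain rfl | hx' : x = i + j ∨ x < i + j := by omega
    · rw [Function.update_self]
      exact .inl ⟨i, hi, rfl⟩
    · rw [hlt _ hx']
      exact h.merged.src x hx'
  · obtain rfl | hx' : x = i + j ∨ x < i + j := by omega
    · rw [Function.update_self]
      exact ⟨i + 1, j, by omega, hi, h.right_le, fun i' hi' => ha _ _ (by omega) hi,
        fun j' hj' => h.cross_right _ hj' _ le_rfl hi⟩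
    · rw [hlt _ hx']
      exact h.merged.below x hx'
  · obtain rfl | hx' : x = i + j ∨ x < i + j := by omega
    · rw [Function.update_self]
      exact ⟨i, j, rfl, hi.le, h.right_le, fun i' h1 h2 => ha _ _ h1 h2, hab⟩
    · rw [hlt _ hx']
      exact h.merged.above x hx'
  · obtain rfl | hx' : x = i + j ∨ x < i + j := by omega
    · rw [Function.update_self]
      exact ha _ _ (by omega) h2
    · rw [hlt _ hx']
      exact h.left x hx' _ (by omega) h2
  · obtain rfl | hx' : x = i + j ∨ x < i + j := by omega
    · rw [Function.update_self]
      exact hab _ h1 h2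
    · rw [hlt _ hx']
      exact h.right x hx' _ h1 h2
  · obtain rfl | hi' : i' = i ∨ i' < i := by omega
    · exact hab _ h2 h3
    · exact h.cross_left _ hi' _ h2 h3

theorem MergeState.right_step {κ : ℕ → ℤ} {a b o : ℕ → ℕ} {len i j : ℕ}
    (h : MergeState κ a b o len i j) (ha : ∀ x y, x ≤ y → y < len → κ (a x) ≤ κ (a y))
    (hb : ∀ x y, x ≤ y → y < len → κ (b x) ≤ κ (b y)) (hj : j < len)
    (hi : i < len → κ (b j) ≤ κ (a i)) :
    MergeState κ a b (Function.update o (i + j) (b j)) len i (j + 1) := by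
  have := (h.symm.left_step hb ha hj hi).symm
  rwa [add_comm j i] at this

/-- The key of the smallest entry in the block of a column. -/
noncomputable def colKey (A : Matrix (Fin m) (Fin n) α) (mem : ℕ → ℕ) (c : ℕ) : ℤ :=
  if c < m + n then key A (mem 0) (mem (8 * c + 5)) c else 0

/-- The word `c` is a column with a key. -/
def ValidCol (m n : ℕ) (mem : ℕ → ℕ) (c : ℕ) : Prop :=
  c < rows n m (mem 0) ∧ mem (8 * c + 5) < rows m n (mem 0)

theorem ValidCol.lt {c : ℕ} (h : ValidCol m n mem c) : c < m + n :=
  h.1.trans_le ((rows_le n m _).trans (by omega))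

theorem ValidCol.congr {mem' : ℕ → ℕ} (h : ∀ x < 8 * (m + n + 20), mem' x = mem x) {c : ℕ}
    (hc : ValidCol m n mem c) : ValidCol m n mem' c := by
  have := hc.lt
  rw [ValidCol, h 0 (by omega), h (8 * c + 5) (by omega)]
  exact hc

theorem ValidCol.colKey_eq {c : ℕ} (hc : ValidCol m n mem c) :
    colKey A mem c = key A (mem 0) (mem (8 * c + 5)) c := if_pos hc.lt

/-- Because `colKey` is constant beyond m + n, it depends only on cells below the workspace. Writing
to the workspace therefore preserves it as a function, not only on valid columns. -/
theorem colKey_congr {mem' : ℕ → ℕ} (h : ∀ x < 8 * (m + n + 20), mem' x = mem x) :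
    colKey A mem' = colKey A mem := by
  funext c
  unfold colKey
  split
  · rw [h 0 (by omega), h (8 * c + 5) (by omega)]
  · rfl

theorem calls_cmp_cols (hW : 1000 * (m + n + 20) ≤ W) (ho : mem 0 ≤ 1) {c c' : ℕ}
    (hc : ValidCol m n mem c) (hc' : ValidCol m n mem c') :
    Calls procs W A 0 [mem (8 * c + 5), c, mem (8 * c' + 5), c'] mem fun v mem' t => mem' = mem ∧
      v = (if colKey A mem c < colKey A mem c' then 1 else 0) ∧ t ≤ 60 := by
  rw [hc.colKey_eq, hc'.colKey_eq]
  exact calls_cmp hW ho hc.2 hc.1 hc'.2 hc'.1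

/-- The full merge `o` exists only in the proof. For s = 2 the elements 2j and 2j + 1 are written to
the same cell and the later one stays, so merging and halving happen in one pass. The inputs stay
readable because no output cell coincides with an input cell. -/
theorem calls_merge (hW : 1000 * (m + n + 20) ≤ W) (ho : mem 0 ≤ 1) {a b len out s : ℕ}
    (hs : s = 1 ∨ s = 2) (hout : 8 * (m + n + 20) ≤ out) (hout' : out + 16 * len < W)
    (ha : a + 8 * len < W) (hb : b + 8 * len < W)
    (hda : ∀ i < len, ∀ j < 2 * len, a + 8 * i ≠ out + 8 * j)
    (hdb : ∀ i < len, ∀ j < 2 * len, b + 8 * i ≠ out + 8 * j)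
    (hva : ∀ i < len, ValidCol m n mem (mem (a + 8 * i)))
    (hvb : ∀ i < len, ValidCol m n mem (mem (b + 8 * i)))
    (hsa : ∀ x y, x ≤ y → y < len → colKey A mem (mem (a + 8 * x)) ≤ colKey A mem (mem (a + 8 * y)))
    (hsb : ∀ x y, x ≤ y → y < len →
      colKey A mem (mem (b + 8 * x)) ≤ colKey A mem (mem (b + 8 * y))) :
    Calls procs W A 2 [a, b, len, out, s] mem fun _ mem' T =>
      (∀ x, (∀ j < 2 * len, x ≠ out + 8 * j) → mem' x = mem x) ∧
      (∃ o, Merged (colKey A mem) (fun i => mem (a + 8 * i)) (fun i => mem (b + 8 * i)) o len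
        (2 * len) ∧ ∀ j, s * j + (s - 1) < 2 * len → mem' (out + 8 * j) = o (s * j + (s - 1))) ∧
      T ≤ 400 * len + 20 := by
  refine ⟨mergeBody, rfl, fun ent => run_of_wp ?_⟩
  simp only [mergeBody, seqs, lt, arr, ↓wp_seq, ↓wp_assign, ↓wp_branch, ↓wp_query, ↓wp_skip, ↓wp_store, ↓wp_loop,
    ↓wp_call, Test.Ok, Test.Holds, Test.time, Expr.Ok, Expr.val, Expr.time, Function.update_apply,
    Nat.reduceEqDiff, reduceIte, OfNat.ofNat_ne_zero, OfNat.ofNat_ne_one, OfNat.zero_ne_ofNat,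
    OfNat.one_ne_ofNat, one_ne_zero, zero_ne_one, List.getD_cons_zero, List.getD_cons_succ,
    List.getD_nil, true_and, and_true, and_assoc, not_le, Nat.reduceAdd, Nat.reduceMul]
  refine run_for (fun q s' => ∃ i j o, i + j = q ∧ s'.loc 0 = a ∧ s'.loc 1 = b ∧ s'.loc 2 = len ∧
      s'.loc 3 = out ∧ s'.loc 4 = s ∧ s'.loc 5 = i ∧ s'.loc 6 = j ∧
      MergeState (colKey A mem) (fun i => mem (a + 8 * i)) (fun i => mem (b + 8 * i)) o len i j ∧
      (∀ x, (∀ j < 2 * len, x ≠ out + 8 * j) → s'.mem x = mem x) ∧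
      ∀ x, s * x + (s - 1) < i + j → s'.mem (out + 8 * x) = o (s * x + (s - 1)))
    0 (2 * len) 170 (by omega) ?_ ?_ ?_ ?_
  · refine ⟨0, 0, fun _ => 0, rfl, rfl, rfl, rfl, rfl, rfl, rfl, rfl, ?_, fun _ _ => rfl, by simp⟩
    refine ⟨⟨?_, ?_, ?_, ?_⟩, ?_, ?_, ?_, ?_, ?_, ?_⟩ <;> simp
  · rintro q ⟨loc, mem', ent'⟩ - hq ⟨i, j, o, rfl, h0, h1, h2, h3, h4, h5, h6, hM, hmem, hres⟩
    dsimp only at *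
    have hma : ∀ i < len, mem' (a + 8 * i) = mem (a + 8 * i) := fun i hi => hmem _ (hda i hi)
    have hmb : ∀ i < len, mem' (b + 8 * i) = mem (b + 8 * i) := fun i hi => hmem _ (hdb i hi)
    have hlow : ∀ x < 8 * (m + n + 20), mem' x = mem x := fun x hx => hmem _ fun j hj => by omega
    have hm0 : mem' 0 = mem 0 := hlow 0 (by omega)
    have hdiv : (i + j) / s ≤ i + j := Nat.div_le_self _ _
    have hil := hM.left_le
    have hjl := hM.right_le
    refine ⟨by simp [h2]; omega, by simp [h2, h5, h6]; omega, ?_⟩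
    -- Writing element i + j of the merge to index (i + j) / s makes the cell of index x final
    -- exactly when i + j = s * x + (s - 1). Earlier writes to it are not covered by the invariant.
    have hupd : ∀ v, (∀ x, (∀ j < 2 * len, x ≠ out + 8 * j) →
        Function.update mem' (out + 8 * ((i + j) / s)) v x = mem x) ∧
        ∀ x, s * x + (s - 1) < i + j + 1 →
          Function.update mem' (out + 8 * ((i + j) / s)) v (out + 8 * x) =
            Function.update o (i + j) v (s * x + (s - 1)) := by
      intro v
      refine ⟨fun x hx => ?_, fun x hx => ?_⟩
      · rw [Function.update_of_ne (hx _ (by omega)), hmem x hx]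
      · rw [Function.update_apply, Function.update_apply]
        rcases hs with rfl | rfl
        · split_ifs with h1 h2 h2
          · rfl
          · omega
          · omega
          · exact hres x (by omega)
        · split_ifs with h1 h2 h2
          · rfl
          · omega
          · omega
          · exact hres x (by omega)
    have hleft : i < len → (j < len → colKey A mem (mem (a + 8 * i)) ≤ colKey A mem (mem (b + 8 * j))) →
        MergeState (colKey A mem) (fun i => mem (a + 8 * i)) (fun i => mem (b + 8 * i))
          (Function.update o (i + j) (mem' (a + 8 * i))) len (i + 1) j := by
      intro hi hj
      rw [hma i hi]
      exact hM.left_step hsa hsb hi hj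
    have hright : j < len → (i < len → colKey A mem (mem (b + 8 * j)) ≤ colKey A mem (mem (a + 8 * i))) →
        MergeState (colKey A mem) (fun i => mem (a + 8 * i)) (fun i => mem (b + 8 * i))
          (Function.update o (i + j) (mem' (b + 8 * j))) len i (j + 1) := by
      intro hi hj
      rw [hmb j hi]
      exact hM.right_step hsa hsb hi hj
    refine run_seq (Run.mono (Q := fun s₁ t₁ => (∀ x < 7, s₁.loc x = loc x) ∧ s₁.mem = mem' ∧
      (0 < s₁.loc 7 → i < len ∧
        (j < len → colKey A mem (mem (a + 8 * i)) ≤ colKey A mem (mem (b + 8 * j)))) ∧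
      (¬ 0 < s₁.loc 7 → j < len ∧
        (i < len → colKey A mem (mem (b + 8 * j)) ≤ colKey A mem (mem (a + 8 * i)))) ∧ t₁ ≤ 120)
      (run_of_wp ?_) ?_)
    · simp only [h0, h1, h2, h3, h4, h5, h6, seqs, lt, arr, ↓wp_seq, ↓wp_assign, ↓wp_branch, ↓wp_query, ↓wp_skip, ↓wp_store, ↓wp_loop,
    ↓wp_call, Test.Ok, Test.Holds, Test.time, Expr.Ok, Expr.val, Expr.time, Function.update_apply,
    Nat.reduceEqDiff, reduceIte, OfNat.ofNat_ne_zero, OfNat.ofNat_ne_one, OfNat.zero_ne_ofNat,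
    OfNat.one_ne_ofNat, one_ne_zero, zero_ne_one, List.getD_cons_zero, List.getD_cons_succ,
    List.getD_nil, true_and, and_true, and_assoc, not_le, Nat.reduceAdd, Nat.reduceMul]
      refine ⟨fun h7 => ⟨by omega, fun x hx => by simp [hx.ne], ?_⟩, fun h7 => ⟨fun h8 =>
        ⟨by omega, fun x hx => by simp [hx.ne], ?_⟩, fun h8 => ?_⟩⟩
      · simp
        omega
      · simp
        omega
      repeat refine And.intro (by omega) ?_
      have hvi := (hva i h8).congr hlow
      have hvj := (hvb j h7).congr hlow
      have hck := colKey_congr (A := A) hlow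
      have hvi' := hvi.lt
      have hvj' := hvj.lt
      rw [hma i h8, hmb j h7]
      refine run_call ?_ (calls_cmp_cols hW (by rwa [← hm0] at ho) hvi hvj) ?_
      · simp
        omega
      rintro r mem₁ ent₁ T ⟨rfl, hr, hT⟩
      rw [hck] at hr
      refine ⟨fun x hx => ?_, rfl, ?_⟩
      · simp [Function.update_apply, hx.ne, (show x ≠ 8 by omega), (show x ≠ 9 by omega)]
      simp only [Function.update_self, List.map_cons, List.map_nil, List.sum_cons, List.sum_nil,
        seqs, lt, arr, ↓wp_seq, ↓wp_assign, ↓wp_branch, ↓wp_query, ↓wp_skip, ↓wp_store, ↓wp_loop,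
    ↓wp_call, Test.Ok, Test.Holds, Test.time, Expr.Ok, Expr.val, Expr.time, Function.update_apply,
    Nat.reduceEqDiff, reduceIte, OfNat.ofNat_ne_zero, OfNat.ofNat_ne_one, OfNat.zero_ne_ofNat,
    OfNat.one_ne_ofNat, one_ne_zero, zero_ne_one, List.getD_cons_zero, List.getD_cons_succ,
    List.getD_nil, true_and, and_true, and_assoc, not_le, Nat.reduceAdd, Nat.reduceMul]
      split_ifs at hr with hlt
      · exact ⟨fun _ => ⟨h8, fun _ => hlt.le⟩, fun h => by omega, by omega⟩
      · exact ⟨fun h => by omega, fun _ => ⟨h7, fun _ => not_lt.1 hlt⟩, by omega⟩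
    · rintro ⟨loc₁, mem₁, ent₁⟩ t₁ ⟨hl, hm, h7, h7', ht⟩
      dsimp only at hm hl h7 h7'
      subst hm
      refine run_of_wp ?_
      simp only [hl, h0, h1, h2, h3, h4, h5, h6, Nat.reduceLT, seqs, lt, arr, ↓wp_seq, ↓wp_assign, ↓wp_branch, ↓wp_query, ↓wp_skip, ↓wp_store, ↓wp_loop,
    ↓wp_call, Test.Ok, Test.Holds, Test.time, Expr.Ok, Expr.val, Expr.time, Function.update_apply,
    Nat.reduceEqDiff, reduceIte, OfNat.ofNat_ne_zero, OfNat.ofNat_ne_one, OfNat.zero_ne_ofNat,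
    OfNat.one_ne_ofNat, one_ne_zero, zero_ne_one, List.getD_cons_zero, List.getD_cons_succ,
    List.getD_nil, true_and, and_true, and_assoc, not_le, Nat.reduceAdd, Nat.reduceMul]
      refine ⟨by omega, fun h8 => ?_, fun h8 => ?_⟩
      · obtain ⟨h9, h10⟩ := h7 h8
        repeat refine And.intro (by omega) ?_
        refine ⟨⟨i + 1, j, Function.update o (i + j) (mem₁ (a + 8 * i)), by omega,
          rfl, rfl, hleft h9 h10, fun x hx =>
          (Function.update_apply _ _ _ _).symm.trans ((hupd _).1 x hx), fun x hx =>
          (Function.update_apply _ _ _ _).symm.trans ((hupd _).2 x (by omega))⟩, by omega⟩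
      · obtain ⟨h9, h10⟩ := h7' h8
        repeat refine And.intro (by omega) ?_
        refine ⟨⟨i, j + 1, Function.update o (i + j) (mem₁ (b + 8 * j)), by omega,
          rfl, rfl, hright h9 h10, fun x hx =>
          (Function.update_apply _ _ _ _).symm.trans ((hupd _).1 x hx), fun x hx =>
          (Function.update_apply _ _ _ _).symm.trans ((hupd _).2 x (by omega))⟩, by omega⟩
  · rintro ⟨loc, mem', ent'⟩ ⟨i, j, o, h, h0, h1, h2, h3, h4, h5, h6, hM, hmem, hres⟩
    dsimp only at *
    simp [h2, h5, h6]
    omega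
  · rintro ⟨loc, mem', ent'⟩ T ⟨i, j, o, h, h0, h1, h2, h3, h4, h5, h6, hM, hmem, hres⟩ hT
    dsimp only at *
    simp only [seqs, lt, arr, ↓wp_seq, ↓wp_assign, ↓wp_branch, ↓wp_query, ↓wp_skip, ↓wp_store, ↓wp_loop,
    ↓wp_call, Test.Ok, Test.Holds, Test.time, Expr.Ok, Expr.val, Expr.time, Function.update_apply,
    Nat.reduceEqDiff, reduceIte, OfNat.ofNat_ne_zero, OfNat.ofNat_ne_one, OfNat.zero_ne_ofNat,
    OfNat.one_ne_ofNat, one_ne_zero, zero_ne_one, List.getD_cons_zero, List.getD_cons_succ,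
    List.getD_nil, true_and, and_true, and_assoc, not_le, Nat.reduceAdd, Nat.reduceMul] at hT ⊢
    exact ⟨hmem, ⟨o, h ▸ hM.merged, by rwa [h] at hres⟩, by omega⟩

end Saddle

/-! ### Sorted samples of a list -/

namespace Saddle

open RAM Expr Test Cmd

/-- The number of elements of a list of length `N` with keys at most `v`. -/
def countLe (κ : ℕ → ℤ) (f : ℕ → ℕ) (N : ℕ) (v : ℤ) : ℕ :=
  ∑ u ∈ Finset.range N, if κ (f u) ≤ v then 1 else 0

/-- The number of elements of a list of length `N` with keys at least `v`. -/
def countGe (κ : ℕ → ℤ) (f : ℕ → ℕ) (N : ℕ) (v : ℤ) : ℕ :=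
  ∑ u ∈ Finset.range N, if v ≤ κ (f u) then 1 else 0

theorem countLe_add (κ : ℕ → ℤ) (f : ℕ → ℕ) (N M : ℕ) (v : ℤ) :
    countLe κ f (N + M) v = countLe κ f N v + countLe κ (fun u => f (N + u)) M v :=
  Finset.sum_range_add _ _ _

theorem countGe_add (κ : ℕ → ℤ) (f : ℕ → ℕ) (N M : ℕ) (v : ℤ) :
    countGe κ f (N + M) v = countGe κ f N v + countGe κ (fun u => f (N + u)) M v :=
  Finset.sum_range_add _ _ _

theorem countLe_mono {κ : ℕ → ℤ} {f : ℕ → ℕ} {N : ℕ} {v v' : ℤ} (h : v ≤ v') :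
    countLe κ f N v ≤ countLe κ f N v' := by
  refine Finset.sum_le_sum fun u _ => ?_
  split_ifs <;> omega

theorem countGe_anti {κ : ℕ → ℤ} {f : ℕ → ℕ} {N : ℕ} {v v' : ℤ} (h : v' ≤ v) :
    countGe κ f N v ≤ countGe κ f N v' := by
  refine Finset.sum_le_sum fun u _ => ?_
  split_ifs <;> omega

/-- The sorted list `y` of length `len` is a sample of the list `f` of length `N`: each of its
elements stands for `w` elements, up to an error of `d / 2`. -/
structure Sample (κ : ℕ → ℤ) (f : ℕ → ℕ) (N : ℕ) (y : ℕ → ℕ) (len w d : ℕ) : Prop where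
  sorted : ∀ x z, x ≤ z → z < len → κ (y x) ≤ κ (y z)
  src : ∀ j < len, ∃ u < N, y j = f u
  below : ∀ j < len, w * (2 * (j + 1)) ≤ 2 * countLe κ f N (κ (y j)) + d
  above : ∀ j < len, w * (2 * (len - j)) ≤ 2 * countGe κ f N (κ (y j)) + d

namespace Sample

variable {κ : ℕ → ℤ} {f : ℕ → ℕ} {N : ℕ} {y a b o : ℕ → ℕ} {len w d : ℕ}

theorem below' (h : Sample κ f N y len w d) {i : ℕ} {v : ℤ} (hi : i ≤ len)
    (hv : ∀ i' < i, κ (y i') ≤ v) : w * (2 * i) ≤ 2 * countLe κ f N v + d := by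
  cases i with
  | zero => simp
  | succ i =>
    have h1 := h.below i (by omega)
    have h2 := countLe_mono (κ := κ) (f := f) (N := N) (hv i (by omega))
    omega

theorem above' (h : Sample κ f N y len w d) {i : ℕ} {v : ℤ} (hi : i ≤ len)
    (hv : ∀ i', i ≤ i' → i' < len → v ≤ κ (y i')) :
    w * (2 * (len - i)) ≤ 2 * countGe κ f N v + d := by
  obtain rfl | hi' := hi.eq_or_lt
  · simp
  · have h1 := h.above i hi'
    have h2 := countGe_anti (κ := κ) (f := f) (N := N) (hv i le_rfl hi')
    omega

/-- The element `o x` dominates the first i elements of one sample and the first j of the other,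
where i + j = x + 1. The bounds of the two samples for i and j add up, and so do their errors. -/
theorem merged_below (ha : Sample κ f N a len w d)
    (hb : Sample κ (fun u => f (N + u)) N b len w d) (h : Merged κ a b o len (2 * len)) {x : ℕ}
    (hx : x < 2 * len) : w * (2 * (x + 1)) ≤ 2 * countLe κ f (2 * N) (κ (o x)) + 2 * d := by
  obtain ⟨i, j, hij, hi, hj, h1, h2⟩ := h.below x hx
  have h3 := ha.below' hi h1
  have h4 := hb.below' hj h2
  rw [two_mul N, countLe_add, ← hij]
  have : w * (2 * (i + j)) = w * (2 * i) + w * (2 * j) := by ring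
  omega

theorem merged_above (ha : Sample κ f N a len w d)
    (hb : Sample κ (fun u => f (N + u)) N b len w d) (h : Merged κ a b o len (2 * len)) {x : ℕ}
    (hx : x < 2 * len) :
    w * (2 * (2 * len - x)) ≤ 2 * countGe κ f (2 * N) (κ (o x)) + 2 * d := by
  obtain ⟨i, j, hij, hi, hj, h1, h2⟩ := h.above x hx
  have h3 := ha.above' hi h1
  have h4 := hb.above' hj h2
  rw [two_mul N, countGe_add]
  have : w * (2 * (2 * len - x)) = w * (2 * (len - i)) + w * (2 * (len - j)) := by
    rw [← mul_add]
    congr 1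
    omega
  omega

theorem merged_src (ha : Sample κ f N a len w d)
    (hb : Sample κ (fun u => f (N + u)) N b len w d) (h : Merged κ a b o len (2 * len)) {x : ℕ}
    (hx : x < 2 * len) : ∃ u < 2 * N, o x = f u := by
  obtain ⟨i, hi, h1⟩ | ⟨i, hi, h1⟩ := h.src x hx
  · obtain ⟨u, hu, h2⟩ := ha.src i hi
    exact ⟨u, by omega, h1.trans h2⟩
  · obtain ⟨u, hu, h2⟩ := hb.src i hi
    exact ⟨N + u, by omega, h1.trans h2⟩

theorem merge (ha : Sample κ f N a len w d) (hb : Sample κ (fun u => f (N + u)) N b len w d)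
    (h : Merged κ a b o len (2 * len)) : Sample κ f (2 * N) o (2 * len) w (2 * d) where
  sorted := h.sorted
  src _ hj := merged_src ha hb h hj
  below _ hj := merged_below ha hb h hj
  above _ hj := merged_above ha hb h hj

/-- Keeping every second element, starting with the second one, doubles the weight. Counting from
below loses nothing, as 2(j + 1) elements of the merge are at most element 2j + 1. From above, one
merged element of weight w is missing, which in the doubled scale of `d` is the extra 2w. -/
theorem merge_decimate (ha : Sample κ f N a len w d)
    (hb : Sample κ (fun u => f (N + u)) N b len w d) (h : Merged κ a b o len (2 * len)) :
    Sample κ f (2 * N) (fun j => o (2 * j + 1)) len (2 * w) (2 * d + 2 * w) where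
  sorted x z hxz hz := h.sorted _ _ (by omega) (by omega)
  src _ hj := merged_src ha hb h (by omega)
  below j hj := by
    have := merged_below ha hb h (show 2 * j + 1 < 2 * len by omega)
    have h1 : 2 * w * (2 * (j + 1)) = w * (2 * (2 * j + 1 + 1)) := by ring
    omega
  above j hj := by
    have := merged_above ha hb h (show 2 * j + 1 < 2 * len by omega)
    have h1 : 2 * w * (2 * (len - j)) = w * (2 * (2 * len - (2 * j + 1))) + 2 * w := by
      obtain ⟨e, rfl⟩ := Nat.exists_eq_add_of_lt hj
      rw [show j + e + 1 - j = e + 1 by omega,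
        show 2 * (j + e + 1) - (2 * j + 1) = 2 * e + 1 by omega]
      ring
    omega

theorem congr {y' f' : ℕ → ℕ} (h : Sample κ f N y len w d) (hf : ∀ u < N, f' u = f u)
    (hy : ∀ j < len, y' j = y j) : Sample κ f' N y' len w d := by
  have h1 : ∀ v, countLe κ f' N v = countLe κ f N v := fun v =>
    Finset.sum_congr rfl fun u hu => by rw [hf u (Finset.mem_range.1 hu)]
  have h2 : ∀ v, countGe κ f' N v = countGe κ f N v := fun v =>
    Finset.sum_congr rfl fun u hu => by rw [hf u (Finset.mem_range.1 hu)]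
  refine ⟨fun x z hx hz => ?_, fun j hj => ?_, fun j hj => ?_, fun j hj => ?_⟩
  · rw [hy x (by omega), hy z hz]
    exact h.sorted x z hx hz
  · obtain ⟨u, hu, h3⟩ := h.src j hj
    exact ⟨u, hu, by rw [hy j hj, hf u hu, h3]⟩
  · rw [hy j hj, h1]
    exact h.below j hj
  · rw [hy j hj, h2]
    exact h.above j hj

theorem singleton (κ : ℕ → ℤ) (f : ℕ → ℕ) : Sample κ f 1 f 1 1 0 := by
  refine ⟨fun x z hx hz => ?_, fun j hj => ⟨j, hj, rfl⟩, fun j hj => ?_, fun j hj => ?_⟩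
  · obtain rfl : x = z := by omega
    exact le_rfl
  · obtain rfl : j = 0 := by omega
    simp only [countLe, Finset.sum_range_one, le_refl, if_true]
  · obtain rfl : j = 0 := by omega
    simp only [countGe, Finset.sum_range_one, le_refl, if_true]

end Sample

variable {α : Type*} [LinearOrder α] {m n : ℕ} {W : ℕ} {A : Matrix (Fin m) (Fin n) α}
  {mem : ℕ → ℕ}

/-- Merging two samples that are stored in memory. -/
theorem calls_merge_sample (hW : 1000 * (m + n + 20) ≤ W) (ho : mem 0 ≤ 1) {a b len out s : ℕ}
    (hs : s = 1 ∨ s = 2) (hout : 8 * (m + n + 20) ≤ out) (hout' : out + 16 * len < W)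
    (ha : a + 8 * len < W) (hb : b + 8 * len < W)
    (hda : ∀ i < len, ∀ j < 2 * len, a + 8 * i ≠ out + 8 * j)
    (hdb : ∀ i < len, ∀ j < 2 * len, b + 8 * i ≠ out + 8 * j) {f : ℕ → ℕ} {N w d : ℕ}
    (hv : ∀ u < 2 * N, ValidCol m n mem (f u))
    (hsa : Sample (colKey A mem) f N (fun i => mem (a + 8 * i)) len w d)
    (hsb : Sample (colKey A mem) (fun u => f (N + u)) N (fun i => mem (b + 8 * i)) len w d) :
    Calls procs W A 2 [a, b, len, out, s] mem fun _ mem' T =>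
      (∀ x, (∀ j < 2 * len, x ≠ out + 8 * j) → mem' x = mem x) ∧
      (s = 1 → Sample (colKey A mem) f (2 * N) (fun i => mem' (out + 8 * i)) (2 * len) w (2 * d)) ∧
      (s = 2 → Sample (colKey A mem) f (2 * N) (fun i => mem' (out + 8 * i)) len (2 * w)
        (2 * d + 2 * w)) ∧ T ≤ 400 * len + 20 := by
  refine (calls_merge hW ho hs hout hout' ha hb hda hdb ?_ ?_ hsa.sorted hsb.sorted).mono ?_
  · intro i hi
    obtain ⟨u, hu, h⟩ := hsa.src i hi
    exact h ▸ hv u (by omega)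
  · intro i hi
    obtain ⟨u, hu, h⟩ := hsb.src i hi
    exact h ▸ hv (N + u) (by omega)
  · rintro r mem' T ⟨h1, ⟨o, h2, h3⟩, h4⟩
    refine ⟨h1, ?_, ?_, h4⟩
    · rintro rfl
      exact (hsa.merge hsb h2).congr (fun _ _ => rfl) fun j hj => by
        have := h3 j (by omega)
        simpa using this
    · rintro rfl
      exact (hsa.merge_decimate hsb h2).congr (fun _ _ => rfl) fun j hj => h3 j (by omega)

/-- The four quarters are sampled recursively, merged in pairs, and the two results are merged with
halving. The error obeys d(i+1) = 4 d(i) + 2 · 2^i, solved by 4^i - 2^i, about half of the list in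
the doubled scale. Merging costs O(2^i) against a list of length 2 · 4^i, so the total time is
linear; the subtracted term 2000 · 2^i in the bound absorbs the merging. -/
theorem calls_sample (hW : 1000 * (m + n + 20) ≤ W) (i : ℕ) : ∀ {mem : ℕ → ℕ} {a out : ℕ},
    mem 0 ≤ 1 → 8 * (m + n + 20) ≤ out → out + 40 * (2 * 2 ^ i) < W → a + 16 * 4 ^ i ≤ out →
    (∀ u < 2 * 4 ^ i, ValidCol m n mem (mem (a + 8 * u))) →
    Calls procs W A 3 [2 * 4 ^ i, 2 * 2 ^ i, a, out] mem fun _ mem' T =>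
      (∀ x < out, mem' x = mem x) ∧
      Sample (colKey A mem) (fun u => mem (a + 8 * u)) (2 * 4 ^ i) (fun j => mem' (out + 8 * j))
        (2 * 2 ^ i) (2 ^ i) (4 ^ i - 2 ^ i) ∧ T + 2000 * 2 ^ i ≤ 2500 * 4 ^ i := by
  induction i with
  | zero =>
    intro mem a out ho hout hout' ha hv
    refine ⟨sampleBody, rfl, fun ent => run_of_wp ?_⟩
    simp only [sampleBody, pow_zero, mul_one, seqs, lt, arr, ↓wp_seq, ↓wp_assign, ↓wp_branch, ↓wp_query, ↓wp_skip, ↓wp_store, ↓wp_loop,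
    ↓wp_call, Test.Ok, Test.Holds, Test.time, Expr.Ok, Expr.val, Expr.time, Function.update_apply,
    Nat.reduceEqDiff, reduceIte, OfNat.ofNat_ne_zero, OfNat.ofNat_ne_one, OfNat.zero_ne_ofNat,
    OfNat.one_ne_ofNat, one_ne_zero, zero_ne_one, List.getD_cons_zero, List.getD_cons_succ,
    List.getD_nil, true_and, and_true, and_assoc, not_le, Nat.reduceAdd, Nat.reduceMul] at *
    refine ⟨by omega, fun _ => ?_, by omega⟩
    refine run_call ?_ (calls_merge_sample (a := a) (b := a + 8) (len := 1) (out := out) (s := 1)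
      (f := fun u => mem (a + 8 * u)) (N := 1) (w := 1) (d := 0) hW ho
      (.inl rfl) hout (by omega) (by omega) (by omega) (fun i hi j hj => by omega)
      (fun i hi j hj => by omega) hv (Sample.singleton _ _)
      ((Sample.singleton _ _).congr (fun _ _ => rfl) fun j hj => by grind)) ?_
    · simp
      omega
    rintro r mem₁ ent₁ T ⟨h1, h2, -, h3⟩
    simp only [List.map_cons, List.map_nil, List.sum_cons, List.sum_nil, seqs, lt, arr, ↓wp_seq, ↓wp_assign, ↓wp_branch, ↓wp_query, ↓wp_skip, ↓wp_store, ↓wp_loop,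
    ↓wp_call, Test.Ok, Test.Holds, Test.time, Expr.Ok, Expr.val, Expr.time, Function.update_apply,
    Nat.reduceEqDiff, reduceIte, OfNat.ofNat_ne_zero, OfNat.ofNat_ne_one, OfNat.zero_ne_ofNat,
    OfNat.one_ne_ofNat, one_ne_zero, zero_ne_one, List.getD_cons_zero, List.getD_cons_succ,
    List.getD_nil, true_and, and_true, and_assoc, not_le, Nat.reduceAdd, Nat.reduceMul]
    refine ⟨fun x hx => h1 x fun j hj => by omega, h2 rfl, by omega⟩
  | succ i ih =>
    intro mem a out ho hout hout' ha hv
    have hp : 0 < 2 ^ i := by positivity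
    have hq : 2 ^ i ≤ 4 ^ i := Nat.pow_le_pow_left (by omega) i
    simp only [pow_succ] at *
    generalize 2 ^ i = p at *
    generalize 4 ^ i = q at *
    refine ⟨sampleBody, rfl, fun ent => run_of_wp ?_⟩
    simp only [sampleBody, seqs, lt, arr, ↓wp_seq, ↓wp_assign, ↓wp_branch, ↓wp_query, ↓wp_skip, ↓wp_store, ↓wp_loop,
    ↓wp_call, Test.Ok, Test.Holds, Test.time, Expr.Ok, Expr.val, Expr.time, Function.update_apply,
    Nat.reduceEqDiff, reduceIte, OfNat.ofNat_ne_zero, OfNat.ofNat_ne_one, OfNat.zero_ne_ofNat,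
    OfNat.one_ne_ofNat, one_ne_zero, zero_ne_one, List.getD_cons_zero, List.getD_cons_succ,
    List.getD_nil, true_and, and_true, and_assoc, not_le, Nat.reduceAdd, Nat.reduceMul] at *
    have e1 : 2 * (q * 4) / 4 = 2 * q := by omega
    have e2 : 2 * (p * 2) / 2 = 2 * p := by omega
    simp only [e1, e2]
    refine ⟨by omega, fun _ => by omega, fun _ => ?_⟩
    repeat refine And.intro (by omega) ?_
    have cong : ∀ {mem₁ : ℕ → ℕ} {b : ℕ}, (∀ x < b, mem₁ x = mem x) → out ≤ b →
        (∀ x < 8 * (m + n + 20), mem₁ x = mem x) ∧ (∀ u < 8 * q, mem₁ (a + 8 * u) = mem (a + 8 * u)) ∧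
        colKey A mem₁ = colKey A mem ∧ mem₁ 0 = mem 0 ∧
        ∀ u < 8 * q, ValidCol m n mem₁ (mem₁ (a + 8 * u)) := by
      intro mem₁ b h hb
      have h1 : ∀ x < 8 * (m + n + 20), mem₁ x = mem x := fun x hx => h x (by omega)
      have h2 : ∀ u < 8 * q, mem₁ (a + 8 * u) = mem (a + 8 * u) := fun u hu => h _ (by omega)
      refine ⟨h1, h2, colKey_congr h1, h 0 (by omega), fun u hu => ?_⟩
      rw [h2 u hu]
      exact (hv u (by omega)).congr h1
    -- The samples of the quarters are placed one behind the other, beyond the room for the result.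
    -- A recursive call changes no cell below its own output, so it preserves the samples made
    -- before, and its workspace may be overwritten by the next call.
    have child : ∀ (k : ℕ) {mem₁ : ℕ → ℕ} {a' out' : ℕ}, k < 4 → a' = a + 8 * (k * (2 * q)) →
        out' = out + 32 * p + k * (16 * p) → (∀ x < out, mem₁ x = mem x) →
        Calls procs W A 3 [2 * q, 2 * p, a', out'] mem₁ fun _ mem' T =>
          (∀ x < out', mem' x = mem₁ x) ∧
          Sample (colKey A mem) (fun u => mem (a + 8 * (k * (2 * q) + u))) (2 * q)
            (fun j => mem' (out' + 8 * j)) (2 * p) p (q - p) ∧ T + 2000 * p ≤ 2500 * q := by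
      rintro k mem₁ a' out' hk rfl rfl h
      obtain ⟨h1, h2, h3, h4, h5⟩ := cong h le_rfl
      have hkp : k * (16 * p) ≤ 3 * (16 * p) := Nat.mul_le_mul_right _ (by omega)
      have hkq : k * (2 * q) ≤ 3 * (2 * q) := Nat.mul_le_mul_right _ (by omega)
      refine (ih (mem := mem₁) (by omega) (by omega) (by omega) (by omega) fun u hu => ?_).mono ?_
      · have := h5 (k * (2 * q) + u) (by omega)
        rwa [mul_add, ← add_assoc] at this
      · rintro r mem' T ⟨g1, g2, g3⟩
        rw [h3] at g2
        refine ⟨g1, g2.congr (fun u hu => ?_) fun _ _ => rfl, g3⟩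
        have := h2 (k * (2 * q) + u) (by omega)
        rw [← this, mul_add, ← add_assoc]

    refine run_call_of_eq (child 0 (a' := a) (out' := out + 32 * p) (by omega) (by omega)
      (by omega) fun _ _ => rfl) (by simp <;> omega) (by
    simp only [List.map_cons, List.map_nil, List.cons.injEq, seqs, lt, arr, ↓wp_seq, ↓wp_assign, ↓wp_branch, ↓wp_query, ↓wp_skip, ↓wp_store, ↓wp_loop,
    ↓wp_call, Test.Ok, Test.Holds, Test.time, Expr.Ok, Expr.val, Expr.time, Function.update_apply,
    Nat.reduceEqDiff, reduceIte, OfNat.ofNat_ne_zero, OfNat.ofNat_ne_one, OfNat.zero_ne_ofNat,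
    OfNat.one_ne_ofNat, one_ne_zero, zero_ne_one, List.getD_cons_zero, List.getD_cons_succ,
    List.getD_nil, true_and, and_true, and_assoc, not_le, Nat.reduceAdd, Nat.reduceMul]
    all_goals omega) rfl ?_
    rintro - mem₁ - T₁ ⟨f1, s1, t1⟩
    simp only [List.map_cons, List.map_nil, List.sum_cons, List.sum_nil, seqs, lt, arr, ↓wp_seq, ↓wp_assign, ↓wp_branch, ↓wp_query, ↓wp_skip, ↓wp_store, ↓wp_loop,
    ↓wp_call, Test.Ok, Test.Holds, Test.time, Expr.Ok, Expr.val, Expr.time, Function.update_apply,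
    Nat.reduceEqDiff, reduceIte, OfNat.ofNat_ne_zero, OfNat.ofNat_ne_one, OfNat.zero_ne_ofNat,
    OfNat.one_ne_ofNat, one_ne_zero, zero_ne_one, List.getD_cons_zero, List.getD_cons_succ,
    List.getD_nil, true_and, and_true, and_assoc, not_le, Nat.reduceAdd, Nat.reduceMul]
    refine run_call_of_eq (child 1 (a' := a + 16 * q) (out' := out + 48 * p) (by omega) (by omega)
      (by omega) fun _ _ => by grind) (by simp <;> omega) (by
    simp only [List.map_cons, List.map_nil, List.cons.injEq, seqs, lt, arr, ↓wp_seq, ↓wp_assign, ↓wp_branch, ↓wp_query, ↓wp_skip, ↓wp_store, ↓wp_loop,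
    ↓wp_call, Test.Ok, Test.Holds, Test.time, Expr.Ok, Expr.val, Expr.time, Function.update_apply,
    Nat.reduceEqDiff, reduceIte, OfNat.ofNat_ne_zero, OfNat.ofNat_ne_one, OfNat.zero_ne_ofNat,
    OfNat.one_ne_ofNat, one_ne_zero, zero_ne_one, List.getD_cons_zero, List.getD_cons_succ,
    List.getD_nil, true_and, and_true, and_assoc, not_le, Nat.reduceAdd, Nat.reduceMul]
    all_goals omega) rfl ?_
    rintro - mem₂ - T₂ ⟨f2, s2, t2⟩
    simp only [List.map_cons, List.map_nil, List.sum_cons, List.sum_nil, seqs, lt, arr, ↓wp_seq, ↓wp_assign, ↓wp_branch, ↓wp_query, ↓wp_skip, ↓wp_store, ↓wp_loop,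
    ↓wp_call, Test.Ok, Test.Holds, Test.time, Expr.Ok, Expr.val, Expr.time, Function.update_apply,
    Nat.reduceEqDiff, reduceIte, OfNat.ofNat_ne_zero, OfNat.ofNat_ne_one, OfNat.zero_ne_ofNat,
    OfNat.one_ne_ofNat, one_ne_zero, zero_ne_one, List.getD_cons_zero, List.getD_cons_succ,
    List.getD_nil, true_and, and_true, and_assoc, not_le, Nat.reduceAdd, Nat.reduceMul]
    refine run_call_of_eq (child 2 (a' := a + 32 * q) (out' := out + 64 * p) (by omega) (by omega)
      (by omega) fun _ _ => by grind) (by simp <;> omega) (by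
    simp only [List.map_cons, List.map_nil, List.cons.injEq, seqs, lt, arr, ↓wp_seq, ↓wp_assign, ↓wp_branch, ↓wp_query, ↓wp_skip, ↓wp_store, ↓wp_loop,
    ↓wp_call, Test.Ok, Test.Holds, Test.time, Expr.Ok, Expr.val, Expr.time, Function.update_apply,
    Nat.reduceEqDiff, reduceIte, OfNat.ofNat_ne_zero, OfNat.ofNat_ne_one, OfNat.zero_ne_ofNat,
    OfNat.one_ne_ofNat, one_ne_zero, zero_ne_one, List.getD_cons_zero, List.getD_cons_succ,
    List.getD_nil, true_and, and_true, and_assoc, not_le, Nat.reduceAdd, Nat.reduceMul]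
    all_goals omega) rfl ?_
    rintro - mem₃ - T₃ ⟨f3, s3, t3⟩
    simp only [List.map_cons, List.map_nil, List.sum_cons, List.sum_nil, seqs, lt, arr, ↓wp_seq, ↓wp_assign, ↓wp_branch, ↓wp_query, ↓wp_skip, ↓wp_store, ↓wp_loop,
    ↓wp_call, Test.Ok, Test.Holds, Test.time, Expr.Ok, Expr.val, Expr.time, Function.update_apply,
    Nat.reduceEqDiff, reduceIte, OfNat.ofNat_ne_zero, OfNat.ofNat_ne_one, OfNat.zero_ne_ofNat,
    OfNat.one_ne_ofNat, one_ne_zero, zero_ne_one, List.getD_cons_zero, List.getD_cons_succ,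
    List.getD_nil, true_and, and_true, and_assoc, not_le, Nat.reduceAdd, Nat.reduceMul]
    refine run_call_of_eq (child 3 (a' := a + 48 * q) (out' := out + 80 * p) (by omega) (by omega)
      (by omega) fun _ _ => by grind) (by simp <;> omega) (by
    simp only [List.map_cons, List.map_nil, List.cons.injEq, seqs, lt, arr, ↓wp_seq, ↓wp_assign, ↓wp_branch, ↓wp_query, ↓wp_skip, ↓wp_store, ↓wp_loop,
    ↓wp_call, Test.Ok, Test.Holds, Test.time, Expr.Ok, Expr.val, Expr.time, Function.update_apply,
    Nat.reduceEqDiff, reduceIte, OfNat.ofNat_ne_zero, OfNat.ofNat_ne_one, OfNat.zero_ne_ofNat,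
    OfNat.one_ne_ofNat, one_ne_zero, zero_ne_one, List.getD_cons_zero, List.getD_cons_succ,
    List.getD_nil, true_and, and_true, and_assoc, not_le, Nat.reduceAdd, Nat.reduceMul]
    all_goals omega) rfl ?_
    rintro - mem₄ - T₄ ⟨f4, s4, t4⟩
    simp only [List.map_cons, List.map_nil, List.sum_cons, List.sum_nil, seqs, lt, arr, ↓wp_seq, ↓wp_assign, ↓wp_branch, ↓wp_query, ↓wp_skip, ↓wp_store, ↓wp_loop,
    ↓wp_call, Test.Ok, Test.Holds, Test.time, Expr.Ok, Expr.val, Expr.time, Function.update_apply,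
    Nat.reduceEqDiff, reduceIte, OfNat.ofNat_ne_zero, OfNat.ofNat_ne_one, OfNat.zero_ne_ofNat,
    OfNat.one_ne_ofNat, one_ne_zero, zero_ne_one, List.getD_cons_zero, List.getD_cons_succ,
    List.getD_nil, true_and, and_true, and_assoc, not_le, Nat.reduceAdd, Nat.reduceMul]
    obtain ⟨g1, g2, g3, g4, g5⟩ := cong (mem₁ := mem₄) (b := out) (fun _ _ => by grind) le_rfl
    refine run_call_of_eq (calls_merge_sample (a := out + 32 * p) (b := out + 48 * p)
      (len := 2 * p) (out := out + 96 * p) (s := 1) (f := fun u => mem (a + 8 * u)) (N := 2 * q)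
      (w := p) (d := q - p) hW
      (by omega) (.inl rfl) (by omega) (by omega) (by omega) (by omega)
      (fun _ _ _ _ => by omega) (fun _ _ _ _ => by omega)
      (fun u hu => (hv u (by omega)).congr g1)
      (by rw [g3]; exact s1.congr (fun u hu => by simp) fun j hj => by grind)
      (by rw [g3]; exact s2.congr (fun u hu => by simp) fun j hj => by grind))
      (by simp <;> omega) (by
    simp only [List.map_cons, List.map_nil, List.cons.injEq, seqs, lt, arr, ↓wp_seq, ↓wp_assign, ↓wp_branch, ↓wp_query, ↓wp_skip, ↓wp_store, ↓wp_loop,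
    ↓wp_call, Test.Ok, Test.Holds, Test.time, Expr.Ok, Expr.val, Expr.time, Function.update_apply,
    Nat.reduceEqDiff, reduceIte, OfNat.ofNat_ne_zero, OfNat.ofNat_ne_one, OfNat.zero_ne_ofNat,
    OfNat.one_ne_ofNat, one_ne_zero, zero_ne_one, List.getD_cons_zero, List.getD_cons_succ,
    List.getD_nil, true_and, and_true, and_assoc, not_le, Nat.reduceAdd, Nat.reduceMul]
    all_goals omega) rfl ?_
    rintro - mem₅ - T₅ ⟨f5, s5, -, t5⟩
    have s5 := s5 rfl
    rw [g3] at s5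
    simp only [List.map_cons, List.map_nil, List.sum_cons, List.sum_nil, seqs, lt, arr, ↓wp_seq, ↓wp_assign, ↓wp_branch, ↓wp_query, ↓wp_skip, ↓wp_store, ↓wp_loop,
    ↓wp_call, Test.Ok, Test.Holds, Test.time, Expr.Ok, Expr.val, Expr.time, Function.update_apply,
    Nat.reduceEqDiff, reduceIte, OfNat.ofNat_ne_zero, OfNat.ofNat_ne_one, OfNat.zero_ne_ofNat,
    OfNat.one_ne_ofNat, one_ne_zero, zero_ne_one, List.getD_cons_zero, List.getD_cons_succ,
    List.getD_nil, true_and, and_true, and_assoc, not_le, Nat.reduceAdd, Nat.reduceMul]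
    obtain ⟨g1, g2, g3, g4, g5⟩ := cong (mem₁ := mem₅) (b := out)
      (fun _ _ => by rw [f5 _ fun _ _ => by omega]; grind) le_rfl
    refine run_call_of_eq (calls_merge_sample (a := out + 64 * p) (b := out + 80 * p)
      (len := 2 * p) (out := out + 128 * p) (s := 1) (f := fun u => mem (a + 8 * (4 * q + u)))
      (N := 2 * q) (w := p) (d := q - p) hW
      (by omega) (.inl rfl) (by omega) (by omega) (by omega) (by omega)
      (fun _ _ _ _ => by omega) (fun _ _ _ _ => by omega)
      (fun u hu => (hv (4 * q + u) (by omega)).congr g1)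
      (by
        rw [g3]
        refine s3.congr (fun u hu => ?_) fun j hj => ?_
        · rw [show 2 * (2 * q) + u = 4 * q + u by omega]
        · rw [f5 _ fun _ _ => by omega]; grind)
      (by
        rw [g3]
        refine s4.congr (fun u hu => ?_) fun j hj => ?_
        · rw [show 3 * (2 * q) + u = 4 * q + (2 * q + u) by omega]
        · rw [f5 _ fun _ _ => by omega]))
      (by simp <;> omega) (by
    simp only [List.map_cons, List.map_nil, List.cons.injEq, seqs, lt, arr, ↓wp_seq, ↓wp_assign, ↓wp_branch, ↓wp_query, ↓wp_skip, ↓wp_store, ↓wp_loop,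
    ↓wp_call, Test.Ok, Test.Holds, Test.time, Expr.Ok, Expr.val, Expr.time, Function.update_apply,
    Nat.reduceEqDiff, reduceIte, OfNat.ofNat_ne_zero, OfNat.ofNat_ne_one, OfNat.zero_ne_ofNat,
    OfNat.one_ne_ofNat, one_ne_zero, zero_ne_one, List.getD_cons_zero, List.getD_cons_succ,
    List.getD_nil, true_and, and_true, and_assoc, not_le, Nat.reduceAdd, Nat.reduceMul]
    all_goals omega) rfl ?_
    rintro - mem₆ - T₆ ⟨f6, s6, -, t6⟩
    have s6 := s6 rfl
    rw [g3] at s6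
    simp only [List.map_cons, List.map_nil, List.sum_cons, List.sum_nil, seqs, lt, arr, ↓wp_seq, ↓wp_assign, ↓wp_branch, ↓wp_query, ↓wp_skip, ↓wp_store, ↓wp_loop,
    ↓wp_call, Test.Ok, Test.Holds, Test.time, Expr.Ok, Expr.val, Expr.time, Function.update_apply,
    Nat.reduceEqDiff, reduceIte, OfNat.ofNat_ne_zero, OfNat.ofNat_ne_one, OfNat.zero_ne_ofNat,
    OfNat.one_ne_ofNat, one_ne_zero, zero_ne_one, List.getD_cons_zero, List.getD_cons_succ,
    List.getD_nil, true_and, and_true, and_assoc, not_le, Nat.reduceAdd, Nat.reduceMul]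
    obtain ⟨g1, g2, g3, g4, g5⟩ := cong (mem₁ := mem₆) (b := out)
      (fun _ _ => by rw [f6 _ fun _ _ => by omega, f5 _ fun _ _ => by omega]; grind) le_rfl
    refine run_call_of_eq (calls_merge_sample (a := out + 96 * p) (b := out + 128 * p)
      (len := 4 * p) (out := out) (s := 2) (f := fun u => mem (a + 8 * u))
      (N := 4 * q) (w := p) (d := 2 * (q - p)) hW
      (by omega) (.inr rfl) (by omega) (by omega) (by omega) (by omega)
      (fun _ _ _ _ => by omega) (fun _ _ _ _ => by omega)
      (fun u hu => (hv u (by omega)).congr g1)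
      (by
        rw [g3]
        rw [← mul_assoc, ← mul_assoc] at s5
        refine s5.congr (fun u hu => rfl) fun j hj => ?_
        rw [f6 _ fun _ _ => by omega])
      (by
        rw [g3]
        rw [← mul_assoc, ← mul_assoc] at s6
        exact s6))
      (by simp <;> omega) (by
    simp only [List.map_cons, List.map_nil, List.cons.injEq, seqs, lt, arr, ↓wp_seq, ↓wp_assign, ↓wp_branch, ↓wp_query, ↓wp_skip, ↓wp_store, ↓wp_loop,
    ↓wp_call, Test.Ok, Test.Holds, Test.time, Expr.Ok, Expr.val, Expr.time, Function.update_apply,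
    Nat.reduceEqDiff, reduceIte, OfNat.ofNat_ne_zero, OfNat.ofNat_ne_one, OfNat.zero_ne_ofNat,
    OfNat.one_ne_ofNat, one_ne_zero, zero_ne_one, List.getD_cons_zero, List.getD_cons_succ,
    List.getD_nil, true_and, and_true, and_assoc, not_le, Nat.reduceAdd, Nat.reduceMul]
    all_goals omega) rfl ?_
    rintro - mem₇ - T₇ ⟨f7, -, s7, t7⟩
    have s7 := s7 rfl
    rw [g3] at s7
    simp only [List.map_cons, List.map_nil, List.sum_cons, List.sum_nil, seqs, lt, arr, ↓wp_seq, ↓wp_assign, ↓wp_branch, ↓wp_query, ↓wp_skip, ↓wp_store, ↓wp_loop,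
    ↓wp_call, Test.Ok, Test.Holds, Test.time, Expr.Ok, Expr.val, Expr.time, Function.update_apply,
    Nat.reduceEqDiff, reduceIte, OfNat.ofNat_ne_zero, OfNat.ofNat_ne_one, OfNat.zero_ne_ofNat,
    OfNat.one_ne_ofNat, one_ne_zero, zero_ne_one, List.getD_cons_zero, List.getD_cons_succ,
    List.getD_nil, true_and, and_true, and_assoc, not_le, Nat.reduceAdd, Nat.reduceMul]
    refine ⟨fun x hx => ?_, ?_, by omega⟩
    · rw [f7 _ fun _ _ => by omega, f6 _ fun _ _ => by omega, f5 _ fun _ _ => by omega]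
      grind
    · rw [show 2 * (q * 4) = 2 * (4 * q) by omega, show 2 * (p * 2) = 4 * p by omega,
        show p * 2 = 2 * p by omega, show q * 4 - 2 * p = 2 * (2 * (q - p)) + 2 * p by omega]
      exact s7

end Saddle

/-! ### Pivots in linear time -/

namespace Saddle

open RAM Expr Test Cmd

variable {α : Type*} [LinearOrder α] {m n : ℕ} {W : ℕ} {A : Matrix (Fin m) (Fin n) α}
  {mem : ℕ → ℕ}

theorem countLe_eq_card (κ : ℕ → ℤ) (f : ℕ → ℕ) (N : ℕ) (v : ℤ) :
    countLe κ f N v = ((Finset.range N).filter fun u => κ (f u) ≤ v).card :=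
  (Finset.card_filter _ _).symm

theorem countGe_eq_card (κ : ℕ → ℤ) (f : ℕ → ℕ) (N : ℕ) (v : ℤ) :
    countGe κ f N v = ((Finset.range N).filter fun u => v ≤ κ (f u)).card :=
  (Finset.card_filter _ _).symm

theorem card_filter_range_le_Ico {P : ℕ → Prop} [DecidablePred P] {lo N b : ℕ} (h : lo + N ≤ b) :
    ((Finset.range N).filter fun u => P (lo + u)).card ≤ ((Finset.Ico lo b).filter P).card := by
  refine Finset.card_le_card_of_injOn (lo + ·) (fun u hu => ?_) (fun x _ y _ h => ?_)
  · simp only [Finset.coe_filter, Finset.mem_range, Set.mem_setOf_eq, Finset.mem_Ico] at hu ⊢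
    exact ⟨by omega, hu.2⟩
  · simpa using h

/-- A sample bounds the number of keys that are at least v, whereas a pivot needs keys strictly
above it. As the keys are distinct, the two numbers differ by at most one. -/
theorem card_filter_le_succ {κ : ℕ → ℤ} {s : Finset ℕ} {v : ℤ}
    (h : ∀ x ∈ s, ∀ y ∈ s, κ x = κ y → x = y) :
    (s.filter fun j => v ≤ κ j).card ≤ (s.filter fun j => v < κ j).card + 1 := by
  have h1 : (s.filter fun j => v ≤ κ j) =
      (s.filter fun j => v < κ j) ∪ s.filter fun j => κ j = v := by
    ext j
    simp only [Finset.mem_filter, Finset.mem_union]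
    grind
  rw [h1]
  refine (Finset.card_union_le _ _).trans (Nat.add_le_add_left (Finset.card_le_one.2 ?_) _)
  simp only [Finset.mem_filter]
  exact fun x hx y hy => h _ hx.1 _ hy.1 (hx.2.trans hy.2.symm)

/-- Write N for the number of columns, p = 2^i and q = 4^i = p². The sample of length 2p is taken
from the first 2q columns, where 2q ≤ N < 8q. Its element with index p - 1 has at least (q + p)/2
keys at most it and (q + 3p)/2 keys at least it among these. Both exceed N/16, the second one even
after the pivot itself is left out. -/
theorem calls_pivot (hW : 1000 * (m + n + 20) ≤ W) (ho : mem 0 ≤ 1) (hG : mem 96 = m + n)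
    (hn : mem 16 ≤ m + n) {lo : ℕ} (hlo : lo + 2 ≤ mem 16)
    (hv : ∀ j, lo ≤ j → j < mem 16 → ValidCol m n mem (mem (8 * j + 2)))
    (hinj : ∀ j ∈ Finset.Ico lo (mem 16), ∀ k ∈ Finset.Ico lo (mem 16),
      colKey A mem (mem (8 * j + 2)) = colKey A mem (mem (8 * k + 2)) → j = k) :
    Calls procs W A 4 [lo] mem fun r mem' T => (∀ x < 8 * (m + n + 20), mem' x = mem x) ∧
      (∃ j, lo ≤ j ∧ j < mem 16 ∧ r = mem (8 * j + 2)) ∧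
      mem 16 - lo ≤ 16 * ((Finset.Ico lo (mem 16)).filter
        fun j => colKey A mem (mem (8 * j + 2)) ≤ colKey A mem r).card ∧
      mem 16 - lo ≤ 16 * ((Finset.Ico lo (mem 16)).filter
        fun j => colKey A mem r < colKey A mem (mem (8 * j + 2))).card ∧
      T ≤ 2000 * (mem 16 - lo) := by
  refine ⟨pivotBody, rfl, fun ent => run_of_wp ?_⟩
  simp only [pivotBody, seqs, lt, arr, ↓wp_seq, ↓wp_assign, ↓wp_branch, ↓wp_query, ↓wp_skip, ↓wp_store, ↓wp_loop,
    ↓wp_call, Test.Ok, Test.Holds, Test.time, Expr.Ok, Expr.val, Expr.time, Function.update_apply,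
    Nat.reduceEqDiff, reduceIte, OfNat.ofNat_ne_zero, OfNat.ofNat_ne_one, OfNat.zero_ne_ofNat,
    OfNat.one_ne_ofNat, one_ne_zero, zero_ne_one, List.getD_cons_zero, List.getD_cons_succ,
    List.getD_nil, true_and, and_true, and_assoc, not_le, Nat.reduceAdd, Nat.reduceMul]
  repeat refine And.intro (by omega) ?_
  refine run_loop (fun s => mem 16 - s.loc 2) (fun s T => s.mem = mem ∧ s.loc 0 = lo ∧
    s.loc 1 = mem 16 - lo ∧ s.loc 4 = 8 * (m + n + 20) ∧ ∃ i, s.loc 2 = 2 * 4 ^ i ∧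
      s.loc 3 = 2 * 2 ^ i ∧ 2 * 4 ^ i ≤ mem 16 - lo ∧ T ≤ 20 * 4 ^ i) ?_ ?_ ?_
  · exact ⟨rfl, rfl, rfl, by simp [hG], 0, by simp, by simp, by omega, by simp⟩
  · rintro ⟨loc, mem', ent'⟩ T ⟨h1, h2, h3, h4, i, h5, h6, h7, h8⟩
    dsimp only at *
    subst h1
    have hp : 0 < 2 ^ i := by positivity
    have hq : 2 ^ i ≤ 4 ^ i := Nat.pow_le_pow_left (by omega) i
    refine ⟨by simp [h5, h6, h3]; omega, fun hb => run_of_wp ?_⟩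
    simp only [h2, h3, h4, h5, h6, seqs, lt, arr, ↓wp_seq, ↓wp_assign, ↓wp_branch, ↓wp_query, ↓wp_skip, ↓wp_store, ↓wp_loop,
    ↓wp_call, Test.Ok, Test.Holds, Test.time, Expr.Ok, Expr.val, Expr.time, Function.update_apply,
    Nat.reduceEqDiff, reduceIte, OfNat.ofNat_ne_zero, OfNat.ofNat_ne_one, OfNat.zero_ne_ofNat,
    OfNat.one_ne_ofNat, one_ne_zero, zero_ne_one, List.getD_cons_zero, List.getD_cons_succ,
    List.getD_nil, true_and, and_true, and_assoc, not_le, Nat.reduceAdd, Nat.reduceMul] at hb ⊢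
    repeat refine And.intro (by omega) ?_
    exact ⟨⟨i + 1, by ring, by ring, by omega, by omega⟩, by omega⟩
  · rintro ⟨loc, mem', ent'⟩ T ⟨h1, h2, h3, h4, i, h5, h6, h7, h8⟩ hb
    dsimp only at *
    subst h1
    have hp : 0 < 2 ^ i := by positivity
    have hq : 2 ^ i ≤ 4 ^ i := Nat.pow_le_pow_left (by omega) i
    have hpq : 2 ^ i * 2 ^ i = 4 ^ i := by
      rw [← mul_pow]
      norm_num
    simp only [h3, h5, seqs, lt, arr, ↓wp_seq, ↓wp_assign, ↓wp_branch, ↓wp_query, ↓wp_skip, ↓wp_store, ↓wp_loop,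
    ↓wp_call, Test.Ok, Test.Holds, Test.time, Expr.Ok, Expr.val, Expr.time, Function.update_apply,
    Nat.reduceEqDiff, reduceIte, OfNat.ofNat_ne_zero, OfNat.ofNat_ne_one, OfNat.zero_ne_ofNat,
    OfNat.one_ne_ofNat, one_ne_zero, zero_ne_one, List.getD_cons_zero, List.getD_cons_succ,
    List.getD_nil, true_and, and_true, and_assoc, not_le, Nat.reduceAdd, Nat.reduceMul] at hb
    refine run_of_wp ?_
    simp only [h2, h3, h4, h5, h6, seqs, lt, arr, ↓wp_seq, ↓wp_assign, ↓wp_branch, ↓wp_query, ↓wp_skip, ↓wp_store, ↓wp_loop,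
    ↓wp_call, Test.Ok, Test.Holds, Test.time, Expr.Ok, Expr.val, Expr.time, Function.update_apply,
    Nat.reduceEqDiff, reduceIte, OfNat.ofNat_ne_zero, OfNat.ofNat_ne_one, OfNat.zero_ne_ofNat,
    OfNat.one_ne_ofNat, one_ne_zero, zero_ne_one, List.getD_cons_zero, List.getD_cons_succ,
    List.getD_nil, true_and, and_true, and_assoc, not_le, Nat.reduceAdd, Nat.reduceMul]
    refine run_call_of_eq (calls_sample (a := 8 * lo + 2) (out := 8 * (m + n + 20)) hW i ho le_rfl
      (by omega) (by omega)
      fun u hu => ?_) (by simp <;> omega) (by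
    simp only [List.map_cons, List.map_nil, List.cons.injEq, seqs, lt, arr, ↓wp_seq, ↓wp_assign, ↓wp_branch, ↓wp_query, ↓wp_skip, ↓wp_store, ↓wp_loop,
    ↓wp_call, Test.Ok, Test.Holds, Test.time, Expr.Ok, Expr.val, Expr.time, Function.update_apply,
    Nat.reduceEqDiff, reduceIte, OfNat.ofNat_ne_zero, OfNat.ofNat_ne_one, OfNat.zero_ne_ofNat,
    OfNat.one_ne_ofNat, one_ne_zero, zero_ne_one, List.getD_cons_zero, List.getD_cons_succ,
    List.getD_nil, true_and, and_true, and_assoc, not_le, Nat.reduceAdd, Nat.reduceMul]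
    all_goals omega) rfl ?_
    · have := hv (lo + u) (by omega) (by omega)
      rwa [mul_add, add_right_comm] at this
    rintro - mem₁ - T₁ ⟨f1, s1, t1⟩
    generalize 2 ^ i = p at *
    generalize 4 ^ i = q at *
    have e1 : 2 * p / 2 = p := by omega
    simp only [h4, h6, e1, List.map_cons, List.map_nil, List.sum_cons, List.sum_nil, seqs, lt, arr, ↓wp_seq, ↓wp_assign, ↓wp_branch, ↓wp_query, ↓wp_skip, ↓wp_store, ↓wp_loop,
    ↓wp_call, Test.Ok, Test.Holds, Test.time, Expr.Ok, Expr.val, Expr.time, Function.update_apply,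
    Nat.reduceEqDiff, reduceIte, OfNat.ofNat_ne_zero, OfNat.ofNat_ne_one, OfNat.zero_ne_ofNat,
    OfNat.one_ne_ofNat, one_ne_zero, zero_ne_one, List.getD_cons_zero, List.getD_cons_succ,
    List.getD_nil, true_and, and_true, and_assoc, not_le, Nat.reduceAdd, Nat.reduceMul]
    have hlt : p - 1 < 2 * p := by omega
    obtain ⟨u, hu, hsrc⟩ := s1.src (p - 1) hlt
    have h9 := s1.below (p - 1) hlt
    have h10 := s1.above (p - 1) hlt
    rw [hsrc] at h9 h10 ⊢
    rw [countLe_eq_card] at h9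
    rw [countGe_eq_card] at h10
    rw [show p - 1 + 1 = p by omega, show p * (2 * p) = 2 * (p * p) by ring, hpq] at h9
    rw [show 2 * p - (p - 1) = p + 1 by omega, show p * (2 * (p + 1)) = 2 * (p * p) + 2 * p by ring,
      hpq] at h10
    have e2 : ∀ u, 8 * lo + 2 + 8 * u = 8 * (lo + u) + 2 := fun u => by ring
    simp only [e2] at h9 h10 ⊢
    have h11 := card_filter_range_le_Ico (b := mem' 16) (lo := lo) (N := 2 * q) (P := fun j =>
      colKey A mem' (mem' (8 * j + 2)) ≤ colKey A mem' (mem' (8 * (lo + u) + 2))) (by omega)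
    have h12 := card_filter_range_le_Ico (b := mem' 16) (lo := lo) (N := 2 * q) (P := fun j =>
      colKey A mem' (mem' (8 * (lo + u) + 2)) ≤ colKey A mem' (mem' (8 * j + 2))) (by omega)
    have h13 := card_filter_le_succ (v := colKey A mem' (mem' (8 * (lo + u) + 2))) hinj
    repeat refine And.intro (by omega) ?_
    refine ⟨⟨lo + u, by omega, by omega, rfl⟩, by omega, by omega, by omega⟩

end Saddle

/-! ### Partition of the columns by a threshold, and the staircase walk -/

namespace Saddle

open RAM Expr Test Cmd

variable {α : Type*} [LinearOrder α] {m n : ℕ} {W : ℕ} {A : Matrix (Fin m) (Fin n) α}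
  {mem : ℕ → ℕ}

/-- The list of columns is permuted by `σ` between the indices `lo` and `hi`. -/
structure ColPerm (mem mem' : ℕ → ℕ) (lo hi : ℕ) (σ : Equiv.Perm ℕ) : Prop where
  fix : ∀ j, j < lo ∨ hi ≤ j → σ j = j
  perm : ∀ j, mem' (8 * j + 2) = mem (8 * σ j + 2)
  same : ∀ x, x % 8 ≠ 2 → mem' x = mem x

namespace ColPerm

variable {mem mem' mem'' : ℕ → ℕ} {lo hi : ℕ} {σ τ : Equiv.Perm ℕ}

theorem refl (mem : ℕ → ℕ) (lo hi : ℕ) : ColPerm mem mem lo hi 1 :=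
  ⟨fun _ _ => rfl, fun _ => rfl, fun _ _ => rfl⟩

theorem mem_range (h : ColPerm mem mem' lo hi σ) {j : ℕ} (h1 : lo ≤ j) (h2 : j < hi) :
    lo ≤ σ j ∧ σ j < hi := by
  by_contra h3
  have h4 : σ (σ j) = σ j := h.fix _ (by omega)
  have := σ.injective h4
  omega

theorem symm (h : ColPerm mem mem' lo hi σ) : ColPerm mem' mem lo hi σ.symm where
  fix j hj := by
    have := h.fix j hj
    rw [Equiv.symm_apply_eq, this]
  perm j := by rw [h.perm, Equiv.apply_symm_apply]
  same x hx := (h.same x hx).symm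

theorem trans (h : ColPerm mem mem' lo hi σ) (h' : ColPerm mem' mem'' lo hi τ) :
    ColPerm mem mem'' lo hi (σ * τ) where
  fix j hj := by rw [Equiv.Perm.mul_apply, h'.fix j hj, h.fix j hj]
  perm j := by rw [h'.perm, h.perm, Equiv.Perm.mul_apply]
  same x hx := (h'.same x hx).trans (h.same x hx)

theorem mono {lo' hi' : ℕ} (h : ColPerm mem mem' lo hi σ) (h1 : lo' ≤ lo) (h2 : hi ≤ hi') :
    ColPerm mem mem' lo' hi' σ :=
  ⟨fun j hj => h.fix j (by omega), h.perm, h.same⟩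

theorem swap {x y : ℕ} (h1 : lo ≤ x) (h2 : x ≤ y) (h3 : y < hi)
    (hx : mem' (8 * x + 2) = mem (8 * y + 2)) (hy : mem' (8 * y + 2) = mem (8 * x + 2))
    (h : ∀ z, z ≠ 8 * x + 2 → z ≠ 8 * y + 2 → mem' z = mem z) :
    ColPerm mem mem' lo hi (Equiv.swap x y) where
  fix j hj := Equiv.swap_apply_of_ne_of_ne (by omega) (by omega)
  perm j := by
    rw [Equiv.swap_apply_def]
    split_ifs with h1 h2
    · rw [h1, hx]
    · rw [h2, hy]
    · exact h _ (by omega) (by omega)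
  same z hz := h z (by omega) (by omega)

theorem forall_iff (h : ColPerm mem mem' lo hi σ) (p : ℕ → Prop) :
    (∀ j, lo ≤ j → j < hi → p (mem' (8 * j + 2))) ↔
      ∀ j, lo ≤ j → j < hi → p (mem (8 * j + 2)) := by
  refine ⟨fun h1 j h2 h3 => ?_, fun h1 j h2 h3 => ?_⟩
  · have := h.symm.mem_range h2 h3
    rw [h.symm.perm]
    exact h1 _ this.1 this.2
  · have := h.mem_range h2 h3
    rw [h.perm]
    exact h1 _ this.1 this.2

theorem colKey_eq (h : ColPerm mem mem' lo hi σ) : colKey A mem' = colKey A mem := by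
  funext c
  unfold colKey
  rw [h.same 0 (by omega), h.same _ (by omega)]

theorem validCol_iff (h : ColPerm mem mem' lo hi σ) {c : ℕ} :
    ValidCol m n mem' c ↔ ValidCol m n mem c := by
  unfold ValidCol
  rw [h.same 0 (by omega), h.same _ (by omega)]

theorem card_filter (h : ColPerm mem mem' lo hi σ) (p : ℕ → Prop) [DecidablePred p] :
    ((Finset.Ico lo hi).filter fun j => p (mem' (8 * j + 2))).card =
      ((Finset.Ico lo hi).filter fun j => p (mem (8 * j + 2))).card := by
  refine Finset.card_nbij' σ σ.symm (fun j hj => ?_) (fun j hj => ?_) (fun _ _ => by simp)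
    fun _ _ => by simp
  · simp only [Finset.coe_filter, Finset.mem_Ico, Set.mem_setOf_eq] at hj ⊢
    exact ⟨h.mem_range hj.1.1 hj.1.2, h.perm j ▸ hj.2⟩
  · simp only [Finset.coe_filter, Finset.mem_Ico, Set.mem_setOf_eq] at hj ⊢
    exact ⟨h.symm.mem_range hj.1.1 hj.1.2, h.symm.perm j ▸ hj.2⟩

end ColPerm

theorem calls_scan (hW : 1000 * (m + n + 20) ≤ W) (ho : mem 0 ≤ 1) (hn : mem 16 ≤ m + n)
    {lo pr pc : ℕ} (hlo : lo ≤ mem 16) (hpr : pr < rows m n (mem 0)) (hpc : pc < rows n m (mem 0))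
    (hv : ∀ j, lo ≤ j → j < mem 16 → ValidCol m n mem (mem (8 * j + 2))) :
    Calls procs W A 5 [lo, pr, pc] mem fun r mem' T => (∃ σ, ColPerm mem mem' lo (mem 16) σ) ∧
      lo ≤ r ∧ r ≤ mem 16 ∧
      (∀ j, lo ≤ j → j < r → colKey A mem (mem' (8 * j + 2)) ≤ key A (mem 0) pr pc) ∧
      (∀ j, r ≤ j → j < mem 16 → key A (mem 0) pr pc < colKey A mem (mem' (8 * j + 2))) ∧
      T ≤ 200 * (mem 16 - lo) + 20 := by
  refine ⟨scanBody, rfl, fun ent => run_of_wp ?_⟩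
  simp only [scanBody, seqs, lt, arr, ↓wp_seq, ↓wp_assign, ↓wp_branch, ↓wp_query, ↓wp_skip, ↓wp_store, ↓wp_loop,
    ↓wp_call, Test.Ok, Test.Holds, Test.time, Expr.Ok, Expr.val, Expr.time, Function.update_apply,
    Nat.reduceEqDiff, reduceIte, OfNat.ofNat_ne_zero, OfNat.ofNat_ne_one, OfNat.zero_ne_ofNat,
    OfNat.one_ne_ofNat, one_ne_zero, zero_ne_one, List.getD_cons_zero, List.getD_cons_succ,
    List.getD_nil, true_and, and_true, and_assoc, not_le, Nat.reduceAdd, Nat.reduceMul]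
  repeat refine And.intro (by omega) ?_
  -- The columns before index `a` are known to be small and those from `b` on to be large. Each
  -- round either advances `a` or decreases `b`, so the counter a + (mem 16 - b) grows by one, and
  -- at the end a = b.
  refine run_for (fun i s => ∃ a b σ, s.loc 0 = a ∧ s.loc 1 = pr ∧ s.loc 2 = pc ∧ s.loc 3 = b ∧
      lo ≤ a ∧ a ≤ b ∧ b ≤ mem 16 ∧ a + (mem 16 - b) = i ∧ ColPerm mem s.mem lo (mem 16) σ ∧
      (∀ j, lo ≤ j → j < a → colKey A mem (s.mem (8 * j + 2)) ≤ key A (mem 0) pr pc) ∧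
      (∀ j, b ≤ j → j < mem 16 → key A (mem 0) pr pc < colKey A mem (s.mem (8 * j + 2))))
    lo (mem 16) 170 hlo ?_ ?_ ?_ ?_
  · exact ⟨lo, mem 16, 1, rfl, rfl, rfl, rfl, le_rfl, hlo, le_rfl, by omega, .refl _ _ _,
      fun _ _ _ => by omega, fun _ _ _ => by omega⟩
  · rintro i ⟨loc, mem', ent'⟩ - hi ⟨a, b, σ, h0, h1, h2, h3, h4, h5, h6, h7, h8, h9, h10⟩
    dsimp only at *
    refine ⟨by simp, by simp [h0, h3]; omega, run_of_wp ?_⟩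
    simp only [h0, h1, h2, h3, seqs, lt, arr, ↓wp_seq, ↓wp_assign, ↓wp_branch, ↓wp_query, ↓wp_skip, ↓wp_store, ↓wp_loop,
    ↓wp_call, Test.Ok, Test.Holds, Test.time, Expr.Ok, Expr.val, Expr.time, Function.update_apply,
    Nat.reduceEqDiff, reduceIte, OfNat.ofNat_ne_zero, OfNat.ofNat_ne_one, OfNat.zero_ne_ofNat,
    OfNat.one_ne_ofNat, one_ne_zero, zero_ne_one, List.getD_cons_zero, List.getD_cons_succ,
    List.getD_nil, true_and, and_true, and_assoc, not_le, Nat.reduceAdd, Nat.reduceMul]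
    repeat refine And.intro (by omega) ?_
    have hm0 : mem' 0 = mem 0 := h8.same _ (by omega)
    have hva : ValidCol m n mem' (mem' (8 * a + 2)) :=
      h8.validCol_iff.2 ((h8.forall_iff _).2 hv a h4 (by omega))
    have hlt := hva.lt
    have hck := h8.colKey_eq (A := A)
    refine run_call_of_eq (calls_cmp hW (by omega) (by rwa [hm0]) (by rwa [hm0]) hva.2 hva.1)
      (by simp <;> omega) (by
    simp only [List.map_cons, List.map_nil, List.cons.injEq, seqs, lt, arr, ↓wp_seq, ↓wp_assign, ↓wp_branch, ↓wp_query, ↓wp_skip, ↓wp_store, ↓wp_loop,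
    ↓wp_call, Test.Ok, Test.Holds, Test.time, Expr.Ok, Expr.val, Expr.time, Function.update_apply,
    Nat.reduceEqDiff, reduceIte, OfNat.ofNat_ne_zero, OfNat.ofNat_ne_one, OfNat.zero_ne_ofNat,
    OfNat.one_ne_ofNat, one_ne_zero, zero_ne_one, List.getD_cons_zero, List.getD_cons_succ,
    List.getD_nil, true_and, and_true, and_assoc, not_le, Nat.reduceAdd, Nat.reduceMul]
    all_goals omega) rfl ?_
    rintro r mem₁ ent₁ T ⟨rfl, hr, hT⟩
    rw [← hva.colKey_eq, hck, hm0] at hr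
    simp only [h0, h1, h2, h3, List.map_cons, List.map_nil, List.sum_cons, List.sum_nil, seqs, lt, arr, ↓wp_seq, ↓wp_assign, ↓wp_branch, ↓wp_query, ↓wp_skip, ↓wp_store, ↓wp_loop,
    ↓wp_call, Test.Ok, Test.Holds, Test.time, Expr.Ok, Expr.val, Expr.time, Function.update_apply,
    Nat.reduceEqDiff, reduceIte, OfNat.ofNat_ne_zero, OfNat.ofNat_ne_one, OfNat.zero_ne_ofNat,
    OfNat.one_ne_ofNat, one_ne_zero, zero_ne_one, List.getD_cons_zero, List.getD_cons_succ,
    List.getD_nil, true_and, and_true, and_assoc, not_le, Nat.reduceAdd, Nat.reduceMul]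
    refine ⟨by omega, fun h => ?_, fun h => ?_⟩
    · have hlt : key A (mem 0) pr pc < colKey A mem (mem₁ (8 * a + 2)) := by
        by_contra h9
        simp [h9] at hr
        omega
      repeat refine And.intro (by omega) ?_
      have hsw : ColPerm mem₁ (fun x => if x = 8 * (b - 1) + 2 then mem₁ (8 * a + 2) else
          if x = 8 * a + 2 then mem₁ (8 * (b - 1) + 2) else mem₁ x) lo (mem 16)
          (Equiv.swap a (b - 1)) := by
        refine ColPerm.swap h4 (by omega) (by omega) ?_ ?_ fun z h1 h2 => ?_
        · simp only [if_true]
          split_ifs with h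
          · rw [h]
          · rfl
        · simp
        · simp [h1, h2]
      have hsw' := h8.trans hsw
      have heq : (fun x => if x = 8 * (b - 1) + 2 then mem₁ (8 * a + 2) else
          if x = 8 * a + 2 then mem₁ (8 * (b - 1) + 2) else mem₁ x) =
          Function.update (Function.update mem₁ (8 * a + 2) (mem₁ (8 * (b - 1) + 2)))
            (8 * (b - 1) + 2) (mem₁ (8 * a + 2)) := by
        funext x
        simp only [Function.update_apply]
      refine ⟨⟨a, b - 1, _, rfl, rfl, h4, by omega, by omega, by omega, heq ▸ hsw',
        fun j h11 h12 => ?_, fun j h11 h12 => ?_⟩, by omega⟩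
      · rw [if_neg (by omega), if_neg (by omega)]
        exact h9 j h11 h12
      · split_ifs with h13 h14
        · exact hlt
        · omega
        · exact h10 j (by omega) h12
    · have hle : colKey A mem (mem₁ (8 * a + 2)) ≤ key A (mem 0) pr pc := by
        by_contra h9
        simp [not_le.1 h9] at hr
        omega
      repeat refine And.intro (by omega) ?_
      refine ⟨⟨a + 1, b, σ, rfl, rfl, by omega, by omega, h6, by omega, h8,
        fun j h11 h12 => ?_, h10⟩, by omega⟩
      obtain rfl | h13 : j = a ∨ j < a := by omega
      · exact hle
      · exact h9 j h11 h13
  · rintro ⟨loc, mem', ent'⟩ ⟨a, b, σ, h0, h1, h2, h3, h4, h5, h6, h7, h8, h9, h10⟩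
    dsimp only at *
    simp [h0, h3]
    omega
  · rintro ⟨loc, mem', ent'⟩ T ⟨a, b, σ, h0, h1, h2, h3, h4, h5, h6, h7, h8, h9, h10⟩ hT
    dsimp only at *
    obtain rfl : a = b := by omega
    simp only [seqs, lt, arr, ↓wp_seq, ↓wp_assign, ↓wp_branch, ↓wp_query, ↓wp_skip, ↓wp_store, ↓wp_loop,
    ↓wp_call, Test.Ok, Test.Holds, Test.time, Expr.Ok, Expr.val, Expr.time, Function.update_apply,
    Nat.reduceEqDiff, reduceIte, OfNat.ofNat_ne_zero, OfNat.ofNat_ne_one, OfNat.zero_ne_ofNat,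
    OfNat.one_ne_ofNat, one_ne_zero, zero_ne_one, List.getD_cons_zero, List.getD_cons_succ,
    List.getD_nil, true_and, and_true, and_assoc, not_le, Nat.reduceAdd, Nat.reduceMul] at hT ⊢
    exact ⟨⟨σ, h8⟩, by omega, by omega, by rwa [h0], by rwa [h0], by omega⟩

/-- Each comparison of the current row and column with v either shows that the column has a key
below v or that the row has a key at least v, and moves on from that one. The walk ends when the
rows or the columns are used up, so one of the two statements holds for all of them. The pointer in
cell `48` is where the next walk resumes, so the time is charged to the rows newly passed and to the
columns. -/
theorem calls_walk (hW : 1000 * (m + n + 20) ≤ W) (ho : mem 0 ≤ 1) (hm : mem 8 ≤ m + n)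
    (hn : mem 16 ≤ m + n) {lo pr pc : ℕ} (hlo : lo ≤ mem 16) (hrp : mem 48 ≤ mem 8)
    (hpr : pr < rows m n (mem 0)) (hpc : pc < rows n m (mem 0))
    (hR : ∀ k < mem 8, mem (8 * k + 1) < rows m n (mem 0))
    (hC : ∀ j < mem 16, mem (8 * j + 2) < rows n m (mem 0)) :
    Calls procs W A 6 [lo, pr, pc] mem fun r mem' T => (∀ x, x ≠ 48 → mem' x = mem x) ∧
      mem 48 ≤ mem' 48 ∧ mem' 48 ≤ mem 8 ∧
      (∀ k, mem 48 ≤ k → k < mem' 48 → ∃ j < mem 16,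
        key A (mem 0) pr pc ≤ key A (mem 0) (mem (8 * k + 1)) (mem (8 * j + 2))) ∧
      (r = 1 ∧ mem' 48 = mem 8 ∨ r = 0 ∧ ∀ j, lo ≤ j → j < mem 16 → ∃ k < mem 8,
        key A (mem 0) (mem (8 * k + 1)) (mem (8 * j + 2)) < key A (mem 0) pr pc) ∧
      T ≤ 200 * (mem 16 - lo + (mem' 48 - mem 48)) + 50 := by
  refine ⟨walkBody, rfl, fun ent => run_of_wp ?_⟩
  simp only [walkBody, seqs, lt, arr, ↓wp_seq, ↓wp_assign, ↓wp_branch, ↓wp_query, ↓wp_skip, ↓wp_store, ↓wp_loop,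
    ↓wp_call, Test.Ok, Test.Holds, Test.time, Expr.Ok, Expr.val, Expr.time, Function.update_apply,
    Nat.reduceEqDiff, reduceIte, OfNat.ofNat_ne_zero, OfNat.ofNat_ne_one, OfNat.zero_ne_ofNat,
    OfNat.one_ne_ofNat, one_ne_zero, zero_ne_one, List.getD_cons_zero, List.getD_cons_succ,
    List.getD_nil, true_and, and_true, and_assoc, not_le, Nat.reduceAdd, Nat.reduceMul]
  refine run_loop (fun s => (mem 8 - s.mem 48) + (mem 16 - s.loc 0)) (fun s T =>
    s.loc 1 = pr ∧ s.loc 2 = pc ∧ lo ≤ s.loc 0 ∧ s.loc 0 ≤ mem 16 ∧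
    (∀ x, x ≠ 48 → s.mem x = mem x) ∧ mem 48 ≤ s.mem 48 ∧ s.mem 48 ≤ mem 8 ∧
    (∀ k, mem 48 ≤ k → k < s.mem 48 → ∃ j < mem 16,
        key A (mem 0) pr pc ≤ key A (mem 0) (mem (8 * k + 1)) (mem (8 * j + 2))) ∧
    (∀ j, lo ≤ j → j < s.loc 0 → ∃ k < mem 8,
        key A (mem 0) (mem (8 * k + 1)) (mem (8 * j + 2)) < key A (mem 0) pr pc) ∧
    T ≤ 200 * (s.loc 0 - lo + (s.mem 48 - mem 48))) ?_ ?_ ?_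
  · exact ⟨rfl, rfl, le_rfl, hlo, fun _ _ => rfl, le_rfl, hrp, fun k h1 h2 => absurd h2 (by simpa using h1),
      fun j h1 h2 => absurd h2 (by simpa using h1), by simp⟩
  · rintro ⟨loc, mem', ent'⟩ T ⟨h1, h2, h3, h4, h5, h6, h7, h8, h9, h10⟩
    dsimp only at *
    have e0 := h5 0 (by omega)
    have e8 := h5 8 (by omega)
    have e16 := h5 16 (by omega)
    refine ⟨by simp <;> omega, fun hb => run_of_wp ?_⟩
    simp only [h1, h2, e8, e16, seqs, lt, arr, ↓wp_seq, ↓wp_assign, ↓wp_branch, ↓wp_query, ↓wp_skip, ↓wp_store, ↓wp_loop,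
    ↓wp_call, Test.Ok, Test.Holds, Test.time, Expr.Ok, Expr.val, Expr.time, Function.update_apply,
    Nat.reduceEqDiff, reduceIte, OfNat.ofNat_ne_zero, OfNat.ofNat_ne_one, OfNat.zero_ne_ofNat,
    OfNat.one_ne_ofNat, one_ne_zero, zero_ne_one, List.getD_cons_zero, List.getD_cons_succ,
    List.getD_nil, true_and, and_true, and_assoc, not_le, Nat.reduceAdd, Nat.reduceMul] at hb ⊢
    have eR := h5 (8 * mem' 48 + 1) (by omega)
    have eC := h5 (8 * loc 0 + 2) (by omega)
    refine run_call_of_eq (calls_cmp (mem := mem') (r := mem' (8 * mem' 48 + 1))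
      (c := mem' (8 * loc 0 + 2)) (r' := pr) (c' := pc) hW (by omega)
      (by rw [eR, e0]; exact hR _ hb.1) (by rw [eC, e0]; exact hC _ hb.2) (by rwa [e0])
      (by rwa [e0])) (by simp [h1, h2] <;> omega)
      (by
        simp only [h1, h2, List.map_cons, List.map_nil, List.cons.injEq, seqs, lt, arr, ↓wp_seq, ↓wp_assign, ↓wp_branch, ↓wp_query, ↓wp_skip, ↓wp_store, ↓wp_loop,
    ↓wp_call, Test.Ok, Test.Holds, Test.time, Expr.Ok, Expr.val, Expr.time, Function.update_apply,
    Nat.reduceEqDiff, reduceIte, OfNat.ofNat_ne_zero, OfNat.ofNat_ne_one, OfNat.zero_ne_ofNat,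
    OfNat.one_ne_ofNat, one_ne_zero, zero_ne_one, List.getD_cons_zero, List.getD_cons_succ,
    List.getD_nil, true_and, and_true, and_assoc, not_le, Nat.reduceAdd, Nat.reduceMul]) rfl ?_
    rintro r mem₁ ent₁ T ⟨rfl, hr, hT⟩
    rw [e0, eR, eC] at hr
    simp only [List.map_cons, List.map_nil, List.sum_cons, List.sum_nil, seqs, lt, arr, ↓wp_seq, ↓wp_assign, ↓wp_branch, ↓wp_query, ↓wp_skip, ↓wp_store, ↓wp_loop,
    ↓wp_call, Test.Ok, Test.Holds, Test.time, Expr.Ok, Expr.val, Expr.time, Function.update_apply,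
    Nat.reduceEqDiff, reduceIte, OfNat.ofNat_ne_zero, OfNat.ofNat_ne_one, OfNat.zero_ne_ofNat,
    OfNat.one_ne_ofNat, one_ne_zero, zero_ne_one, List.getD_cons_zero, List.getD_cons_succ,
    List.getD_nil, true_and, and_true, and_assoc, not_le, Nat.reduceAdd, Nat.reduceMul]
    refine ⟨by omega, fun h => ?_, fun h => ?_⟩
    · have hlt : key A (mem 0) (mem (8 * mem₁ 48 + 1)) (mem (8 * loc 0 + 2)) < key A (mem 0) pr pc := by
        by_contra h9
        simp [h9] at hr
        omega
      repeat refine And.intro (by omega) ?_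
      (and_intros <;> try first | omega | assumption | rfl)
      intro j h11 h12
      obtain rfl | h13 : j = loc 0 ∨ j < loc 0 := by omega
      · exact ⟨_, hb.1, hlt⟩
      · exact h9 j h11 h13
    · have hle : key A (mem 0) pr pc ≤ key A (mem 0) (mem (8 * mem₁ 48 + 1)) (mem (8 * loc 0 + 2)) := by
        by_contra h9
        simp [not_le.1 h9] at hr
        omega
      repeat refine And.intro (by omega) ?_
      (and_intros <;> try first | omega | assumption | rfl)
      · intro x hx
        rw [if_neg hx]
        exact h5 x hx
      · intro k h11 h12
        obtain rfl | h13 : k = mem₁ 48 ∨ k < mem₁ 48 := by omega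
        · exact ⟨_, hb.2, hle⟩
        · exact h8 k h11 h13
  · rintro ⟨loc, mem', ent'⟩ T ⟨h1, h2, h3, h4, h5, h6, h7, h8, h9, h10⟩ hb
    dsimp only at *
    have e8 := h5 8 (by omega)
    have e16 := h5 16 (by omega)
    simp only [e8, e16, seqs, lt, arr, ↓wp_seq, ↓wp_assign, ↓wp_branch, ↓wp_query, ↓wp_skip, ↓wp_store, ↓wp_loop,
    ↓wp_call, Test.Ok, Test.Holds, Test.time, Expr.Ok, Expr.val, Expr.time, Function.update_apply,
    Nat.reduceEqDiff, reduceIte, OfNat.ofNat_ne_zero, OfNat.ofNat_ne_one, OfNat.zero_ne_ofNat,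
    OfNat.one_ne_ofNat, one_ne_zero, zero_ne_one, List.getD_cons_zero, List.getD_cons_succ,
    List.getD_nil, true_and, and_true, and_assoc, not_le, Nat.reduceAdd, Nat.reduceMul] at hb ⊢
    repeat refine And.intro (by omega) ?_
    refine ⟨fun h => ?_, fun h => ?_⟩
    · (and_intros <;> try first | omega | assumption | rfl)
    · refine ⟨by omega, h5, h6, h7, h8, .inr fun j hj1 hj2 => h9 j hj1 (by omega), by omega⟩

end Saddle

/-! ### The main invariant and the change of the bounds -/

namespace Saddle

open RAM Expr Test Cmd

variable {α : Type*} [LinearOrder α] {m n : ℕ} {W : ℕ} {A : Matrix (Fin m) (Fin n) α}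
  {mem : ℕ → ℕ}

/-- The lower bound. -/
noncomputable def loKey (A : Matrix (Fin m) (Fin n) α) (mem : ℕ → ℕ) : ℤ :=
  key A (mem 0) (mem 56) (mem 64)

/-- The upper bound. -/
noncomputable def hiKey (A : Matrix (Fin m) (Fin n) α) (mem : ℕ → ℕ) : ℤ :=
  key A (mem 0) (mem 72) (mem 80)

/-- The main invariant. The columns listed before the index `al` are regarded as deleted. -/
structure Core (A : Matrix (Fin m) (Fin n) α) (al : ℕ) (mem : ℕ → ℕ) : Prop where
  flag : mem 0 ≤ 1
  size : mem 96 = m + n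
  row_le : mem 8 ≤ m + n
  col_le : mem 16 ≤ m + n
  row : ∀ k < mem 8, mem (8 * k + 1) < rows m n (mem 0)
  col : ∀ j < mem 16, mem (8 * j + 2) < rows n m (mem 0)
  row_inj : ∀ j < mem 8, ∀ k < mem 8, mem (8 * j + 1) = mem (8 * k + 1) → j = k
  col_inj : ∀ j < mem 16, ∀ k < mem 16, mem (8 * j + 2) = mem (8 * k + 2) → j = k
  lo_row : mem 56 < rows m n (mem 0)
  lo_col : mem 64 < rows n m (mem 0)
  hi_row : mem 72 < rows m n (mem 0)
  hi_col : mem 80 < rows n m (mem 0)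
  lo : ∀ r < rows m n (mem 0), ∃ c < rows n m (mem 0), loKey A mem ≤ key A (mem 0) r c
  hi : ∀ c < rows n m (mem 0), ∃ r < rows m n (mem 0), key A (mem 0) r c ≤ hiKey A mem
  dead_row : ∀ r < rows m n (mem 0), (∃ k < mem 8, mem (8 * k + 1) = r ∧ mem (8 * k + 3) = 0) ∨
    ∃ c < rows n m (mem 0), hiKey A mem ≤ key A (mem 0) r c
  dead_col : ∀ c < rows n m (mem 0), (∃ j, al ≤ j ∧ j < mem 16 ∧ mem (8 * j + 2) = c) ∨
    ∃ r < rows m n (mem 0), key A (mem 0) r c ≤ loKey A mem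
  dead_zero : ∀ k < m + n, mem 8 ≤ k → mem (8 * k + 3) = 0

/-- The index `k` lies in the block of rows of the column `c`. -/
def InBlock (mem : ℕ → ℕ) (c k : ℕ) : Prop := mem (8 * c + 4) ≤ k ∧ k < mem (8 * c + 4) + mem 24

/-- Each column has a block of rows, with the row of its smallest entry. -/
structure Blocks (A : Matrix (Fin m) (Fin n) α) (mem : ℕ → ℕ) : Prop where
  pos : 1 ≤ mem 24
  le : mem 40 ≤ mem 8
  block : ∀ j < mem 16, mem (8 * mem (8 * j + 2) + 4) + mem 24 ≤ mem 40
  kr : ∀ j < mem 16, ∃ k, InBlock mem (mem (8 * j + 2)) k ∧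
    mem (8 * mem (8 * j + 2) + 5) = mem (8 * k + 1)
  min : ∀ j < mem 16, ∀ k, InBlock mem (mem (8 * j + 2)) k →
    colKey A mem (mem (8 * j + 2)) ≤ key A (mem 0) (mem (8 * k + 1)) (mem (8 * j + 2))

/-- The rows that are not deleted lie in blocks, or have not been used yet. -/
def Cover (mem : ℕ → ℕ) : Prop :=
  ∀ k < mem 40, mem (8 * k + 3) = 0 → ∃ j < mem 16, InBlock mem (mem (8 * j + 2)) k

/-- Frame rule: `Core` does not read arrays 4 and 5, the workspace, or the scalars that only control
one reduction step (block length, e, reserve, row pointer, first surviving column). -/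
theorem Core.congr {al : ℕ} {mem' : ℕ → ℕ} (h : Core A al mem) (hs : ∀ x < 8 * (m + n + 20),
    x % 8 ≤ 3 → x ≠ 24 → x ≠ 32 → x ≠ 40 → x ≠ 48 → x ≠ 88 → mem' x = mem x) :
    Core A al mem' := by
  have h0 : mem' 0 = mem 0 := hs _ (by omega) (by omega) (by omega) (by omega) (by omega) (by omega) (by omega)
  have h8 : mem' 8 = mem 8 := hs _ (by omega) (by omega) (by omega) (by omega) (by omega) (by omega) (by omega)
  have h16 : mem' 16 = mem 16 := hs _ (by omega) (by omega) (by omega) (by omega) (by omega) (by omega) (by omega)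
  have h56 : mem' 56 = mem 56 := hs _ (by omega) (by omega) (by omega) (by omega) (by omega) (by omega) (by omega)
  have h64 : mem' 64 = mem 64 := hs _ (by omega) (by omega) (by omega) (by omega) (by omega) (by omega) (by omega)
  have h72 : mem' 72 = mem 72 := hs _ (by omega) (by omega) (by omega) (by omega) (by omega) (by omega) (by omega)
  have h80 : mem' 80 = mem 80 := hs _ (by omega) (by omega) (by omega) (by omega) (by omega) (by omega) (by omega)
  have h96 : mem' 96 = mem 96 := hs _ (by omega) (by omega) (by omega) (by omega) (by omega) (by omega) (by omega)
  have hk : ∀ k < m + n, mem' (8 * k + 1) = mem (8 * k + 1) ∧ mem' (8 * k + 2) = mem (8 * k + 2) ∧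
      mem' (8 * k + 3) = mem (8 * k + 3) := fun k hk =>
    ⟨hs _ (by omega) (by omega) (by omega) (by omega) (by omega) (by omega) (by omega),
      hs _ (by omega) (by omega) (by omega) (by omega) (by omega) (by omega) (by omega),
      hs _ (by omega) (by omega) (by omega) (by omega) (by omega) (by omega) (by omega)⟩
  have hr : ∀ k < mem 8, k < m + n := fun k hk => hk.trans_le h.row_le
  have hc : ∀ k < mem 16, k < m + n := fun k hk => hk.trans_le h.col_le
  have hlo : loKey A mem' = loKey A mem := by rw [loKey, loKey, h0, h56, h64]
  have hhi : hiKey A mem' = hiKey A mem := by rw [hiKey, hiKey, h0, h72, h80]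
  constructor <;> simp only [h0, h8, h16, h56, h64, h72, h80, h96, hlo, hhi]
  · exact h.flag
  · exact h.size
  · exact h.row_le
  · exact h.col_le
  · exact fun k h1 => (hk k (hr k h1)).1 ▸ h.row k h1
  · exact fun k h1 => (hk k (hc k h1)).2.1 ▸ h.col k h1
  · intro j h1 k h2
    rw [(hk j (hr j h1)).1, (hk k (hr k h2)).1]
    exact h.row_inj j h1 k h2
  · intro j h1 k h2
    rw [(hk j (hc j h1)).2.1, (hk k (hc k h2)).2.1]
    exact h.col_inj j h1 k h2
  · exact h.lo_row
  · exact h.lo_col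
  · exact h.hi_row
  · exact h.hi_col
  · exact h.lo
  · exact h.hi
  · intro r h1
    refine (h.dead_row r h1).imp_left ?_
    rintro ⟨k, h2, h3⟩
    refine ⟨k, h2, ?_⟩
    rwa [(hk k (hr k h2)).1, (hk k (hr k h2)).2.2]
  · intro c h1
    refine (h.dead_col c h1).imp_left ?_
    rintro ⟨j, h2, h3, h4⟩
    refine ⟨j, h2, h3, ?_⟩
    rwa [(hk j (hc j h3)).2.1]
  · exact fun k h1 h2 => (hk k h1).2.2 ▸ h.dead_zero k h1 h2

/-- This needs `al` = 0. With some columns already dropped by index, a permutation could move a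
living column among them. -/
theorem Core.perm {mem' : ℕ → ℕ} {lo : ℕ} {σ : Equiv.Perm ℕ} (h : Core A 0 mem)
    (hs : ColPerm mem mem' lo (mem 16) σ) : Core A 0 mem' := by
  have hs' := hs.mono (Nat.zero_le _) le_rfl
  have e : ∀ x, x % 8 ≠ 2 → mem' x = mem x := hs.same
  have hlo : loKey A mem' = loKey A mem := by
    rw [loKey, loKey, e 0 (by omega), e 56 (by omega), e 64 (by omega)]
  have hhi : hiKey A mem' = hiKey A mem := by
    rw [hiKey, hiKey, e 0 (by omega), e 72 (by omega), e 80 (by omega)]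
  have e1 : ∀ k, mem' (8 * k + 1) = mem (8 * k + 1) := fun k => e _ (by omega)
  have e3 : ∀ k, mem' (8 * k + 3) = mem (8 * k + 3) := fun k => e _ (by omega)
  constructor <;> simp only [e 0 (by omega), e 8 (by omega), e 16 (by omega), e 56 (by omega),
    e 64 (by omega), e 72 (by omega), e 80 (by omega), e 96 (by omega), hlo, hhi, e1, e3]
  · exact h.flag
  · exact h.size
  · exact h.row_le
  · exact h.col_le
  · exact h.row
  · exact fun j hj => (hs'.forall_iff (· < rows n m (mem 0))).2 (fun j _ hj => h.col j hj) j
      (Nat.zero_le _) hj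
  · exact h.row_inj
  · intro j h1 k h2 h3
    rw [hs'.perm, hs'.perm] at h3
    exact σ.injective (h.col_inj _ (hs'.mem_range (Nat.zero_le _) h1).2 _
      (hs'.mem_range (Nat.zero_le _) h2).2 h3)
  · exact h.lo_row
  · exact h.lo_col
  · exact h.hi_row
  · exact h.hi_col
  · exact h.lo
  · exact h.hi
  · exact h.dead_row
  · intro c h1
    refine (h.dead_col c h1).imp_left ?_
    rintro ⟨j, h2, h3, h4⟩
    refine ⟨σ.symm j, Nat.zero_le _, (hs'.symm.mem_range (Nat.zero_le _) h3).2, ?_⟩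
    rw [hs'.perm, Equiv.apply_symm_apply, h4]
  · exact h.dead_zero

/-- Replacing the bounds. -/
theorem Core.of_bounds {al al' : ℕ} {mem' : ℕ → ℕ} (h : Core A al mem)
    (hs : ∀ x, x ≠ 56 → x ≠ 64 → x ≠ 72 → x ≠ 80 → mem' x = mem x)
    (h56 : mem' 56 < rows m n (mem 0)) (h64 : mem' 64 < rows n m (mem 0))
    (h72 : mem' 72 < rows m n (mem 0)) (h80 : mem' 80 < rows n m (mem 0))
    (hlo : ∀ r < rows m n (mem 0), ∃ c < rows n m (mem 0), loKey A mem' ≤ key A (mem 0) r c)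
    (hhi : ∀ c < rows n m (mem 0), ∃ r < rows m n (mem 0), key A (mem 0) r c ≤ hiKey A mem')
    (hdr : ∀ r < rows m n (mem 0), (∃ k < mem 8, mem (8 * k + 1) = r ∧ mem (8 * k + 3) = 0) ∨
      ∃ c < rows n m (mem 0), hiKey A mem' ≤ key A (mem 0) r c)
    (hdc : ∀ c < rows n m (mem 0), (∃ j, al' ≤ j ∧ j < mem 16 ∧ mem (8 * j + 2) = c) ∨
      ∃ r < rows m n (mem 0), key A (mem 0) r c ≤ loKey A mem') : Core A al' mem' := by
  have e0 := hs 0 (by omega) (by omega) (by omega) (by omega)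
  have e8 := hs 8 (by omega) (by omega) (by omega) (by omega)
  have e16 := hs 16 (by omega) (by omega) (by omega) (by omega)
  have e96 := hs 96 (by omega) (by omega) (by omega) (by omega)
  have e1 : ∀ k, mem' (8 * k + 1) = mem (8 * k + 1) := fun k =>
    hs _ (by omega) (by omega) (by omega) (by omega)
  have e2 : ∀ k, mem' (8 * k + 2) = mem (8 * k + 2) := fun k =>
    hs _ (by omega) (by omega) (by omega) (by omega)
  have e3 : ∀ k, mem' (8 * k + 3) = mem (8 * k + 3) := fun k =>
    hs _ (by omega) (by omega) (by omega) (by omega)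
  constructor <;> simp only [e0, e8, e16, e96, e1, e2, e3] <;> first | assumption | skip
  · exact h.flag
  · exact h.size
  · exact h.row_le
  · exact h.col_le
  · exact h.row
  · exact h.col
  · exact h.row_inj
  · exact h.col_inj
  · exact h.dead_zero

/-- Lowering hi keeps every deleted row deletable, since a key at least the old hi is at least the
new one. The only condition that has to be checked is that every column still has a key at most the
new bound. -/
theorem calls_lowerHi (hW : 1000 * (m + n + 20) ≤ W) {al r c : ℕ} (h : Core A al mem)
    (hr : r < rows m n (mem 0)) (hc : c < rows n m (mem 0))
    (hcol : ∀ y < rows n m (mem 0), ∃ x < rows m n (mem 0),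
      key A (mem 0) x y ≤ key A (mem 0) r c) :
    Calls procs W A 9 [r, c] mem fun _ mem' T => (∀ x, x ≠ 72 → x ≠ 80 → mem' x = mem x) ∧
      Core A al mem' ∧ hiKey A mem' ≤ key A (mem 0) r c ∧ T ≤ 120 := by
  refine ⟨lowerHiBody, rfl, fun ent => run_of_wp ?_⟩
  simp only [lowerHiBody, seqs, lt, arr, ↓wp_seq, ↓wp_assign, ↓wp_branch, ↓wp_query, ↓wp_skip, ↓wp_store, ↓wp_loop,
    ↓wp_call, Test.Ok, Test.Holds, Test.time, Expr.Ok, Expr.val, Expr.time, Function.update_apply,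
    Nat.reduceEqDiff, reduceIte, OfNat.ofNat_ne_zero, OfNat.ofNat_ne_one, OfNat.zero_ne_ofNat,
    OfNat.one_ne_ofNat, one_ne_zero, zero_ne_one, List.getD_cons_zero, List.getD_cons_succ,
    List.getD_nil, true_and, and_true, and_assoc, not_le, Nat.reduceAdd, Nat.reduceMul]
  refine run_call_of_eq (calls_cmp hW h.flag hr hc h.hi_row h.hi_col) (by simp <;> omega) (by
    simp only [List.map_cons, List.map_nil, List.cons.injEq, seqs, lt, arr, ↓wp_seq, ↓wp_assign, ↓wp_branch, ↓wp_query, ↓wp_skip, ↓wp_store, ↓wp_loop,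
    ↓wp_call, Test.Ok, Test.Holds, Test.time, Expr.Ok, Expr.val, Expr.time, Function.update_apply,
    Nat.reduceEqDiff, reduceIte, OfNat.ofNat_ne_zero, OfNat.ofNat_ne_one, OfNat.zero_ne_ofNat,
    OfNat.one_ne_ofNat, one_ne_zero, zero_ne_one, List.getD_cons_zero, List.getD_cons_succ,
    List.getD_nil, true_and, and_true, and_assoc, not_le, Nat.reduceAdd, Nat.reduceMul]
    all_goals omega) rfl ?_
  rintro v mem₁ ent₁ T ⟨rfl, hv, hT⟩
  simp only [List.map_cons, List.map_nil, List.sum_cons, List.sum_nil, seqs, lt, arr, ↓wp_seq, ↓wp_assign, ↓wp_branch, ↓wp_query, ↓wp_skip, ↓wp_store, ↓wp_loop,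
    ↓wp_call, Test.Ok, Test.Holds, Test.time, Expr.Ok, Expr.val, Expr.time, Function.update_apply,
    Nat.reduceEqDiff, reduceIte, OfNat.ofNat_ne_zero, OfNat.ofNat_ne_one, OfNat.zero_ne_ofNat,
    OfNat.one_ne_ofNat, one_ne_zero, zero_ne_one, List.getD_cons_zero, List.getD_cons_succ,
    List.getD_nil, true_and, and_true, and_assoc, not_le, Nat.reduceAdd, Nat.reduceMul]
  refine ⟨by omega, fun h1 => ?_, fun h1 => ?_⟩
  · have hlt : key A (mem₁ 0) r c < hiKey A mem₁ := by
      by_contra h9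
      rw [hiKey] at h9
      simp [h9] at hv
      omega
    repeat refine And.intro (by omega) ?_
    have hk : hiKey A (Function.update (Function.update mem₁ 72 r) 80 c) = key A (mem₁ 0) r c := by
      simp [hiKey]
    have hl : loKey A (Function.update (Function.update mem₁ 72 r) 80 c) = loKey A mem₁ := by
      simp [loKey]
    refine ⟨fun x h1 h2 => by simp [h1, h2], ?_, hk.le, by omega⟩
    refine h.of_bounds (fun x _ _ h1 h2 => by simp [h1, h2]) (by simpa using h.lo_row)
      (by simpa using h.lo_col) (by simpa using hr) (by simpa using hc) (by rw [hl]; exact h.lo)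
      (by rw [hk]; exact hcol) (fun r hr => (h.dead_row r hr).imp_right ?_) (by rw [hl]; exact h.dead_col)
    rintro ⟨y, h1, h2⟩
    exact ⟨y, h1, hk ▸ hlt.le.trans h2⟩
  · have hle : hiKey A mem₁ ≤ key A (mem₁ 0) r c := by
      by_contra h9
      rw [hiKey] at h9
      simp [not_le.1 h9] at hv
      omega
    exact ⟨fun _ _ _ => trivial, h, hle, by omega⟩

/-- The minimum with hi is needed because a deleted row is only known to have a key at least hi,
perhaps none at least v. Nothing is lost for the columns: one with a key at most v also has a key at
most hi, by the invariant for hi, hence one at most the minimum. -/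
theorem calls_raiseLo (hW : 1000 * (m + n + 20) ≤ W) {al r c : ℕ} (h : Core A 0 mem)
    (hr : r < rows m n (mem 0)) (hc : c < rows n m (mem 0))
    (hle : loKey A mem ≤ key A (mem 0) r c)
    (hrow : ∀ k < mem 8, ∃ y < rows n m (mem 0),
      key A (mem 0) r c ≤ key A (mem 0) (mem (8 * k + 1)) y)
    (hcol : ∀ j < mem 16, j < al → ∃ x < rows m n (mem 0),
      key A (mem 0) x (mem (8 * j + 2)) ≤ key A (mem 0) r c) :
    Calls procs W A 20 [r, c] mem fun _ mem' T => (∀ x, x ≠ 56 → x ≠ 64 → mem' x = mem x) ∧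
      Core A al mem' ∧ T ≤ 120 := by
  refine ⟨raiseLoBody, rfl, fun ent => run_of_wp ?_⟩
  simp only [raiseLoBody, seqs, lt, arr, ↓wp_seq, ↓wp_assign, ↓wp_branch, ↓wp_query, ↓wp_skip, ↓wp_store, ↓wp_loop,
    ↓wp_call, Test.Ok, Test.Holds, Test.time, Expr.Ok, Expr.val, Expr.time, Function.update_apply,
    Nat.reduceEqDiff, reduceIte, OfNat.ofNat_ne_zero, OfNat.ofNat_ne_one, OfNat.zero_ne_ofNat,
    OfNat.one_ne_ofNat, one_ne_zero, zero_ne_one, List.getD_cons_zero, List.getD_cons_succ,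
    List.getD_nil, true_and, and_true, and_assoc, not_le, Nat.reduceAdd, Nat.reduceMul]
  have key1 : ∀ {r' c' : ℕ}, r' < rows m n (mem 0) → c' < rows n m (mem 0) →
      (key A (mem 0) r' c' = hiKey A mem ∧ hiKey A mem ≤ key A (mem 0) r c ∨
        key A (mem 0) r' c' = key A (mem 0) r c ∧ key A (mem 0) r c ≤ hiKey A mem) →
      Core A al (Function.update (Function.update mem 56 r') 64 c') := by
    intro r' c' hr' hc' hk'
    have hk : hiKey A (Function.update (Function.update mem 56 r') 64 c') = hiKey A mem := by
      simp [hiKey]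
    have hl : loKey A (Function.update (Function.update mem 56 r') 64 c') = key A (mem 0) r' c' := by
      simp [loKey]
    refine h.of_bounds (fun x h1 h2 _ _ => by simp [h1, h2]) (by simpa using hr')
      (by simpa using hc') (by simpa using h.hi_row) (by simpa using h.hi_col) ?_
      (by rw [hk]; exact h.hi) (by rw [hk]; exact h.dead_row) ?_ <;> rw [hl]
    · intro x hx
      obtain ⟨k, h1, rfl, -⟩ | ⟨y, h1, h2⟩ := h.dead_row x hx
      · obtain ⟨y, h2, h3⟩ := hrow k h1
        exact ⟨y, h2, by omega⟩
      · exact ⟨y, h1, by omega⟩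
    · intro y hy
      have hmin : (∃ x < rows m n (mem 0), key A (mem 0) x y ≤ key A (mem 0) r c) →
          ∃ x < rows m n (mem 0), key A (mem 0) x y ≤ key A (mem 0) r' c' := by
        rintro ⟨x, h1, h2⟩
        obtain ⟨x', h1', h2'⟩ := h.hi y hy
        rcases hk' with h3 | h3
        · exact ⟨x', h1', by omega⟩
        · exact ⟨x, h1, by omega⟩
      obtain ⟨j, -, h1, rfl⟩ | ⟨x, h1, h2⟩ := h.dead_col y hy
      · by_cases h2 : al ≤ j
        · exact .inl ⟨j, h2, h1, rfl⟩
        · exact .inr (hmin (hcol j h1 (by omega)))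
      · exact .inr (hmin ⟨x, h1, h2.trans hle⟩)
  refine run_call_of_eq (calls_cmp hW h.flag h.hi_row h.hi_col hr hc) (by simp <;> omega) (by
    simp only [List.map_cons, List.map_nil, List.cons.injEq, seqs, lt, arr, ↓wp_seq, ↓wp_assign, ↓wp_branch, ↓wp_query, ↓wp_skip, ↓wp_store, ↓wp_loop,
    ↓wp_call, Test.Ok, Test.Holds, Test.time, Expr.Ok, Expr.val, Expr.time, Function.update_apply,
    Nat.reduceEqDiff, reduceIte, OfNat.ofNat_ne_zero, OfNat.ofNat_ne_one, OfNat.zero_ne_ofNat,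
    OfNat.one_ne_ofNat, one_ne_zero, zero_ne_one, List.getD_cons_zero, List.getD_cons_succ,
    List.getD_nil, true_and, and_true, and_assoc, not_le, Nat.reduceAdd, Nat.reduceMul]
    all_goals omega) rfl ?_
  rintro v mem₁ ent₁ T ⟨rfl, hv, hT⟩
  simp only [List.map_cons, List.map_nil, List.sum_cons, List.sum_nil, seqs, lt, arr, ↓wp_seq, ↓wp_assign, ↓wp_branch, ↓wp_query, ↓wp_skip, ↓wp_store, ↓wp_loop,
    ↓wp_call, Test.Ok, Test.Holds, Test.time, Expr.Ok, Expr.val, Expr.time, Function.update_apply,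
    Nat.reduceEqDiff, reduceIte, OfNat.ofNat_ne_zero, OfNat.ofNat_ne_one, OfNat.zero_ne_ofNat,
    OfNat.one_ne_ofNat, one_ne_zero, zero_ne_one, List.getD_cons_zero, List.getD_cons_succ,
    List.getD_nil, true_and, and_true, and_assoc, not_le, Nat.reduceAdd, Nat.reduceMul]
  refine ⟨by omega, fun h1 => ?_, fun h1 => ?_⟩
  · have hlt : hiKey A mem₁ < key A (mem₁ 0) r c := by
      by_contra h9
      rw [hiKey] at h9
      simp [h9] at hv
      omega
    repeat refine And.intro (by omega) ?_
    exact ⟨fun x h1 h2 => by simp [h1, h2], key1 h.hi_row h.hi_col (.inl ⟨rfl, hlt.le⟩), by omega⟩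
  · have hle : key A (mem₁ 0) r c ≤ hiKey A mem₁ := by
      by_contra h9
      rw [hiKey] at h9
      simp [not_le.1 h9] at hv
      omega
    repeat refine And.intro (by omega) ?_
    exact ⟨fun x h1 h2 => by simp [h1, h2], key1 hr hc (.inr ⟨rfl, hle⟩), by omega⟩

end Saddle

/-! ### Deleting blocks of rows and assigning new ones -/

namespace Saddle

open RAM Expr Test Cmd

variable {α : Type*} [LinearOrder α] {m n : ℕ} {W : ℕ} {A : Matrix (Fin m) (Fin n) α}
  {mem mem' mem'' : ℕ → ℕ} {S S' : ℕ → Prop} {K K' : ℕ}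

theorem colKey_of_same {c : ℕ} (h0 : mem' 0 = mem 0) (h5 : mem' (8 * c + 5) = mem (8 * c + 5)) :
    colKey A mem' c = colKey A mem c := by
  rw [colKey, colKey, h0, h5]

theorem hiKey_of_same (h : ∀ x, x % 8 = 0 → x ≠ 40 → mem' x = mem x) :
    hiKey A mem' = hiKey A mem := by
  rw [hiKey, hiKey, h 0 (by omega) (by omega), h 72 (by omega) (by omega),
    h 80 (by omega) (by omega)]

theorem Blocks.lt {j k : ℕ} (h : Blocks A mem) (hj : j < mem 16)
    (hk : InBlock mem (mem (8 * j + 2)) k) : k < mem 8 := by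
  have h1 := h.block j hj
  have h2 := h.le
  have h3 := hk.2
  omega

theorem Core.validCol {al j : ℕ} (h : Core A al mem) (hb : Blocks A mem) (hj : j < mem 16) :
    ValidCol m n mem (mem (8 * j + 2)) := by
  obtain ⟨k, h1, h2⟩ := hb.kr j hj
  exact ⟨h.col j hj, h2 ▸ h.row k (hb.lt hj h1)⟩

theorem Core.colKey_inj {al j k : ℕ} (h : Core A al mem) (hb : Blocks A mem) (hj : j < mem 16)
    (hk : k < mem 16) (he : colKey A mem (mem (8 * j + 2)) = colKey A mem (mem (8 * k + 2))) :
    j = k := by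
  have h1 := h.validCol hb hj
  have h2 := h.validCol hb hk
  rw [h1.colKey_eq, h2.colKey_eq] at he
  exact h.col_inj j hj k hk (key_inj h1.2 h1.1 h2.2 h2.1 he).2

theorem Blocks.congr {al : ℕ} (h : Blocks A mem) (hc : Core A al mem)
    (hs : ∀ x < 8 * (m + n + 20), x % 8 ≠ 3 → (x % 8 ≠ 0 ∨ x = 0 ∨ x = 8 ∨ x = 16 ∨ x = 24 ∨ x = 40) →
      mem' x = mem x) : Blocks A mem' := by
  have h0 : mem' 0 = mem 0 := hs 0 (by omega) (by omega) (by omega)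
  have h8 : mem' 8 = mem 8 := hs 8 (by omega) (by omega) (by omega)
  have h16 : mem' 16 = mem 16 := hs 16 (by omega) (by omega) (by omega)
  have h24 : mem' 24 = mem 24 := hs 24 (by omega) (by omega) (by omega)
  have h40 : mem' 40 = mem 40 := hs 40 (by omega) (by omega) (by omega)
  have hr : ∀ k < mem 8, mem' (8 * k + 1) = mem (8 * k + 1) := fun k hk => by
    have := hc.row_le
    exact hs _ (by omega) (by omega) (by omega)
  have hC : ∀ j < mem 16, mem' (8 * j + 2) = mem (8 * j + 2) := fun k hk => by
    have := hc.col_le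
    exact hs _ (by omega) (by omega) (by omega)
  have hcol : ∀ j < mem 16, mem' (8 * mem (8 * j + 2) + 4) = mem (8 * mem (8 * j + 2) + 4) ∧
      mem' (8 * mem (8 * j + 2) + 5) = mem (8 * mem (8 * j + 2) + 5) := fun j hj => by
    have := (hc.validCol h hj).lt
    exact ⟨hs _ (by omega) (by omega) (by omega), hs _ (by omega) (by omega) (by omega)⟩
  have hb : ∀ j < mem 16, ∀ k, InBlock mem' (mem (8 * j + 2)) k ↔ InBlock mem (mem (8 * j + 2)) k := by
    intro j hj k
    rw [InBlock, InBlock, (hcol j hj).1, h24]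
  constructor
  · rw [h24]
    exact h.pos
  · rw [h40, h8]
    exact h.le
  · intro j hj
    rw [h16] at hj
    rw [hC j hj, (hcol j hj).1, h24, h40]
    exact h.block j hj
  · intro j hj
    rw [h16] at hj
    obtain ⟨k, h1, h2⟩ := h.kr j hj
    refine ⟨k, ?_, ?_⟩
    · rw [hC j hj]
      exact (hb j hj k).2 h1
    · rw [hC j hj, (hcol j hj).2, hr k (h.lt hj h1), h2]
  · intro j hj k hk
    rw [h16] at hj
    rw [hC j hj] at hk ⊢
    have hk' := (hb j hj k).1 hk
    rw [h0, hr k (h.lt hj hk'), colKey_of_same h0 (hcol j hj).2]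
    exact h.min j hj k hk'

theorem Blocks.perm {lo : ℕ} {σ : Equiv.Perm ℕ} (h : Blocks A mem)
    (hs : ColPerm mem mem' lo (mem 16) σ) : Blocks A mem' := by
  have hs' := hs.mono (Nat.zero_le _) le_rfl
  have e : ∀ x, x % 8 ≠ 2 → mem' x = mem x := hs.same
  have hck := hs.colKey_eq (A := A)
  have hb : ∀ c k, InBlock mem' c k ↔ InBlock mem c k := by
    intro c k
    rw [InBlock, InBlock, e _ (by omega), e 24 (by omega)]
  have e1 : ∀ k, mem' (8 * k + 1) = mem (8 * k + 1) := fun k => e _ (by omega)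
  have e4 : ∀ k, mem' (8 * k + 4) = mem (8 * k + 4) := fun k => e _ (by omega)
  have e5 : ∀ k, mem' (8 * k + 5) = mem (8 * k + 5) := fun k => e _ (by omega)
  constructor <;> simp only [e 0 (by omega), e 8 (by omega), e 16 (by omega), e 24 (by omega),
    e 40 (by omega), hb, e1, e4, e5, hck]
  · exact h.pos
  · exact h.le
  · exact fun j hj => (hs'.forall_iff fun c => mem (8 * c + 4) + mem 24 ≤ mem 40).2
      (fun j _ hj => h.block j hj) j (Nat.zero_le _) hj
  · exact fun j hj => (hs'.forall_iff fun c => ∃ k, InBlock mem c k ∧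
      mem (8 * c + 5) = mem (8 * k + 1)).2 (fun j _ hj => h.kr j hj) j (Nat.zero_le _) hj
  · exact fun j hj => (hs'.forall_iff fun c => ∀ k, InBlock mem c k →
      colKey A mem c ≤ key A (mem 0) (mem (8 * k + 1)) c).2 (fun j _ hj => h.min j hj) j
      (Nat.zero_le _) hj

theorem Cover.perm {lo : ℕ} {σ : Equiv.Perm ℕ} (h : Cover mem)
    (hs : ColPerm mem mem' lo (mem 16) σ) : Cover mem' := by
  intro k hk hd
  rw [hs.same _ (by omega)] at hk hd
  obtain ⟨j, h1, h2⟩ := h k hk hd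
  have hs' := hs.mono (Nat.zero_le _) le_rfl
  refine ⟨σ.symm j, ?_, ?_⟩
  · rw [hs.same _ (by omega)]
    exact (hs'.symm.mem_range (Nat.zero_le _) h1).2
  · rw [hs.perm, Equiv.apply_symm_apply, InBlock, hs.same _ (by omega), hs.same 24 (by omega)]
    exact h2

theorem Cover.congr {al : ℕ} (h : Cover mem) (hc : Core A al mem) (hb : Blocks A mem)
    (hs : ∀ x < 8 * (m + n + 20), (x % 8 ≠ 0 ∨ x = 16 ∨ x = 24 ∨ x = 40) → mem' x = mem x) :
    Cover mem' := by
  intro k hk hd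
  rw [hs 40 (by omega) (by omega)] at hk
  have h1 := hb.le
  have h2 := hc.row_le
  rw [hs _ (by omega) (by omega)] at hd
  obtain ⟨j, h3, h4⟩ := h k hk hd
  have := hc.col_le
  have := (hc.validCol hb h3).lt
  refine ⟨j, ?_, ?_⟩
  · rwa [hs 16 (by omega) (by omega)]
  · rw [hs _ (by omega) (by omega), InBlock, hs _ (by omega) (by omega), hs 24 (by omega) (by omega)]
    exact h4

/-- Delete the rows with indices from `a` to `b`. -/
def mark (mem : ℕ → ℕ) (a b : ℕ) (x : ℕ) : ℕ :=
  if x % 8 = 3 ∧ 8 * a + 3 ≤ x ∧ x < 8 * b + 3 then 1 else mem x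

theorem mark_of_ne {a b x : ℕ} (h : x % 8 ≠ 3) : mark mem a b x = mem x := if_neg fun h1 => h h1.1

theorem mark_self {a : ℕ} : mark mem a a = mem := by
  funext x
  exact if_neg (by omega)

theorem update_mark {a b : ℕ} (h : a ≤ b) :
    Function.update (mark mem a b) (8 * b + 3) 1 = mark mem a (b + 1) := by
  funext x
  rw [Function.update_apply, mark, mark]
  split_ifs <;> first | rfl | omega

theorem mark_eq {a b k : ℕ} : mark mem a b (8 * k + 3) = if a ≤ k ∧ k < b then 1 else mem (8 * k + 3) := by
  rw [mark]
  split_ifs <;> first | rfl | omega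

theorem Core.mark {al a b : ℕ} (h : Core A al mem) (hab : ∀ k, a ≤ k → k < b → k < mem 8 ∧
    ∃ c < rows n m (mem 0), hiKey A mem ≤ key A (mem 0) (mem (8 * k + 1)) c) :
    Core A al (mark mem a b) := by
  have e : ∀ x, x % 8 ≠ 3 → Saddle.mark mem a b x = mem x := fun x => mark_of_ne
  have hlo : loKey A (Saddle.mark mem a b) = loKey A mem := by
    rw [loKey, loKey, e 0 (by omega), e 56 (by omega), e 64 (by omega)]
  have hhi : hiKey A (Saddle.mark mem a b) = hiKey A mem := by
    rw [hiKey, hiKey, e 0 (by omega), e 72 (by omega), e 80 (by omega)]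
  have e1 : ∀ k, Saddle.mark mem a b (8 * k + 1) = mem (8 * k + 1) := fun k => e _ (by omega)
  have e2 : ∀ k, Saddle.mark mem a b (8 * k + 2) = mem (8 * k + 2) := fun k => e _ (by omega)
  constructor <;> simp only [e 0 (by omega), e 8 (by omega), e 16 (by omega), e 56 (by omega),
    e 64 (by omega), e 72 (by omega), e 80 (by omega), e 96 (by omega), hlo, hhi, e1, e2, mark_eq]
  · exact h.flag
  · exact h.size
  · exact h.row_le
  · exact h.col_le
  · exact h.row
  · exact h.col
  · exact h.row_inj
  · exact h.col_inj
  · exact h.lo_row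
  · exact h.lo_col
  · exact h.hi_row
  · exact h.hi_col
  · exact h.lo
  · exact h.hi
  · intro r h1
    obtain ⟨k, h2, rfl, h4⟩ | h2 := h.dead_row r h1
    · by_cases h5 : a ≤ k ∧ k < b
      · exact .inr (hab k h5.1 h5.2).2
      · exact .inl ⟨k, h2, rfl, by rw [if_neg h5, h4]⟩
    · exact .inr h2
  · exact h.dead_col
  · intro k h1 h2
    rw [if_neg fun h3 => absurd (hab k h3.1 h3.2).1 (by omega)]
    exact h.dead_zero k h1 h2

/-- The blocks of some columns in `S` are deleted and `K` new blocks are used. -/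
structure Killed (A : Matrix (Fin m) (Fin n) α) (S : ℕ → Prop) (mem mem' : ℕ → ℕ) (K : ℕ) : Prop where
  same : ∀ x, x % 8 ≠ 3 → x % 8 ≠ 4 → x % 8 ≠ 5 → x ≠ 40 → mem' x = mem x
  other : ∀ c, ¬ S c → mem' (8 * c + 4) = mem (8 * c + 4) ∧ mem' (8 * c + 5) = mem (8 * c + 5)
  dead : ∀ k, mem (8 * k + 3) ≠ 0 → mem' (8 * k + 3) ≠ 0
  core : Core A 0 mem'
  blocks : Blocks A mem'
  cover : Cover mem → Cover mem'
  used : mem' 40 = mem 40 + mem 24 * K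

theorem Killed.refl (h : Core A 0 mem) (hb : Blocks A mem) : Killed A S mem mem 0 :=
  ⟨fun _ _ _ _ _ => rfl, fun _ _ => ⟨rfl, rfl⟩, fun _ => id, h, hb, id, rfl⟩

theorem Killed.trans (h : Killed A S mem mem' K) (h' : Killed A S mem' mem'' K') :
    Killed A S mem mem'' (K + K') where
  same x h1 h2 h3 h4 := (h'.same x h1 h2 h3 h4).trans (h.same x h1 h2 h3 h4)
  other c hc := ⟨(h'.other c hc).1.trans (h.other c hc).1, (h'.other c hc).2.trans (h.other c hc).2⟩
  dead k hk := h'.dead k (h.dead k hk)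
  core := h'.core
  blocks := h'.blocks
  cover hc := h'.cover (h.cover hc)
  used := by
    rw [h'.used, h.used, h.same 24 (by omega) (by omega) (by omega) (by omega)]
    ring

theorem Killed.mono (h : Killed A S mem mem' K) (hS : ∀ c, S c → S' c) : Killed A S' mem mem' K :=
  ⟨h.same, fun c hc => h.other c fun h1 => hc (hS c h1), h.dead, h.core, h.blocks, h.cover, h.used⟩

theorem Killed.hiKey_eq (h : Killed A S mem mem' K) : hiKey A mem' = hiKey A mem :=
  hiKey_of_same fun x h1 h2 => h.same x (by omega) (by omega) (by omega) h2

theorem Killed.colKey_eq (h : Killed A S mem mem' K) {c : ℕ} (hc : ¬ S c) :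
    colKey A mem' c = colKey A mem c :=
  colKey_of_same (h.same 0 (by omega) (by omega) (by omega) (by omega)) (h.other c hc).2

/-- Deleting a block. -/
theorem Killed.mark {j c : ℕ} (h : Core A 0 mem) (hb : Blocks A mem) (hj : j < mem 16)
    (hc : mem (8 * j + 2) = c) (hhi : hiKey A mem ≤ colKey A mem c) :
    Killed A (· = c) mem (mark mem (mem (8 * c + 4)) (mem (8 * c + 4) + mem 24)) 0 where
  same x h1 _ _ _ := mark_of_ne h1
  other _ _ := ⟨mark_of_ne (by omega), mark_of_ne (by omega)⟩
  dead k hk := by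
    rw [mark_eq]
    split_ifs
    · omega
    · exact hk
  core := by
    subst hc
    -- Each row of the block has, in column `c`, a key at least the minimum of the block, which is
    -- at least hi.
    refine h.mark fun k h1 h2 => ⟨hb.lt hj ⟨h1, h2⟩, _, h.col j hj, hhi.trans (hb.min j hj k ⟨h1, h2⟩)⟩
  blocks := hb.congr h fun x _ h1 _ => mark_of_ne h1
  cover hcov k hk hd := by
    rw [mark_of_ne (by omega)] at hk
    rw [mark_eq] at hd
    split_ifs at hd
    obtain ⟨j', h1, h2⟩ := hcov k hk hd
    refine ⟨j', by rwa [mark_of_ne (by omega)], ?_⟩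
    rw [InBlock, mark_of_ne (by omega), mark_of_ne (by omega), mark_of_ne (by omega)]
    exact h2
  used := by rw [mark_of_ne (by omega)]; rfl

/-- Assigning a new block. -/
theorem Killed.renew {j c : ℕ} (h : Core A 0 mem) (hb : Blocks A mem) (hj : j < mem 16)
    (hc : mem (8 * j + 2) = c) (hdead : ∀ k, InBlock mem c k → mem (8 * k + 3) ≠ 0)
    (hsp : mem 40 + mem 24 ≤ mem 8)
    (hs : ∀ x, x ≠ 8 * c + 4 → x ≠ 8 * c + 5 → x ≠ 40 → mem' x = mem x)
    (h4 : mem' (8 * c + 4) = mem 40) (h40 : mem' 40 = mem 40 + mem 24)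
    (h5 : ∃ k, mem 40 ≤ k ∧ k < mem 40 + mem 24 ∧ mem' (8 * c + 5) = mem (8 * k + 1))
    (hmin : ∀ k, mem 40 ≤ k → k < mem 40 + mem 24 →
      key A (mem 0) (mem' (8 * c + 5)) c ≤ key A (mem 0) (mem (8 * k + 1)) c) :
    Killed A (· = c) mem mem' 1 := by
  have hlt := (h.validCol hb hj).lt
  rw [hc] at hlt
  have e0 : mem' 0 = mem 0 := hs _ (by omega) (by omega) (by omega)
  have e8 : mem' 8 = mem 8 := hs _ (by omega) (by omega) (by omega)
  have e16 : mem' 16 = mem 16 := hs _ (by omega) (by omega) (by omega)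
  have e24 : mem' 24 = mem 24 := hs _ (by omega) (by omega) (by omega)
  have e1 : ∀ k, mem' (8 * k + 1) = mem (8 * k + 1) := fun k => hs _ (by omega) (by omega) (by omega)
  have e2 : ∀ k, mem' (8 * k + 2) = mem (8 * k + 2) := fun k => hs _ (by omega) (by omega) (by omega)
  have e3 : ∀ k, mem' (8 * k + 3) = mem (8 * k + 3) := fun k => hs _ (by omega) (by omega) (by omega)
  have e4 : ∀ c', c' ≠ c → mem' (8 * c' + 4) = mem (8 * c' + 4) := fun c' h =>
    hs _ (by omega) (by omega) (by omega)
  have e5 : ∀ c', c' ≠ c → mem' (8 * c' + 5) = mem (8 * c' + 5) := fun c' h =>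
    hs _ (by omega) (by omega) (by omega)
  refine ⟨fun x h1 h2 h3 h4 => hs x (by omega) (by omega) h4, fun c' hc' => ⟨e4 c' hc', e5 c' hc'⟩,
    fun k hk => by rwa [e3], h.congr fun x _ _ _ _ _ _ _ => hs x (by omega) (by omega) (by omega),
    ⟨?_, ?_, ?_, ?_, ?_⟩, ?_, by rw [h40, mul_one]⟩
  · rw [e24]
    exact hb.pos
  · rw [h40, e8]
    exact hsp
  · intro j' hj'
    rw [e16] at hj'
    rw [e2, e24, h40]
    by_cases h6 : mem (8 * j' + 2) = c
    · rw [h6, h4]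
    · rw [e4 _ h6]
      have := hb.block j' hj'
      omega
  · intro j' hj'
    rw [e16] at hj'
    rw [e2]
    by_cases h6 : mem (8 * j' + 2) = c
    · obtain ⟨k, h7, h8, h9⟩ := h5
      refine ⟨k, ?_, by rw [h6, e1, h9]⟩
      rw [h6, InBlock, h4, e24]
      exact ⟨h7, h8⟩
    · obtain ⟨k, h7, h8⟩ := hb.kr j' hj'
      refine ⟨k, ?_, by rw [e5 _ h6, e1, h8]⟩
      rw [InBlock, e4 _ h6, e24]
      exact h7
  · intro j' hj' k hk
    rw [e16] at hj'
    rw [e2] at hk ⊢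
    by_cases h6 : mem (8 * j' + 2) = c
    · rw [h6] at hk ⊢
      rw [InBlock, h4, e24] at hk
      rw [colKey, if_pos hlt, e0, e1]
      exact hmin k hk.1 hk.2
    · rw [InBlock, e4 _ h6, e24] at hk
      rw [colKey_of_same e0 (e5 _ h6), e0, e1]
      exact hb.min j' hj' k hk
  · intro hcov k hk hd
    rw [h40] at hk
    rw [e3] at hd
    by_cases h6 : k < mem 40
    · obtain ⟨j', h7, h8⟩ := hcov k h6 hd
      refine ⟨j', e16.symm ▸ h7, ?_⟩
      rw [e2]
      -- The column `c` gives up its old block, so the rows there must already be deleted for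
      -- `Cover` to survive.
      by_cases h9 : mem (8 * j' + 2) = c
      · exact absurd hd (hdead k (h9 ▸ h8))
      · rw [InBlock, e4 _ h9, e24]
        exact h8
    · refine ⟨j, e16.symm ▸ hj, ?_⟩
      rw [e2, hc, InBlock, h4, e24]
      omega

end Saddle

/-! ### Renewing the block of one column -/

namespace Saddle

open RAM Expr Test Cmd

variable {α : Type*} [LinearOrder α] {m n : ℕ} {W : ℕ} {A : Matrix (Fin m) (Fin n) α}
  {mem : ℕ → ℕ}

/-- As long as the block minimum of the column exceeds v ≥ hi, every row of the block has a key at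
least hi and may be deleted. Each round takes t rows from the reserve and costs O(t), so the time is
proportional to t for each new block. One further round, which deletes a block without finding a
replacement, is the summand 1. -/
theorem calls_renew (hW : 1000 * (m + n + 20) ≤ W) (h : Core A 0 mem) (hb : Blocks A mem)
    {j c pr pc : ℕ} (hj : j < mem 16) (hc : mem (8 * j + 2) = c) (hpr : pr < rows m n (mem 0))
    (hpc : pc < rows n m (mem 0)) (hhi : hiKey A mem ≤ key A (mem 0) pr pc)
    (hlt : key A (mem 0) pr pc < colKey A mem c) :
    Calls procs W A 7 [c, pr, pc] mem fun r mem' T => ∃ K, Killed A (· = c) mem mem' K ∧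
      (∀ k, InBlock mem c k → mem' (8 * k + 3) ≠ 0) ∧
      (r = 0 ∧ 1 ≤ K ∧ colKey A mem' c ≤ key A (mem 0) pr pc ∨
        r = 1 ∧ mem 8 < mem' 40 + mem 24) ∧ T ≤ (K + 1) * (300 * (mem 24 + 1)) + 20 := by
  refine ⟨renewBody, rfl, fun ent => run_of_wp ?_⟩
  simp only [renewBody, seqs, lt, arr, ↓wp_seq, ↓wp_assign, ↓wp_branch, ↓wp_query, ↓wp_skip, ↓wp_store, ↓wp_loop,
    ↓wp_call, Test.Ok, Test.Holds, Test.time, Expr.Ok, Expr.val, Expr.time, Function.update_apply,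
    Nat.reduceEqDiff, reduceIte, OfNat.ofNat_ne_zero, OfNat.ofNat_ne_one, OfNat.zero_ne_ofNat,
    OfNat.one_ne_ofNat, one_ne_zero, zero_ne_one, List.getD_cons_zero, List.getD_cons_succ,
    List.getD_nil, true_and, and_true, and_assoc, not_le, Nat.reduceAdd, Nat.reduceMul]
  repeat refine And.intro (by omega) ?_
  have ht1 := hb.pos
  have hcl : c < m + n := hc ▸ (h.validCol hb hj).lt
  have hpos : ∀ {mem' K}, Killed A (· = c) mem mem' K → mem' (8 * c + 4) + mem 24 ≤ mem' 40 ∧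
      mem' 40 ≤ mem 8 ∧ mem 8 ≤ m + n ∧ mem' 8 = mem 8 ∧ mem' 24 = mem 24 ∧ mem' 0 = mem 0 ∧
      mem' 16 = mem 16 ∧ mem' (8 * j + 2) = c := by
    intro mem' K hk
    have e8 := hk.same 8 (by omega) (by omega) (by omega) (by omega)
    have e24 := hk.same 24 (by omega) (by omega) (by omega) (by omega)
    have e16 := hk.same 16 (by omega) (by omega) (by omega) (by omega)
    have e2 := hk.same (8 * j + 2) (by omega) (by omega) (by omega) (by omega)
    have h1 := hk.blocks.block j (by omega)
    have h2 := hk.blocks.le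
    rw [e2, hc] at h1
    have h3 := h.row_le
    have e0 := hk.same 0 (by omega) (by omega) (by omega) (by omega)
    refine ⟨by omega, by omega, h3, e8, e24, e0, e16, e2.trans hc⟩
  -- The reserve shrinks with each new block; the flag in variable `3` drops in the round that finds
  -- the reserve too small. The three cases of the invariant are: the current block must go, the key
  -- is low enough, the rows did not suffice. The old block may be unmarked only before the first
  -- round.
  refine run_loop (fun s => (mem 8 - s.mem 40) + s.loc 3) (fun s T => s.loc 0 = c ∧ s.loc 1 = pr ∧
    s.loc 2 = pc ∧ ∃ K, Killed A (· = c) mem s.mem K ∧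
    (s.loc 3 = 1 ∧ s.loc 4 = 0 ∧ key A (mem 0) pr pc < colKey A s.mem c ∧
        T ≤ K * (300 * (mem 24 + 1)) ∧
        ((K = 0 ∧ s.mem = mem) ∨ ∀ k, InBlock mem c k → s.mem (8 * k + 3) ≠ 0) ∨
      s.loc 3 = 0 ∧ s.loc 4 = 0 ∧ colKey A s.mem c ≤ key A (mem 0) pr pc ∧ 1 ≤ K ∧
        T ≤ K * (300 * (mem 24 + 1)) ∧ (∀ k, InBlock mem c k → s.mem (8 * k + 3) ≠ 0) ∨
      s.loc 3 = 0 ∧ s.loc 4 = 1 ∧ mem 8 < s.mem 40 + mem 24 ∧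
        T ≤ (K + 1) * (300 * (mem 24 + 1)) ∧ (∀ k, InBlock mem c k → s.mem (8 * k + 3) ≠ 0)))
    ?_ ?_ ?_
  · exact ⟨rfl, rfl, rfl, 0, .refl h hb, .inl ⟨rfl, rfl, hlt, by simp, .inl ⟨rfl, rfl⟩⟩⟩
  · rintro ⟨loc, mem₁, ent₁⟩ T ⟨h0, h1, h2, K, hK, hor⟩
    dsimp only at *
    refine ⟨by simp <;> omega, fun hb1 => run_of_wp ?_⟩
    simp only [seqs, lt, arr, ↓wp_seq, ↓wp_assign, ↓wp_branch, ↓wp_query, ↓wp_skip, ↓wp_store, ↓wp_loop,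
    ↓wp_call, Test.Ok, Test.Holds, Test.time, Expr.Ok, Expr.val, Expr.time, Function.update_apply,
    Nat.reduceEqDiff, reduceIte, OfNat.ofNat_ne_zero, OfNat.ofNat_ne_one, OfNat.zero_ne_ofNat,
    OfNat.one_ne_ofNat, one_ne_zero, zero_ne_one, List.getD_cons_zero, List.getD_cons_succ,
    List.getD_nil, true_and, and_true, and_assoc, not_le, Nat.reduceAdd, Nat.reduceMul] at hb1
    obtain ⟨h3, h4, hkey, hT, hdead⟩ : loc 3 = 1 ∧ loc 4 = 0 ∧
        key A (mem 0) pr pc < colKey A mem₁ c ∧ T ≤ K * (300 * (mem 24 + 1)) ∧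
        ((K = 0 ∧ mem₁ = mem) ∨ ∀ k, InBlock mem c k → mem₁ (8 * k + 3) ≠ 0) := by
      rcases hor with h | h | h
      · exact h
      · omega
      · omega
    obtain ⟨g1, g2, g3, e8, e24, e0, e16, e2⟩ := hpos hK
    simp only [h0, h1, h2, seqs, lt, arr, ↓wp_seq, ↓wp_assign, ↓wp_branch, ↓wp_query, ↓wp_skip, ↓wp_store, ↓wp_loop,
    ↓wp_call, Test.Ok, Test.Holds, Test.time, Expr.Ok, Expr.val, Expr.time, Function.update_apply,
    Nat.reduceEqDiff, reduceIte, OfNat.ofNat_ne_zero, OfNat.ofNat_ne_one, OfNat.zero_ne_ofNat,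
    OfNat.one_ne_ofNat, one_ne_zero, zero_ne_one, List.getD_cons_zero, List.getD_cons_succ,
    List.getD_nil, true_and, and_true, and_assoc, not_le, Nat.reduceAdd, Nat.reduceMul]
    repeat refine And.intro (by omega) ?_
    refine run_for (fun i s => s.loc 0 = c ∧ s.loc 1 = pr ∧ s.loc 2 = pc ∧ s.loc 3 = 1 ∧
        s.loc 4 = 0 ∧ s.loc 5 = i ∧ s.loc 6 = mem₁ (8 * c + 4) + mem 24 ∧
        s.mem = mark mem₁ (mem₁ (8 * c + 4)) i)
      (mem₁ (8 * c + 4)) (mem₁ (8 * c + 4) + mem 24) 30 (by omega) ?_ ?_ ?_ ?_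
    · exact ⟨by simpa using h0, by simpa using h1, by simpa using h2, by simpa using h3,
        by simpa using h4, by simp, by simp [e24], by simp [mark_self]⟩
    · rintro i ⟨loc', mem₂, ent₂⟩ hi1 hi2 ⟨k0, k1, k2, k3, k4, k5, k6, k7⟩
      dsimp only at *
      refine ⟨by simp <;> omega, by simp <;> omega, run_of_wp ?_⟩
      simp only [k0, k1, k2, k3, k4, k5, k6, k7, update_mark hi1, seqs, lt, arr, ↓wp_seq, ↓wp_assign, ↓wp_branch, ↓wp_query, ↓wp_skip, ↓wp_store, ↓wp_loop,
    ↓wp_call, Test.Ok, Test.Holds, Test.time, Expr.Ok, Expr.val, Expr.time, Function.update_apply,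
    Nat.reduceEqDiff, reduceIte, OfNat.ofNat_ne_zero, OfNat.ofNat_ne_one, OfNat.zero_ne_ofNat,
    OfNat.one_ne_ofNat, one_ne_zero, zero_ne_one, List.getD_cons_zero, List.getD_cons_succ,
    List.getD_nil, true_and, and_true, and_assoc, not_le, Nat.reduceAdd, Nat.reduceMul]
      omega
    · rintro ⟨loc', mem₂, ent₂⟩ ⟨k0, k1, k2, k3, k4, k5, k6, k7⟩
      dsimp only at *
      simp [k5, k6]
    rintro ⟨loc', mem₂, ent₂⟩ T₂ ⟨k0, k1, k2, k3, k4, k5, k6, k7⟩ hT₂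
    dsimp only at *
    simp only [add_tsub_cancel_left, seqs, lt, arr, ↓wp_seq, ↓wp_assign, ↓wp_branch, ↓wp_query, ↓wp_skip, ↓wp_store, ↓wp_loop,
    ↓wp_call, Test.Ok, Test.Holds, Test.time, Expr.Ok, Expr.val, Expr.time, Function.update_apply,
    Nat.reduceEqDiff, reduceIte, OfNat.ofNat_ne_zero, OfNat.ofNat_ne_one, OfNat.zero_ne_ofNat,
    OfNat.one_ne_ofNat, one_ne_zero, zero_ne_one, List.getD_cons_zero, List.getD_cons_succ,
    List.getD_nil, true_and, and_true, and_assoc, not_le, Nat.reduceAdd, Nat.reduceMul] at hT₂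
    have hK2 := hK.trans (Killed.mark hK.core hK.blocks (j := j) (by omega) e2 (by
      rw [hK.hiKey_eq]; omega))
    have hdead2 : ∀ k, InBlock mem c k → mem₂ (8 * k + 3) ≠ 0 := by
      intro k hk
      rw [k7, mark_eq]
      split_ifs with h5
      · omega
      · rcases hdead with ⟨-, rfl⟩ | h6
        · exact absurd hk h5
        · exact h6 k hk
    have hdead3 : ∀ k, InBlock mem₁ c k → mem₂ (8 * k + 3) ≠ 0 := by
      intro k hk
      rw [k7, mark_eq, ← e24]
      split_ifs with h5
      · omega
      · exact absurd hk h5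
    rw [e24, ← k7] at hK2
    have f40 : mem₂ 40 = mem₁ 40 := by rw [k7, mark_of_ne (by omega)]
    obtain ⟨-, -, -, f8, f24, f0, f16, f2⟩ := hpos hK2
    simp only [k0, k1, k2, k3, k4, k5, k6, f8, f24, seqs, lt, arr, ↓wp_seq, ↓wp_assign, ↓wp_branch, ↓wp_query, ↓wp_skip, ↓wp_store, ↓wp_loop,
    ↓wp_call, Test.Ok, Test.Holds, Test.time, Expr.Ok, Expr.val, Expr.time, Function.update_apply,
    Nat.reduceEqDiff, reduceIte, OfNat.ofNat_ne_zero, OfNat.ofNat_ne_one, OfNat.zero_ne_ofNat,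
    OfNat.one_ne_ofNat, one_ne_zero, zero_ne_one, List.getD_cons_zero, List.getD_cons_succ,
    List.getD_nil, true_and, and_true, and_assoc, not_le, Nat.reduceAdd, Nat.reduceMul]
    repeat refine And.intro (by omega) ?_
    refine ⟨fun hsp => ?_, fun hsp => ?_⟩
    · repeat refine And.intro (by omega) ?_
      refine run_call_of_eq (calls_argmin (y := c) (pos := mem₂ 40) (t := mem 24)
        (mem := Function.update mem₂ (8 * c + 4) (mem₂ 40)) hW ?_ ?_ ht1 (by omega) ?_)
        (by simp <;> omega) ?_ rfl ?_
      · simpa [f0] using h.flag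
      · simpa [f0] using hc ▸ h.col j hj
      · intro k h5 h6
        have := hK2.core.row k (by omega)
        rw [f0] at this
        rwa [Function.update_of_ne (by omega), Function.update_of_ne (by omega), f0]
      · simp [k0, f24, show 40 ≠ 8 * c + 4 by omega, show 24 ≠ 8 * c + 4 by omega]
      rintro v mem₃ ent₃ T₃ ⟨rfl, ⟨k, h5, h6, rfl⟩, h7, hT3⟩
      have g0 : ∀ k, (8 * k + 1 = 8 * c + 4) = False := fun k => by simp; omega
      simp only [Function.update_apply, show (0 = 8 * c + 4) = False by simp, g0, if_false, f0] at h7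
      have g35 : (8 * c = 35) = False := by simp; omega
      have g19 : (8 * c = 19) = False := by simp; omega
      have g36 : (8 * c = 36) = False := by simp; omega
      have g20 : (8 * c = 20) = False := by simp; omega
      have g40 : (40 = 8 * c + 4) = False := by simp; omega
      have g24 : (24 = 8 * c + 4) = False := by simp; omega
      simp only [g35, g19, g36, g20, g40, g24, g0, k0, k1, k2, k3, k4, k5, k6, f8, f24, f0, if_false, List.map_cons, List.map_nil, List.sum_cons, List.sum_nil, seqs, lt, arr, ↓wp_seq, ↓wp_assign, ↓wp_branch, ↓wp_query, ↓wp_skip, ↓wp_store, ↓wp_loop,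
    ↓wp_call, Test.Ok, Test.Holds, Test.time, Expr.Ok, Expr.val, Expr.time, Function.update_apply,
    Nat.reduceEqDiff, reduceIte, OfNat.ofNat_ne_zero, OfNat.ofNat_ne_one, OfNat.zero_ne_ofNat,
    OfNat.one_ne_ofNat, one_ne_zero, zero_ne_one, List.getD_cons_zero, List.getD_cons_succ,
    List.getD_nil, true_and, and_true, and_assoc, not_le, Nat.reduceAdd, Nat.reduceMul]
      repeat refine And.intro (by omega) ?_
      generalize hm4 : Function.update (Function.update (Function.update mem₂ (8 * c + 4) (mem₂ 40))
        (8 * c + 5) (mem₂ (8 * k + 1))) 40 (mem₂ 40 + mem 24) = mem₄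
      have q5 : mem₄ (8 * c + 5) = mem₂ (8 * k + 1) := by
        rw [← hm4, Function.update_of_ne (by omega), Function.update_self]
      have q40 : mem₄ 40 = mem₂ 40 + mem 24 := by rw [← hm4, Function.update_self]
      have hK4 := hK2.trans (Killed.renew (mem' := mem₄) hK2.core hK2.blocks (j := j) (c := c)
        (by omega) f2 ?_ (by omega) ?_ ?_ (by omega) ?_ ?_)
      rotate_left
      · intro k hk
        refine hdead3 k ?_
        rw [k7, InBlock, mark_of_ne (by omega), mark_of_ne (by omega)] at hk
        exact hk
      · intro x h5 h6 h7
        rw [← hm4, Function.update_of_ne h7, Function.update_of_ne h6, Function.update_of_ne h5]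
      · rw [← hm4, Function.update_of_ne (by omega), Function.update_of_ne (by omega),
          Function.update_self]
      · exact ⟨k, h5, by omega, q5⟩
      · intro k' h8 h9
        rw [q5, f0]
        exact h7 k' h8 (by omega)
      obtain ⟨d1, d2, -, d8, d24, d0, d16, d2⟩ := hpos hK4
      have hv := hK4.core.validCol hK4.blocks (j := j) (by omega)
      rw [d2] at hv
      refine run_call_of_eq (calls_cmp (mem := mem₄) (r := pr) (c := pc) (r' := mem₄ (8 * c + 5))
        (c' := c) hW hK4.core.flag (by rwa [d0]) (by rwa [d0]) hv.2 hv.1)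
        (by simp <;> omega) ?_ rfl ?_
      · simp [k0, k1, k2, q5]
      rintro v mem₅ ent₅ T₅ ⟨rfl, hv5, hT5⟩
      rw [← hv.colKey_eq, d0] at hv5
      have hdead5 : ∀ k, InBlock mem c k → mem₅ (8 * k + 3) ≠ 0 := by
        intro k hk
        have := hdead2 k hk
        rwa [← hm4, Function.update_of_ne (by omega), Function.update_of_ne (by omega),
          Function.update_of_ne (by omega)]
      have hT6 : T + 300 * (mem 24 + 1) ≤ (K + 0 + 1) * (300 * (mem 24 + 1)) := by
        rw [add_zero, Nat.add_mul, one_mul]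
        exact Nat.add_le_add_right hT _
      simp only [k0, k1, k2, k3, k4, k5, k6, List.map_cons, List.map_nil, List.sum_cons, List.sum_nil, seqs, lt, arr, ↓wp_seq, ↓wp_assign, ↓wp_branch, ↓wp_query, ↓wp_skip, ↓wp_store, ↓wp_loop,
    ↓wp_call, Test.Ok, Test.Holds, Test.time, Expr.Ok, Expr.val, Expr.time, Function.update_apply,
    Nat.reduceEqDiff, reduceIte, OfNat.ofNat_ne_zero, OfNat.ofNat_ne_one, OfNat.zero_ne_ofNat,
    OfNat.one_ne_ofNat, one_ne_zero, zero_ne_one, List.getD_cons_zero, List.getD_cons_succ,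
    List.getD_nil, true_and, and_true, and_assoc, not_le, Nat.reduceAdd, Nat.reduceMul]
      refine ⟨⟨_, hK4, ?_⟩, ?_⟩
      · by_cases h8 : key A (mem 0) pr pc < colKey A mem₅ c
        · rw [if_pos h8] at hv5
          exact .inl ⟨hv5, h8, by omega, .inr hdead5⟩
        · rw [if_neg h8] at hv5
          exact .inr (.inl ⟨hv5, by omega, by omega, by omega, hdead5⟩)
      · split_ifs at hv5 <;> omega
    · repeat refine And.intro (by omega) ?_
      have hT6 : T + 300 * (mem 24 + 1) ≤ (K + 0 + 1) * (300 * (mem 24 + 1)) := by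
        rw [add_zero, Nat.add_mul, one_mul]
        exact Nat.add_le_add_right hT _
      exact ⟨⟨K + 0, hK2, .inr (.inr ⟨hsp, by omega, hdead2⟩)⟩, by omega⟩
  · rintro ⟨loc, mem', ent'⟩ T ⟨h0, h1, h2, K, hK, hor⟩ hb1
    dsimp only at *
    simp only [seqs, lt, arr, ↓wp_seq, ↓wp_assign, ↓wp_branch, ↓wp_query, ↓wp_skip, ↓wp_store, ↓wp_loop,
    ↓wp_call, Test.Ok, Test.Holds, Test.time, Expr.Ok, Expr.val, Expr.time, Function.update_apply,
    Nat.reduceEqDiff, reduceIte, OfNat.ofNat_ne_zero, OfNat.ofNat_ne_one, OfNat.zero_ne_ofNat,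
    OfNat.one_ne_ofNat, one_ne_zero, zero_ne_one, List.getD_cons_zero, List.getD_cons_succ,
    List.getD_nil, true_and, and_true, and_assoc, not_le, Nat.reduceAdd, Nat.reduceMul] at hb1 ⊢
    have e : K * (300 * (mem 24 + 1)) ≤ (K + 1) * (300 * (mem 24 + 1)) :=
      Nat.mul_le_mul_right _ (by omega)
    rcases hor with h3 | h3 | h3
    · omega
    · exact ⟨K, hK, h3.2.2.2.2.2, .inl ⟨h3.2.1, h3.2.2.2.1, h3.2.2.1⟩, by omega⟩
    · exact ⟨K, hK, h3.2.2.2.2, .inr ⟨h3.2.1, h3.2.2.1⟩, by omega⟩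

end Saddle

/-! ### Renewing the blocks of all columns above the threshold -/

namespace Saddle

open RAM Expr Test Cmd

variable {α : Type*} [LinearOrder α] {m n : ℕ} {W : ℕ} {A : Matrix (Fin m) (Fin n) α}
  {mem : ℕ → ℕ}

/-- Listed columns are distinct, so renewing one does not touch the block data of another. The loop
does not stop when the reserve is exhausted: the remaining blocks are deleted too, only without
replacement. Hence all original blocks end up deleted in either case, which is all that the almost
square case needs. -/
theorem calls_kill (hW : 1000 * (m + n + 20) ≤ W) (h : Core A 0 mem) (hb : Blocks A mem)
    {lo pr pc : ℕ} (hlo : lo ≤ mem 16) (hpr : pr < rows m n (mem 0))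
    (hpc : pc < rows n m (mem 0)) (hhi : hiKey A mem ≤ key A (mem 0) pr pc)
    (hlt : ∀ j, lo ≤ j → j < mem 16 → key A (mem 0) pr pc < colKey A mem (mem (8 * j + 2))) :
    Calls procs W A 8 [lo, pr, pc] mem fun r mem' T => ∃ K,
      Killed A (fun c => ∃ j, lo ≤ j ∧ j < mem 16 ∧ mem (8 * j + 2) = c) mem mem' K ∧
      (∀ j, lo ≤ j → j < mem 16 → ∀ k, InBlock mem (mem (8 * j + 2)) k → mem' (8 * k + 3) ≠ 0) ∧
      (r = 0 ∧ mem 16 - lo ≤ K ∧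
          (∀ j, lo ≤ j → j < mem 16 → colKey A mem' (mem (8 * j + 2)) ≤ key A (mem 0) pr pc) ∨
        r = 2 ∧ mem 8 < mem' 40 + mem 24) ∧
      T ≤ (K + (mem 16 - lo)) * (400 * (mem 24 + 1)) + 20 := by
  refine ⟨killBody, rfl, fun ent => run_of_wp ?_⟩
  simp only [killBody, seqs, lt, arr, ↓wp_seq, ↓wp_assign, ↓wp_branch, ↓wp_query, ↓wp_skip, ↓wp_store, ↓wp_loop,
    ↓wp_call, Test.Ok, Test.Holds, Test.time, Expr.Ok, Expr.val, Expr.time, Function.update_apply,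
    Nat.reduceEqDiff, reduceIte, OfNat.ofNat_ne_zero, OfNat.ofNat_ne_one, OfNat.zero_ne_ofNat,
    OfNat.one_ne_ofNat, one_ne_zero, zero_ne_one, List.getD_cons_zero, List.getD_cons_succ,
    List.getD_nil, true_and, and_true, and_assoc, not_le, Nat.reduceAdd, Nat.reduceMul]
  repeat refine And.intro (by omega) ?_
  refine run_loop (fun s => mem 16 - s.loc 0) (fun s T => s.loc 1 = pr ∧ s.loc 2 = pc ∧
    lo ≤ s.loc 0 ∧ s.loc 0 ≤ mem 16 ∧ ∃ K,
    Killed A (fun c => ∃ j, lo ≤ j ∧ j < mem 16 ∧ mem (8 * j + 2) = c) mem s.mem K ∧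
    (∀ j, lo ≤ j → j < s.loc 0 → ∀ k, InBlock mem (mem (8 * j + 2)) k → s.mem (8 * k + 3) ≠ 0) ∧
    (∀ j, s.loc 0 ≤ j → j < mem 16 →
      s.mem (8 * mem (8 * j + 2) + 4) = mem (8 * mem (8 * j + 2) + 4) ∧
      s.mem (8 * mem (8 * j + 2) + 5) = mem (8 * mem (8 * j + 2) + 5)) ∧
    (s.loc 3 = 0 ∧ s.loc 0 - lo ≤ K ∧ (∀ j, lo ≤ j → j < s.loc 0 →
          colKey A s.mem (mem (8 * j + 2)) ≤ key A (mem 0) pr pc) ∨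
        s.loc 3 = 2 ∧ mem 8 < s.mem 40 + mem 24) ∧
    T ≤ (K + (s.loc 0 - lo)) * (400 * (mem 24 + 1))) ?_ ?_ ?_
  · exact ⟨rfl, rfl, le_rfl, hlo, 0, .refl h hb, fun j h1 h2 => absurd h2 (by simpa using h1),
      fun _ _ _ => ⟨rfl, rfl⟩, .inl ⟨rfl, by simp, fun j h1 h2 => absurd h2 (by simpa using h1)⟩,
      Nat.zero_le _⟩
  · rintro ⟨loc, mem₁, ent₁⟩ T ⟨h1, h2, h3, h4, K, hK, h5, h6, h7, hT⟩
    dsimp only at *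
    have e16 := hK.same 16 (by omega) (by omega) (by omega) (by omega)
    have e0 := hK.same 0 (by omega) (by omega) (by omega) (by omega)
    have e8 := hK.same 8 (by omega) (by omega) (by omega) (by omega)
    have e24 := hK.same 24 (by omega) (by omega) (by omega) (by omega)
    have e2 : ∀ j, mem₁ (8 * j + 2) = mem (8 * j + 2) := fun j =>
      hK.same _ (by omega) (by omega) (by omega) (by omega)
    refine ⟨by simp <;> omega, fun hb1 => run_of_wp ?_⟩
    simp only [e16, seqs, lt, arr, ↓wp_seq, ↓wp_assign, ↓wp_branch, ↓wp_query, ↓wp_skip, ↓wp_store, ↓wp_loop,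
    ↓wp_call, Test.Ok, Test.Holds, Test.time, Expr.Ok, Expr.val, Expr.time, Function.update_apply,
    Nat.reduceEqDiff, reduceIte, OfNat.ofNat_ne_zero, OfNat.ofNat_ne_one, OfNat.zero_ne_ofNat,
    OfNat.one_ne_ofNat, one_ne_zero, zero_ne_one, List.getD_cons_zero, List.getD_cons_succ,
    List.getD_nil, true_and, and_true, and_assoc, not_le, Nat.reduceAdd, Nat.reduceMul] at hb1
    have hcl := h.col_le
    simp only [h1, h2, seqs, lt, arr, ↓wp_seq, ↓wp_assign, ↓wp_branch, ↓wp_query, ↓wp_skip, ↓wp_store, ↓wp_loop,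
    ↓wp_call, Test.Ok, Test.Holds, Test.time, Expr.Ok, Expr.val, Expr.time, Function.update_apply,
    Nat.reduceEqDiff, reduceIte, OfNat.ofNat_ne_zero, OfNat.ofNat_ne_one, OfNat.zero_ne_ofNat,
    OfNat.one_ne_ofNat, one_ne_zero, zero_ne_one, List.getD_cons_zero, List.getD_cons_succ,
    List.getD_nil, true_and, and_true, and_assoc, not_le, Nat.reduceAdd, Nat.reduceMul]
    obtain ⟨f4, f5⟩ := h6 (loc 0) le_rfl hb1
    refine run_call_of_eq (calls_renew (mem := mem₁) (j := loc 0) (c := mem (8 * loc 0 + 2))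
      (pr := pr) (pc := pc) hW hK.core hK.blocks (by omega) (e2 _) (by rwa [e0]) (by rwa [e0])
      (by rw [hK.hiKey_eq, e0]; exact hhi) (by
        rw [e0, colKey_of_same e0 f5]
        exact hlt _ h3 hb1)) (by simp <;> omega) ?_ rfl ?_
    · simp [h1, h2, e2]
    rintro r mem₂ ent₂ T₂ ⟨K₂, hK₂, g1, g2, g3⟩
    rw [e0, e8, e24] at g2
    rw [e24] at g3
    have hK' := hK.trans (hK₂.mono (S' := fun c => ∃ j, lo ≤ j ∧ j < mem 16 ∧ mem (8 * j + 2) = c)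
      fun c hc => ⟨loc 0, h3, hb1, hc.symm⟩)
    have i1 : ∀ j, lo ≤ j → j < loc 0 + 1 → ∀ k, InBlock mem (mem (8 * j + 2)) k →
        mem₂ (8 * k + 3) ≠ 0 := by
      intro j j1 j2 k hk
      obtain rfl | j3 : j = loc 0 ∨ j < loc 0 := by omega
      · refine g1 k ?_
        rw [InBlock, f4, e24]
        exact hk
      · exact hK₂.dead k (h5 j j1 j3 k hk)
    have i2 : ∀ j, loc 0 ≠ j → j < mem 16 →
        mem₂ (8 * mem (8 * j + 2) + 4) = mem₁ (8 * mem (8 * j + 2) + 4) ∧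
        mem₂ (8 * mem (8 * j + 2) + 5) = mem₁ (8 * mem (8 * j + 2) + 5) := fun j j1 j2 =>
      hK₂.other _ fun hc => j1 (h.col_inj _ hb1 _ j2 hc.symm)
    have i3 : ∀ j, loc 0 + 1 ≤ j → j < mem 16 →
        mem₂ (8 * mem (8 * j + 2) + 4) = mem (8 * mem (8 * j + 2) + 4) ∧
        mem₂ (8 * mem (8 * j + 2) + 5) = mem (8 * mem (8 * j + 2) + 5) := fun j j1 j2 => by
      rw [(i2 j (by omega) j2).1, (i2 j (by omega) j2).2]
      exact h6 j (by omega) j2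
    have q0 : mem₂ 0 = mem₁ 0 := hK₂.same 0 (by omega) (by omega) (by omega) (by omega)
    have i4 : loc 3 = 0 → loc 0 - lo ≤ K → (∀ j, lo ≤ j → j < loc 0 →
          colKey A mem₁ (mem (8 * j + 2)) ≤ key A (mem 0) pr pc) →
        ∀ j, lo ≤ j → j < loc 0 → colKey A mem₂ (mem (8 * j + 2)) ≤ key A (mem 0) pr pc := by
      intro _ _ j3 j j1 j2
      rw [colKey_of_same q0 (i2 j (by omega) (by omega)).2]
      exact j3 j j1 j2
    have i5 : T + (K₂ + 1) * (400 * (mem 24 + 1)) ≤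
        (K + K₂ + (loc 0 + 1 - lo)) * (400 * (mem 24 + 1)) := by
      rw [show K + K₂ + (loc 0 + 1 - lo) = (K + (loc 0 - lo)) + (K₂ + 1) by omega,
        Nat.add_mul (K + (loc 0 - lo))]
      exact Nat.add_le_add_right hT _
    -- The larger constant 400 covers the overhead of the loop around the call.
    have i6 : (K₂ + 1) * (300 * (mem 24 + 1)) + 100 ≤ (K₂ + 1) * (400 * (mem 24 + 1)) := by
      nlinarith
    have i7 : mem₁ 40 ≤ mem₂ 40 := by rw [hK₂.used]; omega
    simp only [h1, h2, List.map_cons, List.map_nil, List.sum_cons, List.sum_nil, seqs, lt, arr, ↓wp_seq, ↓wp_assign, ↓wp_branch, ↓wp_query, ↓wp_skip, ↓wp_store, ↓wp_loop,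
    ↓wp_call, Test.Ok, Test.Holds, Test.time, Expr.Ok, Expr.val, Expr.time, Function.update_apply,
    Nat.reduceEqDiff, reduceIte, OfNat.ofNat_ne_zero, OfNat.ofNat_ne_one, OfNat.zero_ne_ofNat,
    OfNat.one_ne_ofNat, one_ne_zero, zero_ne_one, List.getD_cons_zero, List.getD_cons_succ,
    List.getD_nil, true_and, and_true, and_assoc, not_le, Nat.reduceAdd, Nat.reduceMul]
    refine ⟨by omega, fun hr => ?_, fun hr => ?_⟩
    · repeat refine And.intro (by omega) ?_
      refine ⟨⟨K + K₂, hK', i1, i3, .inr ?_, by omega⟩, by omega⟩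
      omega
    · repeat refine And.intro (by omega) ?_
      refine ⟨⟨K + K₂, hK', i1, i3, ?_, by omega⟩, by omega⟩
      obtain ⟨g2, g4, g5⟩ : r = 0 ∧ 1 ≤ K₂ ∧
        colKey A mem₂ (mem (8 * loc 0 + 2)) ≤ key A (mem 0) pr pc := by
        rcases g2 with g2 | g2
        · exact g2
        · omega
      rcases h7 with h7 | h7
      · refine .inl ⟨h7.1, by omega, fun j j1 j2 => ?_⟩
        obtain rfl | j3 : j = loc 0 ∨ j < loc 0 := by omega
        · exact g5
        · exact i4 h7.1 h7.2.1 h7.2.2 j j1 j3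
      · exact .inr ⟨h7.1, by omega⟩
  · rintro ⟨loc, mem', ent'⟩ T ⟨h1, h2, h3, h4, K, hK, h5, h6, h7, hT⟩ hb1
    dsimp only at *
    have e16 := hK.same 16 (by omega) (by omega) (by omega) (by omega)
    simp only [e16, seqs, lt, arr, ↓wp_seq, ↓wp_assign, ↓wp_branch, ↓wp_query, ↓wp_skip, ↓wp_store, ↓wp_loop,
    ↓wp_call, Test.Ok, Test.Holds, Test.time, Expr.Ok, Expr.val, Expr.time, Function.update_apply,
    Nat.reduceEqDiff, reduceIte, OfNat.ofNat_ne_zero, OfNat.ofNat_ne_one, OfNat.zero_ne_ofNat,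
    OfNat.one_ne_ofNat, one_ne_zero, zero_ne_one, List.getD_cons_zero, List.getD_cons_succ,
    List.getD_nil, true_and, and_true, and_assoc, not_le, Nat.reduceAdd, Nat.reduceMul] at hb1 ⊢
    have e : loc 0 = mem 16 := by omega
    rw [e] at h5 h7 hT
    exact ⟨K, hK, h5, h7, by omega⟩

end Saddle

/-! ### Pre- and postconditions of the lowering recursion -/

namespace Saddle

open RAM Expr Test Cmd

variable {α : Type*} [LinearOrder α] {m n : ℕ} {W : ℕ} {A : Matrix (Fin m) (Fin n) α}
  {mem mem' mem'' : ℕ → ℕ}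

/-- The lists `f` and `g` of length `hi` agree up to a permutation of the entries with indices at
least `lo`. -/
def Shuffled (f g : ℕ → ℕ) (lo hi : ℕ) : Prop :=
  ∃ σ : Equiv.Perm ℕ, (∀ j, j < lo ∨ hi ≤ j → σ j = j) ∧ ∀ j < hi, g j = f (σ j)

namespace Shuffled

variable {f g h : ℕ → ℕ} {lo hi : ℕ}

theorem of_eq (hfg : ∀ j < hi, g j = f j) : Shuffled f g lo hi := ⟨1, fun _ _ => rfl, hfg⟩

theorem perm_lt {σ : Equiv.Perm ℕ} (h : ∀ j, j < lo ∨ hi ≤ j → σ j = j) {j : ℕ} (h1 : lo ≤ j)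
    (h2 : j < hi) : lo ≤ σ j ∧ σ j < hi := by
  by_contra h3
  have := σ.injective (h (σ j) (by omega))
  omega

theorem symm_fix {σ : Equiv.Perm ℕ} (h : ∀ j, j < lo ∨ hi ≤ j → σ j = j) (j : ℕ)
    (hj : j < lo ∨ hi ≤ j) : σ.symm j = j := by
  rw [Equiv.symm_apply_eq, h j hj]

theorem symm (h : Shuffled f g lo hi) : Shuffled g f lo hi := by
  obtain ⟨σ, h1, h2⟩ := h
  refine ⟨σ.symm, symm_fix h1, fun j hj => ?_⟩
  rw [h2, Equiv.apply_symm_apply]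
  exact (perm_lt (lo := 0) (fun j hj => symm_fix h1 j (by omega)) (Nat.zero_le _) hj).2

theorem trans (h1 : Shuffled f g lo hi) (h2 : Shuffled g h lo hi) : Shuffled f h lo hi := by
  obtain ⟨σ, h1, h3⟩ := h1
  obtain ⟨τ, h2, h4⟩ := h2
  refine ⟨σ * τ, fun j hj => by rw [Equiv.Perm.mul_apply, h2 j hj, h1 j hj], fun j hj => ?_⟩
  rw [h4 j hj, h3, Equiv.Perm.mul_apply]
  exact (perm_lt (lo := 0) (fun j hj => h2 j (by omega)) (Nat.zero_le _) hj).2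

theorem mono {lo' : ℕ} (h : Shuffled f g lo hi) (hlo : lo' ≤ lo) : Shuffled f g lo' hi := by
  obtain ⟨σ, h1, h2⟩ := h
  exact ⟨σ, fun j hj => h1 j (by omega), h2⟩

theorem eq (h : Shuffled f g lo hi) {j : ℕ} (h1 : j < lo) (h2 : j < hi) : g j = f j := by
  obtain ⟨σ, h3, h4⟩ := h
  rw [h4 j h2, h3 j (.inl h1)]

theorem exists_eq (h : Shuffled f g lo hi) {j : ℕ} (h1 : lo ≤ j) (h2 : j < hi) :
    ∃ j', lo ≤ j' ∧ j' < hi ∧ f j = g j' := by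
  obtain ⟨σ, h3, h4⟩ := h.symm
  exact ⟨σ j, (perm_lt h3 h1 h2).1, (perm_lt h3 h1 h2).2, h4 j h2⟩

theorem card_filter_le (h : Shuffled f g lo hi) (p : ℕ → Prop) [DecidablePred p] :
    ((Finset.Ico lo hi).filter fun j => p (g j)).card ≤
      ((Finset.Ico lo hi).filter fun j => p (f j)).card := by
  obtain ⟨σ, h3, h4⟩ := h
  refine Finset.card_le_card_of_injOn σ (fun j hj => ?_) fun _ _ _ _ h => σ.injective h
  simp only [Finset.coe_filter, Finset.mem_Ico, Set.mem_setOf_eq] at hj ⊢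
  exact ⟨perm_lt h3 hj.1.1 hj.1.2, h4 j hj.1.2 ▸ hj.2⟩

end Shuffled

theorem ColPerm.shuffled {lo hi : ℕ} {σ : Equiv.Perm ℕ} (h : ColPerm mem mem' lo hi σ) :
    Shuffled (fun j => mem (8 * j + 2)) (fun j => mem' (8 * j + 2)) lo hi :=
  ⟨σ, h.fix, fun j _ => h.perm j⟩

/-- The number of columns listed from index `lo` on with a key larger than `v`. -/
noncomputable def big (A : Matrix (Fin m) (Fin n) α) (mem : ℕ → ℕ) (lo : ℕ) (v : ℤ) : ℕ :=
  ((Finset.Ico lo (mem 16)).filter fun j => v < colKey A mem (mem (8 * j + 2))).card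

theorem big_le {lo : ℕ} {v : ℤ} : big A mem lo v ≤ mem 16 - lo :=
  (Finset.card_filter_le _ _).trans (by simp)

/-- What is needed to renew the blocks of the columns listed from index `lo` on until their keys
are at most that in position `(pr, pc)`. -/
structure Lowerable (A : Matrix (Fin m) (Fin n) α) (lo pr pc : ℕ) (mem : ℕ → ℕ) : Prop where
  core : Core A 0 mem
  blocks : Blocks A mem
  le : lo ≤ mem 16
  row : pr < rows m n (mem 0)
  col : pc < rows n m (mem 0)
  lo_le : loKey A mem ≤ key A (mem 0) pr pc
  ptr_le : mem 48 ≤ mem 8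
  before : ∀ j < mem 16, j < lo → ∃ x < rows m n (mem 0),
    key A (mem 0) x (mem (8 * j + 2)) ≤ key A (mem 0) pr pc
  walked : ∀ k < mem 48, ∃ y < rows n m (mem 0),
    key A (mem 0) pr pc ≤ key A (mem 0) (mem (8 * k + 1)) y ∧
    ∀ j, lo ≤ j → j < mem 16 → colKey A mem (mem (8 * j + 2)) ≤ key A (mem 0) (mem (8 * k + 1)) y
  pos : 1 ≤ mem 32

/-- The keys of the columns listed from index `lo` on are at most `v` after `K` renewals. -/
structure Lowered (A : Matrix (Fin m) (Fin n) α) (lo : ℕ) (v : ℤ) (mem mem' : ℕ → ℕ) (K : ℕ) :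
    Prop where
  scalar : ∀ x < 8 * (m + n + 20), x % 8 = 0 → x ≠ 40 → x ≠ 48 → x ≠ 72 → x ≠ 80 → mem' x = mem x
  row : ∀ k < mem 8, mem' (8 * k + 1) = mem (8 * k + 1)
  core : Core A 0 mem'
  blocks : Blocks A mem'
  cover : Cover mem → Cover mem'
  used : mem' 40 = mem 40 + mem 24 * K
  shuffled : Shuffled (fun j => mem (8 * j + 2)) (fun j => mem' (8 * j + 2)) lo (mem 16)
  le : ∀ j, lo ≤ j → j < mem 16 → colKey A mem' (mem' (8 * j + 2)) ≤ v
  keep : ∀ j < mem 16, j < lo ∨ colKey A mem (mem (8 * j + 2)) ≤ v →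
    colKey A mem' (mem (8 * j + 2)) = colKey A mem (mem (8 * j + 2))
  many : big A mem lo v ≤ K
  ptr : mem 48 ≤ mem' 48 ∧ mem' 48 ≤ mem 8
  walked : ∀ k < mem' 48, ∃ y < rows n m (mem 0), v ≤ key A (mem 0) (mem (8 * k + 1)) y

/-- The attempt to lower the keys of the columns has ended because of a walk through all rows or
the lack of new blocks. -/
structure Aborted (A : Matrix (Fin m) (Fin n) α) (r : ℕ) (mem mem' : ℕ → ℕ) : Prop where
  scalar : ∀ x < 8 * (m + n + 20), x % 8 = 0 → x ≠ 40 → x ≠ 48 → x ≠ 56 → x ≠ 64 → x ≠ 72 →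
    x ≠ 80 → x ≠ 88 → mem' x = mem x
  cases : r = 1 ∧ Core A (mem' 88) mem' ∧ mem 16 - mem' 88 ≤ mem 32 ∨
    r = 2 ∧ Core A 0 mem' ∧ Blocks A mem' ∧ (Cover mem → Cover mem') ∧
      mem 8 < mem' 40 + mem 24 ∧ mem' 88 = mem 88

/-- The columns that the scan moves before `hi` have a block minimum, hence an entry, at most v.
They join the columns that are already witnessed, and only those behind need further work. -/
theorem Lowerable.scan {lo hi pr pc : ℕ} {σ : Equiv.Perm ℕ} (h : Lowerable A lo pr pc mem)
    (hs : ColPerm mem mem' lo (mem 16) σ) (h1 : lo ≤ hi) (h2 : hi ≤ mem 16)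
    (hle : ∀ j, lo ≤ j → j < hi → colKey A mem (mem' (8 * j + 2)) ≤ key A (mem 0) pr pc) :
    Lowerable A hi pr pc mem' := by
  have e : ∀ x, x % 8 ≠ 2 → mem' x = mem x := hs.same
  have hc := h.core.perm hs
  have hb := h.blocks.perm hs
  have e1 : ∀ k, mem' (8 * k + 1) = mem (8 * k + 1) := fun k => e _ (by omega)
  refine ⟨hc, hb, ?_, ?_, ?_, ?_, ?_, ?_, ?_, ?_⟩
  · rwa [e 16 (by omega)]
  · rw [e 0 (by omega)]
    exact h.row
  · rw [e 0 (by omega)]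
    exact h.col
  · rw [loKey, e 0 (by omega), e 56 (by omega), e 64 (by omega)]
    exact h.lo_le
  · rw [e 48 (by omega), e 8 (by omega)]
    exact h.ptr_le
  · intro j hj hj'
    have hv := hc.validCol hb hj
    rw [e 16 (by omega)] at hj
    rw [e 0 (by omega)]
    by_cases h3 : j < lo
    · rw [hs.shuffled.eq h3 hj]
      exact h.before j hj h3
    · have := hle j (by omega) hj'
      rw [← hs.colKey_eq, hv.colKey_eq, e 0 (by omega)] at this
      exact ⟨_, e 0 (by omega) ▸ hv.2, this⟩
  · intro k hk
    rw [e 48 (by omega)] at hk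
    obtain ⟨y, h3, h4, h5⟩ := h.walked k hk
    rw [e 0 (by omega), e 16 (by omega), e1, hs.colKey_eq]
    exact ⟨y, h3, h4, fun j h6 h7 => (hs.forall_iff (fun c => colKey A mem c ≤ _)).2 h5 j (by omega) h7⟩
  · rw [e 32 (by omega)]
    exact h.pos

/-- Columns that the scan found small keep their keys, so lowering the large ones lowers all, and
the number of columns above v is not affected by the restriction. -/
theorem Lowered.of_scan {lo hi K : ℕ} {v : ℤ} {σ : Equiv.Perm ℕ}
    (h : Lowered A hi v mem' mem'' K) (hs : ColPerm mem mem' lo (mem 16) σ) (h1 : lo ≤ hi)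
    (h2 : hi ≤ mem 16) (hle : ∀ j, lo ≤ j → j < hi → colKey A mem (mem' (8 * j + 2)) ≤ v)
    (hlt : ∀ j, hi ≤ j → j < mem 16 → v < colKey A mem (mem' (8 * j + 2))) :
    Lowered A lo v mem mem'' K := by
  have e : ∀ x, x % 8 ≠ 2 → mem' x = mem x := hs.same
  have e16 : mem' 16 = mem 16 := e 16 (by omega)
  have hck := hs.colKey_eq (A := A)
  have hsh := h.shuffled
  rw [e16] at hsh
  have keep : ∀ j < hi, colKey A mem'' (mem' (8 * j + 2)) = colKey A mem (mem' (8 * j + 2)) := by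
    intro j hj
    rw [h.keep j (by omega) (.inl hj), hck]
  refine ⟨fun x g1 g2 g3 g4 g5 g6 => (h.scalar x g1 g2 g3 g4 g5 g6).trans (e x (by omega)),
    fun k hk => ?_, h.core, h.blocks, ?_, ?_, hs.shuffled.trans (hsh.mono h1), ?_, ?_, ?_, ?_, ?_⟩
  · rw [h.row k (by rwa [e 8 (by omega)]), e _ (by omega)]
  · exact fun hc => h.cover (hc.perm hs)
  · rw [h.used, e 40 (by omega), e 24 (by omega)]
  · intro j g1 g2
    by_cases g3 : j < hi
    · rw [hsh.eq g3 g2, keep j g3]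
      exact hle j g1 g3
    · exact h.le j (by omega) (by omega)
  · intro j g1 g2
    obtain ⟨j', g3, g4⟩ : ∃ j' < hi, mem (8 * j + 2) = mem' (8 * j' + 2) := by
      by_cases g3 : j < lo
      · exact ⟨j, by omega, (hs.shuffled.eq g3 g1).symm⟩
      · obtain ⟨j', g4, g5, g6⟩ := hs.shuffled.exists_eq (by omega) g1
        refine ⟨j', ?_, g6⟩
        by_contra g7
        have := hlt j' (by omega) g5
        rw [← g6] at this
        omega
    rw [g4]
    exact keep j' g3
  · refine le_trans ?_ h.many
    rw [big, big, e16, ← hs.card_filter fun c => v < colKey A mem c]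
    rw [hck]
    refine Finset.card_le_card fun j hj => ?_
    simp only [Finset.mem_filter, Finset.mem_Ico] at hj ⊢
    refine ⟨⟨?_, hj.1.2⟩, hj.2⟩
    by_contra g1
    have := hle j hj.1.1 (by omega)
    omega
  · have := h.ptr
    rwa [e 48 (by omega), e 8 (by omega)] at this
  · have := h.walked
    simp only [e 0 (by omega)] at this
    intro k hk
    obtain ⟨y, g1, g2⟩ := this k hk
    exact ⟨y, g1, by rwa [e _ (by omega)] at g2⟩

theorem Aborted.of_scan {lo r : ℕ} {σ : Equiv.Perm ℕ} (h : Aborted A r mem' mem'')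
    (hs : ColPerm mem mem' lo (mem 16) σ) : Aborted A r mem mem'' := by
  have e : ∀ x, x % 8 ≠ 2 → mem' x = mem x := hs.same
  refine ⟨fun x g1 g2 g3 g4 g5 g6 g7 g8 g9 => (h.scalar x g1 g2 g3 g4 g5 g6 g7 g8 g9).trans (e x (by omega)), ?_⟩
  have := h.cases
  rw [e 16 (by omega), e 32 (by omega), e 8 (by omega), e 24 (by omega), e 88 (by omega)] at this
  refine this.imp_right fun g => ⟨g.1, g.2.1, g.2.2.1, fun hc => g.2.2.2.1 (hc.perm hs), g.2.2.2.2⟩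

end Saddle

/-! ### Composing and transporting the steps of the recursion -/

namespace Saddle

open RAM Expr Test Cmd

variable {α : Type*} [LinearOrder α] {m n : ℕ} {W : ℕ} {A : Matrix (Fin m) (Fin n) α}
  {mem mem' mem'' : ℕ → ℕ}

theorem Core.row_lt {al k : ℕ} (h : Core A al mem) (hk : k < mem 8) : k < m + n :=
  hk.trans_le h.row_le

theorem Core.col_lt {al k : ℕ} (h : Core A al mem) (hk : k < mem 16) : k < m + n :=
  hk.trans_le h.col_le

theorem big_congr {al lo : ℕ} {v : ℤ} (h : Core A al mem)
    (hs : ∀ x < 8 * (m + n + 20), mem' x = mem x) : big A mem' lo v = big A mem lo v := by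
  rw [big, big, hs 16 (by omega), colKey_congr hs]
  congr 1
  refine Finset.filter_congr fun j hj => ?_
  have := h.col_lt (Finset.mem_Ico.1 hj).2
  rw [hs _ (by omega)]

theorem Lowerable.congr {lo pr pc : ℕ} (h : Lowerable A lo pr pc mem)
    (hs : ∀ x < 8 * (m + n + 20), mem' x = mem x) : Lowerable A lo pr pc mem' := by
  have e1 : ∀ k < mem 8, mem' (8 * k + 1) = mem (8 * k + 1) := fun k hk => by
    have := h.core.row_lt hk
    exact hs _ (by omega)
  have e2 : ∀ k < mem 16, mem' (8 * k + 2) = mem (8 * k + 2) := fun k hk => by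
    have := h.core.col_lt hk
    exact hs _ (by omega)
  have h48 := h.ptr_le
  constructor <;> try simp only [loKey, hs 0 (by omega), hs 8 (by omega), hs 16 (by omega),
    hs 32 (by omega), hs 48 (by omega), hs 56 (by omega), hs 64 (by omega), colKey_congr hs]
  · exact h.core.congr fun x hx _ _ _ _ _ _ => hs x hx
  · exact h.blocks.congr h.core fun x hx _ _ => hs x hx
  · exact h.le
  · exact h.row
  · exact h.col
  · exact h.lo_le
  · exact h.ptr_le
  · intro j hj
    rw [e2 j hj]
    exact h.before j hj
  · intro k hk
    rw [e1 k (by omega)]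
    obtain ⟨y, h1, h2, h3⟩ := h.walked k hk
    refine ⟨y, h1, h2, fun j h4 h5 => ?_⟩
    rw [e2 j h5]
    exact h3 j h4 h5
  · exact h.pos

theorem Lowered.of_congr {lo K : ℕ} {v : ℤ} (h : Lowered A lo v mem' mem'' K) (hc : Core A 0 mem)
    (hb : Blocks A mem) (hp : mem 48 ≤ mem 8)
    (hs : ∀ x < 8 * (m + n + 20), mem' x = mem x) : Lowered A lo v mem mem'' K := by
  have e1 : ∀ k < mem 8, mem' (8 * k + 1) = mem (8 * k + 1) := fun k hk => by
    have := hc.row_lt hk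
    exact hs _ (by omega)
  have e2 : ∀ k < mem 16, mem' (8 * k + 2) = mem (8 * k + 2) := fun k hk => by
    have := hc.col_lt hk
    exact hs _ (by omega)
  have e16 := hs 16 (by omega)
  have e8 := hs 8 (by omega)
  refine ⟨fun x g1 g2 g3 g4 g5 g6 => (h.scalar x g1 g2 g3 g4 g5 g6).trans (hs x g1),
    fun k hk => ?_, h.core, h.blocks, ?_, ?_, ?_, ?_, ?_, ?_, ?_, ?_⟩
  · rw [h.row k (by omega), e1 k hk]
  · exact fun hc' => h.cover (hc'.congr hc hb fun x hx _ => hs x hx)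
  · rw [h.used, hs 40 (by omega), hs 24 (by omega)]
  · have := h.shuffled
    rw [e16] at this
    exact (Shuffled.of_eq fun j hj => e2 j hj).trans this
  · have := h.le
    rwa [e16] at this
  · intro j hj
    have := h.keep j (by omega)
    rwa [e2 j hj, colKey_congr hs] at this
  · rw [← big_congr hc hs]
    exact h.many
  · have := h.ptr
    rwa [hs 48 (by omega), e8] at this
  · intro k hk
    have h1 := h.walked k hk
    have := h.ptr.2
    rwa [hs 0 (by omega), e1 k (by omega)] at h1

theorem Aborted.of_congr {r : ℕ} (h : Aborted A r mem' mem'') (hc : Core A 0 mem)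
    (hb : Blocks A mem) (hs : ∀ x < 8 * (m + n + 20), mem' x = mem x) : Aborted A r mem mem'' := by
  refine ⟨fun x g1 g2 g3 g4 g5 g6 g7 g8 g9 => (h.scalar x g1 g2 g3 g4 g5 g6 g7 g8 g9).trans (hs x g1), ?_⟩
  have := h.cases
  rw [hs 16 (by omega), hs 32 (by omega), hs 8 (by omega), hs 24 (by omega), hs 88 (by omega)] at this
  exact this.imp_right fun g => ⟨g.1, g.2.1, g.2.2.1,
    fun hc' => g.2.2.2.1 (hc'.congr hc hb fun x hx _ => hs x hx), g.2.2.2.2⟩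

/-- The threshold rises from v to the key w of some current column. A row passed by the walk for v
remains valid for w, because it has a key at least all current column keys, in particular at least
w. This second half of `walked` is why the row pointer need not be reset. -/
theorem Lowerable.inner {lo pr pc j : ℕ} (h : Lowerable A lo pr pc mem) (h1 : lo ≤ j)
    (h2 : j < mem 16) (hlt : key A (mem 0) pr pc < colKey A mem (mem (8 * j + 2))) :
    Lowerable A lo (mem (8 * mem (8 * j + 2) + 5)) (mem (8 * j + 2)) mem := by
  have hv := h.core.validCol h.blocks h2
  have hk := hv.colKey_eq (A := A)
  refine ⟨h.core, h.blocks, h.le, hv.2, hv.1, ?_, h.ptr_le, fun j' h3 h4 => ?_, fun k h3 => ?_, h.pos⟩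
  · rw [← hk]
    exact h.lo_le.trans hlt.le
  · obtain ⟨x, h5, h6⟩ := h.before j' h3 h4
    exact ⟨x, h5, by rw [← hk]; omega⟩
  · obtain ⟨y, h5, h6, h7⟩ := h.walked k h3
    exact ⟨y, h5, hk ▸ h7 j h1 h2, h7⟩

/-- Returning from w to a smaller v: rows passed so far have a key at least w, hence at least v and
at least all column keys, which are now at most w. The second half of `walked` is thus restored. -/
theorem Lowered.lowerable {lo pr pc K : ℕ} {v : ℤ} (h' : Lowered A lo v mem mem' K)
    (h : Lowerable A lo pr pc mem) (hv : key A (mem 0) pr pc ≤ v) : Lowerable A lo pr pc mem' := by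
  have e : ∀ x < 100, x % 8 = 0 → x ≠ 40 → x ≠ 48 → x ≠ 72 → x ≠ 80 → mem' x = mem x :=
    fun x hx => h'.scalar x (by omega)
  have e0 := e 0 (by omega) (by omega) (by omega) (by omega) (by omega) (by omega)
  have e8 := e 8 (by omega) (by omega) (by omega) (by omega) (by omega) (by omega)
  have e16 := e 16 (by omega) (by omega) (by omega) (by omega) (by omega) (by omega)
  have e32 := e 32 (by omega) (by omega) (by omega) (by omega) (by omega) (by omega)
  have e56 := e 56 (by omega) (by omega) (by omega) (by omega) (by omega) (by omega)
  have e64 := e 64 (by omega) (by omega) (by omega) (by omega) (by omega) (by omega)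
  have hp := h'.ptr
  constructor <;> try simp only [loKey, e0, e8, e16, e32, e56, e64]
  · exact h'.core
  · exact h'.blocks
  · exact h.le
  · exact h.row
  · exact h.col
  · exact h.lo_le
  · exact h'.ptr.2
  · intro j h1 h2
    rw [h'.shuffled.eq h2 h1]
    exact h.before j h1 h2
  · intro k hk
    obtain ⟨y, h1, h2⟩ := h'.walked k hk
    rw [h'.row k (by omega)]
    exact ⟨y, h1, by omega, fun j h3 h4 => (h'.le j h3 h4).trans h2⟩
  · exact h.pos

/-- For the count of renewals, a column above v was either above w and was renewed in the first
stage, or it kept its key and is still above v when the second stage starts. So the numbers of such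
columns add up to at least the number above v. -/
theorem Lowered.trans {lo K K' : ℕ} {v w : ℤ} (h : Lowered A lo w mem mem' K)
    (h' : Lowered A lo v mem' mem'' K') (hvw : v ≤ w)
    (hlt : ∀ j, lo ≤ j → j < mem 16 → v < colKey A mem (mem (8 * j + 2))) :
    Lowered A lo v mem mem'' (K + K') := by
  have e : ∀ x < 100, x % 8 = 0 → x ≠ 40 → x ≠ 48 → x ≠ 72 → x ≠ 80 → mem' x = mem x :=
    fun x hx => h.scalar x (by omega)
  have e0 := e 0 (by omega) (by omega) (by omega) (by omega) (by omega) (by omega)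
  have e8 := e 8 (by omega) (by omega) (by omega) (by omega) (by omega) (by omega)
  have e16 := e 16 (by omega) (by omega) (by omega) (by omega) (by omega) (by omega)
  have e24 := e 24 (by omega) (by omega) (by omega) (by omega) (by omega) (by omega)
  have hp := h.ptr
  have hp' := h'.ptr
  refine ⟨fun x g1 g2 g3 g4 g5 g6 => (h'.scalar x g1 g2 g3 g4 g5 g6).trans (h.scalar x g1 g2 g3 g4 g5 g6),
    fun k hk => (h'.row k (by omega)).trans (h.row k hk), h'.core, h'.blocks,
    fun hc => h'.cover (h.cover hc), ?_, h.shuffled.trans (e16 ▸ h'.shuffled), ?_, ?_, ?_, ?_, ?_⟩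
  · rw [h'.used, h.used, e24]
    ring
  · exact e16 ▸ h'.le
  · intro j h1 h2
    have h3 : j < lo := by
      by_contra h4
      have := hlt j (by omega) h1
      omega
    have h4 := h'.keep j (by omega) (.inl h3)
    have h5 : mem' (8 * j + 2) = mem (8 * j + 2) := h.shuffled.eq h3 h1
    rw [h5] at h4
    rw [h4, h.keep j h1 (.inl h3)]
  · have h1 : big A mem lo v ≤ big A mem lo w + big A mem' lo v := by
      have h2 : big A mem' lo v = ((Finset.Ico lo (mem 16)).filter fun j =>
          v < colKey A mem' (mem' (8 * j + 2))).card := by rw [big, e16]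
      rw [h2]
      refine le_trans ?_ (Nat.add_le_add_left (h.shuffled.symm.card_filter_le fun c =>
        v < colKey A mem' c) _)
      refine le_trans (Finset.card_le_card ?_) (Finset.card_union_le _ _)
      intro j hj
      simp only [Finset.mem_union, Finset.mem_filter, Finset.mem_Ico] at hj ⊢
      by_cases h3 : w < colKey A mem (mem (8 * j + 2))
      · exact .inl ⟨hj.1, h3⟩
      · refine .inr ⟨hj.1, ?_⟩
        rw [h.keep j hj.1.2 (.inr (by omega))]
        exact hj.2
    have h2 := h.many
    have h3 := h'.many
    omega
  · omega
  · intro k hk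
    obtain ⟨y, h1, h2⟩ := h'.walked k hk
    rw [e0] at h1 h2
    rw [h.row k (by omega)] at h2
    exact ⟨y, h1, h2⟩

theorem Lowered.aborted {lo K r : ℕ} {v : ℤ} (h : Lowered A lo v mem mem' K)
    (h' : Aborted A r mem' mem'') : Aborted A r mem mem'' := by
  have e : ∀ x < 100, x % 8 = 0 → x ≠ 40 → x ≠ 48 → x ≠ 72 → x ≠ 80 → mem' x = mem x :=
    fun x hx => h.scalar x (by omega)
  refine ⟨fun x g1 g2 g3 g4 g5 g6 g7 g8 g9 => (h'.scalar x g1 g2 g3 g4 g5 g6 g7 g8 g9).trans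
    (h.scalar x g1 g2 g3 g4 g7 g8), ?_⟩
  have := h'.cases
  rw [e 16 (by omega) (by omega) (by omega) (by omega) (by omega) (by omega),
    e 32 (by omega) (by omega) (by omega) (by omega) (by omega) (by omega),
    e 8 (by omega) (by omega) (by omega) (by omega) (by omega) (by omega),
    e 24 (by omega) (by omega) (by omega) (by omega) (by omega) (by omega),
    e 88 (by omega) (by omega) (by omega) (by omega) (by omega) (by omega)] at this
  exact this.imp_right fun g => ⟨g.1, g.2.1, g.2.2.1, fun hc => g.2.2.2.1 (h.cover hc), g.2.2.2.2⟩

/-- The base of the recursion, after a successful walk and the renewal of all columns above v. The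
rows before the old pointer are known from earlier walks, the others from this one. -/
theorem Lowerable.lowered {lo pr pc K : ℕ} {S : ℕ → Prop} (h : Lowerable A lo pr pc mem)
    (hs : ∀ x, x ≠ 48 → x ≠ 72 → x ≠ 80 → mem' x = mem x)
    (h48 : mem 48 ≤ mem' 48) (h48' : mem' 48 ≤ mem 8)
    (hwalk : ∀ k, mem 48 ≤ k → k < mem' 48 → ∃ j < mem 16,
      key A (mem 0) pr pc ≤ key A (mem 0) (mem (8 * k + 1)) (mem (8 * j + 2)))
    (hlt : ∀ j, lo ≤ j → j < mem 16 → key A (mem 0) pr pc < colKey A mem (mem (8 * j + 2)))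
    (hK : Killed A S mem' mem'' K) (hS : ∀ c, S c → ∃ j, lo ≤ j ∧ j < mem 16 ∧ mem (8 * j + 2) = c)
    (hmany : mem 16 - lo ≤ K)
    (hle : ∀ j, lo ≤ j → j < mem 16 → colKey A mem'' (mem (8 * j + 2)) ≤ key A (mem 0) pr pc) :
    Lowered A lo (key A (mem 0) pr pc) mem mem'' K := by
  have e : ∀ x, x % 8 ≠ 3 → x % 8 ≠ 4 → x % 8 ≠ 5 → x ≠ 40 → x ≠ 48 → x ≠ 72 → x ≠ 80 →
      mem'' x = mem x := fun x h1 h2 h3 h4 h5 h6 h7 =>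
    (hK.same x h1 h2 h3 h4).trans (hs x h5 h6 h7)
  have e48 : mem'' 48 = mem' 48 := hK.same 48 (by omega) (by omega) (by omega) (by omega)
  have e2 : ∀ j, mem'' (8 * j + 2) = mem (8 * j + 2) := fun j =>
    e _ (by omega) (by omega) (by omega) (by omega) (by omega) (by omega) (by omega)
  refine ⟨fun x g1 g2 g3 g4 g5 g6 => e x (by omega) (by omega) (by omega) g3 g4 g5 g6,
    fun k hk => e _ (by omega) (by omega) (by omega) (by omega) (by omega) (by omega) (by omega),
    hK.core, hK.blocks, fun hc => hK.cover (hc.congr h.core h.blocks fun x _ hx =>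
      hs x (by omega) (by omega) (by omega)), ?_, .of_eq fun j _ => e2 j, ?_, ?_,
    big_le.trans hmany, ⟨by omega, by omega⟩, ?_⟩
  · rw [hK.used, hs 40 (by omega) (by omega) (by omega), hs 24 (by omega) (by omega) (by omega)]
  · intro j h1 h2
    rw [e2]
    exact hle j h1 h2
  · intro j h1 h2
    have h3 : j < lo := by
      by_contra h4
      have := hlt j (by omega) h1
      omega
    rw [hK.colKey_eq]
    · exact colKey_of_same (hs _ (by omega) (by omega) (by omega)) (hs _ (by omega) (by omega) (by omega))
    · intro h4
      obtain ⟨j', h5, h6, h7⟩ := hS _ h4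
      have := h.core.col_inj _ h6 _ h1 h7
      omega
  · intro k hk
    rw [e48] at hk
    by_cases h1 : k < mem 48
    · obtain ⟨y, h2, h3, -⟩ := h.walked k h1
      exact ⟨y, h2, h3⟩
    · obtain ⟨j, h2, h3⟩ := hwalk k (by omega) hk
      exact ⟨_, h.core.col j h2, h3⟩

end Saddle

/-! ### The lowering recursion and its running time -/

namespace Saddle

open RAM Expr Test Cmd

variable {α : Type*} [LinearOrder α] {m n : ℕ} {W : ℕ} {A : Matrix (Fin m) (Fin n) α}
  {mem mem' mem'' : ℕ → ℕ}

theorem big_of_scan {lo hi : ℕ} {v : ℤ} {σ : Equiv.Perm ℕ} (hs : ColPerm mem mem' lo (mem 16) σ)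
    (h1 : lo ≤ hi) (hle : ∀ j, lo ≤ j → j < hi → colKey A mem (mem' (8 * j + 2)) ≤ v)
    (hlt : ∀ j, hi ≤ j → j < mem 16 → v < colKey A mem (mem' (8 * j + 2))) :
    big A mem lo v = mem 16 - hi := by
  rw [big, ← hs.card_filter fun c => v < colKey A mem c, ← Nat.card_Ico]
  congr 1
  ext j
  simp only [Finset.mem_filter, Finset.mem_Ico]
  refine ⟨fun h => ⟨?_, h.1.2⟩, fun h => ⟨⟨by omega, h.2⟩, hlt j h.1 h.2⟩⟩
  by_contra h2
  have := hle j h.1.1 (by omega)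
  omega

/-- The first call runs at depth d, but its K₁ renewals are charged at depth d + 1, which frees
60000 K₁. As y ≤ 16 K₁, this pays for the pivot and the overhead of the y large columns. The scan of
all X columns is covered by the term 300 (X + 1). -/
theorem time_rec {X y K₁ K₂ t d Δ₁ Δ₂ T T₁ T₂ R : ℕ} (hT : T ≤ 200 * X + 2000 * y + T₁ + T₂ + 300)
    (h1 : T₁ ≤ 300 * (y + 1) + 60000 * (K₁ * (t + d + 1)) + 200 * Δ₁)
    (h2 : T₂ ≤ 300 * (y + 1) + 60000 * (K₂ * (t + (d + 1) + 1)) + 200 * Δ₂ + R)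
    (hy : y ≤ 16 * K₁) (hy' : 2 ≤ y) :
    T ≤ 300 * (X + 1) + 60000 * ((K₁ + K₂) * (t + (d + 1) + 1)) + 200 * (Δ₁ + Δ₂) + R := by
  have : (K₁ + K₂) * (t + (d + 1) + 1) = K₁ * (t + d + 1) + K₁ + K₂ * (t + (d + 1) + 1) := by ring
  omega

/-- If the first call is aborted, its renewals may be too few to pay. The charge for the large
columns pays instead: it falls from y to at most 15y/16 of them in the call, and the difference
covers the pivot. -/
theorem time_abort {X y b K t d Δ T T₁ : ℕ} (hT : T ≤ 200 * X + 2000 * y + T₁ + 300)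
    (h1 : T₁ ≤ 300 * (y + 1) + 60000 * (K * (t + d + 1)) + 200 * Δ + 60000 * (b * (t + 1)))
    (hb : 16 * b ≤ 15 * y) (hy : 2 ≤ y) :
    T ≤ 300 * (X + 1) + 60000 * (K * (t + (d + 1) + 1)) + 200 * Δ + 60000 * (y * (t + 1)) := by
  have h2 : K * (t + (d + 1) + 1) = K * (t + d + 1) + K := by ring
  have h3 : 16 * b * (t + 1) ≤ 15 * y * (t + 1) := Nat.mul_le_mul_right _ hb
  rw [mul_assoc, mul_assoc] at h3
  have h4 : y * 1 ≤ y * (t + 1) := Nat.mul_le_mul_left _ (by omega)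
  omega

/-- A pivot removes at least a sixteenth of the large columns, so the depth counts factors of 15/16
down to e columns. -/
theorem depth_step {b y e d : ℕ} (hb : 16 * b ≤ 15 * y) (h : y * 15 ^ (d + 1) ≤ e * 16 ^ (d + 1)) :
    b * 15 ^ d ≤ e * 16 ^ d := by
  have h1 : 16 * b * 15 ^ d ≤ 15 * y * 15 ^ d := Nat.mul_le_mul_right _ hb
  have h2 : 15 * y * 15 ^ d = y * 15 ^ (d + 1) := by ring
  have h3 : e * 16 ^ (d + 1) = 16 * (e * 16 ^ d) := by ring
  have h4 : 16 * b * 15 ^ d = 16 * (b * 15 ^ d) := by ring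
  omega

theorem big_add_le {lo : ℕ} {v : ℤ} :
    big A mem lo v + ((Finset.Ico lo (mem 16)).filter
      fun j => colKey A mem (mem (8 * j + 2)) ≤ v).card = mem 16 - lo := by
  rw [big, ← Nat.card_Ico, ← Finset.card_filter_add_card_filter_not (s := Finset.Ico lo (mem 16))
    (fun j => v < colKey A mem (mem (8 * j + 2)))]
  simp only [not_lt]

/-- The outcome of lowering the keys. -/
def LowerPost (A : Matrix (Fin m) (Fin n) α) (lo : ℕ) (v : ℤ) (D : ℕ) (mem : ℕ → ℕ) (r : ℕ)
    (mem' : ℕ → ℕ) (T : ℕ) : Prop :=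
  (r = 0 ∧ ∃ K, Lowered A lo v mem mem' K ∧ T ≤ 300 * (mem 16 - lo + 1) +
    60000 * (K * (mem 24 + D + 1)) + 200 * (mem' 48 - mem 48)) ∨
  (Aborted A r mem mem' ∧ ∃ K Δ, mem 40 + mem 24 * K ≤ mem 8 ∧ mem 48 + Δ ≤ mem 8 ∧
    T ≤ 300 * (mem 16 - lo + 1) + 60000 * (K * (mem 24 + D + 1)) + 200 * Δ +
      60000 * (big A mem lo v * (mem 24 + 1)))

/-- With y columns above v, y > e, let w be a pivot among their keys. At most 15y/16 columns are
above w, so the call for w goes one level down. At least y/16 columns are above w and each is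
renewed, so the renewals pay for this level. The call that continues from w to v may again meet many
columns above v and stays at the same depth, but by then the reserve has shrunk. `N` bounds the
lexicographic measure that consists of the unused rows and the columns above v. At most e columns
above v are settled by one walk. In the aborted outcomes, `K` and `Δ` still count renewals and
passed rows, hence are bounded by the rows available. The last summand pays for blocks that were
deleted but not replaced. -/
theorem calls_lower (hW : 1000 * (m + n + 20) ≤ W) (N : ℕ) : ∀ (D : ℕ) {mem : ℕ → ℕ}
    {lo pr pc : ℕ}, Lowerable A lo pr pc mem →
    (mem 8 - mem 40) * (m + n + 1) + big A mem lo (key A (mem 0) pr pc) < N →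
    big A mem lo (key A (mem 0) pr pc) * 15 ^ D ≤ mem 32 * 16 ^ D →
    Calls procs W A 10 [lo, pr, pc] mem (LowerPost A lo (key A (mem 0) pr pc) D mem) := by
  induction N with
  | zero => intros; omega
  | succ N ih =>
    intro D mem lo pr pc h hN hD
    refine ⟨lowerBody, rfl, fun ent => run_of_wp ?_⟩
    simp only [lowerBody, seqs, lt, arr, ↓wp_seq, ↓wp_assign, ↓wp_branch, ↓wp_query, ↓wp_skip, ↓wp_store, ↓wp_loop,
    ↓wp_call, Test.Ok, Test.Holds, Test.time, Expr.Ok, Expr.val, Expr.time, Function.update_apply,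
    Nat.reduceEqDiff, reduceIte, OfNat.ofNat_ne_zero, OfNat.ofNat_ne_one, OfNat.zero_ne_ofNat,
    OfNat.one_ne_ofNat, one_ne_zero, zero_ne_one, List.getD_cons_zero, List.getD_cons_succ,
    List.getD_nil, true_and, and_true, and_assoc, not_le, Nat.reduceAdd, Nat.reduceMul]
    have hnl := h.core.col_le
    have hml := h.core.row_le
    refine run_call_of_eq (calls_scan (lo := lo) (pr := pr) (pc := pc) hW h.core.flag h.core.col_le h.le h.row
      h.col (fun j _ hj => h.core.validCol h.blocks hj)) (by simp <;> omega) (by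
    simp only [List.map_cons, List.map_nil, List.cons.injEq, seqs, lt, arr, ↓wp_seq, ↓wp_assign, ↓wp_branch, ↓wp_query, ↓wp_skip, ↓wp_store, ↓wp_loop,
    ↓wp_call, Test.Ok, Test.Holds, Test.time, Expr.Ok, Expr.val, Expr.time, Function.update_apply,
    Nat.reduceEqDiff, reduceIte, OfNat.ofNat_ne_zero, OfNat.ofNat_ne_one, OfNat.zero_ne_ofNat,
    OfNat.one_ne_ofNat, one_ne_zero, zero_ne_one, List.getD_cons_zero, List.getD_cons_succ,
    List.getD_nil, true_and, and_true, and_assoc, not_le, Nat.reduceAdd, Nat.reduceMul]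
    all_goals omega) rfl ?_
    rintro hi mem₁ ent₁ T₁ ⟨⟨σ, hs⟩, hi1, hi2, hle, hlt, hT₁⟩
    have hL := h.scan hs hi1 hi2 hle
    have hbig := big_of_scan hs hi1 hle hlt
    have e : ∀ x, x % 8 ≠ 2 → mem₁ x = mem x := hs.same
    have e0 := e 0 (by omega)
    have e8 := e 8 (by omega)
    have e16 := e 16 (by omega)
    have e24 := e 24 (by omega)
    have e32 := e 32 (by omega)
    have e40 := e 40 (by omega)
    have e48 := e 48 (by omega)
    have hck := hs.colKey_eq (A := A)
    have hlt₁ : ∀ j, hi ≤ j → j < mem₁ 16 → key A (mem₁ 0) pr pc < colKey A mem₁ (mem₁ (8 * j + 2)) := by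
      rw [e16, e0, hck]
      exact hlt
    simp only [e16, e32, List.map_cons, List.map_nil, List.sum_cons, List.sum_nil, seqs, lt, arr, ↓wp_seq, ↓wp_assign, ↓wp_branch, ↓wp_query, ↓wp_skip, ↓wp_store, ↓wp_loop,
    ↓wp_call, Test.Ok, Test.Holds, Test.time, Expr.Ok, Expr.val, Expr.time, Function.update_apply,
    Nat.reduceEqDiff, reduceIte, OfNat.ofNat_ne_zero, OfNat.ofNat_ne_one, OfNat.zero_ne_ofNat,
    OfNat.one_ne_ofNat, one_ne_zero, zero_ne_one, List.getD_cons_zero, List.getD_cons_succ,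
    List.getD_nil, true_and, and_true, and_assoc, not_le, Nat.reduceAdd, Nat.reduceMul]
    repeat refine And.intro (by omega) ?_
    refine ⟨fun g1 => ?_, fun g1 => ?_⟩
    · refine ⟨by omega, .inl ⟨rfl, 0, Lowered.of_scan ?_ hs hi1 hi2 hle hlt, by simp; omega⟩⟩
      have hf : ∀ j, hi ≤ j → j < mem₁ 16 → False := fun j _ _ => by omega
      refine ⟨fun _ _ _ _ _ _ _ => rfl, fun _ _ => rfl, hL.core, hL.blocks, id, rfl, .of_eq fun _ _ => rfl,
        fun j g2 g3 => (hf j g2 g3).elim, fun _ _ _ => rfl, ?_, ⟨le_rfl, hL.ptr_le⟩, fun k hk => ?_⟩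
      · have := big_le (A := A) (mem := mem₁) (lo := hi) (v := key A (mem 0) pr pc)
        omega
      · obtain ⟨y, g2, g3, -⟩ := hL.walked k hk
        exact ⟨y, g2, e0 ▸ g3⟩
    repeat refine And.intro (by omega) ?_
    refine ⟨fun g2 => ?_, fun g2 => ?_⟩
    · refine run_call_of_eq (calls_walk (lo := hi) (pr := pr) (pc := pc) hW hL.core.flag
        hL.core.row_le hL.core.col_le hL.le hL.ptr_le hL.row hL.col hL.core.row hL.core.col)
        (by simp <;> omega) (by
    simp only [List.map_cons, List.map_nil, List.cons.injEq, seqs, lt, arr, ↓wp_seq, ↓wp_assign, ↓wp_branch, ↓wp_query, ↓wp_skip, ↓wp_store, ↓wp_loop,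
    ↓wp_call, Test.Ok, Test.Holds, Test.time, Expr.Ok, Expr.val, Expr.time, Function.update_apply,
    Nat.reduceEqDiff, reduceIte, OfNat.ofNat_ne_zero, OfNat.ofNat_ne_one, OfNat.zero_ne_ofNat,
    OfNat.one_ne_ofNat, one_ne_zero, zero_ne_one, List.getD_cons_zero, List.getD_cons_succ,
    List.getD_nil, true_and, and_true, and_assoc, not_le, Nat.reduceAdd, Nat.reduceMul]
    all_goals omega) rfl ?_
      rintro r mem₂ ent₂ T₂ ⟨w1, w2, w3, w4, w5, w6⟩
      have hC₂ : Core A 0 mem₂ := hL.core.congr fun x _ _ _ _ _ _ _ => w1 x (by omega)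
      have hB₂ : Blocks A mem₂ := hL.blocks.congr hL.core fun x _ _ _ => w1 x (by omega)
      have f0 := w1 0 (by omega)
      have f8 := w1 8 (by omega)
      have f16 := w1 16 (by omega)
      have f1 : ∀ k, mem₂ (8 * k + 1) = mem₁ (8 * k + 1) := fun k => w1 _ (by omega)
      have f2 : ∀ k, mem₂ (8 * k + 2) = mem₁ (8 * k + 2) := fun k => w1 _ (by omega)
      simp only [List.map_cons, List.map_nil, List.sum_cons, List.sum_nil, seqs, lt, arr, ↓wp_seq, ↓wp_assign, ↓wp_branch, ↓wp_query, ↓wp_skip, ↓wp_store, ↓wp_loop,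
    ↓wp_call, Test.Ok, Test.Holds, Test.time, Expr.Ok, Expr.val, Expr.time, Function.update_apply,
    Nat.reduceEqDiff, reduceIte, OfNat.ofNat_ne_zero, OfNat.ofNat_ne_one, OfNat.zero_ne_ofNat,
    OfNat.one_ne_ofNat, one_ne_zero, zero_ne_one, List.getD_cons_zero, List.getD_cons_succ,
    List.getD_nil, true_and, and_true, and_assoc, not_le, Nat.reduceAdd, Nat.reduceMul]
      repeat refine And.intro (by omega) ?_
      refine ⟨fun g3 => ?_, fun g3 => ?_⟩
      · repeat refine And.intro (by omega) ?_
        have u : ∀ x, x ≠ 88 → Function.update mem₂ 88 hi x = mem₂ x := fun x hx =>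
          Function.update_of_ne hx _ _
        have hC₃ : Core A 0 (Function.update mem₂ 88 hi) :=
          hC₂.congr fun x _ _ _ _ _ _ hx => u x hx
        have hkl : loKey A (Function.update mem₂ 88 hi) = loKey A mem₁ := by
          rw [loKey, u 0 (by omega), u 56 (by omega), u 64 (by omega), f0, w1 56 (by omega),
            w1 64 (by omega), loKey]
        refine run_call_of_eq (calls_raiseLo (al := hi) (r := pr) (c := pc) hW hC₃ (by
            rw [u 0 (by omega), f0]
            exact hL.row) (by
            rw [u 0 (by omega), f0]
            exact hL.col) (by
            rw [u 0 (by omega), f0, hkl]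
            exact hL.lo_le) ?_ ?_)
          (by simp <;> omega) (by
    simp only [List.map_cons, List.map_nil, List.cons.injEq, seqs, lt, arr, ↓wp_seq, ↓wp_assign, ↓wp_branch, ↓wp_query, ↓wp_skip, ↓wp_store, ↓wp_loop,
    ↓wp_call, Test.Ok, Test.Holds, Test.time, Expr.Ok, Expr.val, Expr.time, Function.update_apply,
    Nat.reduceEqDiff, reduceIte, OfNat.ofNat_ne_zero, OfNat.ofNat_ne_one, OfNat.zero_ne_ofNat,
    OfNat.one_ne_ofNat, one_ne_zero, zero_ne_one, List.getD_cons_zero, List.getD_cons_succ,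
    List.getD_nil, true_and, and_true, and_assoc, not_le, Nat.reduceAdd, Nat.reduceMul]
    all_goals omega) rfl ?_
        · intro k hk
          rw [u 8 (by omega), f8] at hk
          rw [u 0 (by omega), u _ (by omega), f0, f1]
          -- The walk has reached the last row. Rows before the starting point of this walk are
          -- known from earlier walks.
          by_cases g4 : k < mem₁ 48
          · obtain ⟨y, g5, g6, -⟩ := hL.walked k g4
            exact ⟨y, g5, g6⟩
          · obtain ⟨j, g5, g6⟩ := w4 k (by omega) (by omega)
            exact ⟨_, hL.core.col j g5, g6⟩
        · intro j hj hj'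
          rw [u 16 (by omega), f16] at hj
          rw [u 0 (by omega), u _ (by omega), f0, f2]
          exact hL.before j hj hj'
        rintro r₃ mem₃ ent₃ T₃ ⟨v1, v2, v3⟩
        have v88 : mem₃ 88 = hi := by rw [v1 88 (by omega) (by omega), Function.update_self]
        simp only [List.map_cons, List.map_nil, List.sum_cons, List.sum_nil, seqs, lt, arr, ↓wp_seq, ↓wp_assign, ↓wp_branch, ↓wp_query, ↓wp_skip, ↓wp_store, ↓wp_loop,
    ↓wp_call, Test.Ok, Test.Holds, Test.time, Expr.Ok, Expr.val, Expr.time, Function.update_apply,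
    Nat.reduceEqDiff, reduceIte, OfNat.ofNat_ne_zero, OfNat.ofNat_ne_one, OfNat.zero_ne_ofNat,
    OfNat.one_ne_ofNat, one_ne_zero, zero_ne_one, List.getD_cons_zero, List.getD_cons_succ,
    List.getD_nil, true_and, and_true, and_assoc, not_le, Nat.reduceAdd, Nat.reduceMul]
        refine ⟨by omega, .inr ⟨Aborted.of_scan (lo := lo) (σ := σ) ⟨fun x _ _ _ k1 k2 k3 _ _ k4 => ?_,
          .inl ⟨rfl, by rwa [v88], by omega⟩⟩ hs, 0, mem₂ 48 - mem₁ 48, by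
            have := h.blocks.le
            simpa using this, by omega, ?_⟩⟩
        · rw [v1 x k2 k3, u x k4, w1 x k1]
        · have := Nat.mul_le_mul_left (big A mem lo (key A (mem 0) pr pc)) (Nat.le_add_left 1 (mem 24))
          omega
      · have hr : r = 0 := by omega
        obtain ⟨-, hw⟩ := w5.resolve_left (by omega)
        have hk₂ : ∀ c, colKey A mem₂ c = colKey A mem₁ c := fun c =>
          colKey_of_same f0 (w1 _ (by omega))
        have hl₂ : loKey A mem₂ = loKey A mem₁ := by
          rw [loKey, loKey, f0, w1 56 (by omega), w1 64 (by omega)]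
        refine run_call_of_eq (calls_lowerHi (r := pr) (c := pc) hW hC₂ (by
            rw [f0]
            exact hL.row) (by
            rw [f0]
            exact hL.col) ?_)
          (by simp <;> omega) (by
    simp only [List.map_cons, List.map_nil, List.cons.injEq, seqs, lt, arr, ↓wp_seq, ↓wp_assign, ↓wp_branch, ↓wp_query, ↓wp_skip, ↓wp_store, ↓wp_loop,
    ↓wp_call, Test.Ok, Test.Holds, Test.time, Expr.Ok, Expr.val, Expr.time, Function.update_apply,
    Nat.reduceEqDiff, reduceIte, OfNat.ofNat_ne_zero, OfNat.ofNat_ne_one, OfNat.zero_ne_ofNat,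
    OfNat.one_ne_ofNat, one_ne_zero, zero_ne_one, List.getD_cons_zero, List.getD_cons_succ,
    List.getD_nil, true_and, and_true, and_assoc, not_le, Nat.reduceAdd, Nat.reduceMul]
    all_goals omega) rfl ?_
        -- All columns have a key at most v: the deleted ones even one at most lo, those before `hi`
        -- by assumption or by the scan, the others by the walk. So hi may drop to v.
        · intro y hy
          rw [f0] at hy ⊢
          obtain ⟨j, -, k1, rfl⟩ | ⟨x, k1, k2⟩ := hL.core.dead_col y hy
          · by_cases k2 : j < hi
            · exact hL.before j k1 k2
            · obtain ⟨k, k3, k4⟩ := hw j (by omega) k1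
              exact ⟨_, hL.core.row k k3, k4.le⟩
          · exact ⟨x, k1, k2.trans hL.lo_le⟩
        rintro r₃ mem₃ ent₃ T₃ ⟨v1, hC₃, v2, v3⟩
        have hB₃ : Blocks A mem₃ := hB₂.congr hC₂ fun x _ _ _ => v1 x (by omega) (by omega)
        have m₃ : ∀ x, x ≠ 48 → x ≠ 72 → x ≠ 80 → mem₃ x = mem₁ x := fun x k1 k2 k3 =>
          (v1 x k2 k3).trans (w1 x k1)
        have n0 := m₃ 0 (by omega) (by omega) (by omega)
        have n8 := m₃ 8 (by omega) (by omega) (by omega)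
        have n16 := m₃ 16 (by omega) (by omega) (by omega)
        have n24 := m₃ 24 (by omega) (by omega) (by omega)
        have n40 := m₃ 40 (by omega) (by omega) (by omega)
        have n48 : mem₃ 48 = mem₂ 48 := v1 48 (by omega) (by omega)
        have n2 : ∀ j, mem₃ (8 * j + 2) = mem₁ (8 * j + 2) := fun j =>
          m₃ _ (by omega) (by omega) (by omega)
        have n5 : ∀ c, colKey A mem₃ c = colKey A mem₁ c := fun c =>
          colKey_of_same n0 (m₃ _ (by omega) (by omega) (by omega))
        simp only [List.map_cons, List.map_nil, List.sum_cons, List.sum_nil, seqs, lt, arr, ↓wp_seq, ↓wp_assign, ↓wp_branch, ↓wp_query, ↓wp_skip, ↓wp_store, ↓wp_loop,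
    ↓wp_call, Test.Ok, Test.Holds, Test.time, Expr.Ok, Expr.val, Expr.time, Function.update_apply,
    Nat.reduceEqDiff, reduceIte, OfNat.ofNat_ne_zero, OfNat.ofNat_ne_one, OfNat.zero_ne_ofNat,
    OfNat.one_ne_ofNat, one_ne_zero, zero_ne_one, List.getD_cons_zero, List.getD_cons_succ,
    List.getD_nil, true_and, and_true, and_assoc, not_le, Nat.reduceAdd, Nat.reduceMul]
        refine run_call_of_eq (calls_kill (lo := hi) (pr := pr) (pc := pc) hW hC₃ hB₃ (by omega) (by
            rw [n0]
            exact hL.row) (by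
            rw [n0]
            exact hL.col) (by
            rw [n0, ← f0]
            exact v2) ?_)
          (by simp <;> omega) (by
    simp only [List.map_cons, List.map_nil, List.cons.injEq, seqs, lt, arr, ↓wp_seq, ↓wp_assign, ↓wp_branch, ↓wp_query, ↓wp_skip, ↓wp_store, ↓wp_loop,
    ↓wp_call, Test.Ok, Test.Holds, Test.time, Expr.Ok, Expr.val, Expr.time, Function.update_apply,
    Nat.reduceEqDiff, reduceIte, OfNat.ofNat_ne_zero, OfNat.ofNat_ne_one, OfNat.zero_ne_ofNat,
    OfNat.one_ne_ofNat, one_ne_zero, zero_ne_one, List.getD_cons_zero, List.getD_cons_succ,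
    List.getD_nil, true_and, and_true, and_assoc, not_le, Nat.reduceAdd, Nat.reduceMul]
    all_goals omega) rfl ?_
        · intro j k1 k2
          rw [n0, n2, n5]
          exact hlt₁ j k1 (by omega)
        rintro r₄ mem₄ ent₄ T₄ ⟨K, hK, -, k1, k2⟩
        rw [n24, e24, n16, e16] at k2
        have ku := hK.used
        have kt : (K + (mem 16 - hi)) * (400 * (mem 24 + 1)) =
            400 * (K * (mem 24 + 1)) + 400 * ((mem 16 - hi) * (mem 24 + 1)) := by ring
        have kt2 : K * (mem 24 + D + 1) = K * (mem 24 + 1) + K * D := by ring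
        have kt3 : (mem 16 - hi) * 1 ≤ (mem 16 - hi) * (mem 24 + 1) :=
          Nat.mul_le_mul_left _ (by omega)
        have kt4 : K * 1 ≤ K * (mem 24 + 1) := Nat.mul_le_mul_left _ (by omega)
        have n48' : mem₄ 48 = mem₂ 48 :=
          (hK.same 48 (by omega) (by omega) (by omega) (by omega)).trans n48
        simp only [List.map_cons, List.map_nil, List.sum_cons, List.sum_nil, seqs, lt, arr, ↓wp_seq, ↓wp_assign, ↓wp_branch, ↓wp_query, ↓wp_skip, ↓wp_store, ↓wp_loop,
    ↓wp_call, Test.Ok, Test.Holds, Test.time, Expr.Ok, Expr.val, Expr.time, Function.update_apply,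
    Nat.reduceEqDiff, reduceIte, OfNat.ofNat_ne_zero, OfNat.ofNat_ne_one, OfNat.zero_ne_ofNat,
    OfNat.one_ne_ofNat, one_ne_zero, zero_ne_one, List.getD_cons_zero, List.getD_cons_succ,
    List.getD_nil, true_and, and_true, and_assoc, not_le, Nat.reduceAdd, Nat.reduceMul]
        rcases k1 with ⟨rfl, k3, k4⟩ | ⟨rfl, k3⟩
        · have kt5 : (mem 16 - hi) * (mem 24 + 1) ≤ K * (mem 24 + 1) :=
            Nat.mul_le_mul_right _ (by omega)
          refine .inl ⟨rfl, K, Lowered.of_scan (e0 ▸ hL.lowered m₃ (by omega) (by omega)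
            (fun k k5 k6 => w4 k k5 (by omega)) hlt₁ hK ?_ (by omega) ?_) hs hi1 hi2 hle hlt, by omega⟩
          · rintro c ⟨j, k5, k6, rfl⟩
            exact ⟨j, k5, by omega, (n2 j).symm⟩
          · intro j k5 k6
            have := k4 j k5 (by omega)
            rwa [n2, n0] at this
        · have k8 := hK.blocks.le
          have n8' := hK.same 8 (by omega) (by omega) (by omega) (by omega)
          rw [n24, n40] at ku
          rw [e24, e40] at ku
          refine .inr ⟨Aborted.of_scan (lo := lo) (σ := σ) ⟨fun x _ k4 k5 k6 _ _ k7 k8 _ => ?_,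
            .inr ⟨rfl, hK.core, hK.blocks, fun hc => hK.cover (hc.congr hL.core hL.blocks fun x _ hx =>
              m₃ x (by omega) (by omega) (by omega)), by omega, ?_⟩⟩ hs, K, mem₂ 48 - mem₁ 48,
              by omega, by omega, ?_⟩
          · rw [hK.same x (by omega) (by omega) (by omega) k5, m₃ x k6 k7 k8]
          · rw [hK.same 88 (by omega) (by omega) (by omega) (by omega),
              m₃ 88 (by omega) (by omega) (by omega)]
          · rw [hbig]
            omega
    · obtain _ | d := D
      -- At depth 0 the hypothesis says that at most e columns are above v, so the recursive branch
      -- cannot be reached.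
      · rw [hbig] at hD
        omega
      have hpos := h.pos
      refine run_call_of_eq (calls_pivot (A := A) (lo := hi) hW hL.core.flag hL.core.size hL.core.col_le (by omega)
        (fun j _ hj => hL.core.validCol hL.blocks hj) fun j k1 k k2 k3 => hL.core.colKey_inj hL.blocks
          (Finset.mem_Ico.1 k1).2 (Finset.mem_Ico.1 k2).2 k3) (by simp <;> omega) (by
    simp only [List.map_cons, List.map_nil, List.cons.injEq, seqs, lt, arr, ↓wp_seq, ↓wp_assign, ↓wp_branch, ↓wp_query, ↓wp_skip, ↓wp_store, ↓wp_loop,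
    ↓wp_call, Test.Ok, Test.Holds, Test.time, Expr.Ok, Expr.val, Expr.time, Function.update_apply,
    Nat.reduceEqDiff, reduceIte, OfNat.ofNat_ne_zero, OfNat.ofNat_ne_one, OfNat.zero_ne_ofNat,
    OfNat.one_ne_ofNat, one_ne_zero, zero_ne_one, List.getD_cons_zero, List.getD_cons_succ,
    List.getD_nil, true_and, and_true, and_assoc, not_le, Nat.reduceAdd, Nat.reduceMul]
    all_goals omega) rfl ?_
      rintro pm mem₂ ent₂ T₂ ⟨hs₂, ⟨jm, j1, j2, rfl⟩, q1, q2, hT₂⟩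
      have hL₂ := hL.congr hs₂
      have f0 := hs₂ 0 (by omega)
      have f8 := hs₂ 8 (by omega)
      have f16 := hs₂ 16 (by omega)
      have f24 := hs₂ 24 (by omega)
      have f32 := hs₂ 32 (by omega)
      have f40 := hs₂ 40 (by omega)
      have f48 := hs₂ 48 (by omega)
      have hv := hL.core.validCol hL.blocks j2
      have hvl := hv.lt
      have fm : mem₂ (8 * jm + 2) = mem₁ (8 * jm + 2) := hs₂ _ (by omega)
      have fk : mem₂ (8 * mem₁ (8 * jm + 2) + 5) = mem₁ (8 * mem₁ (8 * jm + 2) + 5) := hs₂ _ (by omega)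
      have hck₂ := colKey_congr (A := A) hs₂
      have hlt₂ : ∀ j, hi ≤ j → j < mem₂ 16 →
          key A (mem₂ 0) pr pc < colKey A mem₂ (mem₂ (8 * j + 2)) := by
        intro j k1 k2
        rw [f0, hck₂, hs₂ _ (by omega)]
        exact hlt₁ j k1 (by omega)
      have hI := hL₂.inner j1 (by omega) (hlt₂ jm j1 (by omega))
      rw [fm, fk] at hI
      have hih := ih d hI
      obtain ⟨w, hw⟩ : ∃ w, w = key A (mem₂ 0) (mem₁ (8 * mem₁ (8 * jm + 2) + 5))
        (mem₁ (8 * jm + 2)) := ⟨_, rfl⟩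
      rw [← hw] at hih
      have hw' : w = colKey A mem₁ (mem₁ (8 * jm + 2)) := by rw [hv.colKey_eq, hw, f0]
      have hvw : key A (mem 0) pr pc < w := by
        have := hlt₁ jm j1 j2
        rwa [e0, ← hw'] at this
      rw [← hw'] at q1 q2
      have hb₂ : big A mem₂ hi w = ((Finset.Ico hi (mem₁ 16)).filter
          fun j => w < colKey A mem₁ (mem₁ (8 * j + 2))).card := by
        rw [big_congr hL.core hs₂, big]
      have hbadd := big_add_le (A := A) (mem := mem₁) (lo := hi) (v := w)
      rw [← big_congr hL.core hs₂] at hbadd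
      rw [e16] at q1 q2 hb₂ hbadd
      rw [e16] at hT₂
      -- At least a sixteenth of the columns have keys at most the pivot.
      have hb16 : 16 * big A mem₂ hi w ≤ 15 * (mem 16 - hi) := by omega
      simp only [List.map_cons, List.map_nil, List.sum_cons, List.sum_nil, seqs, lt, arr, ↓wp_seq, ↓wp_assign, ↓wp_branch, ↓wp_query, ↓wp_skip, ↓wp_store, ↓wp_loop,
    ↓wp_call, Test.Ok, Test.Holds, Test.time, Expr.Ok, Expr.val, Expr.time, Function.update_apply,
    Nat.reduceEqDiff, reduceIte, OfNat.ofNat_ne_zero, OfNat.ofNat_ne_one, OfNat.zero_ne_ofNat,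
    OfNat.one_ne_ofNat, one_ne_zero, zero_ne_one, List.getD_cons_zero, List.getD_cons_succ,
    List.getD_nil, true_and, and_true, and_assoc, not_le, Nat.reduceAdd, Nat.reduceMul]
      repeat refine And.intro (by omega) ?_
      refine run_call_of_eq (hih (by
        rw [f8, e8, f40, e40]
        omega) (by
        rw [f32, e32]
        rw [hbig] at hD
        exact depth_step hb16 hD)) (by simp <;> omega) (by simp [fk]) rfl ?_
      rintro r₃ mem₃ ent₃ T₃ hpost
      simp only [List.map_cons, List.map_nil, List.sum_cons, List.sum_nil, seqs, lt, arr, ↓wp_seq, ↓wp_assign, ↓wp_branch, ↓wp_query, ↓wp_skip, ↓wp_store, ↓wp_loop,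
    ↓wp_call, Test.Ok, Test.Holds, Test.time, Expr.Ok, Expr.val, Expr.time, Function.update_apply,
    Nat.reduceEqDiff, reduceIte, OfNat.ofNat_ne_zero, OfNat.ofNat_ne_one, OfNat.zero_ne_ofNat,
    OfNat.one_ne_ofNat, one_ne_zero, zero_ne_one, List.getD_cons_zero, List.getD_cons_succ,
    List.getD_nil, true_and, and_true, and_assoc, not_le, Nat.reduceAdd, Nat.reduceMul]
      repeat refine And.intro (by omega) ?_
      rcases hpost with ⟨rfl, K, hK, hT₃⟩ | ⟨hab, K, Δ, k1, k2, hT₃⟩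
      · refine ⟨fun k => by omega, fun _ => ?_⟩
        have hL₃ := hK.lowerable hL₂ (by
          rw [f0, e0]
          exact hvw.le)
        have hsc : ∀ x < 100, x % 8 = 0 → x ≠ 40 → x ≠ 48 → x ≠ 72 → x ≠ 80 → mem₃ x = mem₁ x :=
          fun x k1 k2 k3 k4 k5 k6 => (hK.scalar x (by omega) k2 k3 k4 k5 k6).trans (hs₂ x (by omega))
        have g0 := hsc 0 (by omega) (by omega) (by omega) (by omega) (by omega) (by omega)
        have g8 := hsc 8 (by omega) (by omega) (by omega) (by omega) (by omega) (by omega)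
        have g16 := hsc 16 (by omega) (by omega) (by omega) (by omega) (by omega) (by omega)
        have g24 := hsc 24 (by omega) (by omega) (by omega) (by omega) (by omega) (by omega)
        have g32 := hsc 32 (by omega) (by omega) (by omega) (by omega) (by omega) (by omega)
        have hmany := hK.many
        have hused := hK.used
        have hble := big_le (A := A) (mem := mem₃) (lo := hi) (v := key A (mem₃ 0) pr pc)
        have hle3 := hK.blocks.le
        have ht := hK.blocks.pos
        rw [f24, e24, f40, e40] at hused
        have hK1 : 1 ≤ mem 24 * K := Nat.mul_pos (by omega) (by omega)
        have hptr := hK.ptr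
        rw [f48, e48, f8, e8] at hptr
        -- The first call used at least one new block. One row less in reserve outweighs any change
        -- in the number of large columns, which is at most m + n.
        have hmul : (mem 8 - mem₃ 40) * (m + n + 1) + (m + n + 1) ≤
            (mem 8 - mem 40) * (m + n + 1) := by
          rw [← Nat.succ_mul]
          exact Nat.mul_le_mul_right _ (by omega)
        refine run_call_of_eq (ih (d + 1) hL₃ (by
          rw [g8, e8]
          omega) (by
          rw [g32, e32]
          rw [hbig] at hD
          exact (Nat.mul_le_mul_right _ (by omega)).trans hD)) (by simp <;> omega) (by
    simp only [List.map_cons, List.map_nil, List.cons.injEq, seqs, lt, arr, ↓wp_seq, ↓wp_assign, ↓wp_branch, ↓wp_query, ↓wp_skip, ↓wp_store, ↓wp_loop,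
    ↓wp_call, Test.Ok, Test.Holds, Test.time, Expr.Ok, Expr.val, Expr.time, Function.update_apply,
    Nat.reduceEqDiff, reduceIte, OfNat.ofNat_ne_zero, OfNat.ofNat_ne_one, OfNat.zero_ne_ofNat,
    OfNat.one_ne_ofNat, one_ne_zero, zero_ne_one, List.getD_cons_zero, List.getD_cons_succ,
    List.getD_nil, true_and, and_true, and_assoc, not_le, Nat.reduceAdd, Nat.reduceMul]
    all_goals omega) rfl ?_
        rintro r₄ mem₄ ent₄ T₄ hpost
        simp only [List.map_cons, List.map_nil, List.sum_cons, List.sum_nil, seqs, lt, arr, ↓wp_seq, ↓wp_assign, ↓wp_branch, ↓wp_query, ↓wp_skip, ↓wp_store, ↓wp_loop,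
    ↓wp_call, Test.Ok, Test.Holds, Test.time, Expr.Ok, Expr.val, Expr.time, Function.update_apply,
    Nat.reduceEqDiff, reduceIte, OfNat.ofNat_ne_zero, OfNat.ofNat_ne_one, OfNat.zero_ne_ofNat,
    OfNat.one_ne_ofNat, one_ne_zero, zero_ne_one, List.getD_cons_zero, List.getD_cons_succ,
    List.getD_nil, true_and, and_true, and_assoc, not_le, Nat.reduceAdd, Nat.reduceMul]
        rcases hpost with ⟨rfl, K', hK', hT₄⟩ | ⟨hab, K', Δ, k1, k2, hT₄⟩
        · have hptr' := hK'.ptr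
          rw [g0, e0] at hK'
          refine .inl ⟨rfl, K + K', Lowered.of_scan ((hK.trans hK' hvw.le (by
            rw [f0, e0] at hlt₂
            exact hlt₂)).of_congr hL.core hL.blocks hL.ptr_le hs₂) hs hi1 hi2 hle hlt, ?_⟩
          have := time_rec (X := mem 16 - lo) (y := mem 16 - hi) (K₁ := K) (K₂ := K') (t := mem 24)
            (d := d) (Δ₁ := mem₃ 48 - mem 48) (Δ₂ := mem₄ 48 - mem₃ 48) (T₁ := T₃) (T₂ := T₄) (R := 0)
            (T := T₁ + T₂ + T₃ + T₄ + 200) (by omega)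
            (by rw [f16, e16, f24, e24, f48, e48] at hT₃; exact hT₃)
            (by rw [g16, e16, g24, e24] at hT₄; omega) (by omega) (by omega)
          omega
        · rw [g16, e16, g24, e24] at hT₄
          rw [g24, e24, g8, e8] at k1
          rw [g8, e8] at k2
          refine .inr ⟨((hK.aborted hab).of_congr hL.core hL.blocks hs₂).of_scan hs, K + K',
            (mem₃ 48 - mem 48) + Δ, by rw [mul_add]; omega, by omega, ?_⟩
          rw [hbig]
          have hR : big A mem₃ hi (key A (mem₃ 0) pr pc) * (mem 24 + 1) ≤
              (mem 16 - hi) * (mem 24 + 1) := Nat.mul_le_mul_right _ (by omega)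
          have := time_rec (X := mem 16 - lo) (y := mem 16 - hi) (K₁ := K) (K₂ := K') (t := mem 24)
            (d := d) (Δ₁ := mem₃ 48 - mem 48) (Δ₂ := Δ) (T₁ := T₃) (T₂ := T₄)
            (R := 60000 * ((mem 16 - hi) * (mem 24 + 1)))
            (T := T₁ + T₂ + T₃ + T₄ + 200) (by omega)
            (by rw [f16, e16, f24, e24, f48, e48] at hT₃; exact hT₃)
            (by omega) (by omega) (by omega)
          omega
      · have hr : 0 < r₃ := by
          rcases hab.cases with ⟨k, -⟩ | ⟨k, -⟩ <;> omega
        refine ⟨fun _ => ?_, fun k => by omega⟩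
        rw [f24, e24, f16, e16] at hT₃
        rw [f24, e24, f40, e40, f8, e8] at k1
        rw [f48, e48, f8, e8] at k2
        refine .inr ⟨(hab.of_congr hL.core hL.blocks hs₂).of_scan hs, K, Δ, k1, k2, ?_⟩
        rw [hbig]
        have := time_abort (X := mem 16 - lo) (y := mem 16 - hi) (K := K) (t := mem 24) (d := d)
          (Δ := Δ) (T₁ := T₃) (b := big A mem₂ hi w) (T := T₁ + T₂ + T₃ + 200) (by omega)
          hT₃ hb16 (by omega)
        omega

end Saddle

/-! ### The initial blocks, and counting the rows that survive -/

namespace Saddle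

open RAM Expr Test Cmd

variable {α : Type*} [LinearOrder α] {m n : ℕ} {W : ℕ} {A : Matrix (Fin m) (Fin n) α}
  {mem mem' : ℕ → ℕ}

/-- The columns with indices less than `i` have blocks of `t` rows. -/
def Assigned (A : Matrix (Fin m) (Fin n) α) (t i : ℕ) (mem mem' : ℕ → ℕ) : Prop :=
  ∀ j < i, mem' (8 * mem (8 * j + 2) + 4) = t * j ∧
    (∃ k, t * j ≤ k ∧ k < t * j + t ∧ mem' (8 * mem (8 * j + 2) + 5) = mem (8 * k + 1)) ∧
    ∀ k, t * j ≤ k → k < t * j + t →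
      key A (mem 0) (mem' (8 * mem (8 * j + 2) + 5)) (mem (8 * j + 2)) ≤
        key A (mem 0) (mem (8 * k + 1)) (mem (8 * j + 2))

theorem calls_blocks (hW : 1000 * (m + n + 20) ≤ W) {al t : ℕ} (h : Core A al mem) (ht : 1 ≤ t)
    (htn : t * mem 16 ≤ mem 8) :
    Calls procs W A 11 [t] mem fun _ mem' T => (∀ x, x % 8 ≠ 4 → x % 8 ≠ 5 → mem' x = mem x) ∧
      Assigned A t (mem 16) mem mem' ∧ T ≤ 220 * (t * mem 16) + 20 := by
  refine ⟨blocksBody, rfl, fun ent => run_of_wp ?_⟩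
  simp only [blocksBody, seqs, lt, arr, ↓wp_seq, ↓wp_assign, ↓wp_branch, ↓wp_query, ↓wp_skip, ↓wp_store, ↓wp_loop,
    ↓wp_call, Test.Ok, Test.Holds, Test.time, Expr.Ok, Expr.val, Expr.time, Function.update_apply,
    Nat.reduceEqDiff, reduceIte, OfNat.ofNat_ne_zero, OfNat.ofNat_ne_one, OfNat.zero_ne_ofNat,
    OfNat.one_ne_ofNat, one_ne_zero, zero_ne_one, List.getD_cons_zero, List.getD_cons_succ,
    List.getD_nil, true_and, and_true, and_assoc, not_le, Nat.reduceAdd, Nat.reduceMul]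
  repeat refine And.intro (by omega) ?_
  have hml := h.row_le
  have hnl := h.col_le
  refine run_for (fun i s => s.loc 0 = t ∧ s.loc 1 = i ∧
    (∀ x, x % 8 ≠ 4 → x % 8 ≠ 5 → s.mem x = mem x) ∧ Assigned A t i mem s.mem)
    0 (mem 16) (200 * t) (Nat.zero_le _) ?_ ?_ ?_ ?_
  · exact ⟨rfl, rfl, fun _ _ _ => rfl, fun j hj => absurd hj (by omega)⟩
  · rintro i ⟨loc, mem₁, ent₁⟩ - hi ⟨h0, h1, hs, hA⟩
    dsimp only at *
    have e16 := hs 16 (by omega) (by omega)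
    have e0 := hs 0 (by omega) (by omega)
    have e2 := hs (8 * i + 2) (by omega) (by omega)
    have hti : t * i + t ≤ mem 8 := by
      rw [← Nat.mul_succ]
      exact (Nat.mul_le_mul_left _ hi).trans htn
    have hcol := h.col i hi
    have hcl := hcol.trans_le (rows_le n m _)
    refine ⟨by simp <;> omega, by simp [e16, h1]; omega, run_of_wp ?_⟩
    simp only [h0, h1, e2, seqs, lt, arr, ↓wp_seq, ↓wp_assign, ↓wp_branch, ↓wp_query, ↓wp_skip, ↓wp_store, ↓wp_loop,
    ↓wp_call, Test.Ok, Test.Holds, Test.time, Expr.Ok, Expr.val, Expr.time, Function.update_apply,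
    Nat.reduceEqDiff, reduceIte, OfNat.ofNat_ne_zero, OfNat.ofNat_ne_one, OfNat.zero_ne_ofNat,
    OfNat.one_ne_ofNat, one_ne_zero, zero_ne_one, List.getD_cons_zero, List.getD_cons_succ,
    List.getD_nil, true_and, and_true, and_assoc, not_le, Nat.reduceAdd, Nat.reduceMul]
    repeat refine And.intro (by omega) ?_
    have ux : ∀ x v, x % 8 ≠ 4 → x % 8 ≠ 5 →
        Function.update mem₁ (8 * mem (8 * i + 2) + 4) v x = mem x := fun x v h1 h2 => by
      rw [Function.update_of_ne (by omega), hs x h1 h2]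
    refine run_call_of_eq (calls_argmin (mem := Function.update mem₁ (8 * mem (8 * i + 2) + 4) (t * i))
      (y := mem (8 * i + 2)) (pos := t * i) (t := t) hW ?_ ?_ ht (by omega) ?_)
      (by simp [h0, h1]; omega) (by simp [h0, h1]) rfl ?_
    · rw [ux _ _ (by omega) (by omega)]
      exact h.flag
    · rw [ux _ _ (by omega) (by omega)]
      exact hcol
    · intro k k1 k2
      rw [ux _ _ (by omega) (by omega), ux _ _ (by omega) (by omega)]
      exact h.row k (by omega)
    rintro v mem₂ ent₂ T ⟨rfl, ⟨k, k1, k2, rfl⟩, k3, hT⟩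
    rw [ux _ _ (by omega) (by omega)] at k3 ⊢
    simp only [h0, h1, List.map_cons, List.map_nil, List.sum_cons, List.sum_nil, seqs, lt, arr, ↓wp_seq, ↓wp_assign, ↓wp_branch, ↓wp_query, ↓wp_skip, ↓wp_store, ↓wp_loop,
    ↓wp_call, Test.Ok, Test.Holds, Test.time, Expr.Ok, Expr.val, Expr.time, Function.update_apply,
    Nat.reduceEqDiff, reduceIte, OfNat.ofNat_ne_zero, OfNat.ofNat_ne_one, OfNat.zero_ne_ofNat,
    OfNat.one_ne_ofNat, one_ne_zero, zero_ne_one, List.getD_cons_zero, List.getD_cons_succ,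
    List.getD_nil, true_and, and_true, and_assoc, not_le, Nat.reduceAdd, Nat.reduceMul]
    repeat refine And.intro (by omega) ?_
    refine ⟨fun x x1 x2 => ?_, fun j hj => ?_, by omega⟩
    · rw [if_neg (by omega), if_neg (by omega)]
      exact hs x x1 x2
    · by_cases hji : j = i
      · subst hji
        have k4 : ∀ k', t * j ≤ k' → k' < t * j + t →
            key A (mem 0) (mem (8 * k + 1)) (mem (8 * j + 2)) ≤
              key A (mem 0) (mem (8 * k' + 1)) (mem (8 * j + 2)) := by
          intro k' k5 k6
          have := k3 k' k5 k6
          rwa [ux _ _ (by omega) (by omega), ux _ _ (by omega) (by omega)] at this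
        rw [Function.update_of_ne (by omega), Function.update_self, Function.update_self]
        exact ⟨rfl, ⟨k, k1, k2, rfl⟩, k4⟩
      · have hne : mem (8 * j + 2) ≠ mem (8 * i + 2) := fun hc =>
          hji (h.col_inj j (by omega) i hi hc)
        rw [Function.update_of_ne (by omega), Function.update_of_ne (by omega),
          Function.update_of_ne (by omega), Function.update_of_ne (by omega)]
        exact hA j (by omega)
  · rintro ⟨loc, mem₁, ent₁⟩ ⟨h0, h1, hs, hA⟩
    dsimp only at *
    have e16 := hs 16 (by omega) (by omega)
    refine ⟨by simp <;> omega, by simp [e16, h1]⟩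
  · rintro ⟨loc, mem₁, ent₁⟩ T ⟨h0, h1, hs, hA⟩ hT
    dsimp only at *
    simp only [seqs, lt, arr, ↓wp_seq, ↓wp_assign, ↓wp_branch, ↓wp_query, ↓wp_skip, ↓wp_store, ↓wp_loop,
    ↓wp_call, Test.Ok, Test.Holds, Test.time, Expr.Ok, Expr.val, Expr.time, Function.update_apply,
    Nat.reduceEqDiff, reduceIte, OfNat.ofNat_ne_zero, OfNat.ofNat_ne_one, OfNat.zero_ne_ofNat,
    OfNat.one_ne_ofNat, one_ne_zero, zero_ne_one, List.getD_cons_zero, List.getD_cons_succ,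
    List.getD_nil, true_and, and_true, and_assoc, not_le, Nat.reduceAdd, Nat.reduceMul] at hT ⊢
    refine ⟨hs, hA, ?_⟩
    have h2 : (mem 16 - 0) * (6 + 200 * t) = 6 * (1 * mem 16) + 200 * (t * mem 16) := by
      rw [Nat.sub_zero]
      ring
    have h3 : 1 * mem 16 ≤ t * mem 16 := Nat.mul_le_mul_right _ ht
    omega

theorem Blocks.of_assigned {al t : ℕ} (h : Core A al mem) (ht : 1 ≤ t)
    (hA : Assigned A t (mem 16) mem mem') (hs : ∀ x < 8 * (m + n + 20), x % 8 = 1 ∨ x % 8 = 2 ∨ x = 0 ∨ x = 8 ∨ x = 16 →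
      mem' x = mem x) (h24 : mem' 24 = t) (h40 : t * mem 16 ≤ mem' 40) (hle : mem' 40 ≤ mem 8) :
    Blocks A mem' := by
  have e0 := hs 0 (by omega) (by omega)
  have e8 := hs 8 (by omega) (by omega)
  have e16 := hs 16 (by omega) (by omega)
  have e1 : ∀ k < mem 8, mem' (8 * k + 1) = mem (8 * k + 1) := fun k hk => by
    have := h.row_lt hk
    exact hs _ (by omega) (by omega)
  have e2 : ∀ k < mem 16, mem' (8 * k + 2) = mem (8 * k + 2) := fun k hk => by
    have := h.col_lt hk
    exact hs _ (by omega) (by omega)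
  have hti : ∀ j < mem 16, t * j + t ≤ mem' 40 := fun j hj => by
    rw [← Nat.mul_succ]
    exact (Nat.mul_le_mul_left _ hj).trans h40
  refine ⟨by omega, by omega, fun j hj => ?_, fun j hj => ?_, fun j hj k hk => ?_⟩
  · rw [e16] at hj
    rw [e2 j hj, (hA j hj).1, h24]
    exact hti j hj
  · rw [e16] at hj
    have := hti j hj
    obtain ⟨a1, ⟨k, a2, a3, a4⟩, a5⟩ := hA j hj
    refine ⟨k, ?_, ?_⟩
    · rw [e2 j hj, InBlock, a1, h24]
      exact ⟨a2, a3⟩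
    · rw [e2 j hj, a4, e1 k (by omega)]
  · rw [e16] at hj
    have := hti j hj
    obtain ⟨a1, -, a5⟩ := hA j hj
    rw [e2 j hj] at hk ⊢
    rw [InBlock, a1, h24] at hk
    have hcl := (h.col j hj).trans_le (rows_le n m _)
    rw [colKey, if_pos (by omega), e0, e1 k (by omega)]
    exact a5 k hk.1 hk.2

/-- The blocks tile the indices before cell `40`: index `k` lies in the block of the column with
index k / t. -/
theorem Cover.of_assigned {al t : ℕ} (h : Core A al mem) (ht : 1 ≤ t)
    (hA : Assigned A t (mem 16) mem mem') (hs : ∀ x < 8 * (m + n + 20), x % 8 = 1 ∨ x % 8 = 2 ∨ x = 0 ∨ x = 8 ∨ x = 16 →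
      mem' x = mem x) (h24 : mem' 24 = t) (h40 : mem' 40 = t * mem 16) : Cover mem' := by
  intro k hk _
  have hj : k / t < mem 16 := Nat.div_lt_of_lt_mul (by omega)
  have := h.col_lt hj
  refine ⟨k / t, by rwa [hs 16 (by omega) (by omega)], ?_⟩
  rw [hs _ (by omega) (by omega), InBlock, (hA _ hj).1, h24]
  have h1 := Nat.div_add_mod k t
  have h2 := Nat.mod_lt k ht
  omega

/-- Columns with an entry at most lo are deleted by merely regarding a later index as the first one.
-/
theorem Core.drop {al : ℕ} (h : Core A 0 mem) (hle : ∀ j < mem 16, j < al →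
    ∃ x < rows m n (mem 0), key A (mem 0) x (mem (8 * j + 2)) ≤ loKey A mem) : Core A al mem := by
  refine { h with dead_col := fun c hc => ?_ }
  obtain ⟨j, -, h1, h2⟩ | h1 := h.dead_col c hc
  · by_cases h3 : al ≤ j
    · exact .inl ⟨j, h3, h1, h2⟩
    · exact .inr (h2 ▸ hle j h1 (by omega))
  · exact .inr h1

/-- The number of rows that are not deleted. -/
def alive (mem : ℕ → ℕ) (k : ℕ) : ℕ := ((Finset.range k).filter fun k => mem (8 * k + 3) = 0).card

theorem alive_le (mem : ℕ → ℕ) (k : ℕ) : alive mem k ≤ k :=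
  (Finset.card_filter_le _ _).trans (by simp)

theorem alive_add_le {mem : ℕ → ℕ} {k : ℕ} {f : ℕ → ℕ} {s : Finset ℕ}
    (h : ∀ j ∈ s, f j < k ∧ mem (8 * f j + 3) ≠ 0)
    (hf : ∀ j ∈ s, ∀ j' ∈ s, f j = f j' → j = j') : alive mem k + s.card ≤ k := by
  have h1 : s.card ≤ ((Finset.range k).filter fun k => ¬ mem (8 * k + 3) = 0).card := by
    refine Finset.card_le_card_of_injOn f (fun j hj => ?_) fun x hx y hy => hf x hx y hy
    simp only [Finset.coe_filter, Finset.mem_range, Set.mem_setOf_eq]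
    exact h j hj
  have h2 := Finset.card_filter_add_card_filter_not (s := Finset.range k) fun k => mem (8 * k + 3) = 0
  rw [Finset.card_range] at h2
  rw [alive]
  omega

/-- A row that is not deleted lies in the block of some column or was never used. The union bound
suffices, so it does not matter whether the current blocks are disjoint. -/
theorem Cover.alive_le (h : Cover mem) : alive mem (mem 8) ≤ mem 16 * mem 24 + (mem 8 - mem 40) := by
  have h1 : ((Finset.range (mem 8)).filter fun k => mem (8 * k + 3) = 0) ⊆
      ((Finset.range (mem 16)).biUnion fun j => Finset.Ico (mem (8 * mem (8 * j + 2) + 4))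
        (mem (8 * mem (8 * j + 2) + 4) + mem 24)) ∪ Finset.Ico (mem 40) (mem 8) := by
    intro k hk
    simp only [Finset.mem_filter, Finset.mem_range, Finset.mem_union, Finset.mem_biUnion,
      Finset.mem_Ico] at hk ⊢
    by_cases h2 : k < mem 40
    · obtain ⟨j, h3, h4⟩ := h k h2 hk.2
      exact .inl ⟨j, h3, h4⟩
    · exact .inr ⟨by omega, hk.1⟩
  refine (Finset.card_le_card h1).trans ((Finset.card_union_le _ _).trans ?_)
  rw [Nat.card_Ico]
  refine Nat.add_le_add_right (Finset.card_biUnion_le.trans ?_) _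
  simp

end Saddle

/-! ### Reduction of almost square matrices -/

namespace Saddle

open RAM Expr Test Cmd

variable {α : Type*} [LinearOrder α] {m n : ℕ} {W : ℕ} {A : Matrix (Fin m) (Fin n) α}
  {mem mem' : ℕ → ℕ}

theorem Core.exists_le_of_colKey_le {al j : ℕ} {v : ℤ} (h : Core A al mem) (hb : Blocks A mem)
    (hj : j < mem 16) (hv : colKey A mem (mem (8 * j + 2)) ≤ v) :
    ∃ x < rows m n (mem 0), key A (mem 0) x (mem (8 * j + 2)) ≤ v := by
  have hc := h.validCol hb hj
  exact ⟨_, hc.2, hc.colKey_eq (A := A) ▸ hv⟩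

/-- The outcome of one step of the reduction: the indices of the columns are at least the index in
cell `88`, the other columns and the marked rows are deleted. -/
structure Reduced (A : Matrix (Fin m) (Fin n) α) (mem mem' : ℕ → ℕ) : Prop where
  core : Core A (mem' 88) mem'
  flag : mem' 0 = mem 0
  row : mem' 8 = mem 8
  col : mem' 16 = mem 16

-- With a rows, b columns and a < 2b, each column gets one row. If at least b/16 of these entries
-- are at most lo, their columns are deleted. Otherwise a pivot splits the more than 15b/16
-- remaining columns into parts of more than 15b/256 each. The walk deletes the columns of the lower
-- part if it passes all rows, and otherwise the rows assigned to the upper part. In all cases at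
-- least (a + b)/64 lines vanish, as a + b < 3b.
set_option maxHeartbeats 1000000 in
theorem calls_square (hW : 1000 * (m + n + 20) ≤ W) (h : Core A 0 mem) (h1 : 2 ≤ mem 16)
    (h2 : mem 16 ≤ mem 8) (h3 : mem 8 < 2 * mem 16) :
    Calls procs W A 12 [] mem fun _ mem' T => Reduced A mem mem' ∧
      64 * ((mem 16 - mem' 88) + alive mem' (mem 8)) ≤ 63 * (mem 8 + mem 16) ∧
      T ≤ 10000 * mem 8 := by
  refine ⟨squareBody, rfl, fun ent => run_of_wp ?_⟩
  have hml := h.row_le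
  have hnl := h.col_le
  simp only [squareBody, seqs, lt, arr, ↓wp_seq, ↓wp_assign, ↓wp_branch, ↓wp_query, ↓wp_skip, ↓wp_store, ↓wp_loop,
    ↓wp_call, Test.Ok, Test.Holds, Test.time, Expr.Ok, Expr.val, Expr.time, Function.update_apply,
    Nat.reduceEqDiff, reduceIte, OfNat.ofNat_ne_zero, OfNat.ofNat_ne_one, OfNat.zero_ne_ofNat,
    OfNat.one_ne_ofNat, one_ne_zero, zero_ne_one, List.getD_cons_zero, List.getD_cons_succ,
    List.getD_nil, true_and, and_true, and_assoc, not_le, Nat.reduceAdd, Nat.reduceMul]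
  refine run_call_of_eq (calls_blocks (t := 1) hW h le_rfl (by omega)) (by simp <;> omega) (by
    simp only [List.map_cons, List.map_nil, List.cons.injEq, seqs, lt, arr, ↓wp_seq, ↓wp_assign, ↓wp_branch, ↓wp_query, ↓wp_skip, ↓wp_store, ↓wp_loop,
    ↓wp_call, Test.Ok, Test.Holds, Test.time, Expr.Ok, Expr.val, Expr.time, Function.update_apply,
    Nat.reduceEqDiff, reduceIte, OfNat.ofNat_ne_zero, OfNat.ofNat_ne_one, OfNat.zero_ne_ofNat,
    OfNat.one_ne_ofNat, one_ne_zero, zero_ne_one, List.getD_cons_zero, List.getD_cons_succ,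
    List.getD_nil, true_and, and_true, and_assoc, not_le, Nat.reduceAdd, Nat.reduceMul]
    all_goals omega) rfl ?_
  rintro r₁ mem₁ ent₁ T₁ ⟨hs₁, hA, hT₁⟩
  simp only [List.map_cons, List.map_nil, List.sum_cons, List.sum_nil, seqs, lt, arr, ↓wp_seq, ↓wp_assign, ↓wp_branch, ↓wp_query, ↓wp_skip, ↓wp_store, ↓wp_loop,
    ↓wp_call, Test.Ok, Test.Holds, Test.time, Expr.Ok, Expr.val, Expr.time, Function.update_apply,
    Nat.reduceEqDiff, reduceIte, OfNat.ofNat_ne_zero, OfNat.ofNat_ne_one, OfNat.zero_ne_ofNat,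
    OfNat.one_ne_ofNat, one_ne_zero, zero_ne_one, List.getD_cons_zero, List.getD_cons_succ,
    List.getD_nil, true_and, and_true, and_assoc, not_le, Nat.reduceAdd, Nat.reduceMul]
  repeat refine And.intro (by omega) ?_
  obtain ⟨M, hM⟩ : ∃ M, M = Function.update (Function.update (Function.update mem₁ 24 1) 40 (mem₁ 8)) 48 0 :=
    ⟨_, rfl⟩
  have u : ∀ x, x ≠ 24 → x ≠ 40 → x ≠ 48 → M x = mem₁ x := fun x a b c => by
    rw [hM, Function.update_of_ne c, Function.update_of_ne b, Function.update_of_ne a]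
  have u24 : M 24 = 1 := by rw [hM]; rfl
  have u40 : M 40 = mem 8 := by rw [hM, ← hs₁ 8 (by omega) (by omega)]; rfl
  have u48 : M 48 = 0 := by rw [hM]; rfl
  have us : ∀ x, x % 8 ≠ 4 → x % 8 ≠ 5 → x ≠ 24 → x ≠ 40 → x ≠ 48 → M x = mem x := fun x a b c d e =>
    (u x c d e).trans (hs₁ x a b)
  have hAM : Assigned A 1 (mem 16) mem M := by
    intro j hj
    rw [u _ (by omega) (by omega) (by omega), u _ (by omega) (by omega) (by omega)]
    exact hA j hj
  have hC : Core A 0 M := h.congr fun x a b c d e f g => us x (by omega) (by omega) c e f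
  have hB : Blocks A M := Blocks.of_assigned h le_rfl hAM
    (fun x _ a => us x (by omega) (by omega) (by omega) (by omega) (by omega)) u24 (by omega)
    (by omega)
  have u0 := us 0 (by omega) (by omega) (by omega) (by omega) (by omega)
  have u8 := us 8 (by omega) (by omega) (by omega) (by omega) (by omega)
  have u16 := us 16 (by omega) (by omega) (by omega) (by omega) (by omega)
  have hpos : ∀ j, 0 ≤ j → j < M 16 → ∃ i < mem 16, M (8 * j + 2) = mem (8 * i + 2) ∧
      M (8 * M (8 * j + 2) + 4) = i := by
    intro j _ hj
    rw [us (8 * j + 2) (by omega) (by omega) (by omega) (by omega) (by omega)]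
    exact ⟨j, by omega, rfl, by rw [(hAM j (by omega)).1, one_mul]⟩
  clear hA hAM
  refine run_call_of_eq (calls_scan (mem := M) (lo := 0) (pr := M 56) (pc := M 64) hW hC.flag hC.col_le
    (Nat.zero_le _) hC.lo_row hC.lo_col (fun j _ hj => hC.validCol hB hj)) (by simp <;> omega)
    (by simp [hM]) hM.symm ?_
  rintro hi mem₂ ent₂ T₂ ⟨⟨σ, hs₂⟩, i1, i2, i3, i4, hT₂⟩
  have e : ∀ x, x % 8 ≠ 2 → mem₂ x = M x := hs₂.same
  have e0 := e 0 (by omega)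
  have e8 := e 8 (by omega)
  have e16 := e 16 (by omega)
  have hC₂ := hC.perm hs₂
  have hB₂ := hB.perm hs₂
  have hck₂ := hs₂.colKey_eq (A := A)
  have hlo₂ : loKey A mem₂ = loKey A M := by
    rw [loKey, loKey, e0, e 56 (by omega), e 64 (by omega)]
  have hle₂ : ∀ j < mem₂ 16, j < hi → colKey A mem₂ (mem₂ (8 * j + 2)) ≤ loKey A mem₂ :=
    fun j _ hj => by
      rw [hlo₂, hck₂]
      exact i3 j (Nat.zero_le _) hj
  have hlt₂ : ∀ j, hi ≤ j → j < mem₂ 16 → loKey A mem₂ < colKey A mem₂ (mem₂ (8 * j + 2)) :=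
    fun j hj hj' => by
      rw [hlo₂, hck₂]
      exact i4 j hj (by omega)
  have hpos₂ := (hs₂.forall_iff fun c => ∃ i < mem 16, c = mem (8 * i + 2) ∧ M (8 * c + 4) = i).2 hpos
  clear i3 i4
  simp only [List.map_cons, List.map_nil, List.sum_cons, List.sum_nil, seqs, lt, arr, ↓wp_seq, ↓wp_assign, ↓wp_branch, ↓wp_query, ↓wp_skip, ↓wp_store, ↓wp_loop,
    ↓wp_call, Test.Ok, Test.Holds, Test.time, Expr.Ok, Expr.val, Expr.time, Function.update_apply,
    Nat.reduceEqDiff, reduceIte, OfNat.ofNat_ne_zero, OfNat.ofNat_ne_one, OfNat.zero_ne_ofNat,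
    OfNat.one_ne_ofNat, one_ne_zero, zero_ne_one, List.getD_cons_zero, List.getD_cons_succ,
    List.getD_nil, true_and, and_true, and_assoc, not_le, Nat.reduceAdd, Nat.reduceMul]
  repeat refine And.intro (by omega) ?_
  refine ⟨fun g1 => ?_, fun g1 => ?_⟩
  · repeat refine And.intro (by omega) ?_
    have v : ∀ x, x ≠ 88 → Function.update mem₂ 88 hi x = mem₂ x := fun x hx =>
      Function.update_of_ne hx _ _
    have hal := alive_le (Function.update mem₂ 88 hi) (mem 8)
    refine ⟨⟨?_, ?_, ?_, ?_⟩, ?_, ?_⟩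
    · rw [Function.update_self]
      refine (hC₂.drop (al := hi) fun j hj hj' =>
        hC₂.exists_le_of_colKey_le hB₂ hj (hle₂ j hj hj')).congr fun x _ _ _ _ _ _ hx => v x hx
    · rw [v 0 (by omega), e0, u0]
    · rw [v 8 (by omega), e8, u8]
    · rw [v 16 (by omega), e16, u16]
    · omega
    · omega
  have g2 : 15 * mem 16 < 16 * (mem 16 - hi) := by omega
  refine run_call_of_eq (calls_pivot (A := A) (lo := hi) hW hC₂.flag hC₂.size hC₂.col_le (by omega)
    (fun j _ hj => hC₂.validCol hB₂ hj) fun j k1 k k2 k3 => hC₂.colKey_inj hB₂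
      (Finset.mem_Ico.1 k1).2 (Finset.mem_Ico.1 k2).2 k3) (by simp <;> omega) (by
    simp only [List.map_cons, List.map_nil, List.cons.injEq, seqs, lt, arr, ↓wp_seq, ↓wp_assign, ↓wp_branch, ↓wp_query, ↓wp_skip, ↓wp_store, ↓wp_loop,
    ↓wp_call, Test.Ok, Test.Holds, Test.time, Expr.Ok, Expr.val, Expr.time, Function.update_apply,
    Nat.reduceEqDiff, reduceIte, OfNat.ofNat_ne_zero, OfNat.ofNat_ne_one, OfNat.zero_ne_ofNat,
    OfNat.one_ne_ofNat, one_ne_zero, zero_ne_one, List.getD_cons_zero, List.getD_cons_succ,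
    List.getD_nil, true_and, and_true, and_assoc, not_le, Nat.reduceAdd, Nat.reduceMul]
    all_goals omega) rfl ?_
  rintro pm mem₃ ent₃ T₃ ⟨hs₃, ⟨jm, j1, j2, rfl⟩, q1, q2, hT₃⟩
  have hv := hC₂.validCol hB₂ j2
  have hvl := hv.lt
  obtain ⟨c, hc⟩ : ∃ c, c = mem₂ (8 * jm + 2) := ⟨_, rfl⟩
  rw [← hc] at hv hvl q1 q2 ⊢
  obtain ⟨r, hr⟩ : ∃ r, r = mem₂ (8 * c + 5) := ⟨_, rfl⟩
  have hC₃ : Core A 0 mem₃ := hC₂.congr fun x hx _ _ _ _ _ _ => hs₃ x hx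
  have hB₃ : Blocks A mem₃ := hB₂.congr hC₂ fun x hx _ _ => hs₃ x hx
  have f0 := hs₃ 0 (by omega)
  have f8 := hs₃ 8 (by omega)
  have f16 := hs₃ 16 (by omega)
  have hr₃ := hs₃ (8 * c + 5) (by omega)
  have hvr : r < rows m n (mem₃ 0) := by
    rw [f0, hr]
    exact hv.2
  have hvc : c < rows n m (mem₃ 0) := by
    rw [f0]
    exact hv.1
  have hvk : colKey A mem₂ c = key A (mem₃ 0) r c := by rw [hv.colKey_eq, f0, hr]
  have hlo : loKey A mem₂ < key A (mem₃ 0) r c := by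
    rw [← hvk, hc]
    exact hlt₂ jm j1 j2
  rw [hvk] at q1 q2
  simp only [List.map_cons, List.map_nil, List.sum_cons, List.sum_nil, seqs, lt, arr, ↓wp_seq, ↓wp_assign, ↓wp_branch, ↓wp_query, ↓wp_skip, ↓wp_store, ↓wp_loop,
    ↓wp_call, Test.Ok, Test.Holds, Test.time, Expr.Ok, Expr.val, Expr.time, Function.update_apply,
    Nat.reduceEqDiff, reduceIte, OfNat.ofNat_ne_zero, OfNat.ofNat_ne_one, OfNat.zero_ne_ofNat,
    OfNat.one_ne_ofNat, one_ne_zero, zero_ne_one, List.getD_cons_zero, List.getD_cons_succ,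
    List.getD_nil, true_and, and_true, and_assoc, not_le, Nat.reduceAdd, Nat.reduceMul]
  repeat refine And.intro (by omega) ?_
  refine run_call_of_eq (calls_scan (mem := mem₃) (lo := hi) (pr := r) (pc := c) hW hC₃.flag hC₃.col_le
    (by omega) hvr hvc (fun j _ hj => hC₃.validCol hB₃ hj)) (by simp <;> omega) (by
    simp only [List.map_cons, List.map_nil, List.cons.injEq, seqs, lt, arr, ↓wp_seq, ↓wp_assign, ↓wp_branch, ↓wp_query, ↓wp_skip, ↓wp_store, ↓wp_loop,
    ↓wp_call, Test.Ok, Test.Holds, Test.time, Expr.Ok, Expr.val, Expr.time, Function.update_apply,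
    Nat.reduceEqDiff, reduceIte, OfNat.ofNat_ne_zero, OfNat.ofNat_ne_one, OfNat.zero_ne_ofNat,
    OfNat.one_ne_ofNat, one_ne_zero, zero_ne_one, List.getD_cons_zero, List.getD_cons_succ,
    List.getD_nil, true_and, and_true, and_assoc, not_le, Nat.reduceAdd, Nat.reduceMul]
    all_goals omega) rfl ?_
  rintro lo mem₄ ent₄ T₄ ⟨⟨τ, hs₄⟩, i3, i4, i5, i6, hT₄⟩
  have e' : ∀ x, x % 8 ≠ 2 → mem₄ x = mem₃ x := hs₄.same
  have g0 := e' 0 (by omega)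
  have g8 := e' 8 (by omega)
  have g16 := e' 16 (by omega)
  have g24 := e' 24 (by omega)
  have g40 := e' 40 (by omega)
  have g48 := e' 48 (by omega)
  have f24 := hs₃ 24 (by omega)
  have f40 := hs₃ 40 (by omega)
  have f48 := hs₃ 48 (by omega)
  have e24 := e 24 (by omega)
  have e40 := e 40 (by omega)
  have e48 := e 48 (by omega)
  have hC₄ := hC₃.perm hs₄
  have hB₄ := hB₃.perm hs₄
  have hck₃ : colKey A mem₃ = colKey A mem₂ := colKey_congr hs₃
  have hck₄ := hs₄.colKey_eq (A := A)
  have hlo₄ : loKey A mem₄ = loKey A mem₂ := by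
    rw [loKey, loKey, g0, e' 56 (by omega), e' 64 (by omega), hs₃ 56 (by omega), hs₃ 64 (by omega), f0]
  have hcard : ∀ p : ℕ → Prop, [DecidablePred p] →
      ((Finset.Ico hi (mem₂ 16)).filter fun j => p (mem₄ (8 * j + 2))).card =
        ((Finset.Ico hi (mem₂ 16)).filter fun j => p (mem₂ (8 * j + 2))).card := by
    intro p _
    have := hs₄.card_filter p
    rw [f16] at this
    rw [this]
    congr 1
    refine Finset.filter_congr fun j hj => ?_
    rw [Finset.mem_Ico] at hj
    rw [hs₃ _ (by omega)]
  have y1 : mem₂ 16 - hi ≤ 16 * (lo - hi) := by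
    rw [← hcard fun c' => colKey A mem₂ c' ≤ key A (mem₃ 0) r c] at q1
    refine q1.trans (Nat.mul_le_mul_left _ ?_)
    rw [← Nat.card_Ico]
    refine Finset.card_le_card fun j hj => ?_
    rw [Finset.mem_filter, Finset.mem_Ico] at hj
    rw [Finset.mem_Ico]
    by_contra hcon
    have := i6 j (by omega) (by omega)
    rw [hck₃] at this
    exact absurd hj.2 (not_le.2 this)
  have y2 : mem₂ 16 - hi ≤ 16 * (mem₂ 16 - lo) := by
    rw [← hcard fun c' => key A (mem₃ 0) r c < colKey A mem₂ c'] at q2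
    refine q2.trans (Nat.mul_le_mul_left _ ?_)
    rw [← Nat.card_Ico]
    refine Finset.card_le_card fun j hj => ?_
    rw [Finset.mem_filter, Finset.mem_Ico] at hj
    rw [Finset.mem_Ico]
    by_contra hcon
    have := i5 j (by omega) (by omega)
    rw [hck₃] at this
    exact absurd hj.2 (not_lt.2 this)
  have hbefore : ∀ j < mem₄ 16, j < lo → ∃ x < rows m n (mem₄ 0),
      key A (mem₄ 0) x (mem₄ (8 * j + 2)) ≤ key A (mem₄ 0) r c := by
    intro j hj hj'
    refine hC₄.exists_le_of_colKey_le hB₄ hj ?_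
    rw [g0]
    by_cases hji : j < hi
    · rw [hs₄.perm, hs₄.fix j (.inl hji), hck₄, hck₃, hs₃ _ (by omega)]
      exact (hle₂ j (by omega) hji).trans hlo.le
    · rw [hck₄]
      exact i5 j (by omega) hj'
  have hafter : ∀ j, lo ≤ j → j < mem₄ 16 →
      key A (mem₄ 0) r c < colKey A mem₄ (mem₄ (8 * j + 2)) := by
    intro j hj hj'
    rw [g0, hck₄]
    exact i6 j hj (by omega)
  have hpos₃ : ∀ j, hi ≤ j → j < mem₃ 16 → ∃ i < mem 16, mem₃ (8 * j + 2) = mem (8 * i + 2) ∧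
      M (8 * mem₃ (8 * j + 2) + 4) = i := by
    intro j hj hj'
    rw [hs₃ _ (by omega)]
    exact hpos₂ j (Nat.zero_le _) (by omega)
  have hpos₄ := (hs₄.forall_iff fun c => ∃ i < mem 16, c = mem (8 * i + 2) ∧ M (8 * c + 4) = i).2 hpos₃
  clear hpos hpos₃ hpos₂ i5 i6 hcard q1 q2
  rw [← g0] at hvr hvc hlo
  rw [← hlo₄] at hlo
  simp only [List.map_cons, List.map_nil, List.sum_cons, List.sum_nil, seqs, lt, arr, ↓wp_seq, ↓wp_assign, ↓wp_branch, ↓wp_query, ↓wp_skip, ↓wp_store, ↓wp_loop,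
    ↓wp_call, Test.Ok, Test.Holds, Test.time, Expr.Ok, Expr.val, Expr.time, Function.update_apply,
    Nat.reduceEqDiff, reduceIte, OfNat.ofNat_ne_zero, OfNat.ofNat_ne_one, OfNat.zero_ne_ofNat,
    OfNat.one_ne_ofNat, one_ne_zero, zero_ne_one, List.getD_cons_zero, List.getD_cons_succ,
    List.getD_nil, true_and, and_true, and_assoc, not_le, Nat.reduceAdd, Nat.reduceMul]
  repeat refine And.intro (by omega) ?_
  refine run_call_of_eq (calls_walk (lo := lo) (pr := r) (pc := c) hW hC₄.flag hC₄.row_le hC₄.col_le (by omega)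
    (by omega) hvr hvc hC₄.row hC₄.col) (by simp <;> omega) (by
    simp only [List.map_cons, List.map_nil, List.cons.injEq, seqs, lt, arr, ↓wp_seq, ↓wp_assign, ↓wp_branch, ↓wp_query, ↓wp_skip, ↓wp_store, ↓wp_loop,
    ↓wp_call, Test.Ok, Test.Holds, Test.time, Expr.Ok, Expr.val, Expr.time, Function.update_apply,
    Nat.reduceEqDiff, reduceIte, OfNat.ofNat_ne_zero, OfNat.ofNat_ne_one, OfNat.zero_ne_ofNat,
    OfNat.one_ne_ofNat, one_ne_zero, zero_ne_one, List.getD_cons_zero, List.getD_cons_succ,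
    List.getD_nil, true_and, and_true, and_assoc, not_le, Nat.reduceAdd, Nat.reduceMul]
    all_goals omega) rfl ?_
  rintro rr mem₅ ent₅ T₅ ⟨w1, w2, w3, w4, w5, w6⟩
  have hC₅ : Core A 0 mem₅ := hC₄.congr fun x _ _ _ _ _ _ _ => w1 x (by omega)
  have hB₅ : Blocks A mem₅ := hB₄.congr hC₄ fun x _ _ _ => w1 x (by omega)
  have k0 := w1 0 (by omega)
  have k8 := w1 8 (by omega)
  have k16 := w1 16 (by omega)
  have k24 := w1 24 (by omega)
  have hck₅ : ∀ c, colKey A mem₅ c = colKey A mem₄ c := fun c => colKey_of_same k0 (w1 _ (by omega))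
  have hlo₅ : loKey A mem₅ = loKey A mem₄ := by
    rw [loKey, loKey, k0, w1 56 (by omega), w1 64 (by omega)]
  simp only [List.map_cons, List.map_nil, List.sum_cons, List.sum_nil, seqs, lt, arr, ↓wp_seq, ↓wp_assign, ↓wp_branch, ↓wp_query, ↓wp_skip, ↓wp_store, ↓wp_loop,
    ↓wp_call, Test.Ok, Test.Holds, Test.time, Expr.Ok, Expr.val, Expr.time, Function.update_apply,
    Nat.reduceEqDiff, reduceIte, OfNat.ofNat_ne_zero, OfNat.ofNat_ne_one, OfNat.zero_ne_ofNat,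
    OfNat.one_ne_ofNat, one_ne_zero, zero_ne_one, List.getD_cons_zero, List.getD_cons_succ,
    List.getD_nil, true_and, and_true, and_assoc, not_le, Nat.reduceAdd, Nat.reduceMul]
  repeat refine And.intro (by omega) ?_
  refine ⟨fun g3 => ?_, fun g3 => ?_⟩
  · repeat refine And.intro (by omega) ?_
    have v : ∀ x, x ≠ 88 → Function.update mem₅ 88 lo x = mem₅ x := fun x hx =>
      Function.update_of_ne hx _ _
    have v0 := v 0 (by omega)
    have v8 := v 8 (by omega)
    have v16 := v 16 (by omega)
    have hCv : Core A 0 (Function.update mem₅ 88 lo) := hC₅.congr fun x _ _ _ _ _ _ hx => v x hx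
    refine run_call_of_eq (calls_raiseLo (al := lo) (r := r) (c := c) hW hCv (by rwa [v0, k0])
      (by rwa [v0, k0]) ?_ ?_ ?_) (by simp <;> omega) (by
    simp only [List.map_cons, List.map_nil, List.cons.injEq, seqs, lt, arr, ↓wp_seq, ↓wp_assign, ↓wp_branch, ↓wp_query, ↓wp_skip, ↓wp_store, ↓wp_loop,
    ↓wp_call, Test.Ok, Test.Holds, Test.time, Expr.Ok, Expr.val, Expr.time, Function.update_apply,
    Nat.reduceEqDiff, reduceIte, OfNat.ofNat_ne_zero, OfNat.ofNat_ne_one, OfNat.zero_ne_ofNat,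
    OfNat.one_ne_ofNat, one_ne_zero, zero_ne_one, List.getD_cons_zero, List.getD_cons_succ,
    List.getD_nil, true_and, and_true, and_assoc, not_le, Nat.reduceAdd, Nat.reduceMul]
    all_goals omega) rfl ?_
    · rw [loKey, v0, v 56 (by omega), v 64 (by omega), ← loKey, hlo₅, k0]
      exact hlo.le
    · intro k hk
      obtain ⟨j, a1, a2⟩ := w4 k (by omega) (by omega)
      rw [v0, v _ (by omega), k0, w1 _ (by omega)]
      exact ⟨_, hC₄.col j a1, a2⟩
    · intro j hj hj'
      rw [v0, v _ (by omega), k0, w1 _ (by omega)]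
      exact hbefore j (by omega) hj'
    rintro r₆ mem₆ ent₆ T₆ ⟨z1, z2, z3⟩
    have z88 : mem₆ 88 = lo := by rw [z1 88 (by omega) (by omega), Function.update_self]
    have hal := alive_le mem₆ (mem 8)
    simp only [List.map_cons, List.map_nil, List.sum_cons, List.sum_nil, seqs, lt, arr, ↓wp_seq, ↓wp_assign, ↓wp_branch, ↓wp_query, ↓wp_skip, ↓wp_store, ↓wp_loop,
    ↓wp_call, Test.Ok, Test.Holds, Test.time, Expr.Ok, Expr.val, Expr.time, Function.update_apply,
    Nat.reduceEqDiff, reduceIte, OfNat.ofNat_ne_zero, OfNat.ofNat_ne_one, OfNat.zero_ne_ofNat,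
    OfNat.one_ne_ofNat, one_ne_zero, zero_ne_one, List.getD_cons_zero, List.getD_cons_succ,
    List.getD_nil, true_and, and_true, and_assoc, not_le, Nat.reduceAdd, Nat.reduceMul]
    refine ⟨⟨by rwa [z88], ?_, ?_, ?_⟩, by omega, by omega⟩
    · rw [z1 0 (by omega) (by omega)]
      omega
    · rw [z1 8 (by omega) (by omega)]
      omega
    · rw [z1 16 (by omega) (by omega)]
      omega
  obtain ⟨-, hw⟩ := w5.resolve_left (by omega)
  refine run_call_of_eq (calls_lowerHi (r := r) (c := c) hW hC₅ (by rwa [k0]) (by rwa [k0]) ?_)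
    (by simp <;> omega) (by
    simp only [List.map_cons, List.map_nil, List.cons.injEq, seqs, lt, arr, ↓wp_seq, ↓wp_assign, ↓wp_branch, ↓wp_query, ↓wp_skip, ↓wp_store, ↓wp_loop,
    ↓wp_call, Test.Ok, Test.Holds, Test.time, Expr.Ok, Expr.val, Expr.time, Function.update_apply,
    Nat.reduceEqDiff, reduceIte, OfNat.ofNat_ne_zero, OfNat.ofNat_ne_one, OfNat.zero_ne_ofNat,
    OfNat.one_ne_ofNat, one_ne_zero, zero_ne_one, List.getD_cons_zero, List.getD_cons_succ,
    List.getD_nil, true_and, and_true, and_assoc, not_le, Nat.reduceAdd, Nat.reduceMul]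
    all_goals omega) rfl ?_
  · intro y hy
    rw [k0] at hy ⊢
    obtain ⟨j, -, a1, rfl⟩ | ⟨x, a1, a2⟩ := hC₄.dead_col y hy
    · by_cases a2 : j < lo
      · exact hbefore j a1 a2
      · obtain ⟨k, a3, a4⟩ := hw j (by omega) a1
        exact ⟨_, hC₄.row k a3, a4.le⟩
    · exact ⟨x, a1, a2.trans hlo.le⟩
  rintro r₆ mem₆ ent₆ T₆ ⟨z1, hC₆, z2, z3⟩
  have hB₆ : Blocks A mem₆ := hB₅.congr hC₅ fun x _ _ _ => z1 x (by omega) (by omega)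
  have z : ∀ x, x ≠ 48 → x ≠ 72 → x ≠ 80 → mem₆ x = mem₄ x := fun x a b c =>
    (z1 x b c).trans (w1 x a)
  have l0 := z 0 (by omega) (by omega) (by omega)
  have l8 := z 8 (by omega) (by omega) (by omega)
  have l16 := z 16 (by omega) (by omega) (by omega)
  have l24 := z 24 (by omega) (by omega) (by omega)
  have l40 := z 40 (by omega) (by omega) (by omega)
  have hck₆ : ∀ c, colKey A mem₆ c = colKey A mem₄ c := fun c =>
    colKey_of_same l0 (z _ (by omega) (by omega) (by omega))
  simp only [List.map_cons, List.map_nil, List.sum_cons, List.sum_nil, seqs, lt, arr, ↓wp_seq, ↓wp_assign, ↓wp_branch, ↓wp_query, ↓wp_skip, ↓wp_store, ↓wp_loop,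
    ↓wp_call, Test.Ok, Test.Holds, Test.time, Expr.Ok, Expr.val, Expr.time, Function.update_apply,
    Nat.reduceEqDiff, reduceIte, OfNat.ofNat_ne_zero, OfNat.ofNat_ne_one, OfNat.zero_ne_ofNat,
    OfNat.one_ne_ofNat, one_ne_zero, zero_ne_one, List.getD_cons_zero, List.getD_cons_succ,
    List.getD_nil, true_and, and_true, and_assoc, not_le, Nat.reduceAdd, Nat.reduceMul]
  refine run_call_of_eq (calls_kill (lo := lo) (pr := r) (pc := c) hW hC₆ hB₆ (by omega) (by rwa [l0])
    (by rwa [l0]) (by rwa [l0, ← k0]) ?_) (by simp <;> omega) (by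
    simp only [List.map_cons, List.map_nil, List.cons.injEq, seqs, lt, arr, ↓wp_seq, ↓wp_assign, ↓wp_branch, ↓wp_query, ↓wp_skip, ↓wp_store, ↓wp_loop,
    ↓wp_call, Test.Ok, Test.Holds, Test.time, Expr.Ok, Expr.val, Expr.time, Function.update_apply,
    Nat.reduceEqDiff, reduceIte, OfNat.ofNat_ne_zero, OfNat.ofNat_ne_one, OfNat.zero_ne_ofNat,
    OfNat.one_ne_ofNat, one_ne_zero, zero_ne_one, List.getD_cons_zero, List.getD_cons_succ,
    List.getD_nil, true_and, and_true, and_assoc, not_le, Nat.reduceAdd, Nat.reduceMul]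
    all_goals omega) rfl ?_
  · intro j hj hj'
    rw [l0, z _ (by omega) (by omega) (by omega), hck₆]
    exact hafter j hj (by omega)
  rintro r₇ mem₇ ent₇ T₇ ⟨K, hK, hdead, -, hT₇⟩
  simp only [List.map_cons, List.map_nil, List.sum_cons, List.sum_nil, seqs, lt, arr, ↓wp_seq, ↓wp_assign, ↓wp_branch, ↓wp_query, ↓wp_skip, ↓wp_store, ↓wp_loop,
    ↓wp_call, Test.Ok, Test.Holds, Test.time, Expr.Ok, Expr.val, Expr.time, Function.update_apply,
    Nat.reduceEqDiff, reduceIte, OfNat.ofNat_ne_zero, OfNat.ofNat_ne_one, OfNat.zero_ne_ofNat,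
    OfNat.one_ne_ofNat, one_ne_zero, zero_ne_one, List.getD_cons_zero, List.getD_cons_succ,
    List.getD_nil, true_and, and_true, and_assoc, not_le, Nat.reduceAdd, Nat.reduceMul]
  repeat refine And.intro (by omega) ?_
  have v : ∀ x, x ≠ 88 → Function.update mem₇ 88 0 x = mem₇ x := fun x hx =>
    Function.update_of_ne hx _ _
  have hKu := hK.used
  have hKb := hK.blocks.le
  have o8 := hK.same 8 (by omega) (by omega) (by omega) (by omega)
  -- All rows count as used from the start, so no block can be replaced: the call only deletes.
  obtain rfl : K = 0 := by
    rw [l24, g24, f24, e24, u24] at hKu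
    omega
  -- Blocks have length one, and the original column list assigns index i to column number i.
  -- `hpos₄` carries this assignment through the permutations, so distinct columns yield distinct
  -- deleted rows.
  have hal : alive (Function.update mem₇ 88 0) (mem 8) + (Finset.Ico lo (mem 16)).card ≤ mem 8 := by
    refine alive_add_le (f := fun j => mem₆ (8 * mem₆ (8 * j + 2) + 4)) (fun j hj => ?_) fun j hj j' hj' hjj => ?_
    · rw [Finset.mem_Ico] at hj
      have a1 := hB₆.block j (by omega)
      have a2 := hB₆.le
      have a3 := hB₆.pos
      refine ⟨by omega, ?_⟩
      rw [v _ (by omega)]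
      exact hdead j hj.1 (by omega) _ ⟨le_rfl, by omega⟩
    · rw [Finset.mem_Ico] at hj hj'
      have a1 := hC₄.col j (by omega)
      have a2 := hC₄.col j' (by omega)
      have a3 := rows_le n m (mem₄ 0)
      obtain ⟨i, b1, b2, b3⟩ := hpos₄ j (by omega) (by omega)
      obtain ⟨i', b1', b2', b3'⟩ := hpos₄ j' (by omega) (by omega)
      have a4 : ∀ x < 8 * (m + n + 20), x % 8 = 4 → mem₆ x = M x := fun x hx hx' => by
        rw [z x (by omega) (by omega) (by omega), e' x (by omega), hs₃ x hx, e x (by omega)]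
      rw [z (8 * j + 2) (by omega) (by omega) (by omega), z (8 * j' + 2) (by omega) (by omega) (by omega),
        a4 _ (by omega) (by omega), a4 _ (by omega) (by omega), b3, b3'] at hjj
      subst hjj
      exact hC₄.col_inj j (by omega) j' (by omega) (b2.trans b2'.symm)
  rw [Nat.card_Ico] at hal
  rw [zero_add, l16, l24, g24, f24, e24, u24] at hT₇
  refine ⟨⟨?_, ?_, ?_, ?_⟩, ?_, ?_⟩
  · rw [Function.update_self]
    exact hK.core.congr fun x _ _ _ _ _ _ hx => v x hx
  · rw [v 0 (by omega), hK.same 0 (by omega) (by omega) (by omega) (by omega)]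
    omega
  · rw [v 8 (by omega)]
    omega
  · rw [v 16 (by omega), hK.same 16 (by omega) (by omega) (by omega) (by omega)]
    omega
  · omega
  · have b1 : T₁ ≤ 220 * mem 16 + 20 := by omega
    have b2 : T₂ ≤ 200 * mem 16 + 20 := by omega
    have b3 : T₃ ≤ 2000 * mem 16 := by omega
    have b4 : T₄ ≤ 200 * mem 16 + 20 := by omega
    have b5 : T₅ ≤ 200 * (mem 16 + mem 8) + 50 := by omega
    have b7 : T₇ ≤ 800 * mem 16 + 20 := by omega
    clear * - b1 b2 b3 b4 b5 z3 b7 h1 h2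
    omega

end Saddle

/-! ### Reduction of tall matrices -/

namespace Saddle

open RAM Expr Test Cmd

variable {α : Type*} [LinearOrder α] {m n : ℕ} {W : ℕ} {A : Matrix (Fin m) (Fin n) α}
  {mem mem' : ℕ → ℕ}

/-- Eleven factors of 15/16 make less than one half, as 2 · 15^11 ≤ 16^11. -/
theorem two_pow_mul_fifteen_pow_le (k : ℕ) : 2 ^ k * 15 ^ (11 * k) ≤ 16 ^ (11 * k) := by
  rw [pow_mul, pow_mul, ← mul_pow]
  exact Nat.pow_le_pow_left (by norm_num) k

/-- Lowering to lo itself, with depth 11(16t + 1), enough to come down from all columns to e. If it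
succeeds, every column has a key at most lo and all are deleted. If a walk passes all rows, at most
e columns survive. If the reserve runs out, `Cover` bounds the surviving rows by those in the
current blocks and fewer than t unused ones. In the first case only the state with cell `88` set to
the number of columns is claimed to be reduced, since the caller still has to store it. -/
theorem calls_lower_tall (hW : 1000 * (m + n + 20) ≤ W) {t : ℕ} (h : Core A 0 mem) (hB : Blocks A mem)
    (hcov : Cover mem) (h24 : mem 24 = t) (h40 : mem 40 = t * mem 16) (h48 : mem 48 = 0)
    (h88 : mem 88 = 0) (ht1 : 1 ≤ t) (h1 : 2 ≤ mem 16) (h2 : 2 * (t * mem 16) ≤ mem 8)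
    (h32 : 1 ≤ mem 32) (he : mem 16 ≤ mem 32 * 2 ^ (16 * t + 1)) :
    Calls procs W A 10 [0, mem 56, mem 64] mem fun r mem' T =>
      (r = 0 → Reduced A mem (Function.update mem' 88 (mem' 16))) ∧ mem' 16 = mem 16 ∧
      (0 < r → Reduced A mem mem' ∧
        (mem 16 - mem' 88 ≤ mem 32 ∨ 4 * alive mem' (mem 8) ≤ 3 * mem 8)) ∧
      T ≤ 11900000 * mem 8 := by
  have hml := h.row_le
  have hL : Lowerable A 0 (mem 56) (mem 64) mem := ⟨h, hB, Nat.zero_le _, h.lo_row, h.lo_col, le_rfl,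
    by omega, fun _ _ hj => absurd hj (by omega), fun _ hk => absurd hk (by omega), h32⟩
  have hbig := big_le (A := A) (mem := mem) (lo := 0) (v := key A (mem 0) (mem 56) (mem 64))
  have ht2 : 1 * mem 16 ≤ t * mem 16 := Nat.mul_le_mul_right _ ht1
  have ht3 : t * 2 ≤ t * mem 16 := Nat.mul_le_mul_left _ h1
  -- The depth is linear in t, so each renewal costs O(t). The K new blocks contain tK rows of the
  -- reserve. The constant is 189 = 177 + 12, where 177 = 1 + 11 · 16, and 12 = 11 + 1 is charged
  -- with K ≤ tK.
  have time : ∀ K, mem 40 + mem 24 * K ≤ mem 8 →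
      K * (mem 24 + 11 * (16 * t + 1) + 1) ≤ 189 * mem 8 := by
    intro K hK
    rw [h24] at hK ⊢
    have k1 : K * (t + 11 * (16 * t + 1) + 1) = 177 * (t * K) + 12 * (1 * K) := by ring
    have k2 : 1 * K ≤ t * K := Nat.mul_le_mul_right _ ht1
    omega
  refine (calls_lower hW _ (11 * (16 * t + 1)) hL (Nat.lt_succ_self _) ?_).mono ?_
  · refine (Nat.mul_le_mul_right _ (hbig.trans ((Nat.sub_le _ _).trans he))).trans ?_
    rw [mul_assoc]
    exact Nat.mul_le_mul_left _ (two_pow_mul_fifteen_pow_le _)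
  rintro r mem' T (⟨rfl, K, hK, hT⟩ | ⟨hab, K, Δ, hK, hΔ, hT⟩)
  · have s0 := hK.scalar 0 (by omega) (by omega) (by omega) (by omega) (by omega) (by omega)
    have s8 := hK.scalar 8 (by omega) (by omega) (by omega) (by omega) (by omega) (by omega)
    have s16 := hK.scalar 16 (by omega) (by omega) (by omega) (by omega) (by omega) (by omega)
    have s56 := hK.scalar 56 (by omega) (by omega) (by omega) (by omega) (by omega) (by omega)
    have s64 := hK.scalar 64 (by omega) (by omega) (by omega) (by omega) (by omega) (by omega)
    have v : ∀ x, x ≠ 88 → Function.update mem' 88 (mem' 16) x = mem' x := fun x hx =>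
      Function.update_of_ne hx _ _
    refine ⟨fun _ => ⟨?_, ?_, ?_, ?_⟩, s16, fun h => absurd h (by omega), ?_⟩
    · rw [Function.update_self]
      refine (hK.core.drop (al := mem' 16) fun j hj _ => hK.core.exists_le_of_colKey_le hK.blocks hj ?_).congr
        fun x _ _ _ _ _ _ hx => v x hx
      rw [loKey, s0, s56, s64]
      exact hK.le j (Nat.zero_le _) (by omega)
    · rw [v 0 (by omega), s0]
    · rw [v 8 (by omega), s8]
    · rw [v 16 (by omega), s16]
    · have := time K (by rw [← hK.used, ← s8]; exact hK.blocks.le)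
      have := hK.ptr
      omega
  -- Deleting blocks without replacement costs at most t + 1 ≤ 2t for each column, and the product
  -- of 2t and the number of columns is at most the number of rows.
  · have hb : big A mem 0 (key A (mem 0) (mem 56) (mem 64)) * (mem 24 + 1) ≤ mem 8 := by
      refine (Nat.mul_le_mul hbig (show mem 24 + 1 ≤ 2 * t by omega)).trans ?_
      rw [Nat.sub_zero, mul_comm, mul_assoc]
      exact h2
    have hs : ∀ x < 20, x % 8 = 0 → mem' x = mem x := fun x hx hx' =>
      hab.scalar x (by omega) hx' (by omega) (by omega) (by omega) (by omega) (by omega) (by omega) (by omega)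
    have s0 := hs 0 (by omega) (by omega)
    have s8 := hs 8 (by omega) (by omega)
    have s16 := hs 16 (by omega) (by omega)
    have := time K hK
    have s24 := hab.scalar 24 (by omega) (by omega) (by omega) (by omega) (by omega) (by omega)
      (by omega) (by omega) (by omega)
    rcases hab.cases with ⟨rfl, c1, c2⟩ | ⟨rfl, c1, c2, c3, c4, c5⟩
    · exact ⟨fun h => absurd h (by omega), s16, fun _ => ⟨⟨c1, s0, s8, s16⟩, .inl c2⟩, by omega⟩
    · refine ⟨fun h => absurd h (by omega), s16, fun _ => ⟨⟨by rwa [c5, h88], s0, s8, s16⟩, .inr ?_⟩, by omega⟩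
      -- With a rows and b columns, the blocks contain at most tb ≤ a/2 rows. Fewer than t unused
      -- rows remain, and 2t ≤ tb gives t ≤ a/4.
      have c6 := (c3 hcov).alive_le
      rw [s8, s16, s24, h24, mul_comm] at c6
      omega

-- The number e is the number of columns divided by 2^(16t), but at least 1. The exponent balances
-- two demands: the depth must remain O(t), and the ratio of height to width must grow
-- exponentially.
set_option maxHeartbeats 1000000 in
theorem calls_tall (hW : 1000 * (m + n + 20) ≤ W) (h : Core A 0 mem) (h1 : 2 ≤ mem 16)
    (h2 : 2 * mem 16 ≤ mem 8) :
    Calls procs W A 13 [] mem fun _ mem' T => Reduced A mem mem' ∧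
      (mem 16 - mem' 88 ≤ max 1 (mem 16 / 2 ^ (16 * (mem 8 / (2 * mem 16)))) ∨
        4 * alive mem' (mem 8) ≤ 3 * mem 8) ∧ T ≤ 12000000 * mem 8 := by
  refine ⟨tallBody, rfl, fun ent => run_of_wp ?_⟩
  have hml := h.row_le
  have hnl := h.col_le
  obtain ⟨t, ht⟩ : ∃ t, t = mem 8 / (2 * mem 16) := ⟨_, rfl⟩
  have ht1 : 1 ≤ t := by
    rw [ht]
    exact Nat.div_pos h2 (by omega)
  have ht2 : 2 * (t * mem 16) ≤ mem 8 := by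
    have := Nat.div_mul_le_self (mem 8) (2 * mem 16)
    rw [← ht] at this
    linarith
  have ht3 : t * 2 ≤ t * mem 16 := Nat.mul_le_mul_left _ h1
  simp only [tallBody, ← ht, seqs, lt, arr, ↓wp_seq, ↓wp_assign, ↓wp_branch, ↓wp_query, ↓wp_skip, ↓wp_store, ↓wp_loop,
    ↓wp_call, Test.Ok, Test.Holds, Test.time, Expr.Ok, Expr.val, Expr.time, Function.update_apply,
    Nat.reduceEqDiff, reduceIte, OfNat.ofNat_ne_zero, OfNat.ofNat_ne_one, OfNat.zero_ne_ofNat,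
    OfNat.one_ne_ofNat, one_ne_zero, zero_ne_one, List.getD_cons_zero, List.getD_cons_succ,
    List.getD_nil, true_and, and_true, and_assoc, not_le, Nat.reduceAdd, Nat.reduceMul]
  repeat refine And.intro (by omega) ?_
  obtain ⟨M, hM⟩ : ∃ M, M = Function.update mem 24 t := ⟨_, rfl⟩
  have u : ∀ x, x ≠ 24 → M x = mem x := fun x a => by rw [hM, Function.update_of_ne a]
  have u24 : M 24 = t := by rw [hM, Function.update_self]
  have hCM : Core A 0 M := h.congr fun x _ _ a _ _ _ _ => u x a
  have u0 := u 0 (by omega)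
  have u8 := u 8 (by omega)
  have u16 := u 16 (by omega)
  refine run_call_of_eq (calls_blocks (mem := M) (t := t) hW hCM ht1 (by rw [u16, u8]; omega)) (by simp <;> omega) (by simp) hM.symm ?_
  rintro r₁ mem₁ ent₁ T₁ ⟨hs₁, hA, hT₁⟩
  have e8 := hs₁ 8 (by omega) (by omega)
  have e16 := hs₁ 16 (by omega) (by omega)
  simp only [e16, u16, List.map_cons, List.map_nil, List.sum_cons, List.sum_nil, seqs, lt, arr, ↓wp_seq, ↓wp_assign, ↓wp_branch, ↓wp_query, ↓wp_skip, ↓wp_store, ↓wp_loop,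
    ↓wp_call, Test.Ok, Test.Holds, Test.time, Expr.Ok, Expr.val, Expr.time, Function.update_apply,
    Nat.reduceEqDiff, reduceIte, OfNat.ofNat_ne_zero, OfNat.ofNat_ne_one, OfNat.zero_ne_ofNat,
    OfNat.one_ne_ofNat, one_ne_zero, zero_ne_one, List.getD_cons_zero, List.getD_cons_succ,
    List.getD_nil, true_and, and_true, and_assoc, not_le, Nat.reduceAdd, Nat.reduceMul]
  repeat refine And.intro (by omega) ?_
  obtain ⟨M₁, hM₁⟩ : ∃ M₁, M₁ = Function.update (Function.update (Function.update mem₁ 40 (t * mem 16)) 48 0) 88 0 :=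
    ⟨_, rfl⟩
  have u' : ∀ x, x ≠ 40 → x ≠ 48 → x ≠ 88 → M₁ x = mem₁ x := fun x a b c => by
    rw [hM₁, Function.update_of_ne c, Function.update_of_ne b, Function.update_of_ne a]
  have u40 : M₁ 40 = t * mem 16 := by rw [hM₁]; rfl
  have u48 : M₁ 48 = 0 := by rw [hM₁]; rfl
  have u88 : M₁ 88 = 0 := by rw [hM₁]; rfl
  have u16' : M₁ 16 = mem 16 := by rw [u' 16 (by omega) (by omega) (by omega), e16, u16]
  -- The power of two is not computed beyond the first one that exceeds the number of columns. It
  -- would not fit into a word, and e is 1 in that case anyway.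
  refine run_loop (fun s => 16 * t - s.loc 2) (fun s T => s.mem = M₁ ∧ s.loc 0 = t ∧
    s.loc 1 = 2 ^ s.loc 2 ∧ s.loc 2 ≤ 16 * t ∧ s.loc 1 ≤ 2 * mem 16 ∧ T ≤ 25 * s.loc 2) ?_ ?_ ?_
  · exact ⟨hM₁.symm, rfl, rfl, Nat.zero_le _, by simp; omega, Nat.zero_le _⟩
  · rintro ⟨loc, mem₂, ent₂⟩ T ⟨rfl, l0, l1, l2, l3, hT⟩
    dsimp only at *
    refine ⟨by simp [l0]; omega, fun hb => run_of_wp ?_⟩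
    simp only [l0, u16', seqs, lt, arr, ↓wp_seq, ↓wp_assign, ↓wp_branch, ↓wp_query, ↓wp_skip, ↓wp_store, ↓wp_loop,
    ↓wp_call, Test.Ok, Test.Holds, Test.time, Expr.Ok, Expr.val, Expr.time, Function.update_apply,
    Nat.reduceEqDiff, reduceIte, OfNat.ofNat_ne_zero, OfNat.ofNat_ne_one, OfNat.zero_ne_ofNat,
    OfNat.one_ne_ofNat, one_ne_zero, zero_ne_one, List.getD_cons_zero, List.getD_cons_succ,
    List.getD_nil, true_and, and_true, and_assoc, not_le, Nat.reduceAdd, Nat.reduceMul] at hb ⊢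
    repeat refine And.intro (by omega) ?_
    omega
  rintro ⟨loc, mem₂, ent₂⟩ T ⟨rfl, l0, l1, l2, l3, hT⟩ hb
  dsimp only at *
  simp only [l0, u16', seqs, lt, arr, ↓wp_seq, ↓wp_assign, ↓wp_branch, ↓wp_query, ↓wp_skip, ↓wp_store, ↓wp_loop,
    ↓wp_call, Test.Ok, Test.Holds, Test.time, Expr.Ok, Expr.val, Expr.time, Function.update_apply,
    Nat.reduceEqDiff, reduceIte, OfNat.ofNat_ne_zero, OfNat.ofNat_ne_one, OfNat.zero_ne_ofNat,
    OfNat.one_ne_ofNat, one_ne_zero, zero_ne_one, List.getD_cons_zero, List.getD_cons_succ,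
    List.getD_nil, true_and, and_true, and_assoc, not_le, Nat.reduceAdd, Nat.reduceMul] at hb ⊢
  have us : ∀ x, x % 8 ≠ 4 → x % 8 ≠ 5 → x ≠ 24 → x ≠ 40 → x ≠ 48 → x ≠ 88 → mem₂ x = mem x :=
    fun x a b c d e f => (u' x d e f).trans ((hs₁ x a b).trans (u x c))
  have hAM : Assigned A t (mem 16) mem mem₂ := by
    intro j hj
    have := hA j (by omega)
    rw [u' _ (by omega) (by omega) (by omega), u' _ (by omega) (by omega) (by omega)]
    have u1 : ∀ k, M (8 * k + 1) = mem (8 * k + 1) := fun k => u _ (by omega)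
    rw [u (8 * j + 2) (by omega), u0] at this
    simpa only [u1] using this
  have hcall : ∀ e, 1 ≤ e → e ≤ max 1 (mem 16 / 2 ^ (16 * t)) → mem 16 ≤ e * 2 ^ (16 * t + 1) →
      Calls procs W A 10 [0, mem₂ 56, mem₂ 64] (Function.update mem₂ 32 e) fun r mem' T =>
      (r = 0 → Reduced A mem (Function.update mem' 88 (mem' 16))) ∧ mem' 16 = mem 16 ∧
      (0 < r → Reduced A mem mem' ∧
        (mem 16 - mem' 88 ≤ max 1 (mem 16 / 2 ^ (16 * t)) ∨ 4 * alive mem' (mem 8) ≤ 3 * mem 8)) ∧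
      T ≤ 11900000 * mem 8 := by
    intro e a1 a2 a3
    have v : ∀ x, x ≠ 32 → Function.update mem₂ 32 e x = mem₂ x := fun x a => Function.update_of_ne a _ _
    have v24 : Function.update mem₂ 32 e 24 = t := by
      rw [v _ (by omega), u' _ (by omega) (by omega) (by omega), hs₁ _ (by omega) (by omega), u24]
    have v40 := (v 40 (by omega)).trans u40
    have hv : ∀ x, x % 8 ≠ 4 → x % 8 ≠ 5 → x ≠ 24 → x ≠ 32 → x ≠ 40 → x ≠ 48 → x ≠ 88 →
        Function.update mem₂ 32 e x = mem x := fun x a b c d e f g => by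
      rw [v _ d, us _ a b c e f g]
    have v0 := hv 0 (by omega) (by omega) (by omega) (by omega) (by omega) (by omega) (by omega)
    have v8 := hv 8 (by omega) (by omega) (by omega) (by omega) (by omega) (by omega) (by omega)
    have v16 := hv 16 (by omega) (by omega) (by omega) (by omega) (by omega) (by omega) (by omega)
    have hAv : Assigned A t (mem 16) mem (Function.update mem₂ 32 e) := by
      intro j hj
      rw [v _ (by omega), v _ (by omega)]
      exact hAM j hj
    have hs : ∀ x < 8 * (m + n + 20), x % 8 = 1 ∨ x % 8 = 2 ∨ x = 0 ∨ x = 8 ∨ x = 16 →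
        Function.update mem₂ 32 e x = mem x := fun x _ hx =>
      hv x (by omega) (by omega) (by omega) (by omega) (by omega) (by omega) (by omega)
    have v32 : Function.update mem₂ 32 e 32 = e := Function.update_self ..
    have := calls_lower_tall (mem := Function.update mem₂ 32 e) (t := t) hW
      (h.congr fun x _ a b c d e f => hv x (by omega) (by omega) b c d e f)
      (Blocks.of_assigned h ht1 hAv hs v24 v40.ge (by rw [v40]; omega)) (Cover.of_assigned h ht1 hAv hs v24 v40)
      v24 (by rw [v40, v16]) ((v 48 (by omega)).trans u48) ((v 88 (by omega)).trans u88) ht1 (by omega)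
      (by rw [v16, v8]; exact ht2) (by omega) (by rw [v16, v32]; exact a3)
    rw [v 56 (by omega), v 64 (by omega)] at this
    have hred : ∀ mem', Reduced A (Function.update mem₂ 32 e) mem' → Reduced A mem mem' := fun mem' hr =>
      ⟨hr.core, hr.flag.trans v0, hr.row.trans v8, hr.col.trans v16⟩
    refine this.mono ?_
    rintro r mem' T' ⟨p1, p2, p3, p4⟩
    rw [v16, v8, v32] at p3
    refine ⟨fun hr => hred _ (p1 hr), p2.trans v16, fun hr => ⟨hred _ (p3 hr).1, (p3 hr).2.imp_left fun hr => hr.trans a2⟩, by omega⟩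
  rw [u16] at hT₁
  have hp : 0 < 2 ^ loc 2 := by positivity
  have hp2 : 2 ^ loc 2 ≤ 2 ^ (16 * t) := Nat.pow_le_pow_right (by omega) l2
  have hp3 : 2 ^ (16 * t + 1) = 2 * 2 ^ (16 * t) := by ring
  have hdiv := Nat.div_le_self (mem 16) (loc 1)
  repeat refine And.intro (by omega) ?_
  refine ⟨fun g1 => ?_, fun g1 => ?_⟩
  · repeat refine And.intro (by omega) ?_
    refine run_call_of_eq (hcall (mem 16 / loc 1) g1 ?_ ?_) (by simp <;> omega) (by simp) rfl ?_
    -- A quotient of at least 1 means that the loop was ended by its count and not by the size of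
    -- the power.
    · have hj : loc 2 = 16 * t := by
        by_contra hj
        have := Nat.div_eq_of_lt (show mem 16 < loc 1 by omega)
        omega
      rw [l1, hj]
      exact le_max_right _ _
    · have k1 := Nat.lt_div_mul_add (a := mem 16) (show 0 < loc 1 by omega)
      have k2 : 1 * loc 1 ≤ mem 16 / loc 1 * loc 1 := Nat.mul_le_mul_right _ g1
      have k3 : mem 16 / loc 1 * (2 * loc 1) ≤ mem 16 / loc 1 * 2 ^ (16 * t + 1) :=
        Nat.mul_le_mul_left _ (by omega)
      have k4 : mem 16 / loc 1 * (2 * loc 1) = 2 * (mem 16 / loc 1 * loc 1) := by ring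
      omega
    rintro r mem₃ ent₃ T₃ ⟨p1, p2, p3, p4⟩
    simp only [List.map_cons, List.map_nil, List.sum_cons, List.sum_nil, seqs, lt, arr, ↓wp_seq, ↓wp_assign, ↓wp_branch, ↓wp_query, ↓wp_skip, ↓wp_store, ↓wp_loop,
    ↓wp_call, Test.Ok, Test.Holds, Test.time, Expr.Ok, Expr.val, Expr.time, Function.update_apply,
    Nat.reduceEqDiff, reduceIte, OfNat.ofNat_ne_zero, OfNat.ofNat_ne_one, OfNat.zero_ne_ofNat,
    OfNat.one_ne_ofNat, one_ne_zero, zero_ne_one, List.getD_cons_zero, List.getD_cons_succ,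
    List.getD_nil, true_and, and_true, and_assoc, not_le, Nat.reduceAdd, Nat.reduceMul]
    repeat refine And.intro (by omega) ?_
    refine ⟨fun g2 => ?_, fun g2 => ?_⟩
    · exact ⟨(p3 g2).1, (p3 g2).2, by omega⟩
    · repeat refine And.intro (by omega) ?_
      exact ⟨p1 (by omega), .inl (by omega), by omega⟩
  · repeat refine And.intro (by omega) ?_
    have k1 : mem 16 < loc 1 := by
      by_contra hcon
      have := Nat.div_pos (not_lt.1 hcon) (by omega)
      omega
    refine run_call_of_eq (hcall 1 le_rfl (le_max_left _ _) (by omega)) (by simp <;> omega) (by simp) rfl ?_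
    rintro r mem₃ ent₃ T₃ ⟨p1, p2, p3, p4⟩
    simp only [List.map_cons, List.map_nil, List.sum_cons, List.sum_nil, seqs, lt, arr, ↓wp_seq, ↓wp_assign, ↓wp_branch, ↓wp_query, ↓wp_skip, ↓wp_store, ↓wp_loop,
    ↓wp_call, Test.Ok, Test.Holds, Test.time, Expr.Ok, Expr.val, Expr.time, Function.update_apply,
    Nat.reduceEqDiff, reduceIte, OfNat.ofNat_ne_zero, OfNat.ofNat_ne_one, OfNat.zero_ne_ofNat,
    OfNat.one_ne_ofNat, one_ne_zero, zero_ne_one, List.getD_cons_zero, List.getD_cons_succ,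
    List.getD_nil, true_and, and_true, and_assoc, not_le, Nat.reduceAdd, Nat.reduceMul]
    repeat refine And.intro (by omega) ?_
    refine ⟨fun g2 => ?_, fun g2 => ?_⟩
    · exact ⟨(p3 g2).1, (p3 g2).2, by omega⟩
    · repeat refine And.intro (by omega) ?_
      exact ⟨p1 (by omega), .inl (by omega), by omega⟩

end Saddle

/-! ### Compacting the lists of rows and columns -/

namespace Saddle

open RAM Expr Test Cmd

variable {α : Type*} [LinearOrder α] {m n : ℕ} {W : ℕ} {A : Matrix (Fin m) (Fin n) α}
  {mem mem' : ℕ → ℕ}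

theorem alive_succ (mem : ℕ → ℕ) (k : ℕ) :
    alive mem (k + 1) = alive mem k + if mem (8 * k + 3) = 0 then 1 else 0 := by
  rw [alive, alive, Finset.range_add_one, Finset.filter_insert]
  split
  · rw [Finset.card_insert_of_notMem (by simp)]
  · rfl

/-- The invariant between the steps of the reduction. -/
structure Clean (A : Matrix (Fin m) (Fin n) α) (mem : ℕ → ℕ) : Prop where
  core : Core A 0 mem
  zero : ∀ k < m + n, mem (8 * k + 3) = 0

/-- The first `i` rows have been compacted. -/
structure Compacted (mem mem' : ℕ → ℕ) (i : ℕ) : Prop where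
  same : ∀ x, x % 8 ≠ 1 → x % 8 ≠ 3 → mem' x = mem x
  later : ∀ k, i ≤ k → mem' (8 * k + 1) = mem (8 * k + 1) ∧ mem' (8 * k + 3) = mem (8 * k + 3)
  zero : ∀ k < i, mem' (8 * k + 3) = 0
  old : ∀ k < alive mem i, ∃ k' < i, mem' (8 * k + 1) = mem (8 * k' + 1)
  new : ∀ k < i, mem (8 * k + 3) = 0 → ∃ k' < alive mem i, mem' (8 * k' + 1) = mem (8 * k + 1)
  inj : ∀ j k, j < k → k < alive mem i → mem' (8 * j + 1) ≠ mem' (8 * k + 1)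

theorem Compacted.skip {i : ℕ} (h : Compacted mem mem' i) (hi : mem (8 * i + 3) ≠ 0) :
    Compacted mem (Function.update mem' (8 * i + 3) 0) (i + 1) := by
  have u : ∀ x, x ≠ 8 * i + 3 → Function.update mem' (8 * i + 3) 0 x = mem' x := fun x hx =>
    Function.update_of_ne hx _ _
  have hsucc : alive mem (i + 1) = alive mem i := by rw [alive_succ, if_neg hi, add_zero]
  refine ⟨fun x a b => ?_, fun k hk => ?_, fun k hk => ?_, fun k hk => ?_, fun k hk hk' => ?_, fun j k hj hk => ?_⟩
  · rw [u _ (by omega), h.same x a b]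
  · rw [u _ (by omega), u _ (by omega)]
    exact h.later k (by omega)
  · by_cases hki : k = i
    · rw [hki, Function.update_self]
    · rw [u _ (by omega)]
      exact h.zero k (by omega)
  · rw [u _ (by omega)]
    obtain ⟨k', a, b⟩ := h.old k (hsucc ▸ hk)
    exact ⟨k', by omega, b⟩
  · have hki : k ≠ i := fun hki => hi (hki ▸ hk')
    obtain ⟨k', a, b⟩ := h.new k (by omega) hk'
    exact ⟨k', by omega, by rwa [u _ (by omega)]⟩
  · rw [u _ (by omega), u _ (by omega)]
    exact h.inj j k hj (hsucc ▸ hk)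

/-- The list is compacted in place. This is sound because the writing index `alive mem i` never
overtakes the reading index `i`, so the part still to be read is unchanged. -/
theorem Compacted.keep {i N : ℕ} (h : Compacted mem mem' i) (hi : mem (8 * i + 3) = 0) (hN : i < N)
    (hinj : ∀ j < N, ∀ k < N, mem (8 * j + 1) = mem (8 * k + 1) → j = k) :
    Compacted mem (Function.update mem' (8 * alive mem i + 1) (mem (8 * i + 1))) (i + 1) := by
  have hal := alive_le mem i
  have u : ∀ x, x ≠ 8 * alive mem i + 1 →
      Function.update mem' (8 * alive mem i + 1) (mem (8 * i + 1)) x = mem' x := fun x hx =>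
    Function.update_of_ne hx _ _
  have hsucc : alive mem (i + 1) = alive mem i + 1 := by rw [alive_succ, if_pos hi]
  refine ⟨fun x a b => ?_, fun k hk => ?_, fun k hk => ?_, fun k hk => ?_, fun k hk hk' => ?_, fun j k hj hk => ?_⟩
  · rw [u _ (by omega), h.same x a b]
  · rw [u _ (by omega), u _ (by omega)]
    exact h.later k (by omega)
  · rw [u _ (by omega)]
    by_cases hki : k = i
    · rw [hki, (h.later i le_rfl).2, hi]
    · exact h.zero k (by omega)
  · by_cases hki : k = alive mem i
    · exact ⟨i, by omega, by rw [hki, Function.update_self]⟩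
    · obtain ⟨k', a, b⟩ := h.old k (by omega)
      exact ⟨k', by omega, by rwa [u _ (by omega)]⟩
  · by_cases hki : k = i
    · exact ⟨alive mem i, by omega, by rw [hki, Function.update_self]⟩
    · obtain ⟨k', a, b⟩ := h.new k (by omega) hk'
      exact ⟨k', by omega, by rwa [u _ (by omega)]⟩
  · rw [u (8 * j + 1) (by omega)]
    by_cases hki : k = alive mem i
    · obtain ⟨k', a, b⟩ := h.old j (by omega)
      rw [hki, Function.update_self, b]
      intro hc
      have := hinj k' (by omega) i hN hc
      omega
    · rw [u _ (by omega)]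
      exact h.inj j k hj (by omega)

theorem calls_compact (hW : 1000 * (m + n + 20) ≤ W) (h : Core A (mem 88) mem) :
    Calls procs W A 14 [] mem fun _ mem' T => Clean A mem' ∧ mem' 8 = alive mem (mem 8) ∧
      mem' 16 = mem 16 - mem 88 ∧ T ≤ 100 * (mem 8 + mem 16) + 100 := by
  refine ⟨compactBody, rfl, fun ent => run_of_wp ?_⟩
  have hml := h.row_le
  have hnl := h.col_le
  simp only [compactBody, seqs, lt, arr, ↓wp_seq, ↓wp_assign, ↓wp_branch, ↓wp_query, ↓wp_skip, ↓wp_store, ↓wp_loop,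
    ↓wp_call, Test.Ok, Test.Holds, Test.time, Expr.Ok, Expr.val, Expr.time, Function.update_apply,
    Nat.reduceEqDiff, reduceIte, OfNat.ofNat_ne_zero, OfNat.ofNat_ne_one, OfNat.zero_ne_ofNat,
    OfNat.one_ne_ofNat, one_ne_zero, zero_ne_one, List.getD_cons_zero, List.getD_cons_succ,
    List.getD_nil, true_and, and_true, and_assoc, not_le, Nat.reduceAdd, Nat.reduceMul]
  repeat refine And.intro (by omega) ?_
  refine run_loop (fun s => mem 16 - s.loc 0) (fun s T => s.loc 0 = mem 88 + s.loc 1 ∧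
    (s.loc 1 = 0 ∨ mem 88 + s.loc 1 ≤ mem 16) ∧ (∀ x, x % 8 ≠ 2 → s.mem x = mem x) ∧
    (∀ j < s.loc 1, s.mem (8 * j + 2) = mem (8 * (mem 88 + j) + 2)) ∧
    (∀ j, s.loc 1 ≤ j → s.mem (8 * j + 2) = mem (8 * j + 2)) ∧ T ≤ 50 * s.loc 1) ?_ ?_ ?_
  · exact ⟨rfl, .inl rfl, fun _ _ => rfl, fun j hj => absurd hj (by simp), fun _ _ => rfl, Nat.zero_le _⟩
  · rintro ⟨loc, mem₁, ent₁⟩ T ⟨h0, h1, h2, h3, h4, hT⟩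
    dsimp only at *
    have e16 := h2 16 (by omega)
    refine ⟨by simp; omega, fun hb => run_of_wp ?_⟩
    simp only [e16, seqs, lt, arr, ↓wp_seq, ↓wp_assign, ↓wp_branch, ↓wp_query, ↓wp_skip, ↓wp_store, ↓wp_loop,
    ↓wp_call, Test.Ok, Test.Holds, Test.time, Expr.Ok, Expr.val, Expr.time, Function.update_apply,
    Nat.reduceEqDiff, reduceIte, OfNat.ofNat_ne_zero, OfNat.ofNat_ne_one, OfNat.zero_ne_ofNat,
    OfNat.one_ne_ofNat, one_ne_zero, zero_ne_one, List.getD_cons_zero, List.getD_cons_succ,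
    List.getD_nil, true_and, and_true, and_assoc, not_le, Nat.reduceAdd, Nat.reduceMul] at hb ⊢
    repeat refine And.intro (by omega) ?_
    refine ⟨fun x hx => ?_, fun j hj => ?_, fun j hj => ?_, by omega, by omega⟩
    · rw [if_neg (by omega)]
      exact h2 x hx
    · by_cases hj1 : j = loc 1
      · rw [if_pos (by omega), h4 _ (by omega), h0, hj1]
      · rw [if_neg (by omega)]
        exact h3 j (by omega)
    · rw [if_neg (by omega)]
      exact h4 j (by omega)
  rintro ⟨loc, mem₁, ent₁⟩ T ⟨h0, h1, h2, h3, h4, hT⟩ hb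
  dsimp only at *
  have e16 := h2 16 (by omega)
  simp only [e16, seqs, lt, arr, ↓wp_seq, ↓wp_assign, ↓wp_branch, ↓wp_query, ↓wp_skip, ↓wp_store, ↓wp_loop,
    ↓wp_call, Test.Ok, Test.Holds, Test.time, Expr.Ok, Expr.val, Expr.time, Function.update_apply,
    Nat.reduceEqDiff, reduceIte, OfNat.ofNat_ne_zero, OfNat.ofNat_ne_one, OfNat.zero_ne_ofNat,
    OfNat.one_ne_ofNat, one_ne_zero, zero_ne_one, List.getD_cons_zero, List.getD_cons_succ,
    List.getD_nil, true_and, and_true, and_assoc, not_le, Nat.reduceAdd, Nat.reduceMul] at hb ⊢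
  repeat refine And.intro (by omega) ?_
  obtain ⟨j, hj⟩ : ∃ j, j = loc 1 := ⟨_, rfl⟩
  rw [← hj] at h0 h1 h3 hT ⊢
  clear h4
  obtain ⟨M, hM⟩ : ∃ M, M = Function.update mem₁ 16 j := ⟨_, rfl⟩
  have u : ∀ x, x ≠ 16 → M x = mem₁ x := fun x a => by rw [hM, Function.update_of_ne a]
  have u16 : M 16 = j := by rw [hM, Function.update_self]
  have us : ∀ x, x % 8 ≠ 2 → x ≠ 16 → M x = mem x := fun x a b => (u x b).trans (h2 x a)
  have u8 := us 8 (by omega) (by omega)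
  have uk : ∀ k, alive M k = alive mem k := fun k => by
    rw [alive, alive]
    congr 1
    exact Finset.filter_congr fun x _ => by rw [us _ (by omega) (by omega)]
  refine run_for (fun i s => s.loc 0 = i ∧ s.loc 1 = alive M i ∧ Compacted M s.mem i) 0 (mem 8) 50
    (Nat.zero_le _) ?_ ?_ ?_ ?_
  · refine ⟨rfl, rfl, ?_⟩
    rw [← hM]
    exact ⟨fun _ _ _ => rfl, fun _ _ => ⟨rfl, rfl⟩, fun k hk => absurd hk (by omega),
      fun k hk => absurd hk (by simp [alive]), fun k hk => absurd hk (by omega),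
      fun j k _ hk => absurd hk (by simp [alive])⟩
  · rintro i ⟨loc', mem₂, ent₂⟩ - hi ⟨l0, l1, l2⟩
    dsimp only at *
    have e8 := l2.same 8 (by omega) (by omega)
    have hal := alive_le M i
    have hsucc := alive_succ M i
    refine ⟨by simp; omega, by simp [l0]; omega, run_of_wp ?_⟩
    simp only [l0, seqs, lt, arr, ↓wp_seq, ↓wp_assign, ↓wp_branch, ↓wp_query, ↓wp_skip, ↓wp_store, ↓wp_loop,
    ↓wp_call, Test.Ok, Test.Holds, Test.time, Expr.Ok, Expr.val, Expr.time, Function.update_apply,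
    Nat.reduceEqDiff, reduceIte, OfNat.ofNat_ne_zero, OfNat.ofNat_ne_one, OfNat.zero_ne_ofNat,
    OfNat.one_ne_ofNat, one_ne_zero, zero_ne_one, List.getD_cons_zero, List.getD_cons_succ,
    List.getD_nil, true_and, and_true, and_assoc, not_le, Nat.reduceAdd, Nat.reduceMul]
    rw [(l2.later i le_rfl).2]
    repeat refine And.intro (by omega) ?_
    refine ⟨fun g => ?_, fun g => ?_⟩
    · repeat refine And.intro (by omega) ?_
      rw [if_neg (by omega), add_zero] at hsucc
      exact ⟨by omega, l2.skip (by omega), by omega⟩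
    · repeat refine And.intro (by omega) ?_
      rw [if_pos (by omega)] at hsucc
      refine ⟨by omega, ?_, by omega⟩
      rw [l1, (l2.later i le_rfl).1]
      refine l2.keep (by omega) hi fun j hj k hk => ?_
      rw [us _ (by omega) (by omega), us _ (by omega) (by omega)]
      exact h.row_inj j hj k hk
  · rintro ⟨loc', mem₂, ent₂⟩ ⟨l0, l1, l2⟩
    dsimp only at *
    have e8 := l2.same 8 (by omega) (by omega)
    exact ⟨by simp; omega, by simp; omega⟩
  rintro ⟨loc', mem₂, ent₂⟩ T' ⟨l0, l1, l2⟩ hT'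
  dsimp only at *
  simp only [seqs, lt, arr, ↓wp_seq, ↓wp_assign, ↓wp_branch, ↓wp_query, ↓wp_skip, ↓wp_store, ↓wp_loop,
    ↓wp_call, Test.Ok, Test.Holds, Test.time, Expr.Ok, Expr.val, Expr.time, Function.update_apply,
    Nat.reduceEqDiff, reduceIte, OfNat.ofNat_ne_zero, OfNat.ofNat_ne_one, OfNat.zero_ne_ofNat,
    OfNat.one_ne_ofNat, one_ne_zero, zero_ne_one, List.getD_cons_zero, List.getD_cons_succ,
    List.getD_nil, true_and, and_true, and_assoc, not_le, Nat.reduceAdd, Nat.reduceMul] at hT' ⊢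
  repeat refine And.intro (by omega) ?_
  have hal := alive_le mem (mem 8)
  rw [uk] at l1
  obtain ⟨M', hM'⟩ : ∃ M', M' = Function.update mem₂ 8 (loc' 1) := ⟨_, rfl⟩
  rw [← hM']
  have v : ∀ x, x ≠ 8 → M' x = mem₂ x := fun x a => by rw [hM', Function.update_of_ne a]
  have v8 : M' 8 = alive mem (mem 8) := by rw [hM', Function.update_self, l1]
  have v16 : M' 16 = j := by rw [v _ (by omega), l2.same _ (by omega) (by omega), u16]
  have vs : ∀ x, x % 8 = 0 → x ≠ 8 → x ≠ 16 → M' x = mem x := fun x a b c => by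
    rw [v x b, l2.same x (by omega) (by omega), us x (by omega) c]
  have v2 : ∀ k < j, M' (8 * k + 2) = mem (8 * (mem 88 + k) + 2) := fun k hk => by
    rw [v _ (by omega), l2.same _ (by omega) (by omega), u _ (by omega)]
    exact h3 k hk
  have v1 : ∀ k, M' (8 * k + 1) = mem₂ (8 * k + 1) := fun k => v _ (by omega)
  have us1 : ∀ k, M (8 * k + 1) = mem (8 * k + 1) := fun k => us _ (by omega) (by omega)
  have v3 : ∀ k < m + n, M' (8 * k + 3) = 0 := by
    intro k hk
    rw [v _ (by omega)]
    by_cases hk' : k < mem 8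
    · exact l2.zero k hk'
    · rw [(l2.later k (by omega)).2, us _ (by omega) (by omega)]
      exact h.dead_zero k hk (by omega)
  have hlo : loKey A M' = loKey A mem := by
    rw [loKey, loKey, vs 0 (by omega) (by omega) (by omega), vs 56 (by omega) (by omega) (by omega),
      vs 64 (by omega) (by omega) (by omega)]
  have hhi : hiKey A M' = hiKey A mem := by
    rw [hiKey, hiKey, vs 0 (by omega) (by omega) (by omega), vs 72 (by omega) (by omega) (by omega),
      vs 80 (by omega) (by omega) (by omega)]
  have e16' := l2.same 16 (by omega) (by omega)
  refine ⟨⟨?_, v3⟩, by omega, by omega, by omega⟩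
  have old := l2.old
  have new := l2.new
  have inj := l2.inj
  simp only [← v1, us1, uk] at old new inj
  have v0 := vs 0 (by omega) (by omega) (by omega)
  constructor <;> simp only [hlo, hhi, v0, v8, v16, vs 56 (by omega) (by omega) (by omega),
    vs 64 (by omega) (by omega) (by omega), vs 72 (by omega) (by omega) (by omega),
    vs 80 (by omega) (by omega) (by omega), vs 96 (by omega) (by omega) (by omega)]
  · exact h.flag
  · exact h.size
  · omega
  · omega
  · intro k hk
    obtain ⟨k', a, b⟩ := old k hk
    exact b ▸ h.row k' a
  · intro k hk
    rw [v2 k hk]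
    exact h.col _ (by omega)
  · intro a ha b hb he
    rcases lt_trichotomy a b with hab | hab | hab
    · exact (inj a b hab hb he).elim
    · exact hab
    · exact (inj b a hab ha he.symm).elim
  · intro a ha b hb he
    rw [v2 a ha, v2 b hb] at he
    have := h.col_inj _ (by omega) _ (by omega) he
    omega
  · exact h.lo_row
  · exact h.lo_col
  · exact h.hi_row
  · exact h.hi_col
  · exact h.lo
  · exact h.hi
  · intro r hr
    refine (h.dead_row r hr).imp_left ?_
    rintro ⟨k, a, b, c⟩
    obtain ⟨k', d, e⟩ := new k a (by rwa [us _ (by omega) (by omega)])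
    exact ⟨k', d, by rw [e, b], v3 k' (by omega)⟩
  · intro c hc
    refine (h.dead_col c hc).imp_left ?_
    rintro ⟨k, a, b, rfl⟩
    exact ⟨k - mem 88, Nat.zero_le _, by omega, by rw [v2 _ (by omega)]; congr 2; omega⟩
  · exact fun k hk _ => v3 k hk

end Saddle

/-! ### Exchanging rows and columns, initialization, and reading off a value -/

namespace Saddle

open RAM Expr Test Cmd

variable {α : Type*} [LinearOrder α] {m n : ℕ} {W : ℕ} {A : Matrix (Fin m) (Fin n) α}
  {mem mem' : ℕ → ℕ}

/-- The roles of rows and columns have been exchanged. -/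
structure Swapped (mem mem' : ℕ → ℕ) : Prop where
  flag : mem' 0 = 1 - mem 0
  height : mem' 8 = mem 16
  width : mem' 16 = mem 8
  lo_row : mem' 56 = mem 80
  lo_col : mem' 64 = mem 72
  hi_row : mem' 72 = mem 64
  hi_col : mem' 80 = mem 56
  row : ∀ k < mem 16, mem' (8 * k + 1) = mem (8 * k + 2)
  col : ∀ k < mem 8, mem' (8 * k + 2) = mem (8 * k + 1)
  same : ∀ x, x % 8 ≠ 0 → x % 8 ≠ 1 → x % 8 ≠ 2 → mem' x = mem x
  size : mem' 96 = mem 96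

theorem run_exchange_loop (hW : 1000 * (m + n + 20) ≤ W) {N : ℕ} {loc : ℕ → ℕ} {ent : ℕ → Option α}
    {Q : State α → ℕ → Prop} (hN : N ≤ m + n) (h0 : loc 0 = 0) (h1 : loc 1 = N)
    (hQ : ∀ s T, (∀ k < N, s.mem (8 * k + 1) = mem (8 * k + 2) ∧ s.mem (8 * k + 2) = mem (8 * k + 1)) →
      (∀ x, x % 8 ≠ 1 → x % 8 ≠ 2 → s.mem x = mem x) → T ≤ 60 * N + 20 → Q s T) :
    Run procs W A (loop (lt (var 0) (var 1)) (.seq (exchange 2 (arr 1 (var 0)) (arr 2 (var 0)))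
      (assign 0 (add (var 0) (lit 1))))) ⟨loc, mem, ent⟩ Q := by
  refine run_for (fun i s => s.loc 0 = i ∧ s.loc 1 = N ∧
    (∀ k < i, s.mem (8 * k + 1) = mem (8 * k + 2) ∧ s.mem (8 * k + 2) = mem (8 * k + 1)) ∧
    (∀ k, i ≤ k → s.mem (8 * k + 1) = mem (8 * k + 1) ∧ s.mem (8 * k + 2) = mem (8 * k + 2)) ∧
    (∀ x, x % 8 ≠ 1 → x % 8 ≠ 2 → s.mem x = mem x)) 0 N 50 (Nat.zero_le _) ?_ ?_ ?_ ?_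
  · exact ⟨h0, h1, fun k hk => absurd hk (by omega), fun _ _ => ⟨rfl, rfl⟩, fun _ _ _ => rfl⟩
  · rintro i ⟨loc', mem₁, ent₁⟩ - hi ⟨l0, l1, l2, l3, l4⟩
    dsimp only at *
    refine ⟨by simp, by simp; omega, run_of_wp ?_⟩
    simp only [l0, exchange, seqs, lt, arr, ↓wp_seq, ↓wp_assign, ↓wp_branch, ↓wp_query, ↓wp_skip, ↓wp_store, ↓wp_loop,
    ↓wp_call, Test.Ok, Test.Holds, Test.time, Expr.Ok, Expr.val, Expr.time, Function.update_apply,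
    Nat.reduceEqDiff, reduceIte, OfNat.ofNat_ne_zero, OfNat.ofNat_ne_one, OfNat.zero_ne_ofNat,
    OfNat.one_ne_ofNat, one_ne_zero, zero_ne_one, List.getD_cons_zero, List.getD_cons_succ,
    List.getD_nil, true_and, and_true, and_assoc, not_le, Nat.reduceAdd, Nat.reduceMul]
    repeat refine And.intro (by omega) ?_
    refine ⟨fun k hk => ?_, fun k hk => ?_, fun x a b => ?_, by omega⟩
    · by_cases hki : k = i
      · subst hki
        rw [if_neg (by omega), if_pos rfl, if_pos rfl]
        exact ⟨(l3 k le_rfl).2, (l3 k le_rfl).1⟩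
      · rw [if_neg (by omega), if_neg (by omega), if_neg (by omega), if_neg (by omega)]
        exact l2 k (by omega)
    · rw [if_neg (by omega), if_neg (by omega), if_neg (by omega), if_neg (by omega)]
      exact l3 k (by omega)
    · rw [if_neg (by omega), if_neg (by omega)]
      exact l4 x a b
  · rintro ⟨loc', mem₁, ent₁⟩ ⟨l0, l1, l2, l3, l4⟩
    dsimp only at *
    exact ⟨by simp, by simp; omega⟩
  · rintro ⟨loc', mem₁, ent₁⟩ T ⟨l0, l1, l2, l3, l4⟩ hT
    simp only [seqs, lt, arr, ↓wp_seq, ↓wp_assign, ↓wp_branch, ↓wp_query, ↓wp_skip, ↓wp_store, ↓wp_loop,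
    ↓wp_call, Test.Ok, Test.Holds, Test.time, Expr.Ok, Expr.val, Expr.time, Function.update_apply,
    Nat.reduceEqDiff, reduceIte, OfNat.ofNat_ne_zero, OfNat.ofNat_ne_one, OfNat.zero_ne_ofNat,
    OfNat.one_ne_ofNat, one_ne_zero, zero_ne_one, List.getD_cons_zero, List.getD_cons_succ,
    List.getD_nil, true_and, and_true, and_assoc, not_le, Nat.reduceAdd, Nat.reduceMul] at hT
    exact hQ _ _ l2 l4 (by omega)

/-- The two lists are exchanged up to the greater of the two lengths. What this puts behind the end
of the shorter list is never read as a list element. -/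
theorem calls_swap (hW : 1000 * (m + n + 20) ≤ W) (hm : mem 8 ≤ m + n) (hn : mem 16 ≤ m + n) :
    Calls procs W A 15 [] mem fun _ mem' T => Swapped mem mem' ∧
      T ≤ 100 * (mem 8 + mem 16) + 100 := by
  refine ⟨swapBody, rfl, fun ent => run_of_wp ?_⟩
  simp only [swapBody, exchange, seqs, lt, arr, ↓wp_seq, ↓wp_assign, ↓wp_branch, ↓wp_query, ↓wp_skip, ↓wp_store, ↓wp_loop,
    ↓wp_call, Test.Ok, Test.Holds, Test.time, Expr.Ok, Expr.val, Expr.time, Function.update_apply,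
    Nat.reduceEqDiff, reduceIte, OfNat.ofNat_ne_zero, OfNat.ofNat_ne_one, OfNat.zero_ne_ofNat,
    OfNat.one_ne_ofNat, one_ne_zero, zero_ne_one, List.getD_cons_zero, List.getD_cons_succ,
    List.getD_nil, true_and, and_true, and_assoc, not_le, Nat.reduceAdd, Nat.reduceMul]
  have hsw : ∀ N, mem 8 ≤ N → mem 16 ≤ N → ∀ s : State α, (∀ k < N, s.mem (8 * k + 1) =
      Function.update (Function.update (Function.update (Function.update (Function.update
        (Function.update (Function.update mem 0 (1 - mem 0)) 8 (mem 16)) 16 (mem 8)) 56 (mem 80)) 80 (mem 56))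
        64 (mem 72)) 72 (mem 64) (8 * k + 2) ∧ s.mem (8 * k + 2) =
      Function.update (Function.update (Function.update (Function.update (Function.update
        (Function.update (Function.update mem 0 (1 - mem 0)) 8 (mem 16)) 16 (mem 8)) 56 (mem 80)) 80 (mem 56))
        64 (mem 72)) 72 (mem 64) (8 * k + 1)) → (∀ x, x % 8 ≠ 1 → x % 8 ≠ 2 → s.mem x =
      Function.update (Function.update (Function.update (Function.update (Function.update
        (Function.update (Function.update mem 0 (1 - mem 0)) 8 (mem 16)) 16 (mem 8)) 56 (mem 80)) 80 (mem 56))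
        64 (mem 72)) 72 (mem 64) x) → Swapped mem s.mem := by
    intro N hm hn s h1 h2
    have u : ∀ x, x % 8 ≠ 0 → Function.update (Function.update (Function.update (Function.update (Function.update
        (Function.update (Function.update mem 0 (1 - mem 0)) 8 (mem 16)) 16 (mem 8)) 56 (mem 80)) 80 (mem 56))
        64 (mem 72)) 72 (mem 64) x = mem x := by
      intro x hx
      repeat rw [Function.update_of_ne (by omega)]
    constructor
    on_goal 8 =>
      intro k hk
      rw [(h1 k (by omega)).1, u _ (by omega)]
    on_goal 8 =>
      intro k hk
      rw [(h1 k (by omega)).2, u _ (by omega)]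
    on_goal 8 =>
      intro x a b c
      rw [h2 x b c, u x a]
    all_goals
      rw [h2 _ (by omega) (by omega)]
      rfl
  repeat refine And.intro (by omega) ?_
  refine ⟨fun g => ?_, fun g => ?_⟩
  · repeat refine And.intro (by omega) ?_
    refine run_exchange_loop (N := mem 16) hW hn rfl rfl fun s T h1 h2 hT => ?_
    exact ⟨hsw _ g le_rfl s h1 h2, by omega⟩
  · repeat refine And.intro (by omega) ?_
    refine run_exchange_loop (N := mem 8) hW hm rfl rfl fun s T h1 h2 hT => ?_
    exact ⟨hsw _ le_rfl g.le s h1 h2, by omega⟩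

/-- Under transposition with reversed order, lo becomes -hi and conversely, and the row and column
conditions of `Core` turn into each other. Deleted rows are recorded by marks but deleted columns by
an index, so this works only between reduction steps, when both records are empty. -/
theorem Clean.of_swapped (h : Clean A mem) (hs : Swapped mem mem') : Clean A mem' := by
  have hc := h.core
  have hml := hc.row_le
  have hnl := hc.col_le
  have h3 : ∀ k, mem' (8 * k + 3) = mem (8 * k + 3) := fun k => hs.same _ (by omega) (by omega) (by omega)
  have hlo : loKey A mem' = - hiKey A mem := by
    rw [loKey, hiKey, hs.flag, hs.lo_row, hs.lo_col, key_swap A hc.flag]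
  have hhi : hiKey A mem' = - loKey A mem := by
    rw [loKey, hiKey, hs.flag, hs.hi_row, hs.hi_col, key_swap A hc.flag]
  have hz : ∀ k < m + n, mem' (8 * k + 3) = 0 := fun k hk => (h3 k).trans (h.zero k hk)
  refine ⟨?_, hz⟩
  constructor <;> simp only [hlo, hhi, hs.flag, hs.height, hs.width, hs.lo_row, hs.lo_col, hs.hi_row, hs.hi_col,
    hs.size, rows_swap hc.flag, key_swap A hc.flag, neg_le_neg_iff]
  · omega
  · exact hc.size
  · exact hnl
  · exact hml
  · exact fun k hk => hs.row k hk ▸ hc.col k hk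
  · exact fun k hk => hs.col k hk ▸ hc.row k hk
  · intro j hj k hk he
    rw [hs.row j hj, hs.row k hk] at he
    exact hc.col_inj j hj k hk he
  · intro j hj k hk he
    rw [hs.col j hj, hs.col k hk] at he
    exact hc.row_inj j hj k hk he
  · exact hc.hi_col
  · exact hc.hi_row
  · exact hc.lo_col
  · exact hc.lo_row
  · exact hc.hi
  · exact hc.lo
  · intro r hr
    refine (hc.dead_col r hr).imp_left ?_
    rintro ⟨k, -, a, b⟩
    exact ⟨k, a, (hs.row k a).trans b, hz k (by omega)⟩
  · intro c hc'
    refine (hc.dead_row c hc').imp_left ?_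
    rintro ⟨k, a, b, -⟩
    exact ⟨k, Nat.zero_le _, a, (hs.col k a).trans b⟩
  · exact fun k hk _ => hz k hk

/-- The minimum of one column is a valid lower bound: every row has an entry at least that large in
this column. -/
theorem calls_initLo (hW : 1000 * (m + n + 20) ≤ W) (ho : mem 0 ≤ 1) (hm : mem 8 = rows m n (mem 0))
    (hpos : 1 ≤ mem 8) (hR : ∀ k < mem 8, mem (8 * k + 1) = k) (hC : mem 2 = 0)
    (hn : 0 < rows n m (mem 0)) :
    Calls procs W A 16 [] mem fun _ mem' T => (∀ x, x ≠ 56 → x ≠ 64 → mem' x = mem x) ∧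
      mem' 64 = 0 ∧ mem' 56 < rows m n (mem 0) ∧
      (∀ r < rows m n (mem 0), key A (mem 0) (mem' 56) 0 ≤ key A (mem 0) r 0) ∧
      T ≤ 120 * mem 8 + 20 := by
  refine ⟨initLoBody, rfl, fun ent => run_of_wp ?_⟩
  have hml := rows_le m n (mem 0)
  simp only [initLoBody, seqs, lt, arr, ↓wp_seq, ↓wp_assign, ↓wp_branch, ↓wp_query, ↓wp_skip, ↓wp_store, ↓wp_loop,
    ↓wp_call, Test.Ok, Test.Holds, Test.time, Expr.Ok, Expr.val, Expr.time, Function.update_apply,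
    Nat.reduceEqDiff, reduceIte, OfNat.ofNat_ne_zero, OfNat.ofNat_ne_one, OfNat.zero_ne_ofNat,
    OfNat.one_ne_ofNat, one_ne_zero, zero_ne_one, List.getD_cons_zero, List.getD_cons_succ,
    List.getD_nil, true_and, and_true, and_assoc, not_le, Nat.reduceAdd, Nat.reduceMul]
  refine run_call_of_eq (calls_argmin (mem := mem) (y := mem 2) (pos := 0) (t := mem 8) hW ho (by omega)
    hpos (by omega) fun k _ hk => by rw [hR k (by omega)]; omega) (by simp <;> omega) (by
    simp only [List.map_cons, List.map_nil, List.cons.injEq, seqs, lt, arr, ↓wp_seq, ↓wp_assign, ↓wp_branch, ↓wp_query, ↓wp_skip, ↓wp_store, ↓wp_loop,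
    ↓wp_call, Test.Ok, Test.Holds, Test.time, Expr.Ok, Expr.val, Expr.time, Function.update_apply,
    Nat.reduceEqDiff, reduceIte, OfNat.ofNat_ne_zero, OfNat.ofNat_ne_one, OfNat.zero_ne_ofNat,
    OfNat.one_ne_ofNat, one_ne_zero, zero_ne_one, List.getD_cons_zero, List.getD_cons_succ,
    List.getD_nil, true_and, and_true, and_assoc, not_le, Nat.reduceAdd, Nat.reduceMul]
    all_goals omega) rfl ?_
  rintro r mem₁ ent₁ T ⟨rfl, ⟨k, -, k1, rfl⟩, k2, hT⟩
  simp only [hC, List.map_cons, List.map_nil, List.sum_cons, List.sum_nil, seqs, lt, arr, ↓wp_seq, ↓wp_assign, ↓wp_branch, ↓wp_query, ↓wp_skip, ↓wp_store, ↓wp_loop,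
    ↓wp_call, Test.Ok, Test.Holds, Test.time, Expr.Ok, Expr.val, Expr.time, Function.update_apply,
    Nat.reduceEqDiff, reduceIte, OfNat.ofNat_ne_zero, OfNat.ofNat_ne_one, OfNat.zero_ne_ofNat,
    OfNat.one_ne_ofNat, one_ne_zero, zero_ne_one, List.getD_cons_zero, List.getD_cons_succ,
    List.getD_nil, true_and, and_true, and_assoc, not_le, Nat.reduceAdd, Nat.reduceMul]
  repeat refine And.intro (by omega) ?_
  refine ⟨fun x a b => ?_, by rw [hR k (by omega)]; omega, fun r hr => ?_, by omega⟩
  · rw [if_neg b, if_neg a]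
  · have := k2 r (Nat.zero_le _) (by omega)
    rwa [hC, hR r (by omega)] at this

/-- The key in cells `72` and `80` becomes the smaller one of the upper bound and the given key. -/
theorem calls_lowerHi_eq (hW : 1000 * (m + n + 20) ≤ W) {al r c : ℕ} (h : Core A al mem)
    (hr : r < rows m n (mem 0)) (hc : c < rows n m (mem 0)) :
    Calls procs W A 9 [r, c] mem fun _ mem' T => (∀ x, x ≠ 72 → x ≠ 80 → mem' x = mem x) ∧
      mem' 72 < rows m n (mem 0) ∧ mem' 80 < rows n m (mem 0) ∧
      hiKey A mem' = min (hiKey A mem) (key A (mem 0) r c) ∧ T ≤ 120 := by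
  refine ⟨lowerHiBody, rfl, fun ent => run_of_wp ?_⟩
  simp only [lowerHiBody, seqs, lt, arr, ↓wp_seq, ↓wp_assign, ↓wp_branch, ↓wp_query, ↓wp_skip, ↓wp_store, ↓wp_loop,
    ↓wp_call, Test.Ok, Test.Holds, Test.time, Expr.Ok, Expr.val, Expr.time, Function.update_apply,
    Nat.reduceEqDiff, reduceIte, OfNat.ofNat_ne_zero, OfNat.ofNat_ne_one, OfNat.zero_ne_ofNat,
    OfNat.one_ne_ofNat, one_ne_zero, zero_ne_one, List.getD_cons_zero, List.getD_cons_succ,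
    List.getD_nil, true_and, and_true, and_assoc, not_le, Nat.reduceAdd, Nat.reduceMul]
  refine run_call_of_eq (calls_cmp hW h.flag hr hc h.hi_row h.hi_col) (by simp <;> omega) (by
    simp only [List.map_cons, List.map_nil, List.cons.injEq, seqs, lt, arr, ↓wp_seq, ↓wp_assign, ↓wp_branch, ↓wp_query, ↓wp_skip, ↓wp_store, ↓wp_loop,
    ↓wp_call, Test.Ok, Test.Holds, Test.time, Expr.Ok, Expr.val, Expr.time, Function.update_apply,
    Nat.reduceEqDiff, reduceIte, OfNat.ofNat_ne_zero, OfNat.ofNat_ne_one, OfNat.zero_ne_ofNat,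
    OfNat.one_ne_ofNat, one_ne_zero, zero_ne_one, List.getD_cons_zero, List.getD_cons_succ,
    List.getD_nil, true_and, and_true, and_assoc, not_le, Nat.reduceAdd, Nat.reduceMul]
    all_goals omega) rfl ?_
  rintro v mem₁ ent₁ T ⟨rfl, hv, hT⟩
  simp only [List.map_cons, List.map_nil, List.sum_cons, List.sum_nil, seqs, lt, arr, ↓wp_seq, ↓wp_assign, ↓wp_branch, ↓wp_query, ↓wp_skip, ↓wp_store, ↓wp_loop,
    ↓wp_call, Test.Ok, Test.Holds, Test.time, Expr.Ok, Expr.val, Expr.time, Function.update_apply,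
    Nat.reduceEqDiff, reduceIte, OfNat.ofNat_ne_zero, OfNat.ofNat_ne_one, OfNat.zero_ne_ofNat,
    OfNat.one_ne_ofNat, one_ne_zero, zero_ne_one, List.getD_cons_zero, List.getD_cons_succ,
    List.getD_nil, true_and, and_true, and_assoc, not_le, Nat.reduceAdd, Nat.reduceMul]
  refine ⟨by omega, fun h1 => ?_, fun h1 => ?_⟩
  · have hlt : key A (mem₁ 0) r c < hiKey A mem₁ := by
      by_contra h9
      rw [hiKey] at h9
      rw [if_neg h9] at hv
      omega
    repeat refine And.intro (by omega) ?_
    refine ⟨fun x a b => ?_, hr, hc, ?_, by omega⟩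
    · rw [if_neg b, if_neg a]
    · rw [min_eq_right hlt.le, hiKey]
      rfl
  · refine ⟨fun _ _ _ => trivial, h.hi_row, h.hi_col, ?_, by omega⟩
    rw [min_eq_left]
    by_contra h9
    rw [hiKey, not_le] at h9
    rw [if_pos h9] at hv
    omega

/-- The same procedure yields both bounds. The minimum of the first column is taken as lo and
becomes hi by the exchange of roles; then the first column of the transposed matrix gives the new
lo. The search thus starts with the roles exchanged. -/
theorem calls_init (hW : 1000 * (m + n + 20) ≤ W) (hm : 1 ≤ m) (hn : 1 ≤ n) :
    Calls procs W A 17 [m, n] (fun _ => 0) fun _ mem' T => Clean A mem' ∧ mem' 8 = n ∧ mem' 16 = m ∧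
      T ≤ 1000 * (m + n) := by
  refine ⟨initBody, rfl, fun ent => run_of_wp ?_⟩
  simp only [initBody, seqs, lt, arr, ↓wp_seq, ↓wp_assign, ↓wp_branch, ↓wp_query, ↓wp_skip, ↓wp_store, ↓wp_loop,
    ↓wp_call, Test.Ok, Test.Holds, Test.time, Expr.Ok, Expr.val, Expr.time, Function.update_apply,
    Nat.reduceEqDiff, reduceIte, OfNat.ofNat_ne_zero, OfNat.ofNat_ne_one, OfNat.zero_ne_ofNat,
    OfNat.one_ne_ofNat, one_ne_zero, zero_ne_one, List.getD_cons_zero, List.getD_cons_succ,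
    List.getD_nil, true_and, and_true, and_assoc, not_le, Nat.reduceAdd, Nat.reduceMul]
  repeat refine And.intro (by omega) ?_
  obtain ⟨M, hM⟩ : ∃ M : ℕ → ℕ, M = Function.update (Function.update (Function.update (fun _ => 0) 8 m) 16 n) 96 (m + n) := ⟨_, rfl⟩
  have hM0 : ∀ x, x ≠ 8 → x ≠ 16 → x ≠ 96 → M x = 0 := fun x a b c => by
    rw [hM, Function.update_of_ne c, Function.update_of_ne b, Function.update_of_ne a]
  rw [← hM]
  refine run_for (fun i s => s.loc 0 = m ∧ s.loc 1 = n ∧ s.loc 2 = i ∧ s.loc 3 = 0 ∧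
    (∀ k < i, s.mem (8 * k + 1) = k) ∧ (∀ x, x % 8 ≠ 1 → s.mem x = M x)) 0 m 30 (Nat.zero_le _) ?_ ?_ ?_ ?_
  · exact ⟨rfl, rfl, rfl, rfl, fun k hk => absurd hk (by omega), fun _ _ => rfl⟩
  · rintro i ⟨loc, mem₁, ent₁⟩ - hi ⟨l0, l1, l2, l3, l4, l5⟩
    dsimp only at *
    refine ⟨by simp, by simp; omega, run_of_wp ?_⟩
    simp only [l2, seqs, lt, arr, ↓wp_seq, ↓wp_assign, ↓wp_branch, ↓wp_query, ↓wp_skip, ↓wp_store, ↓wp_loop,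
    ↓wp_call, Test.Ok, Test.Holds, Test.time, Expr.Ok, Expr.val, Expr.time, Function.update_apply,
    Nat.reduceEqDiff, reduceIte, OfNat.ofNat_ne_zero, OfNat.ofNat_ne_one, OfNat.zero_ne_ofNat,
    OfNat.one_ne_ofNat, one_ne_zero, zero_ne_one, List.getD_cons_zero, List.getD_cons_succ,
    List.getD_nil, true_and, and_true, and_assoc, not_le, Nat.reduceAdd, Nat.reduceMul]
    repeat refine And.intro (by omega) ?_
    refine ⟨fun k hk => ?_, fun x a => ?_, by omega⟩
    · by_cases hki : k = i
      · rw [if_pos (by omega), hki]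
      · rw [if_neg (by omega), l4 k (by omega)]
    · rw [if_neg (by omega), l5 x a]
  · rintro ⟨loc, mem₁, ent₁⟩ ⟨l0, l1, l2, -⟩
    dsimp only at *
    exact ⟨by simp, by simp; omega⟩
  rintro ⟨loc, mem₁, ent₁⟩ T₁ ⟨l0, l1, l2, l3, l4, l5⟩ hT₁
  dsimp only at *
  refine run_for (fun i s => s.loc 1 = n ∧ s.loc 3 = i ∧
    (∀ k < i, s.mem (8 * k + 2) = k) ∧ (∀ x, x % 8 ≠ 2 → s.mem x = mem₁ x)) 0 n 30 (Nat.zero_le _) ?_ ?_ ?_ ?_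
  · exact ⟨l1, l3, fun k hk => absurd hk (by omega), fun _ _ => rfl⟩
  · rintro i ⟨loc', mem₂, ent₂⟩ - hi ⟨k1, k3, k4, k5⟩
    dsimp only at *
    refine ⟨by simp, by simp; omega, run_of_wp ?_⟩
    simp only [k3, seqs, lt, arr, ↓wp_seq, ↓wp_assign, ↓wp_branch, ↓wp_query, ↓wp_skip, ↓wp_store, ↓wp_loop,
    ↓wp_call, Test.Ok, Test.Holds, Test.time, Expr.Ok, Expr.val, Expr.time, Function.update_apply,
    Nat.reduceEqDiff, reduceIte, OfNat.ofNat_ne_zero, OfNat.ofNat_ne_one, OfNat.zero_ne_ofNat,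
    OfNat.one_ne_ofNat, one_ne_zero, zero_ne_one, List.getD_cons_zero, List.getD_cons_succ,
    List.getD_nil, true_and, and_true, and_assoc, not_le, Nat.reduceAdd, Nat.reduceMul]
    repeat refine And.intro (by omega) ?_
    refine ⟨fun k hk => ?_, fun x a => ?_, by omega⟩
    · by_cases hki : k = i
      · rw [if_pos (by omega), hki]
      · rw [if_neg (by omega), k4 k (by omega)]
    · rw [if_neg (by omega), k5 x a]
  · rintro ⟨loc', mem₂, ent₂⟩ ⟨k1, k3, -⟩
    dsimp only at *
    exact ⟨by simp, by simp; omega⟩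
  rintro ⟨loc', mem₂, ent₂⟩ T₂ ⟨k1, k3, k4, k5⟩ hT₂
  dsimp only at *
  simp only [seqs, lt, arr, ↓wp_seq, ↓wp_assign, ↓wp_branch, ↓wp_query, ↓wp_skip, ↓wp_store, ↓wp_loop,
    ↓wp_call, Test.Ok, Test.Holds, Test.time, Expr.Ok, Expr.val, Expr.time, Function.update_apply,
    Nat.reduceEqDiff, reduceIte, OfNat.ofNat_ne_zero, OfNat.ofNat_ne_one, OfNat.zero_ne_ofNat,
    OfNat.one_ne_ofNat, one_ne_zero, zero_ne_one, List.getD_cons_zero, List.getD_cons_succ,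
    List.getD_nil, true_and, and_true, and_assoc, not_le, Nat.reduceAdd, Nat.reduceMul] at hT₁ hT₂
  have us : ∀ x, x % 8 ≠ 1 → x % 8 ≠ 2 → mem₂ x = M x := fun x a b => (k5 x b).trans (l5 x a)
  have u1 : ∀ k < m, mem₂ (8 * k + 1) = k := fun k hk => (k5 _ (by omega)).trans (l4 k hk)
  have u0 : mem₂ 0 = 0 := by rw [us _ (by omega) (by omega), hM]; rfl
  have u8 : mem₂ 8 = m := by rw [us _ (by omega) (by omega), hM]; rfl
  have u16 : mem₂ 16 = n := by rw [us _ (by omega) (by omega), hM]; rfl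
  have u96 : mem₂ 96 = m + n := by rw [us _ (by omega) (by omega), hM]; rfl
  have u3 : ∀ x, x % 8 = 3 → mem₂ x = 0 := fun x hx => by
    rw [us _ (by omega) (by omega), hM0 x (by omega) (by omega) (by omega)]
  refine run_call_of_eq (calls_initLo (A := A) (mem := mem₂) hW (by omega) (by rw [u8, u0]; rfl) (by omega)
    (fun k hk => u1 k (by omega)) (k4 0 (by omega)) (by rw [u0]; exact hn)) (by simp) (by simp) rfl ?_
  rintro r₃ mem₃ ent₃ T₃ ⟨a1, a2, a3, a4, hT₃⟩
  have b8 := a1 8 (by omega) (by omega)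
  have b16 := a1 16 (by omega) (by omega)
  have b0 := a1 0 (by omega) (by omega)
  simp only [List.map_cons, List.map_nil, List.sum_cons, List.sum_nil, seqs, lt, arr, ↓wp_seq, ↓wp_assign, ↓wp_branch, ↓wp_query, ↓wp_skip, ↓wp_store, ↓wp_loop,
    ↓wp_call, Test.Ok, Test.Holds, Test.time, Expr.Ok, Expr.val, Expr.time, Function.update_apply,
    Nat.reduceEqDiff, reduceIte, OfNat.ofNat_ne_zero, OfNat.ofNat_ne_one, OfNat.zero_ne_ofNat,
    OfNat.one_ne_ofNat, one_ne_zero, zero_ne_one, List.getD_cons_zero, List.getD_cons_succ,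
    List.getD_nil, true_and, and_true, and_assoc, not_le, Nat.reduceAdd, Nat.reduceMul]
  refine run_call_of_eq (calls_swap (A := A) (mem := mem₃) hW (by omega) (by omega)) (by simp) (by simp) rfl ?_
  rintro r₄ mem₄ ent₄ T₄ ⟨hs, hT₄⟩
  simp only [List.map_cons, List.map_nil, List.sum_cons, List.sum_nil, seqs, lt, arr, ↓wp_seq, ↓wp_assign, ↓wp_branch, ↓wp_query, ↓wp_skip, ↓wp_store, ↓wp_loop,
    ↓wp_call, Test.Ok, Test.Holds, Test.time, Expr.Ok, Expr.val, Expr.time, Function.update_apply,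
    Nat.reduceEqDiff, reduceIte, OfNat.ofNat_ne_zero, OfNat.ofNat_ne_one, OfNat.zero_ne_ofNat,
    OfNat.one_ne_ofNat, one_ne_zero, zero_ne_one, List.getD_cons_zero, List.getD_cons_succ,
    List.getD_nil, true_and, and_true, and_assoc, not_le, Nat.reduceAdd, Nat.reduceMul]
  have c0 := hs.flag
  have c8 := hs.height
  have c16 := hs.width
  have hR : ∀ k < n, mem₄ (8 * k + 1) = k := fun k hk => by
    rw [hs.row k (by omega), a1 _ (by omega) (by omega), k4 k hk]
  have hCc : ∀ k < m, mem₄ (8 * k + 2) = k := fun k hk => by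
    rw [hs.col k (by omega), a1 _ (by omega) (by omega), u1 k hk]
  have c0' : mem₄ 0 = 1 := by omega
  refine run_call_of_eq (calls_initLo (A := A) (mem := mem₄) hW (by omega)
    (by rw [c8, c0', b16, u16]; rfl) (by omega)
    (fun k hk => hR k (by omega)) (hCc 0 (by omega)) (by rw [c0']; exact hm)) (by simp) (by simp) rfl ?_
  rintro r₅ mem₅ ent₅ T₅ ⟨d1, d2, d3, d4, hT₅⟩
  simp only [List.map_cons, List.map_nil, List.sum_cons, List.sum_nil, seqs, lt, arr, ↓wp_seq, ↓wp_assign, ↓wp_branch, ↓wp_query, ↓wp_skip, ↓wp_store, ↓wp_loop,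
    ↓wp_call, Test.Ok, Test.Holds, Test.time, Expr.Ok, Expr.val, Expr.time, Function.update_apply,
    Nat.reduceEqDiff, reduceIte, OfNat.ofNat_ne_zero, OfNat.ofNat_ne_one, OfNat.zero_ne_ofNat,
    OfNat.one_ne_ofNat, one_ne_zero, zero_ne_one, List.getD_cons_zero, List.getD_cons_succ,
    List.getD_nil, true_and, and_true, and_assoc, not_le, Nat.reduceAdd, Nat.reduceMul]
  have e0 : mem₅ 0 = 1 := (d1 0 (by omega) (by omega)).trans c0'
  have e8 : mem₅ 8 = n := by rw [d1 8 (by omega) (by omega)]; omega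
  have e16 : mem₅ 16 = m := by rw [d1 16 (by omega) (by omega)]; omega
  have e72 : mem₅ 72 = 0 := by rw [d1 72 (by omega) (by omega), hs.hi_row, a2]
  have e80 : mem₅ 80 = mem₃ 56 := by rw [d1 80 (by omega) (by omega), hs.hi_col]
  have e96 : mem₅ 96 = m + n := by
    rw [d1 96 (by omega) (by omega), hs.size, a1 96 (by omega) (by omega), u96]
  have e1 : ∀ k < n, mem₅ (8 * k + 1) = k := fun k hk => (d1 _ (by omega) (by omega)).trans (hR k hk)
  have e2 : ∀ k < m, mem₅ (8 * k + 2) = k := fun k hk => (d1 _ (by omega) (by omega)).trans (hCc k hk)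
  have e3 : ∀ k, mem₅ (8 * k + 3) = 0 := fun k => by
    rw [d1 _ (by omega) (by omega), hs.same _ (by omega) (by omega) (by omega),
      a1 _ (by omega) (by omega), u3 _ (by omega)]
  rw [c0'] at d3 d4
  rw [u0] at a3 a4
  refine ⟨⟨?_, fun k _ => e3 k⟩, e8, e16, by omega⟩
  constructor <;> simp only [loKey, hiKey, e0, e8, e16, e72, e80, e96, d2, rows, one_ne_zero, if_false, if_true] at a3 a4 d3 d4 ⊢
  · exact le_rfl
  · omega
  · omega
  · exact fun k hk => (e1 k hk).symm ▸ hk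
  · exact fun k hk => (e2 k hk).symm ▸ hk
  · intro j hj k hk he
    rwa [e1 j hj, e1 k hk] at he
  · intro j hj k hk he
    rwa [e2 j hj, e2 k hk] at he
  · exact d3
  · exact hm
  · exact hn
  · exact a3
  · exact fun r hr => ⟨0, hm, d4 r hr⟩
  · intro c hc
    refine ⟨0, hn, ?_⟩
    have h1 := key_swap A (zero_le_one : 0 ≤ 1) 0 c
    have h2 := key_swap A (zero_le_one : 0 ≤ 1) 0 (mem₃ 56)
    rw [Nat.sub_zero] at h1 h2
    have := a4 c hc
    omega
  · exact fun r hr => .inl ⟨r, hr, e1 r hr, e3 r⟩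
  · exact fun c hc => .inl ⟨c, Nat.zero_le _, hc, e2 c hc⟩
  · exact fun k _ _ => e3 k


/-- Every row has an entry that is at least, and every column has one that is at most, the entry in
the given position, where ties are broken as in `rank`. -/
def IsValue (A : Matrix (Fin m) (Fin n) α) (r c : ℕ) : Prop :=
  (r < m ∧ c < n) ∧ (∀ i < m, ∃ j < n, rank A r c ≤ rank A i j) ∧
    ∀ j < n, ∃ i < m, rank A i j ≤ rank A r c

theorem isValue_of_key {o r c : ℕ} (ho : o ≤ 1) (hr : r < rows m n o) (hc : c < rows n m o)
    (h1 : ∀ x < rows m n o, ∃ y < rows n m o, key A o r c ≤ key A o x y)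
    (h2 : ∀ y < rows n m o, ∃ x < rows m n o, key A o x y ≤ key A o r c) :
    IsValue A (if o = 0 then r else c) (if o = 0 then c else r) := by
  obtain rfl | rfl : o = 0 ∨ o = 1 := by omega
  · simp only [rows, key, if_true, Nat.cast_le] at *
    exact ⟨⟨hr, hc⟩, h1, h2⟩
  · simp only [rows, key, one_ne_zero, if_false, neg_le_neg_iff, Nat.cast_le] at *
    exact ⟨⟨hc, hr⟩, h2, h1⟩

/-- Without columns, every column has a key at most lo, so lo is a value. With one column, let h be
the smaller one of hi and the minimum of this column over the remaining rows. Every row has a key at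
least h, the column has a key at most h, and all other columns have one at most lo. So the greater
one of lo and h is a value. If the roles are exchanged, so are the coordinates reported. -/
theorem calls_finish (hW : 1000 * (m + n + 20) ≤ W) (h : Clean A mem) (h1 : mem 16 ≤ 1)
    (h2 : mem 16 ≤ mem 8) :
    Calls procs W A 19 [] mem fun _ mem' T => IsValue A (mem' 56) (mem' 64) ∧
      T ≤ 120 * mem 8 + 1000 := by
  have hc := h.core
  have hml := hc.row_le
  have hnl := hc.col_le
  have fin : ∀ p q, p < rows m n (mem 0) → q < rows n m (mem 0) →
      (∀ x < rows m n (mem 0), ∃ y < rows n m (mem 0), key A (mem 0) p q ≤ key A (mem 0) x y) →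
      (∀ y < rows n m (mem 0), ∃ x < rows m n (mem 0), key A (mem 0) x y ≤ key A (mem 0) p q) →
      (0 < mem 0 → IsValue A q p) ∧ (¬ 0 < mem 0 → IsValue A p q) := by
    intro p q q1 q2 q3 q4
    have := isValue_of_key (A := A) hc.flag q1 q2 q3 q4
    refine ⟨fun g => ?_, fun g => ?_⟩
    · rwa [if_neg (by omega), if_neg (by omega)] at this
    · rwa [if_pos (by omega), if_pos (by omega)] at this
  refine ⟨finishBody, rfl, fun ent => run_of_wp ?_⟩
  simp only [finishBody, exchange, seqs, lt, arr, ↓wp_seq, ↓wp_assign, ↓wp_branch, ↓wp_query, ↓wp_skip, ↓wp_store, ↓wp_loop,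
    ↓wp_call, Test.Ok, Test.Holds, Test.time, Expr.Ok, Expr.val, Expr.time, Function.update_apply,
    Nat.reduceEqDiff, reduceIte, OfNat.ofNat_ne_zero, OfNat.ofNat_ne_one, OfNat.zero_ne_ofNat,
    OfNat.one_ne_ofNat, one_ne_zero, zero_ne_one, List.getD_cons_zero, List.getD_cons_succ,
    List.getD_nil, true_and, and_true, and_assoc, not_le, Nat.reduceAdd, Nat.reduceMul]
  repeat refine And.intro (by omega) ?_
  refine ⟨fun g => ?_, fun g => ?_⟩
  · obtain ⟨f1, f2⟩ := fin (mem 56) (mem 64) hc.lo_row hc.lo_col hc.lo fun y hy => by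
      obtain ⟨j, -, a, -⟩ | a := hc.dead_col y hy
      · omega
      · exact a
    repeat refine And.intro (by omega) ?_
    refine ⟨fun k => ?_, fun k => ?_⟩
    · repeat refine And.intro (by omega) ?_
      exact ⟨f1 k, by omega⟩
    · exact ⟨f2 k, by omega⟩
  repeat refine And.intro (by omega) ?_
  have hy : mem 2 < rows n m (mem 0) := hc.col 0 (by omega)
  refine run_call_of_eq (calls_argmin (mem := mem) (y := mem 2) (pos := 0) (t := mem 8) hW hc.flag hy
    (by omega) (by omega) fun k _ hk => hc.row k (by omega)) (by simp <;> omega) (by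
    simp only [List.map_cons, List.map_nil, List.cons.injEq, seqs, lt, arr, ↓wp_seq, ↓wp_assign, ↓wp_branch, ↓wp_query, ↓wp_skip, ↓wp_store, ↓wp_loop,
    ↓wp_call, Test.Ok, Test.Holds, Test.time, Expr.Ok, Expr.val, Expr.time, Function.update_apply,
    Nat.reduceEqDiff, reduceIte, OfNat.ofNat_ne_zero, OfNat.ofNat_ne_one, OfNat.zero_ne_ofNat,
    OfNat.one_ne_ofNat, one_ne_zero, zero_ne_one, List.getD_cons_zero, List.getD_cons_succ,
    List.getD_nil, true_and, and_true, and_assoc, not_le, Nat.reduceAdd, Nat.reduceMul]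
    all_goals omega) rfl ?_
  rintro r mem₁ ent₁ T ⟨rfl, ⟨k, -, k1, rfl⟩, k2, hT⟩
  rw [Nat.zero_add] at k1
  have hr := hc.row k k1
  simp only [List.map_cons, List.map_nil, List.sum_cons, List.sum_nil, seqs, lt, arr, ↓wp_seq, ↓wp_assign, ↓wp_branch, ↓wp_query, ↓wp_skip, ↓wp_store, ↓wp_loop,
    ↓wp_call, Test.Ok, Test.Holds, Test.time, Expr.Ok, Expr.val, Expr.time, Function.update_apply,
    Nat.reduceEqDiff, reduceIte, OfNat.ofNat_ne_zero, OfNat.ofNat_ne_one, OfNat.zero_ne_ofNat,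
    OfNat.one_ne_ofNat, one_ne_zero, zero_ne_one, List.getD_cons_zero, List.getD_cons_succ,
    List.getD_nil, true_and, and_true, and_assoc, not_le, Nat.reduceAdd, Nat.reduceMul]
  refine run_call_of_eq (calls_lowerHi_eq hW hc hr hy) (by simp) (by
    simp only [List.map_cons, List.map_nil, List.cons.injEq, seqs, lt, arr, ↓wp_seq, ↓wp_assign, ↓wp_branch, ↓wp_query, ↓wp_skip, ↓wp_store, ↓wp_loop,
    ↓wp_call, Test.Ok, Test.Holds, Test.time, Expr.Ok, Expr.val, Expr.time, Function.update_apply,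
    Nat.reduceEqDiff, reduceIte, OfNat.ofNat_ne_zero, OfNat.ofNat_ne_one, OfNat.zero_ne_ofNat,
    OfNat.one_ne_ofNat, one_ne_zero, zero_ne_one, List.getD_cons_zero, List.getD_cons_succ,
    List.getD_nil, true_and, and_true, and_assoc, not_le, Nat.reduceAdd, Nat.reduceMul]
    all_goals omega) rfl ?_
  rintro r₂ mem₂ ent₂ T₂ ⟨a1, a2, a3, a4, hT₂⟩
  have b0 := a1 0 (by omega) (by omega)
  have b56 := a1 56 (by omega) (by omega)
  have b64 := a1 64 (by omega) (by omega)
  simp only [List.map_cons, List.map_nil, List.sum_cons, List.sum_nil, seqs, lt, arr, ↓wp_seq, ↓wp_assign, ↓wp_branch, ↓wp_query, ↓wp_skip, ↓wp_store, ↓wp_loop,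
    ↓wp_call, Test.Ok, Test.Holds, Test.time, Expr.Ok, Expr.val, Expr.time, Function.update_apply,
    Nat.reduceEqDiff, reduceIte, OfNat.ofNat_ne_zero, OfNat.ofNat_ne_one, OfNat.zero_ne_ofNat,
    OfNat.one_ne_ofNat, one_ne_zero, zero_ne_one, List.getD_cons_zero, List.getD_cons_succ,
    List.getD_nil, true_and, and_true, and_assoc, not_le, Nat.reduceAdd, Nat.reduceMul]
  refine run_call_of_eq (calls_cmp (A := A) (mem := mem₂) (r := mem₁ 56) (c := mem₁ 64) (r' := mem₂ 72)
    (c' := mem₂ 80) hW (by rw [b0]; exact hc.flag) (by rw [b0]; exact hc.lo_row) (by rw [b0]; exact hc.lo_col) (by rwa [b0])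
    (by rwa [b0])) (by simp <;> omega) (by
    simp only [List.map_cons, List.map_nil, List.cons.injEq, seqs, lt, arr, ↓wp_seq, ↓wp_assign, ↓wp_branch, ↓wp_query, ↓wp_skip, ↓wp_store, ↓wp_loop,
    ↓wp_call, Test.Ok, Test.Holds, Test.time, Expr.Ok, Expr.val, Expr.time, Function.update_apply,
    Nat.reduceEqDiff, reduceIte, OfNat.ofNat_ne_zero, OfNat.ofNat_ne_one, OfNat.zero_ne_ofNat,
    OfNat.one_ne_ofNat, one_ne_zero, zero_ne_one, List.getD_cons_zero, List.getD_cons_succ,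
    List.getD_nil, true_and, and_true, and_assoc, not_le, Nat.reduceAdd, Nat.reduceMul]
    all_goals omega) rfl ?_
  rintro v mem₃ ent₃ T₃ ⟨rfl, hv, hT₃⟩
  rw [b0, ← loKey] at hv
  rw [hiKey, b0] at a4
  simp only [b0, b56, b64, List.map_cons, List.map_nil, List.sum_cons, List.sum_nil, seqs, lt, arr, ↓wp_seq, ↓wp_assign, ↓wp_branch, ↓wp_query, ↓wp_skip, ↓wp_store, ↓wp_loop,
    ↓wp_call, Test.Ok, Test.Holds, Test.time, Expr.Ok, Expr.val, Expr.time, Function.update_apply,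
    Nat.reduceEqDiff, reduceIte, OfNat.ofNat_ne_zero, OfNat.ofNat_ne_one, OfNat.zero_ne_ofNat,
    OfNat.one_ne_ofNat, one_ne_zero, zero_ne_one, List.getD_cons_zero, List.getD_cons_succ,
    List.getD_nil, true_and, and_true, and_assoc, not_le, Nat.reduceAdd, Nat.reduceMul]
  repeat refine And.intro (by omega) ?_
  have hrow : ∀ x < rows m n (mem₁ 0), ∃ y < rows n m (mem₁ 0),
      key A (mem₁ 0) (mem₃ 72) (mem₃ 80) ≤ key A (mem₁ 0) x y := by
    intro x hx
    rw [a4]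
    obtain ⟨k', c1, rfl, -⟩ | ⟨y, c1, c2⟩ := hc.dead_row x hx
    · exact ⟨_, hy, (min_le_right _ _).trans (k2 k' (Nat.zero_le _) (by omega))⟩
    · exact ⟨y, c1, (min_le_left _ _).trans c2⟩
  have hcol : ∀ y < rows n m (mem₁ 0), ∃ x < rows m n (mem₁ 0),
      key A (mem₁ 0) x y ≤ max (loKey A mem₁) (key A (mem₁ 0) (mem₃ 72) (mem₃ 80)) := by
    intro y hy'
    rw [a4]
    obtain ⟨j, -, c1, rfl⟩ | ⟨x, c1, c2⟩ := hc.dead_col y hy'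
    · obtain rfl : j = 0 := by omega
      rcases le_total (hiKey A mem₁) (key A (mem₁ 0) (mem₁ (8 * k + 1)) (mem₁ 2)) with c2 | c2
      · obtain ⟨x, c3, c4⟩ := hc.hi _ hy'
        exact ⟨x, c3, c4.trans (le_max_of_le_right (min_eq_left c2).ge)⟩
      · exact ⟨_, hr, le_max_of_le_right (min_eq_right c2).ge⟩
    · exact ⟨x, c1, c2.trans (le_max_left _ _)⟩
  refine ⟨fun g => ?_, fun g => ?_⟩
  · have hlt : loKey A mem₁ < key A (mem₁ 0) (mem₃ 72) (mem₃ 80) := by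
      by_contra hcon
      rw [if_neg hcon] at hv
      omega
    rw [max_eq_right hlt.le] at hcol
    obtain ⟨f1, f2⟩ := fin _ _ a2 a3 hrow hcol
    repeat refine And.intro (by omega) ?_
    refine ⟨fun k => ?_, fun k => ?_⟩
    · repeat refine And.intro (by omega) ?_
      exact ⟨f1 k, by omega⟩
    · exact ⟨f2 k, by omega⟩
  · have hle : key A (mem₁ 0) (mem₃ 72) (mem₃ 80) ≤ loKey A mem₁ := by
      by_contra hcon
      rw [if_pos (not_le.1 hcon)] at hv
      omega
    rw [max_eq_left hle] at hcol
    obtain ⟨f1, f2⟩ := fin _ _ hc.lo_row hc.lo_col hc.lo hcol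
    repeat refine And.intro (by omega) ?_
    refine ⟨fun k => ?_, fun k => ?_⟩
    · repeat refine And.intro (by omega) ?_
      exact ⟨f1 k, by omega⟩
    · exact ⟨f2 k, by omega⟩

end Saddle

/-! ### The iterated logarithm -/

theorem lgStar_of_one_lt {x : ℝ} (h : 1 < x) : lgStar x = 1 + lgStar (Real.logb 2 x) := by
  rw [lgStar, if_pos h]

theorem lgStar_mono {x y : ℝ} (h : x ≤ y) : lgStar x ≤ lgStar y := by
  induction x using lgStar.induct generalizing y with
  | case1 x hx ih =>
    rw [lgStar_of_one_lt hx, lgStar_of_one_lt (hx.trans_le h)]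
    exact Nat.add_le_add_left (ih (Real.logb_le_logb_of_le (by norm_num) (by linarith) h)) _
  | case2 x hx =>
    rw [lgStar, if_neg hx]
    exact Nat.zero_le _

theorem lgStar_two_rpow {x : ℝ} (h : 0 < x) : lgStar (2 ^ x) = 1 + lgStar x := by
  rw [lgStar_of_one_lt (Real.one_lt_rpow (by norm_num) h), Real.logb_rpow (by norm_num) (by norm_num)]

/-! ### The potential and the total running time of the reduction -/

namespace Saddle

open RAM Expr Test Cmd

variable {α : Type*} [LinearOrder α] {m n : ℕ} {W : ℕ} {A : Matrix (Fin m) (Fin n) α}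
  {mem mem' : ℕ → ℕ}

/-- The factor of the potential that counts the remaining large reductions. -/
noncomputable def level (L μ ν : ℕ) : ℕ :=
  if ν ≤ 1 then 2 * L - 1 else 3 * L - min L (lgStar ((μ : ℝ) / ν))

/-- The smallest power of two that is at least `k`. -/
def roundUp (k : ℕ) : ℕ := 2 ^ Nat.clog 2 k

theorem le_roundUp (k : ℕ) : k ≤ roundUp k := Nat.le_pow_clog (by norm_num) k

theorem roundUp_le {k : ℕ} (hk : 1 ≤ k) : roundUp k ≤ 2 * k := by
  obtain rfl | hk' : k = 1 ∨ 1 < k := by omega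
  · simp [roundUp]
  · have h1 := Nat.pow_pred_clog_lt_self (b := 2) (by norm_num) hk'
    have h2 := Nat.clog_pos (b := 2) (by norm_num) (show 2 ≤ k by omega)
    have h3 : roundUp k = 2 ^ (Nat.clog 2 k).pred * 2 := by
      rw [roundUp, ← pow_succ, Nat.pred_eq_sub_one, Nat.sub_add_cancel h2]
    omega

/-- Heights are rounded to powers of two so that, while the height shrinks gradually, the ratio in
`level` has a fixed numerator until the height drops by a whole factor of two. -/
theorem roundUp_eq_or {k k' : ℕ} (h : k' ≤ k) : roundUp k' = roundUp k ∨ 2 * roundUp k' ≤ roundUp k := by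
  obtain h1 | h1 := (Nat.clog_mono_right 2 h).eq_or_lt
  · exact .inl (by rw [roundUp, roundUp, h1])
  · refine .inr ?_
    rw [roundUp, roundUp, mul_comm, ← pow_succ]
    exact Nat.pow_le_pow_right (by norm_num) h1

theorem level_le {L : ℕ} (μ ν : ℕ) : level L μ ν ≤ 3 * L := by
  unfold level
  split <;> omega

/-- With at least two columns the level lies between 2L and 3L. The value 2L - 1 for at most one
column is just below, so that a reduction to one column also lowers the level. -/
theorem le_level {L μ ν : ℕ} (h : 2 ≤ ν) : 2 * L ≤ level L μ ν := by
  rw [level, if_neg (by omega)]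
  omega

theorem level_mono {L μ ν ν' : ℕ} (hL : 1 ≤ L) (h : ν' ≤ ν) : level L μ ν' ≤ level L μ ν := by
  by_cases h1 : ν ≤ 1
  · rw [level, level, if_pos h1, if_pos (h.trans h1)]
  by_cases h2 : ν' ≤ 1
  · have := le_level (L := L) (μ := μ) (show 2 ≤ ν by omega)
    rw [level, if_pos h2]
    omega
  · rw [level, level, if_neg h1, if_neg h2]
    have : lgStar ((μ : ℝ) / ν) ≤ lgStar ((μ : ℝ) / ν') := by
      refine lgStar_mono (div_le_div_of_nonneg_left (Nat.cast_nonneg _) ?_ (Nat.cast_le.2 h))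
      exact Nat.cast_pos.2 (by omega)
    omega

/-- The part of the potential that pays for the large reductions. -/
noncomputable def reserve (L a b : ℕ) : ℕ := roundUp (max a b) * level L (roundUp (max a b)) (min a b)

/-- At constant rounded height a smaller width cannot raise the level. When the rounded height
halves, the level may rise, but only from at least 2L to at most 3L, less than a factor of two. -/
theorem reserve_mono {L a b a' b' : ℕ} (hL : 1 ≤ L) (ha : a' ≤ a) (hb : b' ≤ b) :
    reserve L a' b' ≤ reserve L a b := by
  have h1 : max a' b' ≤ max a b := max_le_max ha hb
  have h2 : min a' b' ≤ min a b := min_le_min ha hb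
  rw [reserve, reserve]
  obtain h3 | h3 := roundUp_eq_or h1
  · rw [h3]
    exact Nat.mul_le_mul_left _ (level_mono hL h2)
  by_cases h4 : min a b ≤ 1
  · have h5 : level L (roundUp (max a' b')) (min a' b') = level L (roundUp (max a b)) (min a b) := by
      rw [level, level, if_pos h4, if_pos (h2.trans h4)]
    rw [h5]
    exact Nat.mul_le_mul_right _ (by omega)
  · have h5 := level_le (L := L) (roundUp (max a' b')) (min a' b')
    have h6 := le_level (L := L) (μ := roundUp (max a b)) (show 2 ≤ min a b by omega)
    calc _ ≤ roundUp (max a' b') * (2 * (2 * L)) := Nat.mul_le_mul_left _ (by omega)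
      _ = 2 * roundUp (max a' b') * (2 * L) := by ring
      _ ≤ _ := Nat.mul_le_mul h3 h6

/-- Let x = μ / b be the ratio before the reduction. Since μ ≤ 2a, x is at most 16t, so dividing the
width by 2^(16t) makes the ratio at least 2^x and raises its lg* by one. The cap L in `level` does
not interfere: as b' ≥ 1, also 2^x ≤ b, so lg* x is at most lg* b - 1 < L. -/
theorem level_drop {L a b b' μ : ℕ} (hL : 1 ≤ L) (hb : 2 ≤ b) (hab : 2 * b ≤ a) (h1 : a ≤ μ) (h2 : μ ≤ 2 * a)
    (hb' : b' ≤ max 1 (b / 2 ^ (16 * (a / (2 * b))))) (hl : lgStar (b : ℝ) ≤ L) :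
    level L μ b' + 1 ≤ level L μ b := by
  have h3 := le_level (L := L) (μ := μ) hb
  by_cases h4 : b' ≤ 1
  · rw [level, if_pos h4]
    omega
  obtain ⟨t, ht⟩ : ∃ t, t = a / (2 * b) := ⟨_, rfl⟩
  have ht1 : 1 ≤ t := ht ▸ Nat.div_pos hab (by omega)
  rw [← ht] at hb'
  replace hb' : b' ≤ b / 2 ^ (16 * t) := (le_max_iff.1 hb').resolve_left h4
  have h5 : b' * 2 ^ (16 * t) ≤ b := (Nat.le_div_iff_mul_le (by positivity)).1 hb'
  have h6 : μ ≤ 16 * t * b := by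
    have h7 := Nat.lt_div_mul_add (a := a) (show 0 < 2 * b by omega)
    rw [← ht] at h7
    have h8 : t * (2 * b) = 2 * (t * b) := by ring
    have h9 : 1 * b ≤ t * b := Nat.mul_le_mul_right _ ht1
    have h10 : 16 * t * b = 16 * (t * b) := by ring
    omega
  have hbr : (0 : ℝ) < b := Nat.cast_pos.2 (by omega)
  have hbr' : (0 : ℝ) < b' := Nat.cast_pos.2 (by omega)
  have hx : (0 : ℝ) < (μ : ℝ) / b := div_pos (Nat.cast_pos.2 (by omega)) hbr
  have hx' : (2 : ℝ) ^ ((μ : ℝ) / b) ≤ (2 ^ (16 * t) : ℕ) := by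
    rw [Nat.cast_pow, ← Real.rpow_natCast, Nat.cast_two]
    refine Real.rpow_le_rpow_of_exponent_le (by norm_num) ?_
    rw [div_le_iff₀ hbr]
    exact_mod_cast h6
  have h7 : (2 : ℝ) ^ ((μ : ℝ) / b) ≤ (μ : ℝ) / b' := by
    refine hx'.trans ?_
    rw [le_div_iff₀ hbr', mul_comm]
    exact_mod_cast h5.trans (by omega)
  have h8 : (2 : ℝ) ^ ((μ : ℝ) / b) ≤ b := by
    refine hx'.trans (Nat.cast_le.2 (le_trans ?_ h5))
    exact Nat.le_mul_of_pos_left _ (by omega)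
  have h9 := (lgStar_mono h7).trans' (lgStar_two_rpow hx).ge
  have h10 := (lgStar_mono h8).trans' (lgStar_two_rpow hx).ge
  rw [level, level, if_neg h4, if_neg (by omega)]
  omega

/-- If the rounded height μ stays, one level is lost, worth μ ≥ a. If it halves, the reserve falls
from at least 2μL to at most 3μL/2, a loss of at least a/2. This second case is the reason for the
factor 2. -/
theorem reserve_drop {L a b a' b' : ℕ} (hL : 1 ≤ L) (ha : a' ≤ a) (hb : 2 ≤ b) (hab : 2 * b ≤ a)
    (hb' : b' ≤ b) (hbt : b' ≤ max 1 (b / 2 ^ (16 * (a / (2 * b))))) (hl : lgStar (b : ℝ) ≤ L) :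
    2 * reserve L a' b' + a ≤ 2 * reserve L a b := by
  have h0 : max a b = a := max_eq_left (by omega)
  have h1 : max a' b' ≤ a := max_le ha (by omega)
  have h2 := le_roundUp a
  have h3 := roundUp_le (show 1 ≤ a by omega)
  have h4 := le_level (L := L) (μ := roundUp a) hb
  rw [reserve, reserve, h0, min_eq_right (show b ≤ a by omega)]
  obtain h5 | h5 := roundUp_eq_or h1
  · rw [h5]
    have h6 := level_drop hL hb hab h2 h3 hbt hl
    have h7 := (Nat.add_le_add_right (level_mono (μ := roundUp a) hL (min_le_right a' b')) 1).trans h6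
    have h8 := Nat.mul_le_mul_left (roundUp a) h7
    rw [mul_add, mul_one] at h8
    omega
  · have h6 := level_le (L := L) (roundUp (max a' b')) (min a' b')
    have h7 := Nat.mul_le_mul_left (roundUp (max a' b')) h6
    have h8 : roundUp a * (2 * L) ≤ roundUp a * level L (roundUp a) b := Nat.mul_le_mul_left _ h4
    have h9 : 2 * roundUp (max a' b') * L ≤ roundUp a * L := Nat.mul_le_mul_right _ h5
    have h10 : roundUp a * 1 ≤ roundUp a * L := Nat.mul_le_mul_left _ hL
    have h11 : roundUp (max a' b') * (3 * L) = 3 * (roundUp (max a' b') * L) := by ring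
    have h12 : roundUp a * (2 * L) = 2 * (roundUp a * L) := by ring
    rw [mul_assoc] at h9
    omega

theorem reserve_comm (L a b : ℕ) : reserve L a b = reserve L b a := by
  rw [reserve, reserve, max_comm, min_comm]

theorem reserve_le {L a b : ℕ} (h : 1 ≤ max a b) : reserve L a b ≤ 6 * (max a b * L) := by
  refine (Nat.mul_le_mul (roundUp_le h) (level_le _ _)).trans (le_of_eq ?_)
  ring

/-- The potential of a matrix with `a` rows and `b` columns. -/
noncomputable def potential (L a b : ℕ) : ℕ :=
  50000000 * (a + b) + 25000000 * reserve L a b + if a < b then 500 * (a + b) else 0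

theorem potential_le (L a b : ℕ) :
    potential L a b ≤ 50000500 * (a + b) + 25000000 * reserve L a b := by
  rw [potential]
  split <;> omega

theorem potential_eq {L a b : ℕ} (h : b ≤ a) :
    potential L a b = 50000000 * (a + b) + 25000000 * reserve L a b := by
  rw [potential, if_neg (by omega), add_zero]

/-- Each round is paid for by the drop of the potential. A square step and a tall step that deletes
a quarter of the rows are paid for by the linear part, a tall step that deletes most columns by the
reserve. The extra summand for wide matrices pays for the exchange of roles and for creating such a
matrix. -/
theorem calls_reduce (hW : 1000 * (m + n + 20) ≤ W) (h : Clean A mem) {L : ℕ} (hL : 1 ≤ L)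
    (hl : lgStar ((min (mem 8) (mem 16) : ℕ) : ℝ) ≤ L) :
    Calls procs W A 18 [] mem fun _ mem' T => Clean A mem' ∧ mem' 16 ≤ 1 ∧ mem' 16 ≤ mem' 8 ∧
      mem' 8 ≤ m + n ∧ T ≤ potential L (mem 8) (mem 16) + 20 := by
  refine ⟨reduceBody, rfl, fun ent => run_of_wp ?_⟩
  simp only [reduceBody, seqs, lt, arr, ↓wp_seq, ↓wp_assign, ↓wp_branch, ↓wp_query, ↓wp_skip, ↓wp_store, ↓wp_loop,
    ↓wp_call, Test.Ok, Test.Holds, Test.time, Expr.Ok, Expr.val, Expr.time, Function.update_apply,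
    Nat.reduceEqDiff, reduceIte, OfNat.ofNat_ne_zero, OfNat.ofNat_ne_one, OfNat.zero_ne_ofNat,
    OfNat.one_ne_ofNat, one_ne_zero, zero_ne_one, List.getD_cons_zero, List.getD_cons_succ,
    List.getD_nil, true_and, and_true, and_assoc, not_le, Nat.reduceAdd, Nat.reduceMul]
  refine run_loop (fun s => potential L (s.mem 8) (s.mem 16)) (fun s T => Clean A s.mem ∧
    lgStar ((min (s.mem 8) (s.mem 16) : ℕ) : ℝ) ≤ L ∧
    T + potential L (s.mem 8) (s.mem 16) ≤ potential L (mem 8) (mem 16)) ?_ ?_ ?_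
  · exact ⟨h, hl, by simp⟩
  · rintro ⟨loc, mem₁, ent₁⟩ T ⟨h1, h2, hT⟩
    dsimp only at *
    have hml := h1.core.row_le
    have hnl := h1.core.col_le
    refine ⟨by simp <;> omega, fun hb => run_of_wp ?_⟩
    simp only [seqs, lt, arr, ↓wp_seq, ↓wp_assign, ↓wp_branch, ↓wp_query, ↓wp_skip, ↓wp_store, ↓wp_loop,
    ↓wp_call, Test.Ok, Test.Holds, Test.time, Expr.Ok, Expr.val, Expr.time, Function.update_apply,
    Nat.reduceEqDiff, reduceIte, OfNat.ofNat_ne_zero, OfNat.ofNat_ne_one, OfNat.zero_ne_ofNat,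
    OfNat.one_ne_ofNat, one_ne_zero, zero_ne_one, List.getD_cons_zero, List.getD_cons_succ,
    List.getD_nil, true_and, and_true, and_assoc, not_le, Nat.reduceAdd, Nat.reduceMul] at hb ⊢
    repeat refine And.intro (by omega) ?_
    refine ⟨fun g1 => ?_, fun g1 => ?_⟩
    · refine run_call_of_eq (calls_swap (A := A) hW hml hnl) (by simp) (by simp) rfl ?_
      rintro r mem₂ ent₂ T₂ ⟨hs, hT₂⟩
      simp only [List.map_cons, List.map_nil, List.sum_cons, List.sum_nil, seqs, lt, arr, ↓wp_seq, ↓wp_assign, ↓wp_branch, ↓wp_query, ↓wp_skip, ↓wp_store, ↓wp_loop,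
    ↓wp_call, Test.Ok, Test.Holds, Test.time, Expr.Ok, Expr.val, Expr.time, Function.update_apply,
    Nat.reduceEqDiff, reduceIte, OfNat.ofNat_ne_zero, OfNat.ofNat_ne_one, OfNat.zero_ne_ofNat,
    OfNat.one_ne_ofNat, one_ne_zero, zero_ne_one, List.getD_cons_zero, List.getD_cons_succ,
    List.getD_nil, true_and, and_true, and_assoc, not_le, Nat.reduceAdd, Nat.reduceMul]
      have e8 := hs.height
      have e16 := hs.width
      have hp : potential L (mem₂ 8) (mem₂ 16) + 500 * (mem₁ 8 + mem₁ 16) = potential L (mem₁ 8) (mem₁ 16) := by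
        rw [e8, e16, potential, potential, if_neg (by omega), if_pos g1, reserve_comm]
        ring
      exact ⟨h1.of_swapped hs, by rwa [e8, e16, min_comm], by omega, by omega⟩
    · have hp := potential_eq (L := L) (show mem₁ 16 ≤ mem₁ 8 by omega)
      have key : ∀ mem₂, Reduced A mem₁ mem₂ → ∀ mem₃ : ℕ → ℕ, mem₃ 8 = alive mem₂ (mem₂ 8) → mem₃ 16 = mem₂ 16 - mem₂ 88 →
          mem₃ 8 ≤ mem₁ 8 ∧ mem₃ 16 = mem₁ 16 - mem₂ 88 ∧ mem₃ 8 = alive mem₂ (mem₁ 8) ∧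
          reserve L (mem₃ 8) (mem₃ 16) ≤ reserve L (mem₁ 8) (mem₁ 16) ∧
          lgStar ((min (mem₃ 8) (mem₃ 16) : ℕ) : ℝ) ≤ L := by
        intro mem₂ hr mem₃ k1 k2
        have k3 := alive_le mem₂ (mem₂ 8)
        have k4 := hr.row
        have k5 := hr.col
        refine ⟨by omega, by omega, by rw [k1, k4], reserve_mono hL (by omega) (by omega), ?_⟩
        exact (lgStar_mono (Nat.cast_le.2 (min_le_min (by omega) (by omega)))).trans h2
      repeat refine And.intro (by omega) ?_
      refine ⟨fun g2 => ?_, fun g2 => ?_⟩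
      · refine run_call_of_eq (calls_square (A := A) hW h1.core (by omega) (by omega) (by omega)) (by simp) (by simp) rfl ?_
        rintro r mem₂ ent₂ T₂ ⟨hr, hd, hT₂⟩
        simp only [List.map_cons, List.map_nil, List.sum_cons, List.sum_nil, seqs, lt, arr, ↓wp_seq, ↓wp_assign, ↓wp_branch, ↓wp_query, ↓wp_skip, ↓wp_store, ↓wp_loop,
    ↓wp_call, Test.Ok, Test.Holds, Test.time, Expr.Ok, Expr.val, Expr.time, Function.update_apply,
    Nat.reduceEqDiff, reduceIte, OfNat.ofNat_ne_zero, OfNat.ofNat_ne_one, OfNat.zero_ne_ofNat,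
    OfNat.one_ne_ofNat, one_ne_zero, zero_ne_one, List.getD_cons_zero, List.getD_cons_succ,
    List.getD_nil, true_and, and_true, and_assoc, not_le, Nat.reduceAdd, Nat.reduceMul]
        refine run_call_of_eq (calls_compact (A := A) hW hr.core) (by simp) (by simp) rfl ?_
        rintro r₃ mem₃ ent₃ T₃ ⟨hc, k1, k2, hT₃⟩
        obtain ⟨k3, k4, k5, k6, k7⟩ := key mem₂ hr mem₃ k1 k2
        have hp' := potential_le L (mem₃ 8) (mem₃ 16)
        have k8 := hr.row
        have k9 := hr.col
        simp only [List.map_cons, List.map_nil, List.sum_cons, List.sum_nil, seqs, lt, arr, ↓wp_seq, ↓wp_assign, ↓wp_branch, ↓wp_query, ↓wp_skip, ↓wp_store, ↓wp_loop,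
    ↓wp_call, Test.Ok, Test.Holds, Test.time, Expr.Ok, Expr.val, Expr.time, Function.update_apply,
    Nat.reduceEqDiff, reduceIte, OfNat.ofNat_ne_zero, OfNat.ofNat_ne_one, OfNat.zero_ne_ofNat,
    OfNat.one_ne_ofNat, one_ne_zero, zero_ne_one, List.getD_cons_zero, List.getD_cons_succ,
    List.getD_nil, true_and, and_true, and_assoc, not_le, Nat.reduceAdd, Nat.reduceMul]
        exact ⟨hc, k7, by omega, by omega⟩
      · refine run_call_of_eq (calls_tall (A := A) hW h1.core (by omega) (by omega)) (by simp) (by simp) rfl ?_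
        rintro r mem₂ ent₂ T₂ ⟨hr, hd, hT₂⟩
        simp only [List.map_cons, List.map_nil, List.sum_cons, List.sum_nil, seqs, lt, arr, ↓wp_seq, ↓wp_assign, ↓wp_branch, ↓wp_query, ↓wp_skip, ↓wp_store, ↓wp_loop,
    ↓wp_call, Test.Ok, Test.Holds, Test.time, Expr.Ok, Expr.val, Expr.time, Function.update_apply,
    Nat.reduceEqDiff, reduceIte, OfNat.ofNat_ne_zero, OfNat.ofNat_ne_one, OfNat.zero_ne_ofNat,
    OfNat.one_ne_ofNat, one_ne_zero, zero_ne_one, List.getD_cons_zero, List.getD_cons_succ,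
    List.getD_nil, true_and, and_true, and_assoc, not_le, Nat.reduceAdd, Nat.reduceMul]
        refine run_call_of_eq (calls_compact (A := A) hW hr.core) (by simp) (by simp) rfl ?_
        rintro r₃ mem₃ ent₃ T₃ ⟨hc, k1, k2, hT₃⟩
        obtain ⟨k3, k4, k5, k6, k7⟩ := key mem₂ hr mem₃ k1 k2
        have hp' := potential_le L (mem₃ 8) (mem₃ 16)
        have k8 := hr.row
        have k9 := hr.col
        -- Both cases release about 12500000 for each row: half of 25000000 from the reserve, or a
        -- quarter of 50000000 from the linear part. What is missing from this is kept for the extra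
        -- summand of a wide matrix.
        have hdrop : 12200000 * mem₁ 8 + potential L (mem₃ 8) (mem₃ 16) ≤ potential L (mem₁ 8) (mem₁ 16) := by
          rcases hd with hd | hd
          · rw [min_eq_right (by omega)] at h2
            have := reserve_drop (a := mem₁ 8) (a' := mem₃ 8) (b' := mem₃ 16) hL k3 (by omega) (by omega) (by omega) (k4 ▸ hd) h2
            omega
          · omega
        simp only [List.map_cons, List.map_nil, List.sum_cons, List.sum_nil, seqs, lt, arr, ↓wp_seq, ↓wp_assign, ↓wp_branch, ↓wp_query, ↓wp_skip, ↓wp_store, ↓wp_loop,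
    ↓wp_call, Test.Ok, Test.Holds, Test.time, Expr.Ok, Expr.val, Expr.time, Function.update_apply,
    Nat.reduceEqDiff, reduceIte, OfNat.ofNat_ne_zero, OfNat.ofNat_ne_one, OfNat.zero_ne_ofNat,
    OfNat.one_ne_ofNat, one_ne_zero, zero_ne_one, List.getD_cons_zero, List.getD_cons_succ,
    List.getD_nil, true_and, and_true, and_assoc, not_le, Nat.reduceAdd, Nat.reduceMul]
        exact ⟨hc, k7, by omega, by omega⟩
  · rintro ⟨loc, mem₁, ent₁⟩ T ⟨h1, h2, hT⟩ hb
    dsimp only at *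
    have hml := h1.core.row_le
    simp only [seqs, lt, arr, ↓wp_seq, ↓wp_assign, ↓wp_branch, ↓wp_query, ↓wp_skip, ↓wp_store, ↓wp_loop,
    ↓wp_call, Test.Ok, Test.Holds, Test.time, Expr.Ok, Expr.val, Expr.time, Function.update_apply,
    Nat.reduceEqDiff, reduceIte, OfNat.ofNat_ne_zero, OfNat.ofNat_ne_one, OfNat.zero_ne_ofNat,
    OfNat.one_ne_ofNat, one_ne_zero, zero_ne_one, List.getD_cons_zero, List.getD_cons_succ,
    List.getD_nil, true_and, and_true, and_assoc, not_le, Nat.reduceAdd, Nat.reduceMul] at hb ⊢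
    exact ⟨h1, by omega, by omega, by omega, by omega⟩

end Saddle

/-! ### From a value to saddlepoints, and the main programs -/

namespace Saddle

open RAM Expr Test Cmd

variable {α : Type*} [LinearOrder α] {m n : ℕ} {W : ℕ} {A : Matrix (Fin m) (Fin n) α}
  {mem mem' : ℕ → ℕ}

theorem le_of_rank_le {i i' : Fin m} {j j' : Fin n} (h : rank A i j ≤ rank A i' j') : A i j ≤ A i' j' := by
  by_contra hlt
  exact h.not_gt ((rank_lt_rank i'.2 j'.2 i.2 j.2).2 (.inl (not_le.1 hlt)))

theorem rank_lt_of_lt {i i' : Fin m} {j j' : Fin n} (h : A i j < A i' j') : rank A i j < rank A i' j' :=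
  (rank_lt_rank i.2 j.2 i'.2 j'.2).2 (.inl h)

/-- In the row of the saddlepoint some entry is at least the value, and the saddlepoint is the
maximum there; its column gives the reverse inequality. Ranks are weakened to entries here, because
with ties the saddlepoint need not be at the position of the value. -/
theorem IsValue.eq_of_isSaddlepoint {r i : Fin m} {c j : Fin n} (h : IsValue A r c)
    (hs : IsSaddlepoint A i j) : A i j = A r c := by
  obtain ⟨-, h1, h2⟩ := h
  obtain ⟨y, hy, h3⟩ := h1 i i.2
  obtain ⟨x, hx, h4⟩ := h2 j j.2
  have h5 := le_of_rank_le (j' := ⟨y, hy⟩) h3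
  have h6 := le_of_rank_le (i := ⟨x, hx⟩) h4
  refine le_antisymm (le_trans ?_ h6) (h5.trans ?_)
  · by_cases hxi : (⟨x, hx⟩ : Fin m) = i
    · rw [hxi]
    · exact hs.2 _ hxi
  · by_cases hyj : (⟨y, hy⟩ : Fin n) = j
    · rw [hyj]
    · exact hs.1 _ hyj

/-- Strictness makes the same chain of inequalities hold for ranks. Ranks determine positions, so
the strict saddlepoint is exactly at the value. -/
theorem IsValue.eq_of_isStrictSaddlepoint {r i : Fin m} {c j : Fin n} (h : IsValue A r c)
    (hs : IsStrictSaddlepoint A i j) : i = r ∧ j = c := by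
  obtain ⟨-, h1, h2⟩ := h
  obtain ⟨y, hy, h3⟩ := h1 i i.2
  obtain ⟨x, hx, h4⟩ := h2 j j.2
  have h5 : rank A i y ≤ rank A i j := by
    by_cases hyj : (⟨y, hy⟩ : Fin n) = j
    · rw [← hyj]
    · exact (rank_lt_of_lt (hs.1 _ hyj)).le
  have h6 : rank A i j ≤ rank A x j := by
    by_cases hxi : (⟨x, hx⟩ : Fin m) = i
    · rw [← hxi]
    · exact (rank_lt_of_lt (hs.2 _ hxi)).le
  have := rank_inj (A := A) i.2 j.2 r.2 c.2 (by omega)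
  exact ⟨Fin.ext this.1, Fin.ext this.2⟩

/-- The factor of the running time. -/
noncomputable def lgFactor (m n : ℕ) : ℕ := max 1 (lgStar (min m n : ℕ))

theorem run_core (hW : 1000 * (m + n + 20) ≤ W) (hm : 1 ≤ m) (hn : 1 ≤ n) {loc : ℕ → ℕ}
    {ent : ℕ → Option α} {Q : State α → ℕ → Prop} (h0 : loc 0 = m) (h1 : loc 1 = n)
    (hQ : ∀ s T, (∀ x, x ≠ 9 → s.loc x = loc x) → IsValue A (s.mem 56) (s.mem 64) →
      T ≤ 299000000 * (max m n * lgFactor m n) → Q s T) :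
    Run procs W A core ⟨loc, fun _ => 0, ent⟩ Q := by
  refine run_of_wp ?_
  simp only [core, seqs, lt, arr, ↓wp_seq, ↓wp_assign, ↓wp_branch, ↓wp_query, ↓wp_skip, ↓wp_store, ↓wp_loop,
    ↓wp_call, Test.Ok, Test.Holds, Test.time, Expr.Ok, Expr.val, Expr.time, Function.update_apply,
    Nat.reduceEqDiff, reduceIte, OfNat.ofNat_ne_zero, OfNat.ofNat_ne_one, OfNat.zero_ne_ofNat,
    OfNat.one_ne_ofNat, one_ne_zero, zero_ne_one, List.getD_cons_zero, List.getD_cons_succ,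
    List.getD_nil, true_and, and_true, and_assoc, not_le, Nat.reduceAdd, Nat.reduceMul]
  refine run_call_of_eq (calls_init (A := A) hW hm hn) (by simp) (by simp [h0, h1]) rfl ?_
  rintro r₁ mem₁ ent₁ T₁ ⟨hc, e8, e16, hT₁⟩
  have hmin : min (mem₁ 8) (mem₁ 16) = min m n := by rw [e8, e16, min_comm]
  simp only [List.map_cons, List.map_nil, List.sum_cons, List.sum_nil, seqs, lt, arr, ↓wp_seq, ↓wp_assign, ↓wp_branch, ↓wp_query, ↓wp_skip, ↓wp_store, ↓wp_loop,
    ↓wp_call, Test.Ok, Test.Holds, Test.time, Expr.Ok, Expr.val, Expr.time, Function.update_apply,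
    Nat.reduceEqDiff, reduceIte, OfNat.ofNat_ne_zero, OfNat.ofNat_ne_one, OfNat.zero_ne_ofNat,
    OfNat.one_ne_ofNat, one_ne_zero, zero_ne_one, List.getD_cons_zero, List.getD_cons_succ,
    List.getD_nil, true_and, and_true, and_assoc, not_le, Nat.reduceAdd, Nat.reduceMul]
  refine run_call_of_eq (calls_reduce (A := A) (L := lgFactor m n) hW hc (le_max_left _ _)
    (by rw [hmin]; exact le_max_right _ _)) (by simp) (by simp) rfl ?_
  rintro r₂ mem₂ ent₂ T₂ ⟨hc₂, f1, f2, f3, hT₂⟩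
  simp only [List.map_cons, List.map_nil, List.sum_cons, List.sum_nil, seqs, lt, arr, ↓wp_seq, ↓wp_assign, ↓wp_branch, ↓wp_query, ↓wp_skip, ↓wp_store, ↓wp_loop,
    ↓wp_call, Test.Ok, Test.Holds, Test.time, Expr.Ok, Expr.val, Expr.time, Function.update_apply,
    Nat.reduceEqDiff, reduceIte, OfNat.ofNat_ne_zero, OfNat.ofNat_ne_one, OfNat.zero_ne_ofNat,
    OfNat.one_ne_ofNat, one_ne_zero, zero_ne_one, List.getD_cons_zero, List.getD_cons_succ,
    List.getD_nil, true_and, and_true, and_assoc, not_le, Nat.reduceAdd, Nat.reduceMul]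
  refine run_call_of_eq (calls_finish (A := A) hW hc₂ f1 f2) (by simp) (by simp) rfl ?_
  rintro r₃ mem₃ ent₃ T₃ ⟨hv, hT₃⟩
  simp only [List.map_cons, List.map_nil, List.sum_cons, List.sum_nil, seqs, lt, arr, ↓wp_seq, ↓wp_assign, ↓wp_branch, ↓wp_query, ↓wp_skip, ↓wp_store, ↓wp_loop,
    ↓wp_call, Test.Ok, Test.Holds, Test.time, Expr.Ok, Expr.val, Expr.time, Function.update_apply,
    Nat.reduceEqDiff, reduceIte, OfNat.ofNat_ne_zero, OfNat.ofNat_ne_one, OfNat.zero_ne_ofNat,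
    OfNat.one_ne_ofNat, one_ne_zero, zero_ne_one, List.getD_cons_zero, List.getD_cons_succ,
    List.getD_nil, true_and, and_true, and_assoc, not_le, Nat.reduceAdd, Nat.reduceMul]
  refine hQ _ _ (fun x hx => by simp [Function.update_apply, hx]) hv ?_
  have hL : 1 ≤ lgFactor m n := le_max_left _ _
  have k1 : max m n * 1 ≤ max m n * lgFactor m n := Nat.mul_le_mul_left _ hL
  have k2 := potential_le (lgFactor m n) n m
  have k3 := reserve_le (L := lgFactor m n) (a := n) (b := m) (by omega)
  rw [max_comm] at k3
  rw [e8, e16] at hT₂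
  omega

/-- All addresses and intermediate results are below a fixed multiple of m + n + 20, so words of
O(lg(m + n)) bits suffice. The sum of the two side lengths is at least 2, and the exponent 20
absorbs the constants already for 2. -/
theorem word_bound {x : ℕ} (hx : 2 ≤ x) : 1000 * (x + 20) ≤ x ^ 20 := by
  have h1 : 2 ^ 19 ≤ x ^ 19 := Nat.pow_le_pow_left hx 19
  have h2 : 2 ^ 19 * x ≤ x ^ 19 * x := Nat.mul_le_mul_right _ h1
  rw [← pow_succ] at h2
  norm_num at h2
  omega

theorem run_valueMain (hW : 1000 * (m + n + 20) ≤ W) (hm : 1 ≤ m) (hn : 1 ≤ n) :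
    Run procs W A valueMain (RAM.init α m n) fun s T =>
      T ≤ 300000000 * (max m n * lgFactor m n) ∧ ReportsSaddlepointValue A s := by
  refine run_seq (run_core hW hm hn rfl rfl fun s T hs hv hT => run_of_wp ?_)
  have hL : 1 ≤ lgFactor m n := le_max_left _ _
  have k1 : max m n * 1 ≤ max m n * lgFactor m n := Nat.mul_le_mul_left _ hL
  obtain ⟨hr, hc⟩ := hv.1
  simp only [seqs, lt, arr, ↓wp_seq, ↓wp_assign, ↓wp_branch, ↓wp_query, ↓wp_skip, ↓wp_store, ↓wp_loop,
    ↓wp_call, Test.Ok, Test.Holds, Test.time, Expr.Ok, Expr.val, Expr.time, Function.update_apply,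
    Nat.reduceEqDiff, reduceIte, OfNat.ofNat_ne_zero, OfNat.ofNat_ne_one, OfNat.zero_ne_ofNat,
    OfNat.one_ne_ofNat, one_ne_zero, zero_ne_one, List.getD_cons_zero, List.getD_cons_succ,
    List.getD_nil, true_and, and_true, and_assoc, not_le, Nat.reduceAdd, Nat.reduceMul]
  repeat refine And.intro (by omega) ?_
  refine ⟨hr, hc, by omega, _, rfl, fun i j hij => ?_⟩
  exact IsValue.eq_of_isSaddlepoint (r := ⟨_, hr⟩) (c := ⟨_, hc⟩) hv hij

/-- The value is the only candidate, so comparing it with its row and its column in linear time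
decides the existence of a strict saddlepoint. -/
theorem run_strictMain (hW : 1000 * (m + n + 20) ≤ W) (hm : 1 ≤ m) (hn : 1 ≤ n) :
    Run procs W A strictMain (RAM.init α m n) fun s T =>
      T ≤ 300000000 * (max m n * lgFactor m n) ∧ ReportsStrictSaddlepoint A s := by
  refine run_seq (run_core hW hm hn rfl rfl fun s T hs hv hT => run_of_wp ?_)
  have hL : 1 ≤ lgFactor m n := le_max_left _ _
  have k1 : max m n * 1 ≤ max m n * lgFactor m n := Nat.mul_le_mul_left _ hL
  obtain ⟨hr, hc⟩ := hv.1
  have s0 : s.loc 0 = m := hs 0 (by omega)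
  have s1 : s.loc 1 = n := hs 1 (by omega)
  have s5 : s.loc 5 = 0 := hs 5 (by omega)
  have s6 : s.loc 6 = 0 := hs 6 (by omega)
  simp only [s0, s1, seqs, lt, arr, ↓wp_seq, ↓wp_assign, ↓wp_branch, ↓wp_query, ↓wp_skip, ↓wp_store, ↓wp_loop,
    ↓wp_call, Test.Ok, Test.Holds, Test.time, Expr.Ok, Expr.val, Expr.time, Function.update_apply,
    Nat.reduceEqDiff, reduceIte, OfNat.ofNat_ne_zero, OfNat.ofNat_ne_one, OfNat.zero_ne_ofNat,
    OfNat.one_ne_ofNat, one_ne_zero, zero_ne_one, List.getD_cons_zero, List.getD_cons_succ,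
    List.getD_nil, true_and, and_true, and_assoc, not_le, Nat.reduceAdd, Nat.reduceMul]
  repeat refine And.intro (by omega) ?_
  refine ⟨hr, hc, ?_⟩
  obtain ⟨r, hr'⟩ : ∃ r : Fin m, r = ⟨s.mem 56, hr⟩ := ⟨_, rfl⟩
  obtain ⟨c, hc'⟩ : ∃ c : Fin n, c = ⟨s.mem 64, hc⟩ := ⟨_, rfl⟩
  refine run_for (fun i s => s.loc 1 = r ∧ s.loc 2 = c ∧ s.loc 3 = m ∧ s.loc 4 = n ∧ s.loc 5 = i ∧
    s.loc 6 = 0 ∧ s.ent 0 = some (A r c) ∧ (s.loc 0 = 1 ∧ (∀ k : Fin m, k.1 < i → k ≠ r → A r c < A k c) ∨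
      s.loc 0 = 0 ∧ ∃ k : Fin m, k ≠ r ∧ A k c ≤ A r c)) 0 m 40 (Nat.zero_le _) ?_ ?_ ?_ ?_
  · refine ⟨by simp [hr'], by simp [hc'], ?_⟩
    refine ⟨rfl, rfl, s5, s6, ?_, .inl ⟨rfl, fun k hk => absurd hk (by omega)⟩⟩
    rw [hr', hc']
    rfl
  · rintro i ⟨loc, mem₁, ent₁⟩ - hi ⟨l1, l2, l3, l4, l5, l6, l7, l8⟩
    dsimp only at *
    refine ⟨by simp, by simp; omega, run_of_wp ?_⟩
    simp only [l1, l2, l3, l4, l5, seqs, lt, arr, ↓wp_seq, ↓wp_assign, ↓wp_branch, ↓wp_query, ↓wp_skip, ↓wp_store, ↓wp_loop,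
    ↓wp_call, Test.Ok, Test.Holds, Test.time, Expr.Ok, Expr.val, Expr.time, Function.update_apply,
    Nat.reduceEqDiff, reduceIte, OfNat.ofNat_ne_zero, OfNat.ofNat_ne_one, OfNat.zero_ne_ofNat,
    OfNat.one_ne_ofNat, one_ne_zero, zero_ne_one, List.getD_cons_zero, List.getD_cons_succ,
    List.getD_nil, true_and, and_true, and_assoc, not_le, Nat.reduceAdd, Nat.reduceMul]
    repeat refine And.intro (by omega) ?_
    refine ⟨hi, c.2, by omega, by omega, ⟨_, rfl⟩, ⟨_, l7⟩, fun ⟨g1, x, y, hx, hy, hxy⟩ => ?_, fun g => ?_⟩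
    · obtain rfl := Option.some.inj hx
      obtain rfl := Option.some.inj (l7.symm.trans hy)
      exact ⟨by omega, by omega, by omega, l6, l7, .inr ⟨⟨i, hi⟩, fun hk => g1 ⟨by rw [← hk], by rw [← hk]⟩, hxy⟩,
        by omega⟩
    · refine ⟨by omega, by omega, l6, l7, l8.imp_left fun ⟨l9, l10⟩ => ⟨l9, fun k hk hkr => ?_⟩, by omega⟩
      by_cases hki : k.1 = i
      · obtain rfl : k = ⟨i, hi⟩ := Fin.ext hki
        by_contra hcon
        exact g ⟨fun h => hkr (Fin.ext (le_antisymm h.1 h.2)), _, _, rfl, l7, not_lt.1 hcon⟩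
      · exact l10 k (by omega) hkr
  · rintro ⟨loc, mem₁, ent₁⟩ ⟨l1, l2, l3, l4, l5, l6, l7, l8⟩
    dsimp only at *
    exact ⟨by simp, by simp; omega⟩
  rintro ⟨loc, mem₁, ent₁⟩ T₁ ⟨l1, l2, l3, l4, l5, l6, l7, l8⟩ hT₁
  dsimp only at *
  refine run_for (fun i s => s.loc 1 = r ∧ s.loc 2 = c ∧ s.loc 4 = n ∧ s.loc 6 = i ∧ s.ent 0 = some (A r c) ∧
    (s.loc 0 = 1 ∧ (∀ k : Fin m, k ≠ r → A r c < A k c) ∧ (∀ k : Fin n, k.1 < i → k ≠ c → A r k < A r c) ∨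
      s.loc 0 = 0 ∧ ¬ IsStrictSaddlepoint A r c)) 0 n 40 (Nat.zero_le _) ?_ ?_ ?_ ?_
  · refine ⟨l1, l2, l4, l6, l7, ?_⟩
    rcases l8 with ⟨l8, l9⟩ | ⟨l8, k, l9, l10⟩
    · exact .inl ⟨l8, fun k => l9 k k.2, fun k hk => absurd hk (by omega)⟩
    · exact .inr ⟨l8, fun h => l10.not_gt (h.2 k l9)⟩
  · rintro i ⟨loc, mem₂, ent₂⟩ - hi ⟨l1, l2, l4, l6, l7, l8⟩
    dsimp only at *
    refine ⟨by simp, by simp; omega, run_of_wp ?_⟩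
    simp only [l1, l2, l4, l6, seqs, lt, arr, ↓wp_seq, ↓wp_assign, ↓wp_branch, ↓wp_query, ↓wp_skip, ↓wp_store, ↓wp_loop,
    ↓wp_call, Test.Ok, Test.Holds, Test.time, Expr.Ok, Expr.val, Expr.time, Function.update_apply,
    Nat.reduceEqDiff, reduceIte, OfNat.ofNat_ne_zero, OfNat.ofNat_ne_one, OfNat.zero_ne_ofNat,
    OfNat.one_ne_ofNat, one_ne_zero, zero_ne_one, List.getD_cons_zero, List.getD_cons_succ,
    List.getD_nil, true_and, and_true, and_assoc, not_le, Nat.reduceAdd, Nat.reduceMul]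
    repeat refine And.intro (by omega) ?_
    refine ⟨r.2, hi, by omega, by omega, ⟨_, l7⟩, ⟨_, rfl⟩, fun ⟨g1, x, y, hx, hy, hxy⟩ => ?_, fun g => ?_⟩
    · obtain rfl := Option.some.inj hy
      obtain rfl := Option.some.inj (l7.symm.trans hx)
      refine ⟨by omega, by omega, by omega, l7, .inr fun h => ?_, by omega⟩
      exact hxy.not_gt (h.1 ⟨i, hi⟩ fun hk => g1 ⟨by rw [← hk], by rw [← hk]⟩)
    · refine ⟨by omega, by omega, l7, l8.imp_left fun ⟨l9, l10, l11⟩ => ⟨l9, l10, fun k hk hkr => ?_⟩, by omega⟩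
      by_cases hki : k.1 = i
      · obtain rfl : k = ⟨i, hi⟩ := Fin.ext hki
        by_contra hcon
        exact g ⟨fun h => hkr (Fin.ext (le_antisymm h.1 h.2)), _, _, l7, rfl, not_lt.1 hcon⟩
      · exact l11 k (by omega) hkr
  · rintro ⟨loc, mem₂, ent₂⟩ ⟨l1, l2, l4, l6, l7, l8⟩
    dsimp only at *
    exact ⟨by simp, by simp; omega⟩
  rintro ⟨loc', mem₂, ent₂⟩ T₂ ⟨l1, l2, l4, l6, l7, l8⟩ hT₂
  dsimp only at *
  simp only [seqs, lt, arr, ↓wp_seq, ↓wp_assign, ↓wp_branch, ↓wp_query, ↓wp_skip, ↓wp_store, ↓wp_loop,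
    ↓wp_call, Test.Ok, Test.Holds, Test.time, Expr.Ok, Expr.val, Expr.time, Function.update_apply,
    Nat.reduceEqDiff, reduceIte, OfNat.ofNat_ne_zero, OfNat.ofNat_ne_one, OfNat.zero_ne_ofNat,
    OfNat.one_ne_ofNat, one_ne_zero, zero_ne_one, List.getD_cons_zero, List.getD_cons_succ,
    List.getD_nil, true_and, and_true, and_assoc, not_le, Nat.reduceAdd, Nat.reduceMul] at hT₁ hT₂ ⊢
  refine ⟨by clear * - hT hT₁ hT₂ k1 hm; omega, ?_⟩
  rcases l8 with ⟨l8, l9, l10⟩ | ⟨l8, l9⟩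
  · exact .inl ⟨l8, r, c, ⟨fun k => l10 k k.2, l9⟩, l1, l2⟩
  · refine .inr ⟨l8, fun ⟨i, j, hij⟩ => l9 ?_⟩
    obtain ⟨rfl, rfl⟩ := IsValue.eq_of_isStrictSaddlepoint (r := r) (c := c) (by rw [hr', hc']; exact hv) hij
    exact hij

end Saddle

theorem theorem1 :
    (∃ (P : RAM.Program) (C K : ℕ), ∀ (α : Type*) [LinearOrder α] (m n : ℕ),
      0 < m → 0 < n → ∀ A : Matrix (Fin m) (Fin n) α,
        ∃ (s : RAM.State α) (t : ℕ), P.Halts ((m + n) ^ K) A s t ∧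
          t ≤ C * (max m n * max 1 (lgStar (min m n : ℕ))) ∧
          ReportsStrictSaddlepoint A s) ∧
    (∃ (P : RAM.Program) (C K : ℕ), ∀ (α : Type*) [LinearOrder α] (m n : ℕ),
      0 < m → 0 < n → ∀ A : Matrix (Fin m) (Fin n) α,
        (∃ i j, IsSaddlepoint A i j) →
        ∃ (s : RAM.State α) (t : ℕ), P.Halts ((m + n) ^ K) A s t ∧
          t ≤ C * (max m n * max 1 (lgStar (min m n : ℕ))) ∧
          ReportsSaddlepointValue A s) := by
  refine ⟨⟨⟨Saddle.strictMain, Saddle.procs⟩, 300000000, 20, fun α _ m n hm hn A => ?_⟩,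
    ⟨⟨Saddle.valueMain, Saddle.procs⟩, 300000000, 20, fun α _ m n hm hn A _ => ?_⟩⟩
  · exact Saddle.run_strictMain (Saddle.word_bound (by omega)) hm hn
  · exact Saddle.run_valueMain (Saddle.word_bound (by omega)) hm hn
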